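/- Let $\mathcal D\colon \mathrm{Cat}^{op}\to\mathrm{CAT}$ be a stable derivator: a 2-functor (pseudofunctors are allowed) satisfying (Der1)–(Der4), such that $\mathcal D(\mathbb 1)$ has a zero object and such that a square in $\mathcal D$ is cartesian if and only if it is cocartesian. For a small category $B$ let $\mathcal D^B(A)=\mathcal D(B\times A)$. Morphisms of (pre)derivators are pseudonatural transformations, and natural isomorphisms between them are invertible modifications. The suspension $\Sigma\colon\mathcal E\to\mathcal E$ is the composition of right extension by zero from the object $(0,0)$ to $\ulcorner$, left Kan extension from $\ulcorner$ to $\square=[1]\times[1]$, and evaluation at $(1,1)$. Let $n\ge 1$. Let $M_n$ be the mesh category with objects $(k,l)$, $k\in\mathbb Z$, $0\le l\le n+1$, generated by arrows $(k,l)\to(k,l+1)$ and $(k,l+1)\to(k+1,l)$ subject to the commutativity of all squares. Let $\mathcal D^{M_n,\mathrm{ex}}\subseteq\mathcal D^{M_n}$ be spanned by the diagrams which vanish at all $(k,0)$ and $(k,n+1)$ and in which all mesh squares are bicartesian. Let $\tau=t^*$ be the Auslander–Reiten translation on $\mathcal D^{M_n,\mathrm{ex}}$ induced by $t(k,l)=(k-1,l)$.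 **Theorem.** (1) The suspension $\Sigma$ exists on $\mathcal D^{M_n,\mathrm{ex}}$, and with the Serre functor $S=\Sigma\tau$ there is a natural isomorphism $$\Sigma^{n-1}\cong S^{n+1}\colon \mathcal D^{M_n,\mathrm{ex}}\to\mathcal D^{M_n,\mathrm{ex}}.$$ (2) Let $Q$ be an $A_n$-quiver, i.e. an orientation of the Dynkin diagram $A_n$ (with free category again denoted by $Q$). The suspension $\Sigma$ and the Coxeter functor $\Phi^+$ exist on $\mathcal D^Q$. Here $\Phi^+=s^+_{a_n}\circ\dots\circ s^+_{a_1}$ for an admissible sequence of sinks $(a_1,\dots,a_n)$ of $Q$, i.e. an ordering of all vertices such that each $a_i$ is a sink of $\sigma_{a_{i-1}}\cdots\sigma_{a_1}Q$. For a sink $a$, the reflection functor $s_a^+\colon\mathcal D^Q\to\mathcal D^{\sigma_aQ}$ extends the two arrows ending at $a$ to a cartesian square, whose new initial vertex replaces $a$, and restricts to $\sigma_aQ$; if fewer than two arrows end at $a$, the missing ones are first added with source a zero object. With the Serre functor $S=\Sigma\Phi^+$, for every choice of admissible sequence, there is a natural isomorphism $$\Sigma^{n-1}\cong S^{n+1}\colon\mathcal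 D^Q\to\mathcal D^Q.$$ -/

import Mathlib

open CategoryTheory Bicategory Opposite
open scoped CategoryTheory.Pseudofunctor.StrongTrans

universe u v w w₁ w₂ w₃ v₁ v₂ v₃ u₁ u₂ u₃

namespace AbstractRep

/-! ### Prederivators -/

section
variable {B : Type u₁} [Bicategory.{w₁, v₁} B] {C : Type u₂} [Bicategory.{w₂, v₂} C]
  {E : Type u₃} [Bicategory.{w₃, v₃} E]

/-- Postcomposition of a pseudonatural transformation with a pseudofunctor. -/
def whiskerPost {G H : Pseudofunctor B C} (φ : G ⟶ H) (P : Pseudofunctor C E) :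
    G.comp P ⟶ H.comp P where
  app a := P.map (φ.app a)
  naturality f := (P.mapComp _ _).symm ≪≫ P.map₂Iso (φ.naturality f) ≪≫ P.mapComp _ _
  naturality_naturality {a b f g} η := by
    have h := congrArg P.map₂ (φ.naturality_naturality η)
    simp only [P.map₂_comp, P.map₂_whisker_left, P.map₂_whisker_right] at h
    change P.map₂ (G.map₂ η) ▷ P.map (φ.app b) ≫ (P.mapComp (G.map g) (φ.app b)).inv ≫
      P.map₂ (φ.naturality g).hom ≫ (P.mapComp (φ.app a) (H.map g)).hom =
      ((P.mapComp (G.map f) (φ.app b)).inv ≫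
      P.map₂ (φ.naturality f).hom ≫ (P.mapComp (φ.app a) (H.map f)).hom) ≫
        P.map (φ.app a) ◁ P.map₂ (H.map₂ η)
    rw [← cancel_epi (P.mapComp (G.map f) (φ.app b)).hom,
      ← cancel_mono (P.mapComp (φ.app a) (H.map g)).inv]
    simpa using h
  naturality_id a := by
    have h := congrArg P.map₂ (φ.naturality_id a)
    simp only [P.map₂_comp, P.map₂_whisker_left, P.map₂_whisker_right, P.map₂_left_unitor] at h
    change ((P.mapComp (G.map (𝟙 a)) (φ.app a)).inv ≫
      P.map₂ (φ.naturality (𝟙 a)).hom ≫ (P.mapComp (φ.app a) (H.map (𝟙 a))).hom) ≫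
        P.map (φ.app a) ◁ (P.map₂ (H.mapId a).hom ≫ (P.mapId (H.obj a)).hom) =
      (P.map₂ (G.mapId a).hom ≫ (P.mapId (G.obj a)).hom) ▷ P.map (φ.app a) ≫
        (λ_ (P.map (φ.app a))).hom ≫ (ρ_ (P.map (φ.app a))).inv
    have h2 : P.map₂ (ρ_ (φ.app a)).inv ≫ (P.mapComp (φ.app a) (𝟙 (H.obj a))).hom ≫
        P.map (φ.app a) ◁ (P.mapId (H.obj a)).hom = (ρ_ (P.map (φ.app a))).inv := by
      rw [← cancel_mono (ρ_ (P.map (φ.app a))).hom, Category.assoc, Category.assoc,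
        ← P.map₂_right_unitor, ← P.map₂_comp]
      simp
    rw [← cancel_epi (P.mapComp (G.map (𝟙 a)) (φ.app a)).hom, ← h2]
    have h3 := h =≫ ((P.mapComp (φ.app a) (𝟙 (H.obj a))).hom ≫
        P.map (φ.app a) ◁ (P.mapId (H.obj a)).hom)
    simpa using h3
  naturality_comp {a b c} f g := by
    have h := congrArg P.map₂ (φ.naturality_comp f g)
    simp only [P.map₂_comp, P.map₂_whisker_left, P.map₂_whisker_right, P.map₂_associator,
      ← PrelaxFunctor.map₂Iso_inv, ← PrelaxFunctor.map₂Iso_hom] at h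
    change ((P.mapComp (G.map (f ≫ g)) (φ.app c)).inv ≫
      P.map₂ (φ.naturality (f ≫ g)).hom ≫ (P.mapComp (φ.app a) (H.map (f ≫ g))).hom) ≫
        P.map (φ.app a) ◁ (P.map₂ (H.mapComp f g).hom ≫ (P.mapComp (H.map f) (H.map g)).hom) =
      (P.map₂ (G.mapComp f g).hom ≫ (P.mapComp (G.map f) (G.map g)).hom) ▷ P.map (φ.app c) ≫
        (α_ (P.map (G.map f)) (P.map (G.map g)) (P.map (φ.app c))).hom ≫
        P.map (G.map f) ◁ ((P.mapComp (G.map g) (φ.app c)).inv ≫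
          P.map₂ (φ.naturality g).hom ≫ (P.mapComp (φ.app b) (H.map g)).hom) ≫
        (α_ (P.map (G.map f)) (P.map (φ.app b)) (P.map (H.map g))).inv ≫
        ((P.mapComp (G.map f) (φ.app b)).inv ≫
          P.map₂ (φ.naturality f).hom ≫ (P.mapComp (φ.app a) (H.map f)).hom) ▷ P.map (H.map g) ≫
        (α_ (P.map (φ.app a)) (P.map (H.map f)) (P.map (H.map g))).hom
    rw [← cancel_epi (P.mapComp (G.map (f ≫ g)) (φ.app c)).hom]
    have e1 := P.map₂_associator (φ.app a) (H.map f) (H.map g)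
    have e2 : P.map₂ (α_ (G.map f) (φ.app b) (H.map g)).inv =
      (P.mapComp (G.map f) (φ.app b ≫ H.map g)).hom ≫
        P.map (G.map f) ◁ (P.mapComp (φ.app b) (H.map g)).hom ≫
        (α_ (P.map (G.map f)) (P.map (φ.app b)) (P.map (H.map g))).inv ≫
        (P.mapComp (G.map f) (φ.app b)).inv ▷ P.map (H.map g) ≫
        (P.mapComp (G.map f ≫ φ.app b) (H.map g)).inv := by
      rw [← cancel_epi (P.map₂ (α_ (G.map f) (φ.app b) (H.map g)).hom), ← P.map₂_comp]
      simp
    have h3 := h =≫ ((P.mapComp (φ.app a) (H.map f ≫ H.map g)).hom ≫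
        P.map (φ.app a) ◁ (P.mapComp (H.map f) (H.map g)).hom)
    simp [e2] at h3
    simpa using h3
end

/-- The 2-functor `A ↦ B × A` on (the 1-cell dual of) the 2-category of small categories. -/
def shiftBase (B : Cat.{u, u}) : Pseudofunctor Cat.{u, u}ᵒᵖ Cat.{u, u}ᵒᵖ where
  obj A := op (Cat.of (B × A.unop))
  map f := (Functor.prod (𝟭 B) f.unop.toFunctor).toCatHom.op
  map₂ α := Bicategory.Opposite.op2 (NatTrans.prod (𝟙 (𝟭 B)) α.unop2.toNatTrans).toCatHom₂
  mapId A := Iso.op2 (Cat.Hom.isoMk (Iso.refl _))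
  mapComp f g := Iso.op2 (Cat.Hom.isoMk (Iso.refl _))
  map₂_id f := congrArg Bicategory.Opposite.op2 (by ext; rfl)
  map₂_comp α β := congrArg Bicategory.Opposite.op2 (by
    ext X; exact Prod.ext (Category.comp_id _).symm rfl)
  map₂_whisker_left f g h η := congrArg Bicategory.Opposite.op2 (by
    ext X; apply Prod.ext
    · change 𝟙 _ = 𝟙 _ ≫ 𝟙 _ ≫ 𝟙 _
      simp
    · change _ = 𝟙 _ ≫ _ ≫ 𝟙 _
      rw [Category.id_comp, Category.comp_id]; rfl)
  map₂_whisker_right {a b c f g} η h := congrArg Bicategory.Opposite.op2 (by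
    ext X; apply Prod.ext
    · change 𝟙 _ = 𝟙 _ ≫ 𝟙 _ ≫ 𝟙 _
      simp
    · change _ = 𝟙 _ ≫ _ ≫ 𝟙 _
      rw [Category.id_comp, Category.comp_id]; rfl)
  map₂_associator f g h := congrArg Bicategory.Opposite.op2 (by
    ext X; apply Prod.ext
    · change 𝟙 _ = 𝟙 _ ≫ 𝟙 _ ≫ 𝟙 _ ≫ 𝟙 _ ≫ 𝟙 _
      simp
    · change 𝟙 _ = 𝟙 _ ≫ 𝟙 _ ≫ 𝟙 _ ≫ f.unop.toFunctor.map (𝟙 _) ≫ 𝟙 _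
      simp)
  map₂_left_unitor f := congrArg Bicategory.Opposite.op2 (by
    ext X; apply Prod.ext
    · change 𝟙 _ = 𝟙 _ ≫ 𝟙 _ ≫ 𝟙 _
      simp
    · change 𝟙 _ = 𝟙 _ ≫ 𝟙 _ ≫ 𝟙 _
      simp)
  map₂_right_unitor f := congrArg Bicategory.Opposite.op2 (by
    ext X; apply Prod.ext
    · change 𝟙 _ = 𝟙 _ ≫ 𝟙 _ ≫ 𝟙 _
      simp
    · change 𝟙 _ = 𝟙 _ ≫ f.unop.toFunctor.map (𝟙 _) ≫ 𝟙 _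
      simp)

/-- The transformation with components `f × X : A × X ⥤ B × X`. -/
def shiftBaseMap {A B : Cat.{u, u}} (f : A ⥤ B) : shiftBase B ⟶ shiftBase A where
  app X := (Functor.prod f (𝟭 X.unop)).toCatHom.op
  naturality g := Iso.op2 (Cat.Hom.isoMk (Iso.refl (Functor.prod f g.unop.toFunctor)))
  naturality_naturality η := congrArg Bicategory.Opposite.op2 (by
    ext X; apply Prod.ext
    · change 𝟙 _ ≫ 𝟙 _ = 𝟙 _ ≫ f.map (𝟙 _)
      simp
    · exact (Category.comp_id (η.unop2.toNatTrans.app _)).trans (Category.id_comp _).symm)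
  naturality_id X := congrArg Bicategory.Opposite.op2 (by
    ext X; apply Prod.ext
    · change 𝟙 _ ≫ f.map (𝟙 _) = 𝟙 _ ≫ 𝟙 _ ≫ 𝟙 _
      simp
    · change 𝟙 _ ≫ 𝟙 _ = 𝟙 _ ≫ 𝟙 _ ≫ 𝟙 _
      simp)
  naturality_comp g h := congrArg Bicategory.Opposite.op2 (by
    ext X; apply Prod.ext
    · change 𝟙 _ ≫ f.map (𝟙 _) = 𝟙 _ ≫ 𝟙 _ ≫ 𝟙 _ ≫ 𝟙 _ ≫ 𝟙 _ ≫ 𝟙 _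
      simp
    · change 𝟙 _ ≫ 𝟙 _ = 𝟙 _ ≫ 𝟙 _ ≫ g.unop.toFunctor.map (𝟙 _) ≫ 𝟙 _ ≫ 𝟙 _ ≫ 𝟙 _
      simp)

/-- The transformation with components `X ⥤ B × X`, `x ↦ (b, x)`. -/
def evBase {B : Cat.{u, u}} (b : B) : shiftBase B ⟶ Pseudofunctor.id Cat.{u, u}ᵒᵖ where
  app X := (Functor.prod' ((Functor.const X.unop).obj b) (𝟭 X.unop)).toCatHom.op
  naturality g := Iso.op2 (Cat.Hom.isoMk (Iso.refl
    (Functor.prod' ((Functor.const _).obj b) g.unop.toFunctor)))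
  naturality_naturality η := congrArg Bicategory.Opposite.op2 (by
    ext X; apply Prod.ext
    · change 𝟙 _ ≫ 𝟙 _ = 𝟙 _ ≫ 𝟙 _
      rfl
    · exact (Category.comp_id (η.unop2.toNatTrans.app _)).trans (Category.id_comp _).symm)
  naturality_id X := congrArg Bicategory.Opposite.op2 (by
    ext X; apply Prod.ext
    · change 𝟙 _ ≫ 𝟙 _ = 𝟙 _ ≫ 𝟙 _ ≫ 𝟙 _
      simp
    · change 𝟙 _ ≫ 𝟙 _ = 𝟙 _ ≫ 𝟙 _ ≫ 𝟙 _
      simp)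
  naturality_comp g h := congrArg Bicategory.Opposite.op2 (by
    ext X; apply Prod.ext
    · change 𝟙 _ ≫ 𝟙 _ = 𝟙 _ ≫ 𝟙 _ ≫ 𝟙 _ ≫ 𝟙 _ ≫ 𝟙 _ ≫ 𝟙 _
      simp
    · change 𝟙 _ ≫ 𝟙 _ = 𝟙 _ ≫ 𝟙 _ ≫ g.unop.toFunctor.map (𝟙 _) ≫ 𝟙 _ ≫ 𝟙 _ ≫ 𝟙 _
      simp)

set_option linter.checkUnivs false in
/-- A prederivator: a 2-functor `Cat^op → CAT`, contravariant on functors and covariant on natural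
transformations. Pseudofunctors are allowed; a strict 2-functor is a special case. Morphisms of
prederivators are pseudonatural transformations, and 2-morphisms are modifications. -/
abbrev Prederivator : Type (max (u + 1) (v + 1) (w + 1)) :=
  Pseudofunctor Cat.{u, u}ᵒᵖ Cat.{v, w}

/-- The canonical transformation from `D` precomposed with the identity to `D`. -/
def idComp (D : Prederivator.{u, v, w}) : (Pseudofunctor.id Cat.{u, u}ᵒᵖ).comp D ⟶ D where
  app X := 𝟙 (D.obj X)
  naturality f := ρ_ (D.map f) ≪≫ (λ_ (D.map f)).symm
  naturality_naturality {a b f g} η := by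
    change D.map₂ η ▷ 𝟙 (D.obj b) ≫ (ρ_ (D.map g)).hom ≫ (λ_ (D.map g)).inv =
      ((ρ_ (D.map f)).hom ≫ (λ_ (D.map f)).inv) ≫ 𝟙 (D.obj a) ◁ D.map₂ η
    simp
  naturality_id a := by
    change ((ρ_ (D.map (𝟙 a))).hom ≫ (λ_ (D.map (𝟙 a))).inv) ≫ 𝟙 (D.obj a) ◁ (D.mapId a).hom =
      (D.map₂ (𝟙 (𝟙 a)) ≫ (D.mapId a).hom) ▷ 𝟙 (D.obj a) ≫ (λ_ (𝟙 (D.obj a))).hom ≫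
        (ρ_ (𝟙 (D.obj a))).inv
    simp
  naturality_comp {a b c} f g := by
    change ((ρ_ (D.map (f ≫ g))).hom ≫ (λ_ (D.map (f ≫ g))).inv) ≫
        𝟙 (D.obj a) ◁ (D.mapComp f g).hom =
      (D.map₂ (𝟙 (f ≫ g)) ≫ (D.mapComp f g).hom) ▷ 𝟙 (D.obj c) ≫
        (α_ (D.map f) (D.map g) (𝟙 (D.obj c))).hom ≫
        D.map f ◁ ((ρ_ (D.map g)).hom ≫ (λ_ (D.map g)).inv) ≫
        (α_ (D.map f) (𝟙 (D.obj b)) (D.map g)).inv ≫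
        ((ρ_ (D.map f)).hom ≫ (λ_ (D.map f)).inv) ▷ D.map g ≫
        (α_ (𝟙 (D.obj a)) (D.map f) (D.map g)).hom
    simp

/-- The shifted prederivator `D^B`, `D^B(A) = D(B × A)`. -/
def shift (D : Prederivator.{u, v, w}) (B : Cat.{u, u}) : Prederivator.{u, v, w} :=
  (shiftBase B).comp D

/-- The restriction morphism `f^* : D^B ⟶ D^A`. -/
def restr (D : Prederivator.{u, v, w}) {A B : Cat.{u, u}} (f : A ⥤ B) : shift D B ⟶ shift D A :=
  whiskerPost (shiftBaseMap f) D

/-- The evaluation morphism `b^* : D^B ⟶ D`, `X ↦ X_b`. -/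
def ev (D : Prederivator.{u, v, w}) {B : Cat.{u, u}} (b : B) : shift D B ⟶ D :=
  whiskerPost (evBase b) D ≫ idComp D

/-- The restriction of a morphism of pseudofunctors to sub-pseudofunctors. -/
def subTrans {F : Prederivator.{u, v, w}} (P : F.ObjectProperty) [P.IsClosedUnderMapObj]
    (φ : F ⟶ F) (h : ∀ A X, P.prop A X → P.prop A ((φ.app A).toFunctor.obj X)) :
    P.fullsubcategory ⟶ P.fullsubcategory where
  app A := ((P.prop A).lift ((P.prop A).ι ⋙ (φ.app A).toFunctor) fun X => h A X.1 X.2).toCatHom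
  naturality {A B} f := Cat.Hom.isoMk (NatIso.ofComponents
    (fun X => ObjectProperty.isoMk _ ((Cat.Hom.toNatIso (φ.naturality f)).app X.obj))
    (fun {X Y} g => by
      apply ObjectProperty.hom_ext
      exact (Cat.Hom.toNatIso (φ.naturality f)).hom.naturality g.hom))
  naturality_naturality {A B f g} η := by
    ext X
    apply ObjectProperty.hom_ext
    exact congr($(φ.naturality_naturality η).toNatTrans.app X.obj)
  naturality_id A := by
    ext X
    apply ObjectProperty.hom_ext
    exact congr($(φ.naturality_id A).toNatTrans.app X.obj)
  naturality_comp f g := by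
    ext X
    apply ObjectProperty.hom_ext
    exact congr($(φ.naturality_comp f g).toNatTrans.app X.obj)

/-! ### Derivators -/

section Derivator

variable (D : Prederivator.{u, v, w})

/-- The value `D(A)` of a prederivator. -/
abbrev val (A : Cat.{u, u}) : Cat.{v, w} := D.obj (op A)

/-- The restriction functor `u^* : D(B) ⥤ D(A)`. -/
abbrev res {A B : Cat.{u, u}} (f : A ⥤ B) : val D B ⥤ val D A :=
  (D.map (Functor.toCatHom f).op).toFunctor

/-- The natural transformation `α^* : f^* ⟶ g^*`. -/
abbrev resNat {A B : Cat.{u, u}} {f g : A ⥤ B} (α : f ⟶ g) : res D f ⟶ res D g :=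
  (D.map₂ (Bicategory.Opposite.op2 (NatTrans.toCatHom₂ α))).toNatTrans

/-- The structure isomorphism `(g f)^* ≅ f^* g^*`. -/
abbrev resComp {A B C : Cat.{u, u}} (f : A ⥤ B) (g : B ⥤ C) :
    res D (f ⋙ g) ≅ res D g ⋙ res D f :=
  Cat.Hom.toNatIso (D.mapComp (Functor.toCatHom g).op (Functor.toCatHom f).op)

/-- The terminal category. -/
abbrev pt : Cat.{u, u} := Cat.of (Discrete PUnit.{u + 1})

/-- The functor `pt ⥤ B` classifying an object `b`. -/
abbrev atObj {B : Cat.{u, u}} (b : B) : (pt.{u} : Cat.{u, u}) ⥤ B := Functor.fromPUnit b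

/-- The unique functor to the terminal category. -/
abbrev toPt (A : Cat.{u, u}) : A ⥤ (pt.{u} : Cat.{u, u}) := Functor.star A

/-- The slice category `(f/b)` of pairs `(a, f(a) ⟶ b)`. -/
abbrev sliceOver {A B : Cat.{u, u}} (f : A ⥤ B) (b : B) : Cat.{u, u} :=
  Cat.of (CostructuredArrow f b)

/-- The slice category `(b/f)` of pairs `(a, b ⟶ f(a))`. -/
abbrev sliceUnder {A B : Cat.{u, u}} (f : A ⥤ B) (b : B) : Cat.{u, u} :=
  Cat.of (StructuredArrow b f)

/-- The projection `p : (f/b) ⥤ A`. -/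
abbrev sliceOverProj {A B : Cat.{u, u}} (f : A ⥤ B) (b : B) : sliceOver f b ⥤ A :=
  CostructuredArrow.proj f b

/-- The projection `q : (b/f) ⥤ A`. -/
abbrev sliceUnderProj {A B : Cat.{u, u}} (f : A ⥤ B) (b : B) : sliceUnder f b ⥤ A :=
  StructuredArrow.proj b f

/-- The canonical transformation `f p ⟶ b π`. -/
def sliceOverTrans {A B : Cat.{u, u}} (f : A ⥤ B) (b : B) :
    sliceOverProj f b ⋙ f ⟶ toPt (sliceOver f b) ⋙ atObj b where
  app X := X.hom
  naturality _ _ g := (CostructuredArrow.w g).trans (Category.comp_id _).symm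

/-- The canonical transformation `b π ⟶ f q`. -/
def sliceUnderTrans {A B : Cat.{u, u}} (f : A ⥤ B) (b : B) :
    toPt (sliceUnder f b) ⋙ atObj b ⟶ sliceUnderProj f b ⋙ f where
  app X := X.hom
  naturality _ _ g := (Category.id_comp _).trans (StructuredArrow.w g).symm

/-- The square `p^* f^* ⟶ π^* b^*` obtained from `sliceOverTrans`. -/
def sliceOverSquare {A B : Cat.{u, u}} (f : A ⥤ B) (b : B) :
    TwoSquare (res D f) (res D (atObj b)) (res D (sliceOverProj f b))
      (res D (toPt (sliceOver f b))) :=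
  .mk _ _ _ _ <| (resComp D (sliceOverProj f b) f).inv ≫ resNat D (sliceOverTrans f b) ≫
    (resComp D (toPt (sliceOver f b)) (atObj b)).hom

/-- The square `π^* b^* ⟶ q^* f^*` obtained from `sliceUnderTrans`. -/
def sliceUnderSquare {A B : Cat.{u, u}} (f : A ⥤ B) (b : B) :
    TwoSquare (res D (atObj b)) (res D f) (res D (toPt (sliceUnder f b)))
      (res D (sliceUnderProj f b)) :=
  .mk _ _ _ _ <| (resComp D (toPt (sliceUnder f b)) (atObj b)).inv ≫
    resNat D (sliceUnderTrans f b) ≫ (resComp D (sliceUnderProj f b) f).hom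

/-- A derivator is a prederivator satisfying the axioms (Der1)-(Der4). -/
structure IsDerivator : Prop where
  /-- `D` takes coproducts to products. -/
  der1 (I : Type u) (A : I → Cat.{u, u}) :
    (Functor.pi' fun i => res D (B := Cat.of (Σ i, A i)) (Sigma.incl (C := fun i => (A i : Type u)) i)).IsEquivalence
  /-- Isomorphisms are detected pointwise. -/
  der2 (A : Cat.{u, u}) {X Y : val D A} (f : X ⟶ Y)
    (hf : ∀ a : A, IsIso ((res D (atObj a)).map f)) : IsIso f
  /-- Left Kan extensions exist. -/
  der3_left {A B : Cat.{u, u}} (f : A ⥤ B) : (res D f).IsRightAdjoint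
  /-- Right Kan extensions exist. -/
  der3_right {A B : Cat.{u, u}} (f : A ⥤ B) : (res D f).IsLeftAdjoint
  /-- The mate `π_! p^* ⟶ b^* f_!` is invertible: left Kan extensions are pointwise. -/
  der4_left {A B : Cat.{u, u}} (f : A ⥤ B) (b : B) (lan : val D A ⥤ val D B)
    (colim : val D (sliceOver f b) ⥤ val D pt) (adj : lan ⊣ res D f)
    (adj' : colim ⊣ res D (toPt (sliceOver f b))) :
    IsIso ((mateEquiv adj adj').symm (sliceOverSquare D f b)).natTrans
  /-- The mate `b^* f_* ⟶ π_* q^*` is invertible: right Kan extensions are pointwise. -/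
  der4_right {A B : Cat.{u, u}} (f : A ⥤ B) (b : B) (ran : val D A ⥤ val D B)
    (lim : val D (sliceUnder f b) ⥤ val D pt) (adj : res D f ⊣ ran)
    (adj' : res D (toPt (sliceUnder f b)) ⊣ lim) :
    IsIso (mateEquiv adj adj' (sliceUnderSquare D f b)).natTrans

end Derivator

/-! ### Squares and stability -/

/-- The commutative square `□ = [1] × [1]`. -/
abbrev Sq : Cat.{u, u} := Cat.of (ULift.{u} (Fin 2 × Fin 2))

/-- The full subcategory of `□` obtained by removing the terminal object. -/
abbrev UlCorner : Cat.{u, u} := Cat.of {x : ULift.{u} (Fin 2 × Fin 2) // x ≠ ⟨(1, 1)⟩}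

/-- The full subcategory of `□` obtained by removing the initial object. -/
abbrev LrCorner : Cat.{u, u} := Cat.of {x : ULift.{u} (Fin 2 × Fin 2) // x ≠ ⟨(0, 0)⟩}

/-- The inclusion of `⌜` into `□`. -/
abbrev iUl : UlCorner.{u} ⥤ Sq.{u} := (Subtype.mono_coe _).functor

/-- The inclusion of `⌟` into `□`. -/
abbrev iLr : LrCorner.{u} ⥤ Sq.{u} := (Subtype.mono_coe _).functor

/-- A square `X ∈ D^□(A)` is cocartesian if it lies in the essential image of the left Kan
extension functor along `⌜ ⥤ □`. -/
def IsCocartesian (D : Prederivator.{u, v, w}) (A : Cat.{u, u}ᵒᵖ) (X : (shift D Sq).obj A) :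
    Prop :=
  ∃ (lan : (shift D UlCorner).obj A ⥤ (shift D Sq).obj A),
    Nonempty (lan ⊣ ((restr D iUl).app A).toFunctor) ∧ lan.essImage X

/-- A square `X ∈ D^□(A)` is cartesian if it lies in the essential image of the right Kan
extension functor along `⌟ ⥤ □`. -/
def IsCartesian (D : Prederivator.{u, v, w}) (A : Cat.{u, u}ᵒᵖ) (X : (shift D Sq).obj A) :
    Prop :=
  ∃ (ran : (shift D LrCorner).obj A ⥤ (shift D Sq).obj A),
    Nonempty (((restr D iLr).app A).toFunctor ⊣ ran) ∧ ran.essImage X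

/-- A stable derivator is a pointed derivator in which the classes of cartesian and cocartesian
squares coincide. -/
structure IsStableDerivator (D : Prederivator.{u, v, w}) : Prop extends IsDerivator D where
  pointed : Limits.HasZeroObject (val D pt)
  cocartesian_iff_cartesian (A : Cat.{u, u}ᵒᵖ) (X : (shift D Sq).obj A) :
    IsCocartesian D A X ↔ IsCartesian D A X

/-- `S` is the suspension morphism of `E`: right extension by zero from the object `(0,0)` to `⌜`,
followed by left Kan extension to `□` and evaluation at `(1,1)`. The Kan extension morphisms are
adjoints of the restriction morphisms in the bicategory of prederivators. -/
def IsSuspension (E : Prederivator.{u, v, w}) (S : E ⟶ E) : Prop :=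
  ∃ (R : E ⟶ shift E UlCorner) (L : shift E UlCorner ⟶ shift E Sq),
    Nonempty (Bicategory.Adjunction (ev E (B := UlCorner) ⟨⟨(0, 0)⟩, by simp⟩) R) ∧
    Nonempty (Bicategory.Adjunction L (restr E iUl)) ∧
    Nonempty (S ≅ R ≫ L ≫ ev E (B := Sq) ⟨(1, 1)⟩)

/-- The `m`-fold composition of an endomorphism of a prederivator. -/
def iter {E : Prederivator.{u, v, w}} (S : E ⟶ E) : ℕ → (E ⟶ E)
  | 0 => 𝟙 E
  | m + 1 => iter S m ≫ S

/-! ### The mesh category and coherent Auslander-Reiten quivers -/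

/-- Vertices `(k, l)`, `0 ≤ l ≤ n + 1`, of the repetitive quiver of `(0 < 1 < ... < n + 1)`. -/
@[ext]
structure Mesh (n : ℕ) : Type u where
  k : ℤ
  l : ℕ
  hl : l ≤ n + 1

/-- The mesh category `M_n` is the poset generated by the arrows `(k, l) → (k, l + 1)` and
`(k, l + 1) → (k + 1, l)` (see `Mesh.le_iff`). -/
instance (n : ℕ) : Preorder (Mesh.{u} n) where
  le x y := x.k ≤ y.k ∧ x.k + x.l ≤ y.k + y.l
  le_refl x := ⟨le_rfl, le_rfl⟩
  le_trans x y z h h' := ⟨h.1.trans h'.1, h.2.trans h'.2⟩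

/-- The arrows of the repetitive quiver of `(0 < 1 < ... < n + 1)`. -/
def Mesh.Arrow {n : ℕ} (x y : Mesh.{u} n) : Prop :=
  (y.k = x.k ∧ y.l = x.l + 1) ∨ (y.k = x.k + 1 ∧ x.l = y.l + 1)

theorem Mesh.le_iff {n : ℕ} (x y : Mesh.{u} n) :
    x ≤ y ↔ Relation.ReflTransGen Mesh.Arrow x y := by
  constructor
  · rintro ⟨h1, h2⟩
    obtain ⟨m, hm⟩ : ∃ m : ℕ, (y.k - x.k) + (y.k + y.l - (x.k + x.l)) = m :=
      Int.eq_ofNat_of_zero_le (by omega)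
    induction m generalizing x with
    | zero =>
      have : x = y := Mesh.ext (by omega) (by omega)
      rw [this]
    | succ m ih =>
      have hx := x.hl
      have hy := y.hl
      by_cases h : x.k < y.k ∧ 0 < x.l
      · refine .head (b := ⟨x.k + 1, x.l - 1, by omega⟩) (Or.inr ⟨rfl, ?_⟩)
          (ih _ ?_ ?_ ?_) <;> dsimp <;> omega
      · refine .head (b := ⟨x.k, x.l + 1, by omega⟩) (Or.inl ⟨rfl, rfl⟩)
          (ih _ ?_ ?_ ?_) <;> dsimp <;> omega
  · intro h
    induction h with
    | refl => exact le_rfl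
    | tail _ h ih =>
      refine ih.trans ?_
      rcases h with ⟨h1, h2⟩ | ⟨h1, h2⟩ <;> constructor <;> omega

/-- The mesh category `M_n`. -/
abbrev mesh (n : ℕ) : Cat.{u, u} := Cat.of (Mesh.{u} n)

/-- The square in `M_n` with vertices `(k, l)`, `(k, l + 1)`, `(k + 1, l - 1)`, `(k + 1, l)`,
for `1 ≤ l ≤ n`; here `l` is written as `j + 1`. -/
def meshSquare (n : ℕ) (k : ℤ) (j : ℕ) (hj : j + 1 ≤ n) : Sq.{u} ⥤ mesh.{u} n :=
  Monotone.functor (X := ULift.{u} (Fin 2 × Fin 2)) (Y := Mesh.{u} n)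
    (f := fun x => ⟨k + (x.down.2 : ℕ), j + 1 + (x.down.1 : ℕ) - (x.down.2 : ℕ), by omega⟩) (by
      rintro ⟨x1, x2⟩ ⟨y1, y2⟩ ⟨h1, h2⟩
      have h1' : (x1 : ℕ) ≤ y1 := h1
      have h2' : (x2 : ℕ) ≤ y2 := h2
      have := x2.2
      have := y2.2
      constructor <;> dsimp <;> omega)

/-- The translation `t : M_n ⥤ M_n`, `(k, l) ↦ (k - 1, l)`. -/
def meshShift (n : ℕ) : mesh.{u} n ⥤ mesh.{u} n :=
  Monotone.functor (X := Mesh.{u} n) (Y := Mesh.{u} n)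
    (f := fun x => ⟨x.k - 1, x.l, x.hl⟩) (by
      rintro x y ⟨h1, h2⟩
      constructor <;> dsimp <;> omega)

theorem meshSquare_comp_meshShift (n : ℕ) (k : ℤ) (j : ℕ) (hj : j + 1 ≤ n) :
    meshSquare.{u} n k j hj ⋙ meshShift n = meshSquare n (k - 1) j hj := by
  have thin (x y : Mesh.{u} n) (f g : x ⟶ y) : f = g := Subsingleton.elim f g
  exact CategoryTheory.Functor.ext (fun x => Mesh.ext
    (show k + ((x.down.2 : ℕ) : ℤ) - 1 = k - 1 + ((x.down.2 : ℕ) : ℤ) by omega) rfl)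
    (fun _ _ _ => thin _ _ _ _)

section AR

variable (D : Prederivator.{u, v, w}) (n : ℕ)

/-- A diagram `X ∈ D^{M_n}(A)` which vanishes at all `(k, 0)` and `(k, n + 1)` and which makes all
mesh squares bicartesian. -/
structure IsARDiagram (A : Cat.{u, u}ᵒᵖ) (X : (shift D (mesh n)).obj A) : Prop where
  zero_bot (k : ℤ) :
    Limits.IsZero (((ev D (B := mesh n) ⟨k, 0, by omega⟩).app A).toFunctor.obj X)
  zero_top (k : ℤ) :
    Limits.IsZero (((ev D (B := mesh n) ⟨k, n + 1, le_rfl⟩).app A).toFunctor.obj X)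
  cocartesian (k : ℤ) (j : ℕ) (hj : j + 1 ≤ n) :
    IsCocartesian D A (((restr D (meshSquare n k j hj)).app A).toFunctor.obj X)
  cartesian (k : ℤ) (j : ℕ) (hj : j + 1 ≤ n) :
    IsCartesian D A (((restr D (meshSquare n k j hj)).app A).toFunctor.obj X)

/-- The property of diagrams in `D^{M_n}` defining `D^{M_n,ex}`. In order to span a
sub-prederivator of an arbitrary prederivator, the conditions are imposed on all restrictions of
the diagram along functors in the parameter `A`; if `D` is a derivator, then this is automatic,
since restrictions commute with Kan extensions in unrelated variables. -/
def arProp : (shift D (mesh n)).ObjectProperty where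
  prop A X := ∀ (B : Cat.{u, u}ᵒᵖ) (f : A ⟶ B),
    IsARDiagram D n B (((shift D (mesh n)).map f).toFunctor.obj X)

variable {D n}

theorem IsARDiagram.of_iso {A : Cat.{u, u}ᵒᵖ} {X Y : (shift D (mesh n)).obj A} (e : X ≅ Y)
    (h : IsARDiagram D n A X) : IsARDiagram D n A Y where
  zero_bot k := (h.zero_bot k).of_iso (Functor.mapIso _ e.symm)
  zero_top k := (h.zero_top k).of_iso (Functor.mapIso _ e.symm)
  cocartesian k j hj := by
    obtain ⟨L, hL, hX⟩ := h.cocartesian k j hj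
    exact ⟨L, hL, Functor.essImage.ofIso (Functor.mapIso _ e) hX⟩
  cartesian k j hj := by
    obtain ⟨L, hL, hX⟩ := h.cartesian k j hj
    exact ⟨L, hL, Functor.essImage.ofIso (Functor.mapIso _ e) hX⟩

instance : (arProp D n).IsClosedUnderMapObj where
  map_obj {_ _ X} hX f C g :=
    (hX C (f ≫ g)).of_iso ((Cat.Hom.toNatIso ((shift D (mesh n)).mapComp f g)).app X)

variable (D) in
/-- The isomorphism between evaluation at `a` after restriction along `f` and evaluation
at `f a`. -/
def restrEvIso {A B : Cat.{u, u}} (f : A ⥤ B) (a : A) (C : Cat.{u, u}ᵒᵖ) :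
    (restr D f).app C ≫ (ev D a).app C ≅ (ev D (f.obj a)).app C :=
  let e : Functor.prod' ((Functor.const C.unop).obj a) (𝟭 C.unop) ⋙ Functor.prod f (𝟭 C.unop) ≅
      Functor.prod' ((Functor.const C.unop).obj (f.obj a)) (𝟭 C.unop) :=
    NatIso.ofComponents (fun X => Iso.refl (f.obj a, X)) fun {X Y} g =>
      Prod.ext (show f.map (𝟙 a) ≫ 𝟙 (f.obj a) = 𝟙 (f.obj a) ≫ 𝟙 (f.obj a) by simp)
        (show g ≫ 𝟙 Y = 𝟙 X ≫ g by simp)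
  (α_ (D.map ((shiftBaseMap f).app C)) (D.map ((evBase a).app C)) (𝟙 (D.obj C))).symm ≪≫
    whiskerRightIso ((D.mapComp ((shiftBaseMap f).app C) ((evBase a).app C)).symm ≪≫
      D.map₂Iso (Iso.op2 (Cat.Hom.isoMk e))) (𝟙 (D.obj C))

variable (D) in
/-- The isomorphism `f^* g^* ≅ (g f)^*` of restrictions of shifted prederivators. -/
def restrRestrIso {A B C : Cat.{u, u}} (f : A ⥤ B) (g : B ⥤ C) (X : Cat.{u, u}ᵒᵖ) :
    (restr D g).app X ≫ (restr D f).app X ≅ (restr D (f ⋙ g)).app X :=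
  (D.mapComp ((shiftBaseMap g).app X) ((shiftBaseMap f).app X)).symm

theorem IsARDiagram.shift {A : Cat.{u, u}ᵒᵖ} {X : (shift D (mesh n)).obj A}
    (h : IsARDiagram D n A X) :
    IsARDiagram D n A (((restr D (meshShift n)).app A).toFunctor.obj X) where
  zero_bot k := (h.zero_bot (k - 1)).of_iso
    ((Cat.Hom.toNatIso (restrEvIso D (meshShift n) ⟨k, 0, by omega⟩ A)).app X)
  zero_top k := (h.zero_top (k - 1)).of_iso
    ((Cat.Hom.toNatIso (restrEvIso D (meshShift n) ⟨k, n + 1, le_rfl⟩ A)).app X)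
  cocartesian k j hj := by
    obtain ⟨L, hL, hX⟩ := h.cocartesian (k - 1) j hj
    rw [← meshSquare_comp_meshShift] at hX
    exact ⟨L, hL, Functor.essImage.ofIso
      ((Cat.Hom.toNatIso (restrRestrIso D (meshSquare n k j hj) (meshShift n) A)).app X).symm hX⟩
  cartesian k j hj := by
    obtain ⟨L, hL, hX⟩ := h.cartesian (k - 1) j hj
    rw [← meshSquare_comp_meshShift] at hX
    exact ⟨L, hL, Functor.essImage.ofIso
      ((Cat.Hom.toNatIso (restrRestrIso D (meshSquare n k j hj) (meshShift n) A)).app X).symm hX⟩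

variable (D n)

/-- The prederivator `D^{M_n,ex}` of coherent Auslander-Reiten quivers. -/
abbrev arDer : Prederivator.{u, v, w} := (arProp D n).fullsubcategory

/-- The Auslander-Reiten translation `τ = t^*` on `D^{M_n,ex}`. -/
def arTranslation : arDer D n ⟶ arDer D n :=
  subTrans (arProp D n) (restr D (meshShift n)) fun _ X hX B f =>
    (hX B f).shift.of_iso
      ((Cat.Hom.toNatIso ((restr D (meshShift n)).naturality f)).app X)

end AR

/-! ### Quivers of type `A_n`, reflection functors and Coxeter functors -/

/-- A quiver without multiple arrows is a relation `r`, where `r x y` means that there is an arrow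
`x → y`. It is an `A_n`-quiver if it is an orientation of the Dynkin diagram of type `A_n`. -/
def IsAnQuiver (n : ℕ) {V : Type u} (r : V → V → Prop) : Prop :=
  (∀ x y, r x y → ¬ r y x) ∧ Nonempty (SimpleGraph.fromRel r ≃g SimpleGraph.pathGraph n)

/-- The vertices of the quiver `r`, preordered by the existence of a path. As a category, this is
the free category on `r` modulo the identification of all parallel paths. An `A_n`-quiver is a tree
and has at most one path between any two vertices, so that this is the free category. -/
def Reach {V : Type u} (_r : V → V → Prop) : Type u := V

instance {V : Type u} (r : V → V → Prop) : Preorder (Reach r) where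
  le := Relation.ReflTransGen r
  le_refl _ := .refl
  le_trans _ _ _ := .trans

/-- The category of the preorder `Reach r`. -/
abbrev reachCat {V : Type u} (r : V → V → Prop) : Cat.{u, u} := Cat.of (Reach r)

/-- The functor induced by a map of vertices sending arrows to arrows. -/
def reachMap {V W : Type u} {r : V → V → Prop} {s : W → W → Prop} (f : V → W)
    (hf : ∀ x y, r x y → s (f x) (f y)) : reachCat r ⥤ reachCat s :=
  Monotone.functor (X := Reach r) (Y := Reach s) (f := f) fun _ _ h =>
    Relation.ReflTransGen.lift f hf _ _ h

section Reflection

variable {V : Type u} (r : V → V → Prop) (a : V)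

/-- The vertex `a` is a sink. -/
def IsSink : Prop := ∀ x, ¬ r a x

/-- The reflected quiver: the orientations of all arrows adjacent to `a` are changed. -/
def reflectAt : V → V → Prop := fun x y =>
  ((x = a ∨ y = a) ∧ r y x) ∨ (x ≠ a ∧ y ≠ a ∧ r x y)

/-- Vertices of the quiver `r` with additional vertices `z` (to be sent to zero), such that `a`
becomes the target of precisely two arrows. -/
abbrev ZeroExtVertex : Type u := V ⊕ Fin (2 - Nat.card {x // r x a})

/-- The arrows of `r`, together with one arrow `z → a` for every additional vertex `z`. -/
def zeroExt : ZeroExtVertex r a → ZeroExtVertex r a → Prop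
  | .inl x, .inl y => r x y
  | .inr _, .inl y => y = a
  | _, .inr _ => False

/-- The quiver `zeroExt` with one more vertex `a'` (denoted `none`) and with an arrow `a' → x` for
every arrow `x → a`. In `reachCat`, the two paths of length two from `a'` to `a` form a
commutative square. -/
def squareExt : Option (ZeroExtVertex r a) → Option (ZeroExtVertex r a) → Prop
  | some x, some y => zeroExt r a x y
  | none, some x => zeroExt r a x (.inl a)
  | _, none => False

/-- The inclusion of `r` into `zeroExt`. -/
def inclZeroExt : reachCat r ⥤ reachCat (zeroExt r a) :=
  reachMap Sum.inl fun _ _ h => h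

/-- The inclusion of `zeroExt` into `squareExt`. -/
def inclSquareExt : reachCat (zeroExt r a) ⥤ reachCat (squareExt r a) :=
  reachMap some fun _ _ h => h

open scoped Classical in
/-- The inclusion of the reflected quiver into `squareExt`, sending the vertex `a` to `a'`. -/
noncomputable def inclReflect (ha : IsSink r a) :
    reachCat (reflectAt r a) ⥤ reachCat (squareExt r a) :=
  reachMap (fun x => if x = a then none else some (.inl x)) fun x y h => by
    rcases h with ⟨h, hr⟩ | ⟨h1, h2, hr⟩
    · have hy : y ≠ a := fun e => ha x (e ▸ hr)
      have hx : x = a := h.resolve_right hy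
      subst hx
      simpa [hy, squareExt, zeroExt] using hr
    · simpa [h1, h2, squareExt, zeroExt] using hr

/-- `s : D^Q ⟶ D^{Q'}`, where `Q' = σ_a Q`, is the reflection functor `s_a^+` at the sink `a`:
complete the arrows with target `a` by zeros, extend them to a cartesian square, and restrict. -/
def IsReflection (D : Prederivator.{u, v, w}) (ha : IsSink r a)
    (s : shift D (reachCat r) ⟶ shift D (reachCat (reflectAt r a))) : Prop :=
  ∃ (L : shift D (reachCat r) ⟶ shift D (reachCat (zeroExt r a)))
    (R : shift D (reachCat (zeroExt r a)) ⟶ shift D (reachCat (squareExt r a))),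
    Nonempty (Bicategory.Adjunction L (restr D (inclZeroExt r a))) ∧
    Nonempty (Bicategory.Adjunction (restr D (inclSquareExt r a)) R) ∧
    Nonempty (s ≅ L ≫ R ≫ restr D (inclReflect r a ha))

end Reflection

/-- `IsIteratedReflection D l r r' Φ` means that `l = [a₁, ..., aₘ]`, where `a₁` is a sink of `r`
and each `aᵢ` is a sink of `σ_{aᵢ₋₁} ... σ_{a₁} r`, that `r' = σ_{aₘ} ... σ_{a₁} r`, and
that `Φ = s_{aₘ}^+ ∘ ... ∘ s_{a₁}^+`. -/
inductive IsIteratedReflection (D : Prederivator.{u, v, w}) {V : Type u} :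
    List V → (r r' : V → V → Prop) → (shift D (reachCat r) ⟶ shift D (reachCat r')) → Prop
  | nil (r : V → V → Prop) : IsIteratedReflection D [] r r (𝟙 _)
  | cons {r r' : V → V → Prop} {a : V} {l : List V} (ha : IsSink r a)
      {s : shift D (reachCat r) ⟶ shift D (reachCat (reflectAt r a))}
      (hs : IsReflection r a D ha s)
      {Φ : shift D (reachCat (reflectAt r a)) ⟶ shift D (reachCat r')}
      (hΦ : IsIteratedReflection D l (reflectAt r a) r' Φ) :
      IsIteratedReflection D (a :: l) r r' (s ≫ Φ)

/-- `Φ` is the Coxeter functor `Φ⁺` of the quiver `r`: the composition of the reflection functors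
of an admissible sequence of sinks, that is, of a total ordering of all vertices. -/
def IsCoxeter (D : Prederivator.{u, v, w}) {V : Type u} (r : V → V → Prop)
    (Φ : shift D (reachCat r) ⟶ shift D (reachCat r)) : Prop :=
  ∃ l : List V, l.Nodup ∧ (∀ a, a ∈ l) ∧ IsIteratedReflection D l r r Φ

end AbstractRep

open AbstractRep

namespace AbstractRep

/-! ### Coherence of restriction functors with 2-cells and composition -/

variable {D : Prederivator.{u, v, w}} {A B C E : Cat.{u, u}}

/-! The computation takes place in the mesh category, where all functors involved become
translations of coordinates.

An orientation `Q` of `A_n` embeds into `M_n` as a slice: one vertex on each level `1 ≤ l ≤ n`, with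
consecutive levels joined by a mesh arrow (`exists_isSection`). An object of `D^{M_n,ex}` can be
rebuilt from its values on a slice. To the left of the slice the values are initial vertices of
cartesian squares, to the right they are final vertices of cocartesian squares, and on the boundary
they are zero. Hence restriction `D^{M_n,ex} → D^Q` is an equivalence in each parameter and has a
pseudonatural section (`isAR_iff_isSliceExt`, `exists_comp_arRestr_iso`).

Pasting mesh squares yields a bicartesian rectangle with vertices `(k, l)`, `(k, n+1)`, `(k+l, 0)`,
`(k+l, n+1-l)`, whose two middle vertices carry zero objects (`IsAR.isLan_rect`). Suspension is
therefore restriction along `flipVal : (k, l) ↦ (k+l, n+1-l)`, on `D^{M_n,ex}` and on each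
restriction to a category over `M_n`. Applying `flipVal` twice translates `k` by `n+1`, so `Σ²
τ^{n+1} ≅ 1`. As `flipVal` commutes with the translation, `S^{n+1} ≅ Σ^{n+1} τ^{n+1} ≅ Σ^{n-1}`
(`flipVal_iterate`, `nonempty_arDer_iso`).

A sink at `(k, l)` is the last vertex of a mesh square, and its reflection replaces it by the first
vertex `(k-1, l)` of that square; neighbours missing at the ends of the quiver are supplied by the
zero boundary (`IsSection.nonempty_reflection_iso`). Reflecting each vertex once translates the
whole slice by `t`, so that `Φ⁺` corresponds to `τ` for every admissible sequence
(`IsCoxeter.nonempty_iso`). The isomorphism on `D^{M_n,ex}` is then transported to `D^Q`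
(`IsSection.nonempty_iter_iso`).

Two devices control coherence. Kan extensions along fully faithful functors are handled as locality
conditions `IsRan` and colocality conditions `IsLan`, which by (Der4) can be tested pointwise in
parameters. Kan extension morphisms are only known as bicategorical adjoints; their values on a
family of already extended diagrams follow from uniqueness (`nonempty_comp_comp_left_iso`,
`nonempty_comp_comp_right_iso`), and their existence follows by inverting objectwise equivalences
(`exists_section`). Since `M_n` is a poset, restrictions along functors to it are isomorphic as soon
as the functors agree on objects. -/

theorem resNat_id (f : A ⥤ B) : resNat D (𝟙 f) = 𝟙 _ :=
  congr($(D.map₂_id (Functor.toCatHom f).op).toNatTrans)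

theorem resNat_comp {f g h : A ⥤ B} (α : f ⟶ g) (β : g ⟶ h) :
    resNat D (α ≫ β) = resNat D α ≫ resNat D β :=
  congr($(D.map₂_comp (Bicategory.Opposite.op2 (NatTrans.toCatHom₂ α))
    (Bicategory.Opposite.op2 (NatTrans.toCatHom₂ β))).toNatTrans)

theorem resNat_whiskerLeft (f : A ⥤ B) {g h : B ⥤ C} (α : g ⟶ h) (Z : val D C) :
    (resNat D (Functor.whiskerLeft f α)).app Z ≫ (resComp D f h).hom.app Z =
      (resComp D f g).hom.app Z ≫ (res D f).map ((resNat D α).app Z) := by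
  -- The 1-cells are reversed in `Catᵒᵖ`, so precomposition with `f` becomes whiskering on the
  -- right.
  have h1 : (resNat D (Functor.whiskerLeft f α)).app Z = (resComp D f g).hom.app Z ≫
      (res D f).map ((resNat D α).app Z) ≫ (resComp D f h).inv.app Z :=
    congr($(D.map₂_whisker_right (Bicategory.Opposite.op2 (NatTrans.toCatHom₂ α))
      (Functor.toCatHom f).op).toNatTrans.app Z)
  rw [h1, Category.assoc, Category.assoc, Iso.inv_hom_id_app]
  exact congrArg _ (Category.comp_id _)

theorem resNat_whiskerLeft_assoc (f : A ⥤ B) {g h : B ⥤ C} (α : g ⟶ h) (Z : val D C) {Y : val D A}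
    (k : (res D f).obj ((res D h).obj Z) ⟶ Y) :
    (resNat D (Functor.whiskerLeft f α)).app Z ≫ (resComp D f h).hom.app Z ≫ k =
      (resComp D f g).hom.app Z ≫ (res D f).map ((resNat D α).app Z) ≫ k := by
  simpa using congrArg (· ≫ k) (resNat_whiskerLeft f α Z)

theorem resNat_whiskerRight {f g : A ⥤ B} (α : f ⟶ g) (h : B ⥤ C) (Z : val D C) :
    (resNat D (Functor.whiskerRight α h)).app Z ≫ (resComp D g h).hom.app Z =
      (resComp D f h).hom.app Z ≫ (resNat D α).app ((res D h).obj Z) := by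
  have h1 : (resNat D (Functor.whiskerRight α h)).app Z = (resComp D f h).hom.app Z ≫
      (resNat D α).app ((res D h).obj Z) ≫ (resComp D g h).inv.app Z :=
    congr($(D.map₂_whisker_left (Functor.toCatHom h).op
      (Bicategory.Opposite.op2 (NatTrans.toCatHom₂ α))).toNatTrans.app Z)
  rw [h1, Category.assoc, Category.assoc, Iso.inv_hom_id_app]
  exact congrArg _ (Category.comp_id _)

theorem resNat_whiskerRight_assoc {f g : A ⥤ B} (α : f ⟶ g) (h : B ⥤ C) (Z : val D C) {Y : val D A}
    (k : (res D g).obj ((res D h).obj Z) ⟶ Y) :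
    (resNat D (Functor.whiskerRight α h)).app Z ≫ (resComp D g h).hom.app Z ≫ k =
      (resComp D f h).hom.app Z ≫ (resNat D α).app ((res D h).obj Z) ≫ k := by
  simpa using congrArg (· ≫ k) (resNat_whiskerRight α h Z)

theorem resComp_assoc (f : A ⥤ B) (g : B ⥤ C) (h : C ⥤ E) (Z : val D E) :
    (resComp D f (g ⋙ h)).hom.app Z ≫ (res D f).map ((resComp D g h).hom.app Z) =
      (resComp D (f ⋙ g) h).hom.app Z ≫ (resComp D f g).hom.app ((res D h).obj Z) := by
  -- The associators of `Cat` have identity components; one of them survives as `resNat D (𝟙 _)`.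
  have h1 : (resComp D f (g ⋙ h)).hom.app Z ≫ (res D f).map ((resComp D g h).hom.app Z) =
      (resNat D (𝟙 (f ⋙ g ⋙ h))).app Z ≫ (resComp D (f ⋙ g) h).hom.app Z ≫
        (resComp D f g).hom.app ((res D h).obj Z) ≫ 𝟙 _ :=
    congr($(D.mapComp_assoc_left_hom (Functor.toCatHom h).op (Functor.toCatHom g).op
      (Functor.toCatHom f).op).toNatTrans.app Z)
  rw [h1, resNat_id]
  exact (Category.id_comp _).trans (congrArg _ (Category.comp_id _))

theorem resComp_assoc_assoc (f : A ⥤ B) (g : B ⥤ C) (h : C ⥤ E) (Z : val D E) {Y : val D A}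
    (k : (res D f).obj ((res D g).obj ((res D h).obj Z)) ⟶ Y) :
    (resComp D f (g ⋙ h)).hom.app Z ≫ (res D f).map ((resComp D g h).hom.app Z) ≫ k =
      (resComp D (f ⋙ g) h).hom.app Z ≫ (resComp D f g).hom.app ((res D h).obj Z) ≫ k := by
  simpa using congrArg (· ≫ k) (resComp_assoc f g h Z)

/-- The structure isomorphism `(𝟭 A)^* ≅ 𝟭`. -/
abbrev resId (D : Prederivator.{u, v, w}) (A : Cat.{u, u}) : res D (𝟭 A) ≅ 𝟭 (val D A) :=
  Cat.Hom.toNatIso (D.mapId (op A))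





/-! ### Universal arrows -/

section Universal
variable {𝒞 : Type u₁} [Category.{v₁} 𝒞] {ℰ : Type u₂} [Category.{v₂} ℰ]
  {ℱ : Type u₃} [Category.{v₃} ℱ]

/-- The arrow `η : W ⟶ F Z` is universal from `W` to `F`. -/
def IsUnivArrow (F : 𝒞 ⥤ ℰ) {W : ℰ} {Z : 𝒞} (η : W ⟶ F.obj Z) : Prop :=
  ∀ Z', Function.Bijective fun g : Z ⟶ Z' => η ≫ F.map g

/-- The arrow `ξ : F Z ⟶ W` is universal from `F` to `W`. -/
def IsCounivArrow (F : 𝒞 ⥤ ℰ) {W : ℰ} {Z : 𝒞} (ξ : F.obj Z ⟶ W) : Prop :=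
  ∀ Z', Function.Bijective fun g : Z' ⟶ Z => F.map g ≫ ξ

theorem IsUnivArrow.of_adj {F : 𝒞 ⥤ ℰ} {L : ℰ ⥤ 𝒞} (adj : L ⊣ F) (W : ℰ) :
    IsUnivArrow F (adj.unit.app W) := fun Z' => by
  have := (adj.homEquiv W Z').bijective
  simpa [Adjunction.homEquiv_unit, Function.Bijective, Function.Injective, Function.Surjective]
    using this

theorem IsCounivArrow.of_adj {F : 𝒞 ⥤ ℰ} {R : ℰ ⥤ 𝒞} (adj : F ⊣ R) (W : ℰ) :
    IsCounivArrow F (adj.counit.app W) := fun Z' => by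
  have := (adj.homEquiv Z' W).symm.bijective
  simpa [Adjunction.homEquiv_counit, Function.Bijective, Function.Injective, Function.Surjective]
    using this

/-- Uniqueness of representing objects. This is the way in which comparison maps out of Kan
extensions are seen to be invertible. -/
theorem IsUnivArrow.isIso {F : 𝒞 ⥤ ℰ} {W : ℰ} {Z Z' : 𝒞} {η : W ⟶ F.obj Z}
    (h : IsUnivArrow F η) {g : Z ⟶ Z'} (h' : IsUnivArrow F (η ≫ F.map g)) : IsIso g := by
  obtain ⟨k, hk⟩ := (h' Z).2 η
  have hk : (η ≫ F.map g) ≫ F.map k = η := hk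
  refine ⟨k, (h Z).1 ?_, (h' Z').1 ?_⟩
  · simpa using hk
  · change (η ≫ F.map g) ≫ F.map (k ≫ g) = (η ≫ F.map g) ≫ F.map (𝟙 Z')
    rw [F.map_comp, ← Category.assoc, hk, F.map_id, Category.comp_id]

theorem IsCounivArrow.isIso {F : 𝒞 ⥤ ℰ} {W : ℰ} {Z Z' : 𝒞} {ξ : F.obj Z ⟶ W}
    (h : IsCounivArrow F ξ) {g : Z' ⟶ Z} (h' : IsCounivArrow F (F.map g ≫ ξ)) : IsIso g := by
  obtain ⟨k, hk⟩ := (h' Z).2 ξ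
  have hk : F.map k ≫ F.map g ≫ ξ = ξ := hk
  refine ⟨k, (h' Z').1 ?_, (h Z).1 ?_⟩
  · change F.map (g ≫ k) ≫ F.map g ≫ ξ = F.map (𝟙 Z') ≫ F.map g ≫ ξ
    rw [F.map_comp, Category.assoc, hk, F.map_id, Category.id_comp]
  · simpa using hk

theorem IsUnivArrow.comp_isIso {F : 𝒞 ⥤ ℰ} {W : ℰ} {Z Z' : 𝒞} {η : W ⟶ F.obj Z}
    (h : IsUnivArrow F η) (g : Z ⟶ Z') [IsIso g] : IsUnivArrow F (η ≫ F.map g) := fun Z'' => by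
  have := (h Z'').comp (f := fun k : Z' ⟶ Z'' => g ≫ k) ⟨fun a b hab => (cancel_epi g).1 hab,
    fun k => ⟨inv g ≫ k, by simp⟩⟩
  refine (iff_of_eq ?_).1 this
  congr 1
  funext k
  simp

theorem IsCounivArrow.isIso_comp {F : 𝒞 ⥤ ℰ} {W : ℰ} {Z Z' : 𝒞} {ξ : F.obj Z ⟶ W}
    (h : IsCounivArrow F ξ) (g : Z' ⟶ Z) [IsIso g] : IsCounivArrow F (F.map g ≫ ξ) := fun Z'' => by
  have := (h Z'').comp (f := fun k : Z'' ⟶ Z' => k ≫ g) ⟨fun a b hab => (cancel_mono g).1 hab,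
    fun k => ⟨k ≫ inv g, by simp⟩⟩
  refine (iff_of_eq ?_).1 this
  congr 1
  funext k
  simp

theorem isUnivArrow_comp_map_iff {F : 𝒞 ⥤ ℰ} {W : ℰ} {Z Z' : 𝒞} {η : W ⟶ F.obj Z}
    (g : Z ⟶ Z') [IsIso g] : IsUnivArrow F (η ≫ F.map g) ↔ IsUnivArrow F η :=
  ⟨fun h => by simpa using h.comp_isIso (inv g), fun h => h.comp_isIso g⟩

theorem isCounivArrow_map_comp_iff {F : 𝒞 ⥤ ℰ} {W : ℰ} {Z Z' : 𝒞} {ξ : F.obj Z ⟶ W}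
    (g : Z' ⟶ Z) [IsIso g] : IsCounivArrow F (F.map g ≫ ξ) ↔ IsCounivArrow F ξ :=
  ⟨fun h => by simpa using h.isIso_comp (inv g), fun h => h.isIso_comp g⟩

theorem isUnivArrow_isIso_comp_iff {F : 𝒞 ⥤ ℰ} {W W' : ℰ} {Z : 𝒞} (i : W' ⟶ W) [IsIso i]
    {η : W ⟶ F.obj Z} : IsUnivArrow F (i ≫ η) ↔ IsUnivArrow F η := by
  refine forall_congr' fun Z' => ?_
  have : (fun g : Z ⟶ Z' => (i ≫ η) ≫ F.map g) = (fun k => i ≫ k) ∘ fun g => η ≫ F.map g := by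
    funext g
    simp
  rw [this]
  exact Function.Bijective.of_comp_iff' ⟨fun a b hab => (cancel_epi i).1 hab,
    fun k => ⟨inv i ≫ k, by simp⟩⟩ _

theorem isCounivArrow_comp_isIso_iff {F : 𝒞 ⥤ ℰ} {W W' : ℰ} {Z : 𝒞} (i : W ⟶ W') [IsIso i]
    {ξ : F.obj Z ⟶ W} : IsCounivArrow F (ξ ≫ i) ↔ IsCounivArrow F ξ := by
  refine forall_congr' fun Z' => ?_
  have : (fun g : Z' ⟶ Z => F.map g ≫ ξ ≫ i) = (fun k => k ≫ i) ∘ fun g => F.map g ≫ ξ := by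
    funext g
    simp
  rw [this]
  exact Function.Bijective.of_comp_iff' ⟨fun a b hab => (cancel_mono i).1 hab,
    fun k => ⟨k ≫ inv i, by simp⟩⟩ _

theorem isUnivArrow_natIso_iff {F G : 𝒞 ⥤ ℰ} (e : F ≅ G) {W : ℰ} {Z : 𝒞} {η : W ⟶ F.obj Z} :
    IsUnivArrow G (η ≫ e.hom.app Z) ↔ IsUnivArrow F η := by
  refine forall_congr' fun Z' => ?_
  have : (fun g : Z ⟶ Z' => (η ≫ e.hom.app Z) ≫ G.map g) =
      (fun k => k ≫ e.hom.app Z') ∘ fun g => η ≫ F.map g := by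
    funext g
    simp
  rw [this]
  exact Function.Bijective.of_comp_iff' ⟨fun a b hab => (cancel_mono (e.hom.app Z')).1 hab,
    fun k => ⟨k ≫ e.inv.app Z', by simp⟩⟩ _

theorem isCounivArrow_natIso_iff {F G : 𝒞 ⥤ ℰ} (e : F ≅ G) {W : ℰ} {Z : 𝒞} {ξ : F.obj Z ⟶ W} :
    IsCounivArrow G (e.inv.app Z ≫ ξ) ↔ IsCounivArrow F ξ := by
  refine forall_congr' fun Z' => ?_
  have : (fun g : Z' ⟶ Z => G.map g ≫ e.inv.app Z ≫ ξ) =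
      (fun k => e.inv.app Z' ≫ k) ∘ fun g => F.map g ≫ ξ := by
    funext g
    simp
  rw [this]
  exact Function.Bijective.of_comp_iff' ⟨fun a b hab => (cancel_epi (e.inv.app Z')).1 hab,
    fun k => ⟨e.hom.app Z' ≫ k, by simp⟩⟩ _

/-- Universal arrows to `F` remain universal under a left adjoint `R` (with right adjoint `L`) if
the values of `F` are in the essential image of `L`. -/
theorem isUnivArrow_map_iff {F : 𝒞 ⥤ ℰ} {R : ℰ ⥤ ℱ} {L : ℱ ⥤ ℰ} (adj : R ⊣ L)
    (h : ∀ Z, IsIso (adj.unit.app (F.obj Z))) {W : ℰ} {Z : 𝒞} {η : W ⟶ F.obj Z} :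
    IsUnivArrow (F ⋙ R) (Z := Z) (R.map η) ↔ IsUnivArrow F η := by
  refine forall_congr' fun Z' => ?_
  -- By a triangle identity, applying `R` amounts to composing with the unit and passing to
  -- adjuncts.
  have : (fun g : Z ⟶ Z' => R.map η ≫ (F ⋙ R).map g) =
      (fun k => (adj.homEquiv _ _).symm (k ≫ adj.unit.app (F.obj Z'))) ∘
        fun g => η ≫ F.map g := by
    funext g
    simp [Adjunction.homEquiv_counit]
  rw [this]
  have := h Z'
  exact Function.Bijective.of_comp_iff' ((adj.homEquiv _ _).symm.bijective.comp
    ⟨fun a b hab => (cancel_mono (adj.unit.app (F.obj Z'))).1 hab, fun k => ⟨k ≫ inv (adj.unit.app (F.obj Z')), by simp⟩⟩) _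

theorem isCounivArrow_map_iff {F : 𝒞 ⥤ ℰ} {R : ℰ ⥤ ℱ} {L : ℱ ⥤ ℰ} (adj : L ⊣ R)
    (h : ∀ Z, IsIso (adj.counit.app (F.obj Z))) {W : ℰ} {Z : 𝒞} {ξ : F.obj Z ⟶ W} :
    IsCounivArrow (F ⋙ R) (Z := Z) (R.map ξ) ↔ IsCounivArrow F ξ := by
  refine forall_congr' fun Z' => ?_
  have : (fun g : Z' ⟶ Z => (F ⋙ R).map g ≫ R.map ξ) =
      (fun k => adj.homEquiv _ _ (adj.counit.app (F.obj Z') ≫ k)) ∘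
        fun g => F.map g ≫ ξ := by
    funext g
    simp [Adjunction.homEquiv_unit]
  rw [this]
  have := h Z'
  exact Function.Bijective.of_comp_iff' ((adj.homEquiv _ _).bijective.comp
    ⟨fun a b hab => (cancel_epi (adj.counit.app (F.obj Z'))).1 hab, fun k => ⟨inv (adj.counit.app (F.obj Z')) ≫ k, by simp⟩⟩) _

/-- Needed when a colimit has been reduced to a one-point index category, where the constant diagram
functor is an equivalence. -/
theorem isUnivArrow_of_equivalence (F : 𝒞 ⥤ ℰ) [F.IsEquivalence] {W : ℰ} {Z : 𝒞} (η : W ⟶ F.obj Z) :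
    IsUnivArrow F η ↔ IsIso η := by
  constructor
  · intro h
    obtain ⟨k, hk⟩ := (h (F.objPreimage W)).2 (F.objObjPreimageIso W).inv
    have hk : η ≫ F.map k = (F.objObjPreimageIso W).inv := hk
    have h1 : η ≫ F.map k ≫ (F.objObjPreimageIso W).hom = 𝟙 _ := by
      rw [reassoc_of% hk]; simp
    refine ⟨F.map k ≫ (F.objObjPreimageIso W).hom, h1, ?_⟩
    obtain ⟨m, hm⟩ := F.map_surjective (F.map k ≫ (F.objObjPreimageIso W).hom ≫ η)
    have : m = 𝟙 Z := (h Z).1 (by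
      change η ≫ F.map m = η ≫ F.map (𝟙 Z)
      rw [hm, reassoc_of% h1]; simp)
    rw [Category.assoc, ← hm, this, F.map_id]
  · intro _ Z'
    exact ⟨fun a b hab => F.map_injective ((cancel_epi η).1 hab),
      fun k => ⟨F.preimage (inv η ≫ k), by simp⟩⟩

theorem isCounivArrow_of_equivalence (F : 𝒞 ⥤ ℰ) [F.IsEquivalence] {W : ℰ} {Z : 𝒞}
    (ξ : F.obj Z ⟶ W) : IsCounivArrow F ξ ↔ IsIso ξ := by
  constructor
  · intro h
    obtain ⟨k, hk⟩ := (h (F.objPreimage W)).2 (F.objObjPreimageIso W).hom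
    have hk : F.map k ≫ ξ = (F.objObjPreimageIso W).hom := hk
    have h1 : ((F.objObjPreimageIso W).inv ≫ F.map k) ≫ ξ = 𝟙 _ := by
      rw [Category.assoc, hk]; simp
    refine ⟨(F.objObjPreimageIso W).inv ≫ F.map k, ?_, h1⟩
    obtain ⟨m, hm⟩ := F.map_surjective (ξ ≫ (F.objObjPreimageIso W).inv ≫ F.map k)
    have : m = 𝟙 Z := (h Z).1 (by
      change F.map m ≫ ξ = F.map (𝟙 Z) ≫ ξ
      rw [hm, Category.assoc, h1]; simp)
    rw [← hm, this, F.map_id]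
  · intro _ Z'
    exact ⟨fun a b hab => F.map_injective ((cancel_mono ξ).1 hab),
      fun k => ⟨F.preimage (k ≫ inv ξ), by simp⟩⟩

end Universal

/-! ### Universal cocones and cones -/

section Cones

variable {D : Prederivator.{u, v, w}} {A B C J K K' : Cat.{u, u}}

/-- `Z` is in the essential image of the left Kan extension along the fully faithful functor `f`,
formulated as a colocality property. -/
def IsLan (f : A ⥤ B) (Z : val D B) : Prop :=
  ∀ Z', Function.Bijective fun g : Z ⟶ Z' => (res D f).map g

/-- `Z` is in the essential image of the right Kan extension along the fully faithful functor `f`,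
formulated as a locality property. -/
def IsRan (f : A ⥤ B) (Z : val D B) : Prop :=
  ∀ Z', Function.Bijective fun g : Z' ⟶ Z => (res D f).map g

theorem isLan_iff {f : A ⥤ B} {Z : val D B} :
    IsLan f Z ↔ IsUnivArrow (res D f) (𝟙 ((res D f).obj Z)) := by
  simp [IsLan, IsUnivArrow]

theorem isRan_iff {f : A ⥤ B} {Z : val D B} :
    IsRan f Z ↔ IsCounivArrow (res D f) (𝟙 ((res D f).obj Z)) := by
  simp [IsRan, IsCounivArrow]

/-- The cocone `g^* Z ⟶ π^* β^* Z` induced by `γ : g ⟶ β π`. -/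
def leftCone (π : K ⥤ J) {g : K ⥤ B} (β : J ⥤ B) (γ : g ⟶ π ⋙ β) (Z : val D B) :
    (res D g).obj Z ⟶ (res D π).obj ((res D β).obj Z) :=
  (resNat D γ).app Z ≫ (resComp D π β).hom.app Z

/-- The cone `π^* β^* Z ⟶ g^* Z` induced by `γ : β π ⟶ g`. -/
def rightCone (π : K ⥤ J) {g : K ⥤ B} (β : J ⥤ B) (γ : π ⋙ β ⟶ g) (Z : val D B) :
    (res D π).obj ((res D β).obj Z) ⟶ (res D g).obj Z :=
  (resComp D π β).inv.app Z ≫ (resNat D γ).app Z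

/-- The cocone induced by `γ : g ⟶ β π` on `Z` is universal. -/
def IsLeftExact (π : K ⥤ J) {g : K ⥤ B} (β : J ⥤ B) (γ : g ⟶ π ⋙ β) (Z : val D B) : Prop :=
  IsUnivArrow (res D π) (leftCone π β γ Z)

/-- The cone induced by `γ : β π ⟶ g` on `Z` is universal. -/
def IsRightExact (π : K ⥤ J) {g : K ⥤ B} (β : J ⥤ B) (γ : π ⋙ β ⟶ g) (Z : val D B) : Prop :=
  IsCounivArrow (res D π) (rightCone π β γ Z)

/-- Cocones on a restricted diagram. -/
theorem isLeftExact_res_iff (π : K ⥤ J) {g : K ⥤ B} (β : J ⥤ B) (γ : g ⟶ π ⋙ β) (h : B ⥤ C)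
    (Z : val D C) : IsLeftExact π β γ ((res D h).obj Z) ↔
      IsLeftExact π (β ⋙ h) (Functor.whiskerRight γ h) Z := by
  have e : leftCone π (β ⋙ h) (Functor.whiskerRight γ h) Z ≫
      (res D π).map ((resComp D β h).hom.app Z) =
        (resComp D g h).hom.app Z ≫ leftCone π β γ ((res D h).obj Z) := by
    simp only [leftCone, Category.assoc]
    rw [resComp_assoc, ← resNat_whiskerRight_assoc]
  rw [IsLeftExact, IsLeftExact, ← isUnivArrow_isIso_comp_iff ((resComp D g h).hom.app Z), ← e,
    isUnivArrow_comp_map_iff]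

theorem isRightExact_res_iff (π : K ⥤ J) {g : K ⥤ B} (β : J ⥤ B) (γ : π ⋙ β ⟶ g) (h : B ⥤ C)
    (Z : val D C) : IsRightExact π β γ ((res D h).obj Z) ↔
      IsRightExact π (β ⋙ h) (Functor.whiskerRight γ h) Z := by
  have e : (res D π).map ((resComp D β h).hom.app Z) ≫ rightCone π β γ ((res D h).obj Z) =
      rightCone π (β ⋙ h) (Functor.whiskerRight γ h) Z ≫ (resComp D g h).hom.app Z := by
    simp only [rightCone, Category.assoc]
    rw [resNat_whiskerRight, ← cancel_epi ((resComp D π (β ⋙ h)).hom.app Z),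
      Iso.hom_inv_id_app_assoc, resComp_assoc_assoc, Iso.hom_inv_id_app_assoc]
  rw [IsRightExact, IsRightExact, ← isCounivArrow_comp_isIso_iff ((resComp D g h).hom.app Z), ← e,
    isCounivArrow_map_comp_iff]

theorem isIso_resNat {f g : A ⥤ B} (i : f ⟶ g) [IsIso i] : IsIso (resNat D i) :=
  ⟨resNat D (inv i), by rw [← resNat_comp, IsIso.hom_inv_id, resNat_id], by
    rw [← resNat_comp, IsIso.inv_hom_id, resNat_id]⟩

/-- The cocone may be replaced by an isomorphic one. -/
theorem isLeftExact_iso_iff (π : K ⥤ J) {g g' : K ⥤ B} {β β' : J ⥤ B} (γ : g ⟶ π ⋙ β)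
    (γ' : g' ⟶ π ⋙ β') (i : g ≅ g') (j : β ≅ β')
    (h : i.hom ≫ γ' = γ ≫ Functor.whiskerLeft π j.hom) (Z : val D B) :
    IsLeftExact π β γ Z ↔ IsLeftExact π β' γ' Z := by
  have e : (resNat D i.hom).app Z ≫ leftCone π β' γ' Z =
      leftCone π β γ Z ≫ (res D π).map ((resNat D j.hom).app Z) := by
    simp only [leftCone, Category.assoc]
    rw [← resNat_whiskerLeft, ← NatTrans.comp_app_assoc, ← NatTrans.comp_app_assoc, ← resNat_comp,
      ← resNat_comp, h]
  have hi := isIso_resNat (D := D) i.hom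
  have hj := isIso_resNat (D := D) j.hom
  rw [IsLeftExact, IsLeftExact, ← isUnivArrow_comp_map_iff ((resNat D j.hom).app Z), ← e,
    isUnivArrow_isIso_comp_iff]

/-- The isomorphism `f^* ≅ g^*` induced by `f ≅ g`. -/
def resIso {f g : A ⥤ B} (i : f ≅ g) : res D f ≅ res D g where
  hom := resNat D i.hom
  inv := resNat D i.inv
  hom_inv_id := by rw [← resNat_comp, Iso.hom_inv_id, resNat_id]
  inv_hom_id := by rw [← resNat_comp, Iso.inv_hom_id, resNat_id]

theorem isRightExact_iso_iff (π : K ⥤ J) {g g' : K ⥤ B} {β β' : J ⥤ B} (γ : π ⋙ β ⟶ g)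
    (γ' : π ⋙ β' ⟶ g') (i : g ≅ g') (j : β ≅ β')
    (h : γ ≫ i.hom = Functor.whiskerLeft π j.hom ≫ γ') (Z : val D B) :
    IsRightExact π β γ Z ↔ IsRightExact π β' γ' Z := by
  have e : rightCone π β γ Z ≫ (resNat D i.hom).app Z =
      (res D π).map ((resNat D j.hom).app Z) ≫ rightCone π β' γ' Z := by
    simp only [rightCone, Category.assoc]
    rw [← cancel_epi ((resComp D π β).hom.app Z), ← resNat_whiskerLeft_assoc,
      Iso.hom_inv_id_app_assoc, Iso.hom_inv_id_app_assoc, ← NatTrans.comp_app, ← NatTrans.comp_app,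
      ← resNat_comp, ← resNat_comp, h]
  have hi := isIso_resNat (D := D) i.hom
  have hj := isIso_resNat (D := D) j.hom
  rw [IsRightExact, IsRightExact, ← isCounivArrow_comp_isIso_iff ((resNat D i.hom).app Z), e,
    isCounivArrow_map_comp_iff]

theorem IsLan.of_iso {f : A ⥤ B} {Z Z' : val D B} (h : IsLan f Z) (e : Z ≅ Z') : IsLan f Z' := by
  rw [isLan_iff] at h ⊢
  have h1 := h.comp_isIso e.hom
  rw [Category.id_comp, ← Category.comp_id ((res D f).map e.hom)] at h1
  exact (isUnivArrow_isIso_comp_iff _).1 h1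

theorem IsRan.of_iso {f : A ⥤ B} {Z Z' : val D B} (h : IsRan f Z) (e : Z ≅ Z') : IsRan f Z' := by
  rw [isRan_iff] at h ⊢
  have h1 := h.isIso_comp e.inv
  rw [Category.comp_id, ← Category.id_comp ((res D f).map e.inv)] at h1
  exact (isCounivArrow_comp_isIso_iff _).1 h1

end Cones

/-! ### Homotopy finality of adjoint functors -/

section Derivators

variable {D : Prederivator.{u, v, w}} {A B C J K K' : Cat.{u, u}}

/-- The adjunction in the 1-cell dual of `Cat` opposite to `l ⊣ r`. -/
def opAdjunction {l : K ⥤ K'} {r : K' ⥤ K} (adj : l ⊣ r) :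
    Bicategory.Adjunction (B := Cat.{u, u}ᵒᵖ) (Functor.toCatHom r).op (Functor.toCatHom l).op where
  unit := Bicategory.Opposite.op2 (NatTrans.toCatHom₂ adj.unit)
  counit := Bicategory.Opposite.op2 (NatTrans.toCatHom₂ adj.counit)
  -- Reversing the 1-cells exchanges the two triangle identities.
  left_triangle := congrArg Bicategory.Opposite.op2 (by
    ext X
    simp [BicategoricalCoherence.iso]
    change adj.unit.app (r.obj X) ≫ (𝟙 _ ≫ 𝟙 _) ≫ r.map (adj.counit.app X) = 𝟙 _ ≫ 𝟙 _
    simpa using adj.right_triangle_components X)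
  right_triangle := congrArg Bicategory.Opposite.op2 (by
    ext X
    simp [BicategoricalCoherence.iso]
    change l.map (adj.unit.app X) ≫ (𝟙 _ ≫ 𝟙 _) ≫ adj.counit.app (l.obj X) = 𝟙 _ ≫ 𝟙 _
    exact ((congrArg _ ((congrArg (· ≫ _) (Category.id_comp _)).trans (Category.id_comp _))).trans
      (adj.left_triangle_components X)).trans (Category.id_comp _).symm)

/-- The adjunction `r^* ⊣ l^*` induced by `l ⊣ r`. -/
def resAdj (D : Prederivator.{u, v, w}) {l : K ⥤ K'} {r : K' ⥤ K} (adj : l ⊣ r) : res D r ⊣ res D l :=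
  Adjunction.ofCat (D.mapAdjunction (opAdjunction adj))

theorem resAdj_unit_app {l : K ⥤ K'} {r : K' ⥤ K} (adj : l ⊣ r) (Z : val D K) :
  (resAdj D adj).unit.app Z = (resId D K).inv.app Z ≫ (resNat D adj.unit).app Z ≫ (resComp D l r).hom.app Z := rfl
theorem resAdj_counit_app {l : K ⥤ K'} {r : K' ⥤ K} (adj : l ⊣ r) (Z : val D K') :
  (resAdj D adj).counit.app Z = (resComp D r l).inv.app Z ≫ (resNat D adj.counit).app Z ≫ (resId D K').hom.app Z := rfl


theorem pt_hom_ext {x y : (pt.{u} : Cat.{u, u})} (f g : x ⟶ y) : f = g :=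
  @Subsingleton.elim _ (inferInstanceAs (Subsingleton (ULift (PLift (_ = _))))) f g

/-- The unique morphism between two objects of the terminal category. -/
def ptHom (x y : (pt.{u} : Cat.{u, u})) : x ⟶ y :=
  eqToHom (C := Discrete PUnit.{u + 1}) (Subsingleton.elim _ _)

/-- A terminal object is right adjoint to the functor to the terminal category. -/
def ptAdjOfIsTerminal {t : K} (ht : Limits.IsTerminal t) : toPt K ⊣ atObj t where
  unit := { app := fun x => ht.from x, naturality := fun _ _ _ => ht.hom_ext _ _ }
  counit := { app := fun _ => ptHom _ _, naturality := fun _ _ _ => pt_hom_ext _ _ }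
  left_triangle_components _ := pt_hom_ext _ _
  right_triangle_components _ := ht.hom_ext _ _

/-- An initial object is left adjoint to the functor to the terminal category. -/
def ptAdjOfIsInitial {t : K} (ht : Limits.IsInitial t) : atObj t ⊣ toPt K where
  unit := { app := fun _ => ptHom _ _, naturality := fun _ _ _ => pt_hom_ext _ _ }
  counit := { app := fun x => ht.to x, naturality := fun _ _ _ => ht.hom_ext _ _ }
  left_triangle_components _ := ht.hom_ext _ _
  right_triangle_components _ := pt_hom_ext _ _

theorem isIso_of_codomain_pt {g g' : K ⥤ (pt.{u} : Cat.{u, u})} (α : g ⟶ g') : IsIso α :=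
  ⟨{ app := fun _ => ptHom _ _, naturality := fun _ _ _ => pt_hom_ext _ _ },
    by ext; exact pt_hom_ext _ _, by ext; exact pt_hom_ext _ _⟩

theorem isIso_resNat_app {f g : A ⥤ B} (α : f ⟶ g) [IsIso α] (Z : val D B) :
    IsIso ((resNat D α).app Z) := by
  have := isIso_resNat (D := D) α
  infer_instance

/-- A constant diagram does not see the index functors: after composition with `toPt`, every
transformation becomes one between functors to a point and is thus invertible. -/
theorem isIso_resNat_app_toPt {g g' : K ⥤ K'} (α : g ⟶ g') (y : val D pt) :
    IsIso ((resNat D α).app ((res D (toPt K')).obj y)) := by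
  have := isIso_of_codomain_pt (Functor.whiskerRight α (toPt K'))
  have := isIso_resNat_app (D := D) (Functor.whiskerRight α (toPt K')) y
  have h2 := resNat_whiskerRight (D := D) α (toPt K') y
  have h3 : IsIso ((resComp D g (toPt K')).hom.app y ≫
    (resNat D α).app ((res D (toPt K')).obj y)) := by
    rw [← h2]
    infer_instance
  exact IsIso.of_isIso_comp_left ((resComp D g (toPt K')).hom.app y) _

/-- The functor `res D r` is left adjoint to `res D l`, and the unit of this adjunction is
invertible on constant diagrams. Universal arrows to constant diagrams are thus preserved and
reflected. -/
theorem isUnivArrow_final_iff {l : K ⥤ K'} {r : K' ⥤ K} (adj : l ⊣ r) {V : val D K} {y : val D pt}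
    (η : V ⟶ (res D (toPt K)).obj y) :
    IsUnivArrow (res D (toPt K')) ((res D r).map η ≫ (resComp D r (toPt K)).inv.app y) ↔
      IsUnivArrow (res D (toPt K)) η := by
  rw [← isUnivArrow_map_iff (resAdj D adj) (F := res D (toPt K)) (fun Z => ?_)]
  · exact isUnivArrow_natIso_iff (resComp D r (toPt K)).symm
  · rw [resAdj_unit_app]
    have := isIso_resNat_app_toPt adj.unit Z
    infer_instance

theorem isCounivArrow_initial_iff {l : K' ⥤ K} {r : K ⥤ K'} (adj : l ⊣ r) {V : val D K}
    {y : val D pt} (ξ : (res D (toPt K)).obj y ⟶ V) :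
    IsCounivArrow (res D (toPt K')) ((resComp D l (toPt K)).hom.app y ≫ (res D l).map ξ) ↔
      IsCounivArrow (res D (toPt K)) ξ := by
  rw [← isCounivArrow_map_iff (resAdj D adj) (F := res D (toPt K)) (fun Z => ?_)]
  · exact isCounivArrow_natIso_iff (resComp D l (toPt K)).symm
  · rw [resAdj_counit_app]
    have := isIso_resNat_app_toPt adj.counit Z
    infer_instance

theorem map_leftCone (r : K' ⥤ K) (π : K ⥤ J) {g : K ⥤ B} (β : J ⥤ B) (γ : g ⟶ π ⋙ β)
    (Z : val D B) : (resComp D r g).hom.app Z ≫ (res D r).map (leftCone π β γ Z) =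
      leftCone (g := r ⋙ g) (r ⋙ π) β (Functor.whiskerLeft r γ) Z ≫
        (resComp D r π).hom.app ((res D β).obj Z) := by
  refine (congrArg _ (Functor.map_comp _ _ _)).trans
    ((resNat_whiskerLeft_assoc r γ Z _).symm.trans ?_)
  exact (congrArg _ (resComp_assoc r π β Z)).trans (Category.assoc _ _ _).symm

theorem map_rightCone (l : K' ⥤ K) (π : K ⥤ J) {g : K ⥤ B} (β : J ⥤ B) (γ : π ⋙ β ⟶ g)
    (Z : val D B) : (resComp D l π).hom.app ((res D β).obj Z) ≫ (res D l).map (rightCone π β γ Z) =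
      rightCone (g := l ⋙ g) (l ⋙ π) β (Functor.whiskerLeft l γ) Z ≫ (resComp D l g).hom.app Z := by
  rw [← cancel_epi ((resComp D (l ⋙ π) β).hom.app Z)]
  refine (resComp_assoc_assoc l π β Z _).symm.trans ?_
  rw [← Functor.map_comp, rightCone, Iso.hom_inv_id_app_assoc, rightCone, Category.assoc,
    Iso.hom_inv_id_app_assoc]
  exact (resNat_whiskerLeft l γ Z).symm

/-- Right adjoint functors are homotopy final. -/
theorem isLeftExact_final_iff {l : K ⥤ K'} {r : K' ⥤ K} (adj : l ⊣ r) {g : K ⥤ B}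
    {β : (pt.{u} : Cat.{u, u}) ⥤ B} (γ : g ⟶ toPt K ⋙ β) (Z : val D B) :
    IsLeftExact (g := r ⋙ g) (toPt K') β (Functor.whiskerLeft r γ) Z ↔
      IsLeftExact (toPt K) β γ Z := by
  unfold IsLeftExact
  rw [← isUnivArrow_final_iff adj,
    ← isUnivArrow_isIso_comp_iff ((resComp D r g).hom.app Z)]
  refine iff_of_eq (congrArg _ ?_)
  have h := congrArg (· ≫ (resComp D r (toPt K)).inv.app _) (map_leftCone r (toPt K) β γ Z)
  simp only [Category.assoc, Iso.hom_inv_id_app] at h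
  exact (Category.comp_id _).symm.trans h.symm

/-- Left adjoint functors are homotopy initial. -/
theorem isRightExact_initial_iff {l : K' ⥤ K} {r : K ⥤ K'} (adj : l ⊣ r) {g : K ⥤ B}
    {β : (pt.{u} : Cat.{u, u}) ⥤ B} (γ : toPt K ⋙ β ⟶ g) (Z : val D B) :
    IsRightExact (g := l ⋙ g) (toPt K') β (Functor.whiskerLeft l γ) Z ↔
      IsRightExact (toPt K) β γ Z := by
  unfold IsRightExact
  rw [← isCounivArrow_initial_iff adj,
    ← isCounivArrow_comp_isIso_iff ((resComp D l g).hom.app Z)]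
  exact iff_of_eq (congrArg _ (map_rightCone l (toPt K) β γ Z).symm)

/-! ### The axiom (Der4) for universal arrows -/

section Slices

/-- The pointwise formula freed from a chosen adjoint: `η` differs from the unit of any left Kan
extension functor by an isomorphism `k`, and for the unit the claim is the invertibility of the mate
in (Der4). -/
theorem IsDerivator.isUnivArrow_slice (hD : IsDerivator D) (f : A ⥤ B) (b : B) {W : val D A}
    {Z : val D B} {η : W ⟶ (res D f).obj Z} (h : IsUnivArrow (res D f) η) :
    IsUnivArrow (res D (toPt (sliceOver f b))) ((res D (sliceOverProj f b)).map η ≫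
      (resComp D (sliceOverProj f b) f).inv.app Z ≫
        leftCone (toPt (sliceOver f b)) (atObj b) (sliceOverTrans f b) Z) := by
  have := hD.der3_left f
  have := hD.der3_left (toPt (sliceOver f b))
  let adj := Adjunction.ofIsRightAdjoint (res D f)
  let adj' := Adjunction.ofIsRightAdjoint (res D (toPt (sliceOver f b)))
  have h4 := hD.der4_left f b _ _ adj adj'
  obtain ⟨k, hk⟩ := (IsUnivArrow.of_adj adj W Z).2 η
  have hk : adj.unit.app W ≫ (res D f).map k = η := hk
  have : IsIso k := (IsUnivArrow.of_adj adj W).isIso (hk ▸ h)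
  -- This equates the unit of the colimit adjunction followed by the mate with the canonical cocone
  -- on the Kan extension.
  have h1 := unit_mateEquiv_symm adj adj' (sliceOverSquare D f b) W
  have h2 : IsIso (((mateEquiv adj adj').symm (sliceOverSquare D f b)).app W) :=
    inferInstanceAs (IsIso (((mateEquiv adj adj').symm (sliceOverSquare D f b)).natTrans.app W))
  have h3 := (IsUnivArrow.of_adj adj' ((res D (sliceOverProj f b)).obj W)).comp_isIso
    (((mateEquiv adj adj').symm (sliceOverSquare D f b)).app W)
  replace h3 := (iff_of_eq (congrArg _ h1)).2 h3
  have h5 := h3.comp_isIso ((res D (atObj b)).map k)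
  refine (iff_of_eq (congrArg _ ?_)).1 h5
  rw [← hk, Functor.map_comp, Category.assoc, Category.assoc]
  congr 1
  exact ((sliceOverSquare D f b).natTrans.naturality k).symm

theorem IsDerivator.isCounivArrow_slice (hD : IsDerivator D) (f : A ⥤ B) (b : B) {W : val D A}
    {Z : val D B} {ξ : (res D f).obj Z ⟶ W} (h : IsCounivArrow (res D f) ξ) :
    IsCounivArrow (res D (toPt (sliceUnder f b)))
      ((rightCone (toPt (sliceUnder f b)) (atObj b) (sliceUnderTrans f b) Z ≫
      (resComp D (sliceUnderProj f b) f).hom.app Z) ≫ (res D (sliceUnderProj f b)).map ξ) := by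
  have := hD.der3_right f
  have := hD.der3_right (toPt (sliceUnder f b))
  let adj := Adjunction.ofIsLeftAdjoint (res D f)
  let adj' := Adjunction.ofIsLeftAdjoint (res D (toPt (sliceUnder f b)))
  have h4 := hD.der4_right f b _ _ adj adj'
  obtain ⟨k, hk⟩ := (IsCounivArrow.of_adj adj W Z).2 ξ
  have hk : (res D f).map k ≫ adj.counit.app W = ξ := hk
  have : IsIso k := (IsCounivArrow.of_adj adj W).isIso (hk ▸ h)
  have h1 := mateEquiv_counit adj adj' (sliceUnderSquare D f b) W
  have h2 : IsIso ((mateEquiv adj adj' (sliceUnderSquare D f b)).app W) :=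
    inferInstanceAs (IsIso ((mateEquiv adj adj' (sliceUnderSquare D f b)).natTrans.app W))
  have h3 := (IsCounivArrow.of_adj adj' ((res D (sliceUnderProj f b)).obj W)).isIso_comp
    ((mateEquiv adj adj' (sliceUnderSquare D f b)).app W)
  replace h3 := (iff_of_eq (congrArg _ h1)).1 h3
  have h5 := h3.isIso_comp ((res D (atObj b)).map k)
  refine (iff_of_eq (congrArg _ ?_)).1 h5
  rw [← hk, Functor.map_comp, ← Category.assoc, ← Category.assoc]
  congr 1
  refine ((sliceUnderSquare D f b).natTrans.naturality k).trans (congrArg (· ≫ _) ?_)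
  exact (Category.assoc _ _ _).symm

/-- If a cocone is universal after restriction to the slice over `b`, then the comparison with the
left Kan extension is invertible at `b`. -/
theorem IsDerivator.isIso_map_of_isUnivArrow_slice (hD : IsDerivator D) (f : A ⥤ B) (b : B)
    {W : val D A} {Z₀ Z : val D B} {η : W ⟶ (res D f).obj Z₀} (h : IsUnivArrow (res D f) η)
    (k : Z₀ ⟶ Z) (hk : IsUnivArrow (res D (toPt (sliceOver f b)))
      ((res D (sliceOverProj f b)).map (η ≫ (res D f).map k) ≫
      (resComp D (sliceOverProj f b) f).inv.app Z ≫
        leftCone (toPt (sliceOver f b)) (atObj b) (sliceOverTrans f b) Z)) :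
    IsIso ((res D (atObj b)).map k) := by
  refine (hD.isUnivArrow_slice f b h).isIso ((iff_of_eq (congrArg _ ?_)).1 hk)
  rw [Functor.map_comp, Category.assoc, Category.assoc]
  congr 1
  exact (sliceOverSquare D f b).natTrans.naturality k

theorem IsDerivator.isIso_map_of_isCounivArrow_slice (hD : IsDerivator D) (f : A ⥤ B) (b : B)
    {W : val D A} {Z₀ Z : val D B} {ξ : (res D f).obj Z₀ ⟶ W} (h : IsCounivArrow (res D f) ξ)
    (k : Z ⟶ Z₀) (hk : IsCounivArrow (res D (toPt (sliceUnder f b)))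
      ((rightCone (toPt (sliceUnder f b)) (atObj b) (sliceUnderTrans f b) Z ≫
      (resComp D (sliceUnderProj f b) f).hom.app Z) ≫
        (res D (sliceUnderProj f b)).map ((res D f).map k ≫ ξ))) :
    IsIso ((res D (atObj b)).map k) := by
  refine (hD.isCounivArrow_slice f b h).isIso ((iff_of_eq (congrArg _ ?_)).1 hk)
  rw [Functor.map_comp, ← Category.assoc, ← Category.assoc]
  congr 1
  refine Eq.trans ?_ (((sliceUnderSquare D f b).natTrans.naturality k).symm.trans
    (congrArg (_ ≫ ·) ?_))
  · exact congrArg (· ≫ _) (Category.assoc _ _ _)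
  · exact (Category.assoc _ _ _).symm

theorem IsDerivator.exists_isUnivArrow (hD : IsDerivator D) (f : A ⥤ B) (W : val D A) :
    ∃ (Z : val D B) (η : W ⟶ (res D f).obj Z), IsUnivArrow (res D f) η := by
  have := hD.der3_left f
  exact ⟨_, _, IsUnivArrow.of_adj (Adjunction.ofIsRightAdjoint (res D f)) W⟩

theorem IsDerivator.exists_isCounivArrow (hD : IsDerivator D) (f : A ⥤ B) (W : val D A) :
    ∃ (Z : val D B) (ξ : (res D f).obj Z ⟶ W), IsCounivArrow (res D f) ξ := by
  have := hD.der3_right f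
  exact ⟨_, _, IsCounivArrow.of_adj (Adjunction.ofIsLeftAdjoint (res D f)) W⟩

end Slices

end Derivators

/-! ### Kan extensions along fully faithful functors -/

section FullyFaithful

variable {D : Prederivator.{u, v, w}} {A B C J K K' : Cat.{u, u}}

instance isEquivalence_res_toPt_pt : (res D (toPt pt)).IsEquivalence := by
  have e : 𝟭 (pt.{u} : Cat.{u, u}) ≅ toPt pt := NatIso.ofComponents (fun _ => Iso.refl _)
    fun _ => pt_hom_ext _ _
  exact Functor.isEquivalence_of_iso ((resId D pt).symm ≪≫ resIso e)

/-- The inclusion of a terminal object is a right adjoint and hence final, so the colimit is the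
value there. -/
theorem isUnivArrow_toPt_iff {t : K} (ht : Limits.IsTerminal t) {V : val D K} {y : val D pt}
    (η : V ⟶ (res D (toPt K)).obj y) :
    IsUnivArrow (res D (toPt K)) η ↔ IsIso ((res D (atObj t)).map η) := by
  rw [← isUnivArrow_final_iff (ptAdjOfIsTerminal ht), isUnivArrow_of_equivalence]
  have : IsIso ((resComp D (atObj t) (toPt K)).inv.app y) := inferInstance
  exact isIso_comp_right_iff _ ((resComp D (atObj t) (toPt K)).inv.app y)

theorem isCounivArrow_toPt_iff {t : K} (ht : Limits.IsInitial t) {V : val D K} {y : val D pt}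
    (ξ : (res D (toPt K)).obj y ⟶ V) :
    IsCounivArrow (res D (toPt K)) ξ ↔ IsIso ((res D (atObj t)).map ξ) := by
  rw [← isCounivArrow_initial_iff (ptAdjOfIsInitial ht), isCounivArrow_of_equivalence]
  have : IsIso ((resComp D (atObj t) (toPt K)).hom.app y) := inferInstance
  exact isIso_comp_left_iff ((resComp D (atObj t) (toPt K)).hom.app y) _

theorem isIso_map_leftCone (π : K ⥤ J) {g : K ⥤ B} (β : J ⥤ B) (γ : g ⟶ π ⋙ β) (Z : val D B)
    (t : K) [IsIso (γ.app t)] : IsIso ((res D (atObj t)).map (leftCone π β γ Z)) := by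
  have : IsIso (Functor.whiskerLeft (atObj t) γ) := by
    have (x : (pt.{u} : Cat.{u, u})) : IsIso ((Functor.whiskerLeft (atObj t) γ).app x) :=
      inferInstanceAs (IsIso (γ.app t))
    exact NatIso.isIso_of_isIso_app _
  have h1 := isIso_resNat_app (D := D) (Functor.whiskerLeft (atObj t) γ) Z
  have h2 : IsIso ((resComp D (atObj t) g).hom.app Z ≫
      (res D (atObj t)).map (leftCone π β γ Z)) := by
    rw [map_leftCone]
    have : IsIso (leftCone (g := atObj t ⋙ g) (atObj t ⋙ π) β
      (Functor.whiskerLeft (atObj t) γ) Z) := @IsIso.comp_isIso _ _ _ _ _ _ _ h1 inferInstance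
    infer_instance
  exact IsIso.of_isIso_comp_left ((resComp D (atObj t) g).hom.app Z) _

theorem isIso_map_rightCone (π : K ⥤ J) {g : K ⥤ B} (β : J ⥤ B) (γ : π ⋙ β ⟶ g) (Z : val D B)
    (t : K) [IsIso (γ.app t)] : IsIso ((res D (atObj t)).map (rightCone π β γ Z)) := by
  have : IsIso (Functor.whiskerLeft (atObj t) γ) := by
    have (x : (pt.{u} : Cat.{u, u})) : IsIso ((Functor.whiskerLeft (atObj t) γ).app x) :=
      inferInstanceAs (IsIso (γ.app t))
    exact NatIso.isIso_of_isIso_app _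
  have h1 := isIso_resNat_app (D := D) (Functor.whiskerLeft (atObj t) γ) Z
  have h2 : IsIso ((resComp D (atObj t) π).hom.app ((res D β).obj Z) ≫
      (res D (atObj t)).map (rightCone π β γ Z)) := by
    rw [map_rightCone]
    have : IsIso (rightCone (g := atObj t ⋙ g) (atObj t ⋙ π) β
      (Functor.whiskerLeft (atObj t) γ) Z) := @IsIso.comp_isIso _ _ _ _ _ _ _ inferInstance h1
    infer_instance
  exact IsIso.of_isIso_comp_left ((resComp D (atObj t) π).hom.app ((res D β).obj Z)) _

theorem isIso_map_atObj_comp_iff (p : K ⥤ A) (t : K) {W W' : val D A} (η : W ⟶ W') :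
    IsIso ((res D (atObj t)).map ((res D p).map η)) ↔ IsIso ((res D (atObj (p.obj t))).map η) := by
  have e : atObj t ⋙ p ≅ atObj (p.obj t) := NatIso.ofComponents (fun _ => Iso.refl _)
    fun f => by
      change p.map (𝟙 t) ≫ 𝟙 _ = 𝟙 _ ≫ 𝟙 _
      simp
  exact NatIso.isIso_map_iff ((resComp D (atObj t) p).symm ≪≫ resIso e) η

/-- Left Kan extensions along fully faithful functors are fully faithful. -/
theorem IsDerivator.isIso_of_isUnivArrow (hD : IsDerivator D) (f : A ⥤ B) [f.Full] [f.Faithful]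
    {W : val D A} {Z : val D B} {η : W ⟶ (res D f).obj Z} (h : IsUnivArrow (res D f) η) :
    IsIso η := by
  refine hD.der2 _ _ fun a => ?_
  -- As `f` is fully faithful, the slice over `f a` has the identity as a terminal object, and the
  -- pointwise colimit is evaluation at `a`.
  have h1 := (isUnivArrow_toPt_iff (CostructuredArrow.mkIdTerminal (S := f) (Y := a)) _).1
    (hD.isUnivArrow_slice f (f.obj a) h)
  have : IsIso ((sliceOverTrans f (f.obj a)).app (CostructuredArrow.mk (𝟙 (f.obj a)))) :=
    inferInstanceAs (IsIso (𝟙 (f.obj a)))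
  have h2 := isIso_map_leftCone (D := D) (toPt (sliceOver f (f.obj a))) (atObj (f.obj a))
    (sliceOverTrans f (f.obj a)) Z (CostructuredArrow.mk (𝟙 (f.obj a)))
  rw [Functor.map_comp, Functor.map_comp] at h1
  have h3 := (isIso_comp_right_iff _ (_ ≫ _)).1 h1
  exact (isIso_map_atObj_comp_iff (sliceOverProj f (f.obj a)) _ η).1 h3

/-- Right Kan extensions along fully faithful functors are fully faithful. -/
theorem IsDerivator.isIso_of_isCounivArrow (hD : IsDerivator D) (f : A ⥤ B) [f.Full] [f.Faithful]
    {W : val D A} {Z : val D B} {ξ : (res D f).obj Z ⟶ W} (h : IsCounivArrow (res D f) ξ) :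
    IsIso ξ := by
  refine hD.der2 _ _ fun a => ?_
  have h1 := (isCounivArrow_toPt_iff (StructuredArrow.mkIdInitial (T := f) (Y := a)) _).1
    (hD.isCounivArrow_slice f (f.obj a) h)
  have : IsIso ((sliceUnderTrans f (f.obj a)).app (StructuredArrow.mk (𝟙 (f.obj a)))) :=
    inferInstanceAs (IsIso (𝟙 (f.obj a)))
  have h2 := isIso_map_rightCone (D := D) (toPt (sliceUnder f (f.obj a))) (atObj (f.obj a))
    (sliceUnderTrans f (f.obj a)) Z (StructuredArrow.mk (𝟙 (f.obj a)))
  rw [Functor.map_comp, Functor.map_comp] at h1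
  have h3 := (isIso_comp_left_iff (_ ≫ _) _).1 h1
  exact (isIso_map_atObj_comp_iff (sliceUnderProj f (f.obj a)) _ ξ).1 h3

theorem IsDerivator.isLan_of_isUnivArrow (hD : IsDerivator D) (f : A ⥤ B) [f.Full] [f.Faithful]
    {W : val D A} {Z : val D B} {η : W ⟶ (res D f).obj Z} (h : IsUnivArrow (res D f) η) :
    IsLan f Z := by
  have := hD.isIso_of_isUnivArrow f h
  rwa [isLan_iff, ← isUnivArrow_isIso_comp_iff η, Category.comp_id]

theorem IsDerivator.isRan_of_isCounivArrow (hD : IsDerivator D) (f : A ⥤ B) [f.Full] [f.Faithful]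
    {W : val D A} {Z : val D B} {ξ : (res D f).obj Z ⟶ W} (h : IsCounivArrow (res D f) ξ) :
    IsRan f Z := by
  have := hD.isIso_of_isCounivArrow f h
  rwa [isRan_iff, ← isCounivArrow_comp_isIso_iff ξ, Category.id_comp]

theorem IsDerivator.exists_isLan (hD : IsDerivator D) (f : A ⥤ B) [f.Full] [f.Faithful]
    (W : val D A) : ∃ Z : val D B, IsLan f Z ∧ Nonempty ((res D f).obj Z ≅ W) := by
  obtain ⟨Z, η, h⟩ := hD.exists_isUnivArrow f W
  have := hD.isIso_of_isUnivArrow f h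
  exact ⟨Z, hD.isLan_of_isUnivArrow f h, ⟨(asIso η).symm⟩⟩

theorem IsDerivator.exists_isRan (hD : IsDerivator D) (f : A ⥤ B) [f.Full] [f.Faithful]
    (W : val D A) : ∃ Z : val D B, IsRan f Z ∧ Nonempty ((res D f).obj Z ≅ W) := by
  obtain ⟨Z, ξ, h⟩ := hD.exists_isCounivArrow f W
  have := hD.isIso_of_isCounivArrow f h
  exact ⟨Z, hD.isRan_of_isCounivArrow f h, ⟨asIso ξ⟩⟩

theorem IsDerivator.isLeftExact_slice_of_isLan (hD : IsDerivator D) (f : A ⥤ B) {Z : val D B}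
    (h : IsLan f Z) (b : B) :
    IsLeftExact (toPt (sliceOver f b)) (atObj b) (sliceOverTrans f b) Z := by
  have h1 := hD.isUnivArrow_slice f b (isLan_iff.1 h)
  rw [isUnivArrow_isIso_comp_iff] at h1
  exact (isUnivArrow_isIso_comp_iff _).1 h1

theorem IsDerivator.isRightExact_slice_of_isRan (hD : IsDerivator D) (f : A ⥤ B) {Z : val D B}
    (h : IsRan f Z) (b : B) :
    IsRightExact (toPt (sliceUnder f b)) (atObj b) (sliceUnderTrans f b) Z := by
  have h1 := hD.isCounivArrow_slice f b (isRan_iff.1 h)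
  rw [isCounivArrow_comp_isIso_iff] at h1
  exact (isCounivArrow_comp_isIso_iff _).1 h1

/-- The comparison with the true Kan extension is detected pointwise. On the image of `f` it is
invertible for free, so colimit formulas are only required at the new objects. -/
theorem IsDerivator.isLan_of_isLeftExact_slice (hD : IsDerivator D) (f : A ⥤ B) [f.Full]
    [f.Faithful] {Z : val D B} (h : ∀ b, (∃ a, f.obj a = b) ∨
      IsLeftExact (toPt (sliceOver f b)) (atObj b) (sliceOverTrans f b) Z) : IsLan f Z := by
  obtain ⟨Z₀, η, hη⟩ := hD.exists_isUnivArrow f ((res D f).obj Z)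
  have := hD.isIso_of_isUnivArrow f hη
  obtain ⟨k, hk⟩ := (hη Z).2 (𝟙 _)
  have hk : η ≫ (res D f).map k = 𝟙 _ := hk
  have : IsIso k := by
    refine hD.der2 _ _ fun b => ?_
    rcases h b with ⟨a, rfl⟩ | hb
    · rw [← isIso_map_atObj_comp_iff f a]
      have : IsIso ((res D f).map k) := by
        rw [← IsIso.inv_eq_of_hom_inv_id hk]
        infer_instance
      infer_instance
    · refine hD.isIso_map_of_isUnivArrow_slice f b hη k ?_
      rw [hk, isUnivArrow_isIso_comp_iff]
      exact (isUnivArrow_isIso_comp_iff _).2 hb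
  exact (hD.isLan_of_isUnivArrow f hη).of_iso (asIso k)

theorem IsDerivator.isRan_of_isRightExact_slice (hD : IsDerivator D) (f : A ⥤ B) [f.Full]
    [f.Faithful] {Z : val D B} (h : ∀ b, (∃ a, f.obj a = b) ∨
      IsRightExact (toPt (sliceUnder f b)) (atObj b) (sliceUnderTrans f b) Z) : IsRan f Z := by
  obtain ⟨Z₀, ξ, hξ⟩ := hD.exists_isCounivArrow f ((res D f).obj Z)
  have := hD.isIso_of_isCounivArrow f hξ
  obtain ⟨k, hk⟩ := (hξ Z).2 (𝟙 _)
  have hk : (res D f).map k ≫ ξ = 𝟙 _ := hk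
  have : IsIso k := by
    refine hD.der2 _ _ fun b => ?_
    rcases h b with ⟨a, rfl⟩ | hb
    · rw [← isIso_map_atObj_comp_iff f a]
      have : IsIso ((res D f).map k) := by
        rw [← IsIso.inv_eq_of_inv_hom_id hk]
        infer_instance
      infer_instance
    · refine hD.isIso_map_of_isCounivArrow_slice f b hξ k ?_
      rw [hk, isCounivArrow_comp_isIso_iff]
      exact (isCounivArrow_comp_isIso_iff _).2 hb
  exact (hD.isRan_of_isCounivArrow f hξ).of_iso (asIso k).symm

/-- Bijectivity on morphisms can be checked in two stages, up to conjugation with `resComp`. -/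
theorem IsLan.comp {f : A ⥤ B} {g : B ⥤ C} {Z : val D C} (h : IsLan g Z)
    (h' : IsLan f ((res D g).obj Z)) : IsLan (f ⋙ g) Z := fun Z' => by
  have h1 := (h' ((res D g).obj Z')).comp (h Z')
  have h2 := ((((resComp D f g).app Z').symm.homToEquiv).bijective.comp
    (((resComp D f g).app Z).symm.homFromEquiv.bijective)).comp h1
  refine (iff_of_eq (congrArg _ ?_)).1 h2
  funext k
  simp only [Iso.homToEquiv, Iso.homFromEquiv, Function.comp_apply, Equiv.coe_fn_mk, Iso.symm_hom,
    Iso.symm_inv, Iso.app_hom, Iso.app_inv, Category.assoc]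
  exact ((resComp D f g).hom.naturality_assoc k _).symm.trans (by simp)

theorem IsRan.comp {f : A ⥤ B} {g : B ⥤ C} {Z : val D C} (h : IsRan g Z)
    (h' : IsRan f ((res D g).obj Z)) : IsRan (f ⋙ g) Z := fun Z' => by
  have h1 := (h' ((res D g).obj Z')).comp (h Z')
  have h2 := ((((resComp D f g).app Z).symm.homToEquiv).bijective.comp
    (((resComp D f g).app Z').symm.homFromEquiv.bijective)).comp h1
  refine (iff_of_eq (congrArg _ ?_)).1 h2
  funext k
  simp only [Iso.homToEquiv, Iso.homFromEquiv, Function.comp_apply, Equiv.coe_fn_mk, Iso.symm_hom,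
    Iso.symm_inv, Iso.app_hom, Iso.app_inv, Category.assoc]
  exact ((resComp D f g).hom.naturality_assoc k _).symm.trans (by simp)

theorem IsLan.nonempty_iso {f : A ⥤ B} {Z Z' : val D B} (h : IsLan f Z) (h' : IsLan f Z')
    (e : (res D f).obj Z ≅ (res D f).obj Z') : Nonempty (Z ≅ Z') := by
  obtain ⟨k, hk⟩ := (h Z').2 e.hom
  obtain ⟨m, hm⟩ := (h' Z).2 e.inv
  dsimp only at hk hm
  exact ⟨⟨k, m, (h Z).1 (by simp [hk, hm]), (h' Z').1 (by simp [hk, hm])⟩⟩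

theorem IsRan.nonempty_iso {f : A ⥤ B} {Z Z' : val D B} (h : IsRan f Z) (h' : IsRan f Z')
    (e : (res D f).obj Z ≅ (res D f).obj Z') : Nonempty (Z ≅ Z') := by
  obtain ⟨k, hk⟩ := (h' Z).2 e.hom
  obtain ⟨m, hm⟩ := (h Z').2 e.inv
  dsimp only at hk hm
  exact ⟨⟨k, m, (h Z).1 (by simp [hk, hm]), (h' Z').1 (by simp [hk, hm])⟩⟩

/-- A left Kan extension along a composition `g f` is a left Kan extension along `g`. -/
theorem IsDerivator.isLan_of_comp (hD : IsDerivator D) (f : A ⥤ B) (g : B ⥤ C) [f.Full]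
    [f.Faithful] [g.Full] [g.Faithful] {Z : val D C} (h : IsLan (f ⋙ g) Z) : IsLan g Z := by
  -- Extending in two stages gives a left Kan extension along the composite as well; by uniqueness
  -- it is `Z`, and its second stage is what is wanted.
  obtain ⟨Z₁, h₁, ⟨e₁⟩⟩ := hD.exists_isLan f ((res D (f ⋙ g)).obj Z)
  obtain ⟨Z₂, h₂, ⟨e₂⟩⟩ := hD.exists_isLan g Z₁
  have h₃ := IsLan.comp h₂ (h₁.of_iso e₂.symm)
  obtain ⟨e⟩ := h₃.nonempty_iso h ((resComp D f g).app Z₂ ≪≫ (res D f).mapIso e₂ ≪≫ e₁)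
  exact h₂.of_iso e

/-- A right Kan extension along a composition `g f` is a right Kan extension along `g`. -/
theorem IsDerivator.isRan_of_comp (hD : IsDerivator D) (f : A ⥤ B) (g : B ⥤ C) [f.Full]
    [f.Faithful] [g.Full] [g.Faithful] {Z : val D C} (h : IsRan (f ⋙ g) Z) : IsRan g Z := by
  obtain ⟨Z₁, h₁, ⟨e₁⟩⟩ := hD.exists_isRan f ((res D (f ⋙ g)).obj Z)
  obtain ⟨Z₂, h₂, ⟨e₂⟩⟩ := hD.exists_isRan g Z₁
  have h₃ := IsRan.comp h₂ (h₁.of_iso e₂.symm)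
  obtain ⟨e⟩ := h₃.nonempty_iso h ((resComp D f g).app Z₂ ≪≫ (res D f).mapIso e₂ ≪≫ e₁)
  exact h₂.of_iso e

end FullyFaithful

/-! ### Empty index categories and zero objects -/

section Zero

variable {D : Prederivator.{u, v, w}} {A B C J K K' : Cat.{u, u}}

theorem isEquivalence_res (e : K ⥤ K') [e.IsEquivalence] : (res D e).IsEquivalence := by
  let adj := e.asEquivalence.symm.toAdjunction
  have h1 (Z) : IsIso ((resAdj D adj).unit.app Z) := by
    rw [resAdj_unit_app]
    have := isIso_resNat_app adj.unit Z
    infer_instance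
  have h2 (Z) : IsIso ((resAdj D adj).counit.app Z) := by
    rw [resAdj_counit_app]
    have := isIso_resNat_app adj.counit Z
    infer_instance
  exact (resAdj D adj).toEquivalence.isEquivalence_functor

/-- The functor from an empty category. -/
def emptyFunctor [IsEmpty K] : K ⥤ B where
  obj x := isEmptyElim x
  map {x} := isEmptyElim x
  map_id x := isEmptyElim x
  map_comp {x} := isEmptyElim x

/-- Axiom (Der1) for the empty family: the value on an empty category is equivalent to an empty
product of categories. -/
theorem IsDerivator.nonempty_unique_hom (hD : IsDerivator D) [IsEmpty K] (X Y : val D K) :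
    Nonempty (Unique (X ⟶ Y)) := by
  have h1 := hD.der1 PEmpty (fun i => i.elim)
  let S : Cat.{u, u} := Cat.of (Σ i : PEmpty.{u + 1}, (PEmpty.elim i : Cat.{u, u}))
  have hS : IsEmpty S := ⟨fun x => x.1.elim⟩
  let e : S ⥤ K := emptyFunctor
  have : e.IsEquivalence := ⟨⟨fun {x _ _ _} _ => (hS.false x).elim⟩, ⟨fun {x} => hS.elim x⟩,
    ⟨fun x => isEmptyElim x⟩⟩
  have h2 := isEquivalence_res (D := D) e
  have h3 := ((res D e).asEquivalence.trans
    (Functor.asEquivalence (Functor.pi' fun i => res D (B := S)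
      (Sigma.incl (C := fun i => (PEmpty.elim i : Cat.{u, u})) i)))).fullyFaithfulFunctor.homEquiv
    (X := X) (Y := Y)
  exact ⟨@Equiv.unique _ _ ⟨⟨fun i => i.elim⟩, fun f => by ext i; exact i.elim⟩ h3⟩



/-- An empty colimit is an initial object, which is the same as a zero object because one exists. -/
theorem IsDerivator.isLeftExact_of_isEmpty_iff (hD : IsDerivator D)
    (h0 : Limits.HasZeroObject (val D pt)) [IsEmpty K] {g : K ⥤ B}
    {β : (pt.{u} : Cat.{u, u}) ⥤ B} (γ : g ⟶ toPt K ⋙ β) (Z : val D B) :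
    IsLeftExact (toPt K) β γ Z ↔ Limits.IsZero ((res D β).obj Z) := by
  have hu (y : val D pt) := hD.nonempty_unique_hom ((res D g).obj Z) ((res D (toPt K)).obj y)
  constructor
  · intro h
    have hi : Limits.IsInitial ((res D β).obj Z) := by
      refine @Limits.IsInitial.ofUnique _ _ _ fun y => ?_
      have := (hu y).some
      exact (Equiv.ofBijective _ (h y)).unique
    exact (Limits.isZero_zero _).of_iso (hi.uniqueUpToIso (Limits.isZero_zero _).isInitial)
  · intro h y
    obtain ⟨_⟩ := h.unique_to y
    obtain ⟨_⟩ := hu y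
    exact ⟨fun a b _ => Subsingleton.elim _ _, fun a => ⟨default, Subsingleton.elim _ _⟩⟩

theorem IsDerivator.isRightExact_of_isEmpty_iff (hD : IsDerivator D)
    (h0 : Limits.HasZeroObject (val D pt)) [IsEmpty K] {g : K ⥤ B}
    {β : (pt.{u} : Cat.{u, u}) ⥤ B} (γ : toPt K ⋙ β ⟶ g) (Z : val D B) :
    IsRightExact (toPt K) β γ Z ↔ Limits.IsZero ((res D β).obj Z) := by
  have hu (y : val D pt) := hD.nonempty_unique_hom ((res D (toPt K)).obj y) ((res D g).obj Z)
  constructor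
  · intro h
    have hi : Limits.IsTerminal ((res D β).obj Z) := by
      refine @Limits.IsTerminal.ofUnique _ _ _ fun y => ?_
      have := (hu y).some
      exact (Equiv.ofBijective _ (h y)).unique
    exact (Limits.isZero_zero _).of_iso (hi.uniqueUpToIso (Limits.isZero_zero _).isTerminal)
  · intro h y
    obtain ⟨_⟩ := h.unique_from y
    obtain ⟨_⟩ := hu y
    exact ⟨fun a b _ => Subsingleton.elim _ _, fun a => ⟨default, Subsingleton.elim _ _⟩⟩

/-- Zero objects are detected pointwise. -/
theorem IsDerivator.isZero_of_atObj (hD : IsDerivator D) (h0 : Limits.HasZeroObject (val D pt))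
    {Z : val D B} (h : ∀ b : B, Limits.IsZero ((res D (atObj b)).obj Z)) : Limits.IsZero Z := by
  -- All slices of the functor from the empty category are empty, so `Z` is both a left and a right
  -- Kan extension of the empty diagram, for which all sets of morphisms are singletons.
  let E : Cat.{u, u} := Cat.of (Discrete PEmpty.{u + 1})
  have hE : IsEmpty E := ⟨fun x => x.as.elim⟩
  let e : E ⥤ B := emptyFunctor
  have : e.Full := ⟨fun {x} => hE.elim x⟩
  have : e.Faithful := ⟨fun {x _ _ _} _ => (hE.false x).elim⟩
  have h1 (b : B) : IsEmpty (sliceOver e b) := ⟨fun x => hE.elim x.left⟩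
  have h2 (b : B) : IsEmpty (sliceUnder e b) := ⟨fun x => hE.elim x.right⟩
  have hl : IsLan e Z := hD.isLan_of_isLeftExact_slice e fun b =>
    Or.inr ((hD.isLeftExact_of_isEmpty_iff h0 _ _).2 (h b))
  have hr : IsRan e Z := hD.isRan_of_isRightExact_slice e fun b =>
    Or.inr ((hD.isRightExact_of_isEmpty_iff h0 _ _).2 (h b))
  refine ⟨fun Y => ?_, fun Y => ?_⟩
  · obtain ⟨_⟩ := hD.nonempty_unique_hom ((res D e).obj Z) ((res D e).obj Y)
    exact ⟨(Equiv.ofBijective _ (hl Y)).unique⟩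
  · obtain ⟨_⟩ := hD.nonempty_unique_hom ((res D e).obj Y) ((res D e).obj Z)
    exact ⟨(Equiv.ofBijective _ (hr Y)).unique⟩

theorem IsDerivator.isZero_res_toPt (hD : IsDerivator D) (h0 : Limits.HasZeroObject (val D pt))
    {y : val D pt} (hy : Limits.IsZero y) : Limits.IsZero ((res D (toPt B)).obj y) :=
  hD.isZero_of_atObj h0 fun b => hy.of_iso ((resComp D (atObj b) (toPt B)).symm.app y ≪≫
    (resIso (NatIso.ofComponents (fun _ => Iso.refl _) fun _ => pt_hom_ext _ _)).app y ≪≫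
    (resId D pt).app y)

/-- A zero object over `B` is the constant diagram on a zero object, and constant diagrams restrict
to constant diagrams. -/
theorem IsDerivator.isZero_res (hD : IsDerivator D) (h0 : Limits.HasZeroObject (val D pt))
    (f : A ⥤ B) {Z : val D B} (h : Limits.IsZero Z) : Limits.IsZero ((res D f).obj Z) := by
  obtain ⟨y, hy⟩ := h0
  exact (hD.isZero_res_toPt ⟨y, hy⟩ hy).of_iso
    ((res D f).mapIso (h.iso (hD.isZero_res_toPt ⟨y, hy⟩ hy)) ≪≫ (resComp D f (toPt B)).symm.app y)

end Zero

/-! ### Kan extensions with parameters -/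

section Parameters

variable {D : Prederivator.{u, v, w}} {A B C Q A' B' : Cat.{u, u}}

/-- The functor `(u/b) ⥤ (v/jb)` induced by a commutative square. -/
def sliceOverMap (u : A ⥤ B) (v : A' ⥤ B') (jA : A ⥤ A') (jB : B ⥤ B')
    (i : jA ⋙ v ≅ u ⋙ jB) (b : B) : sliceOver u b ⥤ sliceOver v (jB.obj b) where
  obj x := CostructuredArrow.mk (Y := jA.obj x.left) (i.hom.app x.left ≫ jB.map x.hom)
  map {x y} f := CostructuredArrow.homMk (jA.map f.left) (by
    have h := i.hom.naturality f.left
    have h2 := CostructuredArrow.w f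
    dsimp at h ⊢
    rw [← h2, jB.map_comp, ← Category.assoc, h, Category.assoc])
  map_id x := CostructuredArrow.hom_ext _ _ (jA.map_id _)
  map_comp f g := CostructuredArrow.hom_ext _ _ (jA.map_comp _ _)

/-- The functor `(b/u) ⥤ (jb/v)` induced by a commutative square. -/
def sliceUnderMap (u : A ⥤ B) (v : A' ⥤ B') (jA : A ⥤ A') (jB : B ⥤ B')
    (i : jA ⋙ v ≅ u ⋙ jB) (b : B) : sliceUnder u b ⥤ sliceUnder v (jB.obj b) where
  obj x := StructuredArrow.mk (Y := jA.obj x.right) (jB.map x.hom ≫ i.inv.app x.right)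
  map {x y} f := StructuredArrow.homMk (jA.map f.right) (by
    have h := i.inv.naturality f.right
    have h2 := StructuredArrow.w f
    dsimp at h ⊢
    rw [← h2, jB.map_comp, Category.assoc, Category.assoc, h])
  map_id x := StructuredArrow.hom_ext _ _ (jA.map_id _)
  map_comp f g := StructuredArrow.hom_ext _ _ (jA.map_comp _ _)

/-- The objects `j b` and `j (b)` agree. -/
def atObjIso (j : B ⥤ B') (b : B) : atObj (j.obj b) ≅ atObj b ⋙ j :=
  NatIso.ofComponents (fun _ => Iso.refl _) fun _ => by
    change 𝟙 _ ≫ 𝟙 _ = 𝟙 _ ≫ j.map (𝟙 b)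
    simp

/-- The map of slices is a right adjoint, hence final, so the two cocones with the same vertex are
universal simultaneously. Both the independence of parameters and the reduction of slices to corners
of squares are instances. -/
theorem isLeftExact_slice_res_iff (u : A ⥤ B) (v : A' ⥤ B') (jA : A ⥤ A') (jB : B ⥤ B')
    (i : jA ⋙ v ≅ u ⋙ jB) (b : B) {l : sliceOver v (jB.obj b) ⥤ sliceOver u b}
    (adj : l ⊣ sliceOverMap u v jA jB i b) (X : val D B') :
    IsLeftExact (toPt (sliceOver v (jB.obj b))) (atObj (jB.obj b))
      (sliceOverTrans v (jB.obj b)) X ↔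
    IsLeftExact (toPt (sliceOver u b)) (atObj b) (sliceOverTrans u b) ((res D jB).obj X) := by
  rw [isLeftExact_res_iff, ← isLeftExact_final_iff adj]
  refine isLeftExact_iso_iff _ _ _ (Functor.isoWhiskerLeft (sliceOverProj u b) i)
    (atObjIso jB b) ?_ X
  ext x
  change i.hom.app x.left ≫ jB.map x.hom = (i.hom.app x.left ≫ jB.map x.hom) ≫ 𝟙 _
  simp

theorem isRightExact_slice_res_iff (u : A ⥤ B) (v : A' ⥤ B') (jA : A ⥤ A') (jB : B ⥤ B')
    (i : jA ⋙ v ≅ u ⋙ jB) (b : B) {r : sliceUnder v (jB.obj b) ⥤ sliceUnder u b}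
    (adj : sliceUnderMap u v jA jB i b ⊣ r) (X : val D B') :
    IsRightExact (toPt (sliceUnder v (jB.obj b))) (atObj (jB.obj b))
      (sliceUnderTrans v (jB.obj b)) X ↔
    IsRightExact (toPt (sliceUnder u b)) (atObj b) (sliceUnderTrans u b) ((res D jB).obj X) := by
  rw [isRightExact_res_iff, ← isRightExact_initial_iff adj]
  refine isRightExact_iso_iff _ _ _ (Functor.isoWhiskerLeft (sliceUnderProj u b) i)
    (atObjIso jB b) ?_ X
  ext x
  change (jB.map x.hom ≫ i.inv.app x.right) ≫ i.hom.app x.right = 𝟙 _ ≫ jB.map x.hom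
  simp

/-- The functor `b ↦ (b, c)`. -/
abbrev inclParam (B : Cat.{u, u}) {C : Cat.{u, u}} (c : C) : B ⥤ Cat.of (B × C) :=
  Functor.prod' (𝟭 B) ((Functor.const B).obj c)

/-- The functor `b ↦ (q, (b, c))`. -/
abbrev inclParam₂ {Q : Cat.{u, u}} (q : Q) (B : Cat.{u, u}) {C : Cat.{u, u}} (c : C) :
    B ⥤ Cat.of (Q × Cat.of (B × C)) :=
  Functor.prod' ((Functor.const B).obj q) (inclParam B c)

/-- The functor `f × C : A × C ⥤ B × C`. -/
abbrev prodParam (f : A ⥤ B) (C : Cat.{u, u}) : Cat.of (A × C) ⥤ Cat.of (B × C) :=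
  Functor.prod f (𝟭 C)

/-- The functor `Q × (f × C) : Q × (A × C) ⥤ Q × (B × C)`. -/
abbrev prodParam₂ (Q : Cat.{u, u}) (f : A ⥤ B) (C : Cat.{u, u}) :
    Cat.of (Q × Cat.of (A × C)) ⥤ Cat.of (Q × Cat.of (B × C)) :=
  Functor.prod (𝟭 Q) (prodParam f C)

/-- The square relating `f` and `f × C`. -/
def inclParamIso (f : A ⥤ B) (c : C) : inclParam A c ⋙ prodParam f C ≅ f ⋙ inclParam B c :=
  NatIso.ofComponents (fun a => Iso.refl (f.obj a, c)) fun _ =>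
    Prod.ext ((Category.comp_id _).trans (Category.id_comp _).symm) rfl

/-- The square relating `f` and `Q × (f × C)`. -/
def inclParam₂Iso (q : Q) (f : A ⥤ B) (c : C) :
    inclParam₂ q A c ⋙ prodParam₂ Q f C ≅ f ⋙ inclParam₂ q B c :=
  NatIso.ofComponents (fun a => Iso.refl (q, (f.obj a, c))) fun _ =>
    Prod.ext rfl (Prod.ext ((Category.comp_id _).trans (Category.id_comp _).symm) rfl)

section
variable (f : A ⥤ B) (b : B) (c : C)

/-- The projection `(f × C/(b, c)) ⥤ (f/b)`. -/
def sliceOverParamProj :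
    sliceOver (prodParam f C) ((inclParam B c).obj b) ⥤ sliceOver f b where
  obj x := CostructuredArrow.mk (Y := x.left.1) x.hom.1
  map {x y} g := CostructuredArrow.homMk g.left.1 (congrArg Prod.fst (CostructuredArrow.w g))

/-- The projection `(f × C/(b, c)) ⥤ (f/b)` is left adjoint to the inclusion. -/
def sliceOverParamAdj : sliceOverParamProj f b c ⊣
    sliceOverMap f (prodParam f C) (inclParam A c) (inclParam B c) (inclParamIso f c) b where
  unit :=
    -- Only the parameter moves: it is pushed to `c` along the second component of the structure
    -- map.
    { app := fun x => CostructuredArrow.homMk (𝟙 x.left.1, x.hom.2) (by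
        refine Prod.ext ?_ ?_
        · change f.map (𝟙 _) ≫ 𝟙 _ ≫ x.hom.1 = x.hom.1
          simp
        · change x.hom.2 ≫ 𝟙 _ ≫ 𝟙 _ = x.hom.2
          simp)
      naturality := fun x y g => CostructuredArrow.hom_ext _ _ (by
        refine Prod.ext ?_ ?_
        · change g.left.1 ≫ 𝟙 _ = 𝟙 _ ≫ g.left.1
          simp
        · change g.left.2 ≫ y.hom.2 = x.hom.2 ≫ 𝟙 _
          exact (congrArg Prod.snd (CostructuredArrow.w g)).trans (Category.comp_id _).symm) }
  counit :=
    { app := fun x => CostructuredArrow.homMk (𝟙 x.left) (by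
        change f.map (𝟙 _) ≫ x.hom = 𝟙 _ ≫ x.hom
        simp)
      naturality := fun x y g => CostructuredArrow.hom_ext _ _
        ((Category.comp_id _).trans (Category.id_comp _).symm) }
  left_triangle_components x := CostructuredArrow.hom_ext _ _ (Category.comp_id _)
  right_triangle_components x := CostructuredArrow.hom_ext _ _
    (Prod.ext (Category.comp_id _) (by
      change (𝟙 _ ≫ 𝟙 _) ≫ 𝟙 _ = 𝟙 _
      simp))

/-- The projection `((b, c)/f × C) ⥤ (b/f)`. -/
def sliceUnderParamProj :
    sliceUnder (prodParam f C) ((inclParam B c).obj b) ⥤ sliceUnder f b where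
  obj x := StructuredArrow.mk (Y := x.right.1) x.hom.1
  map {x y} g := StructuredArrow.homMk g.right.1 (congrArg Prod.fst (StructuredArrow.w g))

/-- The projection `((b, c)/f × C) ⥤ (b/f)` is right adjoint to the inclusion. -/
def sliceUnderParamAdj : sliceUnderMap f (prodParam f C) (inclParam A c) (inclParam B c)
    (inclParamIso f c) b ⊣ sliceUnderParamProj f b c where
  unit :=
    { app := fun x => StructuredArrow.homMk (𝟙 x.right) (by
        change x.hom ≫ f.map (𝟙 _) = x.hom ≫ 𝟙 _
        simp)
      naturality := fun x y g => StructuredArrow.hom_ext _ _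
        ((Category.comp_id _).trans (Category.id_comp _).symm) }
  counit :=
    { app := fun x => StructuredArrow.homMk (𝟙 x.right.1, x.hom.2) (by
        refine Prod.ext ?_ ?_
        · change (x.hom.1 ≫ 𝟙 _) ≫ f.map (𝟙 _) = x.hom.1
          simp
        · change (𝟙 _ ≫ 𝟙 _) ≫ x.hom.2 = x.hom.2
          simp)
      naturality := fun x y g => StructuredArrow.hom_ext _ _ (by
        refine Prod.ext ?_ ?_
        · change g.right.1 ≫ 𝟙 _ = 𝟙 _ ≫ g.right.1
          simp
        · change 𝟙 _ ≫ y.hom.2 = x.hom.2 ≫ g.right.2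
          exact (Category.id_comp _).trans (congrArg Prod.snd (StructuredArrow.w g)).symm) }
  left_triangle_components x := StructuredArrow.hom_ext _ _
    (Prod.ext (Category.comp_id _) (by
      change 𝟙 _ ≫ (𝟙 _ ≫ 𝟙 _) = 𝟙 _
      simp))
  right_triangle_components x := StructuredArrow.hom_ext _ _ (Category.comp_id _)

variable (q : Q)

/-- The projection `(Q × f × C/(q, b, c)) ⥤ (f/b)`. -/
def sliceOverParamProj₂ :
    sliceOver (prodParam₂ Q f C) ((inclParam₂ q B c).obj b) ⥤ sliceOver f b where
  obj x := CostructuredArrow.mk (Y := x.left.2.1) x.hom.2.1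
  map {x y} g := CostructuredArrow.homMk g.left.2.1
    (congrArg (fun k => k.2.1) (CostructuredArrow.w g))

/-- The projection `(Q × f × C/(q, b, c)) ⥤ (f/b)` is left adjoint to the inclusion. -/
def sliceOverParamAdj₂ : sliceOverParamProj₂ f b c q ⊣
    sliceOverMap f (prodParam₂ Q f C) (inclParam₂ q A c) (inclParam₂ q B c)
      (inclParam₂Iso q f c) b where
  unit :=
    { app := fun x => CostructuredArrow.homMk (x.hom.1, (𝟙 x.left.2.1, x.hom.2.2)) (by
        refine Prod.ext ?_ (Prod.ext ?_ ?_)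
        · change x.hom.1 ≫ 𝟙 _ ≫ 𝟙 _ = x.hom.1
          simp
        · change f.map (𝟙 _) ≫ 𝟙 _ ≫ x.hom.2.1 = x.hom.2.1
          simp
        · change x.hom.2.2 ≫ 𝟙 _ ≫ 𝟙 _ = x.hom.2.2
          simp)
      naturality := fun x y g => CostructuredArrow.hom_ext _ _ (by
        refine Prod.ext ?_ (Prod.ext ?_ ?_)
        · change g.left.1 ≫ y.hom.1 = x.hom.1 ≫ 𝟙 _
          exact (congrArg Prod.fst (CostructuredArrow.w g)).trans (Category.comp_id _).symm
        · change g.left.2.1 ≫ 𝟙 _ = 𝟙 _ ≫ g.left.2.1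
          simp
        · change g.left.2.2 ≫ y.hom.2.2 = x.hom.2.2 ≫ 𝟙 _
          exact (congrArg (fun k => k.2.2) (CostructuredArrow.w g)).trans
            (Category.comp_id _).symm) }
  counit :=
    { app := fun x => CostructuredArrow.homMk (𝟙 x.left) (by
        change f.map (𝟙 _) ≫ x.hom = 𝟙 _ ≫ x.hom
        simp)
      naturality := fun x y g => CostructuredArrow.hom_ext _ _
        ((Category.comp_id _).trans (Category.id_comp _).symm) }
  left_triangle_components x := CostructuredArrow.hom_ext _ _ (Category.comp_id _)
  right_triangle_components x := CostructuredArrow.hom_ext _ _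
    (Prod.ext (by
      change (𝟙 _ ≫ 𝟙 _) ≫ 𝟙 _ = 𝟙 _
      simp) (Prod.ext (Category.comp_id _) (by
      change (𝟙 _ ≫ 𝟙 _) ≫ 𝟙 _ = 𝟙 _
      simp)))

end

section
variable (f : A ⥤ B) [f.Full] [f.Faithful]

instance : (prodParam f C).Full :=
  ⟨fun g => ⟨(f.preimage g.1, g.2), Prod.ext (f.map_preimage g.1) rfl⟩⟩

instance : (prodParam f C).Faithful :=
  ⟨fun h => Prod.ext (f.map_injective (congrArg Prod.fst h)) (congrArg (fun k => k.2) h)⟩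

instance : (prodParam₂ Q f C).Full :=
  ⟨fun g => ⟨(g.1, (prodParam f C).preimage g.2), Prod.ext rfl ((prodParam f C).map_preimage g.2)⟩⟩

instance : (prodParam₂ Q f C).Faithful :=
  ⟨fun h => Prod.ext (congrArg (fun k => k.1) h)
    ((prodParam f C).map_injective (congrArg Prod.snd h))⟩

/-- Left Kan extensions are computed pointwise in parameters. -/
theorem IsDerivator.isLan_prodParam_iff (hD : IsDerivator D) (X : val D (Cat.of (B × C))) :
    IsLan (prodParam f C) X ↔ ∀ c : C, IsLan f ((res D (inclParam B c)).obj X) := by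
  constructor
  · exact fun h c => hD.isLan_of_isLeftExact_slice f fun b => Or.inr
      ((isLeftExact_slice_res_iff _ _ _ _ _ _ (sliceOverParamAdj f b c) X).1
        (hD.isLeftExact_slice_of_isLan _ h _))
  · exact fun h => hD.isLan_of_isLeftExact_slice _ fun bc => Or.inr
      ((isLeftExact_slice_res_iff _ _ _ _ _ _ (sliceOverParamAdj f bc.1 bc.2) X).2
        (hD.isLeftExact_slice_of_isLan _ (h bc.2) _))

/-- Right Kan extensions are computed pointwise in parameters. -/
theorem IsDerivator.isRan_prodParam_iff (hD : IsDerivator D) (X : val D (Cat.of (B × C))) :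
    IsRan (prodParam f C) X ↔ ∀ c : C, IsRan f ((res D (inclParam B c)).obj X) := by
  constructor
  · exact fun h c => hD.isRan_of_isRightExact_slice f fun b => Or.inr
      ((isRightExact_slice_res_iff _ _ _ _ _ _ (sliceUnderParamAdj f b c) X).1
        (hD.isRightExact_slice_of_isRan _ h _))
  · exact fun h => hD.isRan_of_isRightExact_slice _ fun bc => Or.inr
      ((isRightExact_slice_res_iff _ _ _ _ _ _ (sliceUnderParamAdj f bc.1 bc.2) X).2
        (hD.isRightExact_slice_of_isRan _ (h bc.2) _))

/-- Left Kan extensions are computed pointwise in parameters. -/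
theorem IsDerivator.isLan_prodParam₂_iff (hD : IsDerivator D)
    (X : val D (Cat.of (Q × Cat.of (B × C)))) : IsLan (prodParam₂ Q f C) X ↔
      ∀ (q : Q) (c : C), IsLan f ((res D (inclParam₂ q B c)).obj X) := by
  constructor
  · exact fun h q c => hD.isLan_of_isLeftExact_slice f fun b => Or.inr
      ((isLeftExact_slice_res_iff _ _ _ _ _ _ (sliceOverParamAdj₂ f b c q) X).1
        (hD.isLeftExact_slice_of_isLan _ h _))
  · exact fun h => hD.isLan_of_isLeftExact_slice _ fun bc => Or.inr
      ((isLeftExact_slice_res_iff _ _ _ _ _ _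
        (sliceOverParamAdj₂ f bc.2.1 bc.2.2 bc.1) X).2
        (hD.isLeftExact_slice_of_isLan _ (h bc.1 bc.2.2) _))

end

end Parameters

/-! ### Diagrams indexed by preorders -/

section Preorders

variable {D : Prederivator.{u, v, w}} {A B C K J : Cat.{u, u}}

theorem hom_ext_of_preorder {P : Type u} [Preorder P] {x y : (Cat.of P : Cat.{u, u})} (f g : x ⟶ y) :
    f = g :=
  @Subsingleton.elim _ (inferInstanceAs (Subsingleton (ULift (PLift (_ ≤ _))))) f g

/-- The morphism defined by an inequality. -/
def catHomOfLE {P : Type u} [Preorder P] {x y : P} (h : x ≤ y) :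
    @Quiver.Hom (Cat.of P : Cat.{u, u}) _ x y :=
  @homOfLE P _ x y h

theorem le_of_catHom {P : Type u} [Preorder P] {x y : P}
    (h : @Quiver.Hom (Cat.of P : Cat.{u, u}) _ x y) : x ≤ y := @leOfHom P _ x y h

/-- Parallel functors to a preorder with the same values are isomorphic. -/
def isoOfThin {P : Type u} [Preorder P] {f g : A ⥤ Cat.of P} (h : ∀ x, f.obj x = g.obj x) : f ≅ g :=
  NatIso.ofComponents (fun x => eqToIso (h x)) fun _ => hom_ext_of_preorder _ _

/-- The functor induced by a monotone map. -/
abbrev monoFun {P Q : Type u} [Preorder P] [Preorder Q] (f : P → Q) (hf : Monotone f) :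
    (Cat.of P : Cat.{u, u}) ⥤ (Cat.of Q : Cat.{u, u}) := hf.functor

variable {P Q R S : Type u} [Preorder P] [Preorder Q] [Preorder R] [Preorder S]

theorem full_monoFun {f : P → Q} (hf : Monotone f) (h : ∀ x y, f x ≤ f y → x ≤ y) :
    (monoFun f hf).Full :=
  ⟨fun {x y} g => ⟨catHomOfLE (P := P) (h x y (le_of_catHom (P := Q) g)), hom_ext_of_preorder _ _⟩⟩

theorem faithful_monoFun {f : P → Q} (hf : Monotone f) : (monoFun f hf).Faithful :=
  ⟨fun _ => hom_ext_of_preorder _ _⟩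

theorem subsingleton_sliceOver_hom (f : (Cat.of P : Cat.{u, u}) ⥤ B) (b : B)
    (x y : sliceOver f b) : Subsingleton (x ⟶ y) :=
  ⟨fun _ _ => CostructuredArrow.hom_ext _ _ (hom_ext_of_preorder _ _)⟩

theorem subsingleton_sliceUnder_hom (f : (Cat.of P : Cat.{u, u}) ⥤ B) (b : B)
    (x y : sliceUnder f b) : Subsingleton (x ⟶ y) :=
  ⟨fun _ _ => StructuredArrow.hom_ext _ _ (hom_ext_of_preorder _ _)⟩

/-- Between thin categories a Galois connection on objects is enough, since all naturality
conditions hold automatically. -/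
theorem exists_adj_of_thin_left {𝒞 : Type u} [Category.{u} 𝒞] {ℰ : Type u} [Category.{u} ℰ]
    (h𝒞 : ∀ x y : 𝒞, Subsingleton (x ⟶ y)) (hℰ : ∀ x y : ℰ, Subsingleton (x ⟶ y)) (r : ℰ ⥤ 𝒞)
    (l : 𝒞 → ℰ) (h : ∀ x y, Nonempty (l x ⟶ y) ↔ Nonempty (x ⟶ r.obj y)) :
    ∃ l : 𝒞 ⥤ ℰ, Nonempty (l ⊣ r) := by
  let e (x : 𝒞) (y : ℰ) : (l x ⟶ y) ≃ (x ⟶ r.obj y) :=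
    { toFun := fun k => ((h x y).1 ⟨k⟩).some
      invFun := fun k => ((h x y).2 ⟨k⟩).some
      left_inv := fun _ => Subsingleton.elim _ _
      right_inv := fun _ => Subsingleton.elim _ _ }
  exact ⟨_, ⟨Adjunction.adjunctionOfEquivLeft (F_obj := l) e fun _ _ _ _ _ => Subsingleton.elim _ _⟩⟩

theorem exists_adj_of_thin_right {𝒞 : Type u} [Category.{u} 𝒞] {ℰ : Type u} [Category.{u} ℰ]
    (h𝒞 : ∀ x y : 𝒞, Subsingleton (x ⟶ y)) (hℰ : ∀ x y : ℰ, Subsingleton (x ⟶ y)) (l : 𝒞 ⥤ ℰ)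
    (r : ℰ → 𝒞) (h : ∀ x y, Nonempty (l.obj x ⟶ y) ↔ Nonempty (x ⟶ r y)) :
    ∃ r : ℰ ⥤ 𝒞, Nonempty (l ⊣ r) := by
  let e (x : 𝒞) (y : ℰ) : (l.obj x ⟶ y) ≃ (x ⟶ r y) :=
    { toFun := fun k => ((h x y).1 ⟨k⟩).some
      invFun := fun k => ((h x y).2 ⟨k⟩).some
      left_inv := fun _ => Subsingleton.elim _ _
      right_inv := fun _ => Subsingleton.elim _ _ }
  exact ⟨_, ⟨Adjunction.adjunctionOfEquivRight (G_obj := r) e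
    fun _ _ _ _ _ => Subsingleton.elim _ _⟩⟩

/-- Slices of preorders which are related by a Galois connection define the same cocones. -/
theorem isLeftExact_slice_res_iff_of_galois {k : R → S} {f : P → Q} {g : R → P} {s : S → Q}
    (hk : Monotone k) (hf : Monotone f) (hg : Monotone g) (hs : Monotone s)
    (h : ∀ x, f (g x) = s (k x)) (j : S) (l : P → R) (hl : ∀ a, f a ≤ s j → k (l a) ≤ j)
    (hl' : ∀ a, f a ≤ s j → ∀ x, k x ≤ j → (l a ≤ x ↔ a ≤ g x)) (X : val D (Cat.of Q)) :
    IsLeftExact (toPt (sliceOver (monoFun f hf) (s j))) (atObj (s j))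
        (sliceOverTrans (monoFun f hf) (s j)) X ↔
      IsLeftExact (toPt (sliceOver (monoFun k hk) j)) (atObj j)
        (sliceOverTrans (monoFun k hk) j) ((res D (monoFun s hs)).obj X) := by
  let i : monoFun g hg ⋙ monoFun f hf ≅ monoFun k hk ⋙ monoFun s hs := isoOfThin h
  obtain ⟨l', ⟨adj⟩⟩ := exists_adj_of_thin_left
    (𝒞 := sliceOver (monoFun f hf) (s j)) (ℰ := sliceOver (monoFun k hk) j)
    (subsingleton_sliceOver_hom _ _)
    (subsingleton_sliceOver_hom _ _)
    (sliceOverMap (monoFun k hk) (monoFun f hf) (monoFun g hg) (monoFun s hs) i j)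
    (fun a => CostructuredArrow.mk (Y := l a.left) (catHomOfLE (P := S) (hl a.left (le_of_catHom (P := Q) a.hom))))
    (fun a x => by
      have := hl' a.left (le_of_catHom (P := Q) a.hom) x.left (le_of_catHom (P := S) x.hom)
      constructor
      · rintro ⟨m⟩
        exact ⟨CostructuredArrow.homMk (catHomOfLE (P := P) (this.1 (le_of_catHom (P := R) m.left))) (hom_ext_of_preorder _ _)⟩
      · rintro ⟨m⟩
        exact ⟨CostructuredArrow.homMk (catHomOfLE (P := R) (this.2 (le_of_catHom (P := P) m.left))) (hom_ext_of_preorder _ _)⟩)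
  exact isLeftExact_slice_res_iff _ _ _ _ i j adj X

/-- Slices of preorders which are related by a Galois connection define the same cones. -/
theorem isRightExact_slice_res_iff_of_galois {k : R → S} {f : P → Q} {g : R → P} {s : S → Q}
    (hk : Monotone k) (hf : Monotone f) (hg : Monotone g) (hs : Monotone s)
    (h : ∀ x, f (g x) = s (k x)) (j : S) (l : P → R) (hl : ∀ a, s j ≤ f a → j ≤ k (l a))
    (hl' : ∀ a, s j ≤ f a → ∀ x, j ≤ k x → (x ≤ l a ↔ g x ≤ a)) (X : val D (Cat.of Q)) :
    IsRightExact (toPt (sliceUnder (monoFun f hf) (s j))) (atObj (s j))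
        (sliceUnderTrans (monoFun f hf) (s j)) X ↔
      IsRightExact (toPt (sliceUnder (monoFun k hk) j)) (atObj j)
        (sliceUnderTrans (monoFun k hk) j) ((res D (monoFun s hs)).obj X) := by
  let i : monoFun g hg ⋙ monoFun f hf ≅ monoFun k hk ⋙ monoFun s hs := isoOfThin h
  obtain ⟨l', ⟨adj⟩⟩ := exists_adj_of_thin_right
    (𝒞 := sliceUnder (monoFun k hk) j) (ℰ := sliceUnder (monoFun f hf) (s j))
    (subsingleton_sliceUnder_hom _ _)
    (subsingleton_sliceUnder_hom _ _)
    (sliceUnderMap (monoFun k hk) (monoFun f hf) (monoFun g hg) (monoFun s hs) i j)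
    (fun a => StructuredArrow.mk (Y := l a.right) (catHomOfLE (P := S) (hl a.right (le_of_catHom (P := Q) a.hom))))
    (fun x a => by
      have := hl' a.right (le_of_catHom (P := Q) a.hom) x.right (le_of_catHom (P := S) x.hom)
      constructor
      · rintro ⟨m⟩
        exact ⟨StructuredArrow.homMk (catHomOfLE (P := R) (this.2 (le_of_catHom (P := P) m.right))) (hom_ext_of_preorder _ _)⟩
      · rintro ⟨m⟩
        exact ⟨StructuredArrow.homMk (catHomOfLE (P := P) (this.1 (le_of_catHom (P := R) m.right))) (hom_ext_of_preorder _ _)⟩)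
  exact isRightExact_slice_res_iff _ _ _ _ i j adj X

/-! ### Squares -/

/-- The underlying partial order of `⌜`. -/
abbrev UlSub : Type u := {x : ULift.{u} (Fin 2 × Fin 2) // x ≠ ⟨(1, 1)⟩}

/-- The underlying partial order of `⌟`. -/
abbrev LrSub : Type u := {x : ULift.{u} (Fin 2 × Fin 2) // x ≠ ⟨(0, 0)⟩}

/-- The map `□ → P` with given values. -/
def sqVal {α : Type*} (a b c d : α) (x : ULift.{u} (Fin 2 × Fin 2)) : α :=
  if x.down.1 = 0 then (if x.down.2 = 0 then a else c) else (if x.down.2 = 0 then b else d)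

theorem monotone_sqVal {a b c d : P} (hab : a ≤ b) (hac : a ≤ c) (hbd : b ≤ d) (hcd : c ≤ d) :
    Monotone (sqVal a b c d) := by
  rintro ⟨x1, x2⟩ ⟨y1, y2⟩ ⟨h1, h2⟩
  have had := hab.trans hbd
  dsimp at h1 h2
  fin_cases x1 <;> fin_cases x2 <;> fin_cases y1 <;> fin_cases y2 <;> simp_all [sqVal]

/-- The last argument `a` of `sqVal` is a dummy: the terminal vertex does not belong to `UlSub`. -/
theorem monotone_sqVal_ul {a b c : P} (hab : a ≤ b) (hac : a ≤ c) :
    Monotone fun x : UlSub.{u} => sqVal a b c a x.1 := by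
  rintro ⟨⟨x1, x2⟩, hx⟩ ⟨⟨y1, y2⟩, hy⟩ ⟨h1, h2⟩
  dsimp at h1 h2
  fin_cases x1 <;> fin_cases x2 <;> fin_cases y1 <;> fin_cases y2 <;>
    first | exact absurd rfl hx | exact absurd rfl hy | simp_all [sqVal]

theorem monotone_sqVal_lr {b c d : P} (hbd : b ≤ d) (hcd : c ≤ d) :
    Monotone fun x : LrSub.{u} => sqVal d b c d x.1 := by
  rintro ⟨⟨x1, x2⟩, hx⟩ ⟨⟨y1, y2⟩, hy⟩ ⟨h1, h2⟩
  dsimp at h1 h2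
  fin_cases x1 <;> fin_cases x2 <;> fin_cases y1 <;> fin_cases y2 <;>
    first | exact absurd rfl hx | exact absurd rfl hy | simp_all [sqVal]

/-- The square with given vertices. -/
abbrev sqFun {a b c d : P} (hab : a ≤ b) (hac : a ≤ c) (hbd : b ≤ d) (hcd : c ≤ d) :
    Sq.{u} ⥤ (Cat.of P : Cat.{u, u}) :=
  monoFun (sqVal a b c d) (monotone_sqVal hab hac hbd hcd)

instance : iUl.{u}.Full := full_monoFun (f := Subtype.val) (Subtype.mono_coe _) fun _ _ h => h
instance : iUl.{u}.Faithful := faithful_monoFun (f := Subtype.val) (Subtype.mono_coe _)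
instance : iLr.{u}.Full := full_monoFun (f := Subtype.val) (Subtype.mono_coe _) fun _ _ h => h
instance : iLr.{u}.Faithful := faithful_monoFun (f := Subtype.val) (Subtype.mono_coe _)

/-- Every vertex except the terminal one lies in the corner, so a single slice carries the
condition. -/
theorem IsDerivator.isLan_iUl_iff (hD : IsDerivator D) (X : val D Sq) : IsLan iUl X ↔
    IsLeftExact (toPt (sliceOver iUl (ULift.up (1, 1)))) (atObj (B := Sq) (ULift.up (1, 1)))
      (sliceOverTrans iUl (ULift.up (1, 1))) X :=
  ⟨fun h => hD.isLeftExact_slice_of_isLan _ h _, fun h => hD.isLan_of_isLeftExact_slice _ fun b => by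
    by_cases hb : b = ULift.up (1, 1)
    · exact Or.inr (hb ▸ h)
    · exact Or.inl ⟨⟨b, hb⟩, rfl⟩⟩

theorem IsDerivator.isRan_iLr_iff (hD : IsDerivator D) (X : val D Sq) : IsRan iLr X ↔
    IsRightExact (toPt (sliceUnder iLr (ULift.up (0, 0)))) (atObj (B := Sq) (ULift.up (0, 0)))
      (sliceUnderTrans iLr (ULift.up (0, 0))) X :=
  ⟨fun h => hD.isRightExact_slice_of_isRan _ h _,
    fun h => hD.isRan_of_isRightExact_slice _ fun b => by
      by_cases hb : b = ULift.up (0, 0)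
      · exact Or.inr (hb ▸ h)
      · exact Or.inl ⟨⟨b, hb⟩, rfl⟩⟩

/-- A left Kan extension is computed by a cocartesian square if the slice is, up to finality,
a span. -/
theorem IsDerivator.isLeftExact_slice_iff_of_span (hD : IsDerivator D) {f : P → Q} (hf : Monotone f)
    {a b c : P} {d : Q} (hab : a ≤ b) (hac : a ≤ c) (hbd : f b ≤ d) (hcd : f c ≤ d)
    (h : ∀ y, f y ≤ d → y ≤ b ∨ y ≤ c) (h' : ∀ y, y ≤ b → y ≤ c → y ≤ a) (X : val D (Cat.of Q)) :
    IsLeftExact (toPt (sliceOver (monoFun f hf) d)) (atObj d) (sliceOverTrans (monoFun f hf) d) X ↔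
      IsLan iUl ((res D (sqFun (hf hab) (hf hac) hbd hcd)).obj X) := by
  classical
  rw [hD.isLan_iUl_iff]
  -- The left adjoint sends `y` to the smallest vertex of the corner whose value bounds `y`;
  -- hypotheses `h` and `h'` say that it exists.
  refine isLeftExact_slice_res_iff_of_galois (k := Subtype.val) (g := fun x => sqVal a b c a x.1)
    (Subtype.mono_coe _) hf (monotone_sqVal_ul hab hac) (monotone_sqVal (hf hab) (hf hac) hbd hcd)
    ?_ ⟨(1, 1)⟩ (fun y => if y ≤ b then (if y ≤ c then ⟨⟨(0, 0)⟩, by simp⟩ else ⟨⟨(1, 0)⟩, by simp⟩)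
      else ⟨⟨(0, 1)⟩, by simp⟩) ?_ ?_ X
  · rintro ⟨⟨x1, x2⟩, hx⟩
    fin_cases x1 <;> fin_cases x2 <;> first | exact absurd rfl hx | simp_all [sqVal]
  · intro y _
    split_ifs <;> exact ⟨Fin.le_last _, Fin.le_last _⟩
  · rintro y hy ⟨⟨x1, x2⟩, hx⟩ -
    have h1 := h y hy
    have h2 := h' y
    have h3 : y ≤ a → y ≤ b ∧ y ≤ c := fun h => ⟨h.trans hab, h.trans hac⟩
    rw [← Subtype.coe_le_coe]
    fin_cases x1 <;> fin_cases x2 <;> by_cases h4 : y ≤ b <;> by_cases h5 : y ≤ c <;>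
      first | exact absurd rfl hx | simp_all [sqVal, ← ULift.down_le, Prod.le_def]

/-- A right Kan extension is computed by a cartesian square if the slice is, up to finality,
a cospan. -/
theorem IsDerivator.isRightExact_slice_iff_of_cospan (hD : IsDerivator D) {f : P → Q}
    (hf : Monotone f) {b c d : P} {a : Q} (hab : a ≤ f b) (hac : a ≤ f c) (hbd : b ≤ d) (hcd : c ≤ d)
    (h : ∀ y, a ≤ f y → b ≤ y ∨ c ≤ y) (h' : ∀ y, b ≤ y → c ≤ y → d ≤ y) (X : val D (Cat.of Q)) :
    IsRightExact (toPt (sliceUnder (monoFun f hf) a)) (atObj a)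
        (sliceUnderTrans (monoFun f hf) a) X ↔
      IsRan iLr ((res D (sqFun hab hac (hf hbd) (hf hcd))).obj X) := by
  classical
  rw [hD.isRan_iLr_iff]
  -- Dually, `y` is sent to the largest vertex of the corner whose value lies below `y`.
  refine isRightExact_slice_res_iff_of_galois (k := Subtype.val) (g := fun x => sqVal d b c d x.1)
    (Subtype.mono_coe _) hf (monotone_sqVal_lr hbd hcd) (monotone_sqVal hab hac (hf hbd) (hf hcd))
    ?_ ⟨(0, 0)⟩ (fun y => if b ≤ y then (if c ≤ y then ⟨⟨(1, 1)⟩, by simp⟩ else ⟨⟨(1, 0)⟩, by simp⟩)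
      else ⟨⟨(0, 1)⟩, by simp⟩) ?_ ?_ X
  · rintro ⟨⟨x1, x2⟩, hx⟩
    fin_cases x1 <;> fin_cases x2 <;> first | exact absurd rfl hx | simp_all [sqVal]
  · intro y _
    split_ifs <;> exact ⟨Fin.zero_le _, Fin.zero_le _⟩
  · rintro y hy ⟨⟨x1, x2⟩, hx⟩ -
    have h1 := h y hy
    have h2 := h' y
    have h3 : d ≤ y → b ≤ y ∧ c ≤ y := fun h => ⟨hbd.trans h, hcd.trans h⟩
    rw [← Subtype.coe_le_coe]
    fin_cases x1 <;> fin_cases x2 <;> by_cases h4 : b ≤ y <;> by_cases h5 : c ≤ y <;>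
      first | exact absurd rfl hx | simp_all [sqVal, ← ULift.down_le, Prod.le_def]

end Preorders

/-! ### Bicartesian squares in diagrams on preorders -/

section Bicartesian

variable {D : Prederivator.{u, v, w}} {A B C : Cat.{u, u}}

theorem bijective_of_unique {α β : Type*} (ha : Nonempty (Unique α)) (hb : Nonempty (Unique β))
    (f : α → β) : Function.Bijective f := by
  obtain ⟨_⟩ := ha
  obtain ⟨_⟩ := hb
  exact ⟨fun a b _ => Subsingleton.elim _ _, fun a => ⟨default, Subsingleton.elim _ _⟩⟩

theorem IsDerivator.isLan_of_isZero (hD : IsDerivator D) (h0 : Limits.HasZeroObject (val D pt))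
    (f : A ⥤ B) {Z : val D B} (h : Limits.IsZero Z) : IsLan f Z := fun Z' =>
  bijective_of_unique (h.unique_to Z') ((hD.isZero_res h0 f h).unique_to _) _

theorem IsDerivator.isZero_of_isLan (hD : IsDerivator D) (h0 : Limits.HasZeroObject (val D pt))
    (f : A ⥤ B) {Z : val D B} (h : IsLan f Z) (hZ : Limits.IsZero ((res D f).obj Z)) :
    Limits.IsZero Z := by
  obtain ⟨y, hy⟩ := h0
  have h1 := hD.isZero_res_toPt (B := B) ⟨y, hy⟩ hy
  obtain ⟨e⟩ := h.nonempty_iso (hD.isLan_of_isZero ⟨y, hy⟩ f h1)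
    (hZ.iso (hD.isZero_res ⟨y, hy⟩ f h1))
  exact h1.of_iso e

theorem isLan_prodParam_of_isCocartesian (hD : IsDerivator D) {X : val D (Cat.of (Sq × C))}
    (h : IsCocartesian D (op C) X) : IsLan (prodParam iUl C) X := by
  obtain ⟨lan, ⟨adj⟩, W, ⟨e⟩⟩ := h
  exact (hD.isLan_of_isUnivArrow (prodParam iUl C) (IsUnivArrow.of_adj adj W)).of_iso e

theorem isRan_prodParam_of_isCartesian (hD : IsDerivator D) {X : val D (Cat.of (Sq × C))}
    (h : IsCartesian D (op C) X) : IsRan (prodParam iLr C) X := by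
  obtain ⟨ran, ⟨adj⟩, W, ⟨e⟩⟩ := h
  exact (hD.isRan_of_isCounivArrow (prodParam iLr C) (IsCounivArrow.of_adj adj W)).of_iso e

theorem isCocartesian_of_isLan (hD : IsDerivator D) {X : val D (Cat.of (Sq × C))}
    (h : IsLan (prodParam iUl C) X) : IsCocartesian D (op C) X := by
  have := hD.der3_left (prodParam iUl C)
  let adj := Adjunction.ofIsRightAdjoint (res D (prodParam iUl C))
  let W := (res D (prodParam iUl C)).obj X
  have h1 := IsUnivArrow.of_adj adj W
  have := hD.isIso_of_isUnivArrow (prodParam iUl C) h1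
  obtain ⟨e⟩ := (hD.isLan_of_isUnivArrow (prodParam iUl C) h1).nonempty_iso h
    (asIso (adj.unit.app W)).symm
  exact ⟨_, ⟨adj⟩, W, ⟨e⟩⟩

theorem isCartesian_of_isRan (hD : IsDerivator D) {X : val D (Cat.of (Sq × C))}
    (h : IsRan (prodParam iLr C) X) : IsCartesian D (op C) X := by
  have := hD.der3_right (prodParam iLr C)
  let adj := Adjunction.ofIsLeftAdjoint (res D (prodParam iLr C))
  let W := (res D (prodParam iLr C)).obj X
  have h1 := IsCounivArrow.of_adj adj W
  have := hD.isIso_of_isCounivArrow (prodParam iLr C) h1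
  obtain ⟨e⟩ := (hD.isRan_of_isCounivArrow (prodParam iLr C) h1).nonempty_iso h
    (asIso (adj.counit.app W))
  exact ⟨_, ⟨adj⟩, W, ⟨e⟩⟩

/-- The inclusion of the corner times `C` is fully faithful, so the essential image of any left Kan
extension functor consists of the colocal diagrams. -/
theorem isCocartesian_iff_isLan (hD : IsDerivator D) {X : val D (Cat.of (Sq × C))} :
    IsCocartesian D (op C) X ↔ IsLan (prodParam iUl C) X :=
  ⟨isLan_prodParam_of_isCocartesian hD, isCocartesian_of_isLan hD⟩

theorem isCartesian_iff_isRan (hD : IsDerivator D) {X : val D (Cat.of (Sq × C))} :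
    IsCartesian D (op C) X ↔ IsRan (prodParam iLr C) X :=
  ⟨isRan_prodParam_of_isCartesian hD, isCartesian_of_isRan hD⟩

theorem isLan_iso_iff {f : A ⥤ B} {Z Z' : val D B} (e : Z ≅ Z') : IsLan f Z ↔ IsLan f Z' :=
  ⟨fun h => h.of_iso e, fun h => h.of_iso e.symm⟩

theorem isRan_iso_iff {f : A ⥤ B} {Z Z' : val D B} (e : Z ≅ Z') : IsRan f Z ↔ IsRan f Z' :=
  ⟨fun h => h.of_iso e, fun h => h.of_iso e.symm⟩

/-- In a stable derivator, cocartesian and cartesian squares agree. -/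
theorem IsStableDerivator.isLan_iUl_iff_isRan_iLr (hD : IsStableDerivator D) (Z : val D Sq) :
    IsLan iUl Z ↔ IsRan iLr Z := by
  -- Stability is stated for squares with parameters; the case without parameters is the one with
  -- parameter category a point.
  let p : Cat.of (Sq.{u} × (pt.{u} : Cat.{u, u})) ⥤ Sq.{u} :=
    CategoryTheory.Prod.fst _ _
  have e (c : (pt.{u} : Cat.{u, u})) : (res D (inclParam Sq c)).obj ((res D p).obj Z) ≅ Z :=
    (resComp D (inclParam Sq c) p).symm.app Z ≪≫ (resId D Sq).app Z
  have h1 := hD.isLan_prodParam_iff iUl ((res D p).obj Z)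
  have h2 := hD.isRan_prodParam_iff iLr ((res D p).obj Z)
  have h3 := h1.symm.trans ((isCocartesian_iff_isLan hD.toIsDerivator).symm.trans
    ((hD.cocartesian_iff_cartesian (op pt) ((res D p).obj Z)).trans
      ((isCartesian_iff_isRan hD.toIsDerivator).trans h2)))
  simp only [isLan_iso_iff (e _), isRan_iso_iff (e _)] at h3
  exact ⟨fun h => h3.1 (fun _ => h) ⟨⟨⟩⟩, fun h => h3.2 (fun _ => h) ⟨⟨⟩⟩⟩

variable {P Q R S : Type u} [Preorder P] [Preorder Q] [Preorder R] [Preorder S]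

/-- The square with vertices `a, b, c, d` in the diagram `Z` is cocartesian. -/
def IsBicart (Z : val D (Cat.of P)) (a b c d : P) : Prop :=
  ∃ (hab : a ≤ b) (hac : a ≤ c) (hbd : b ≤ d) (hcd : c ≤ d),
    IsLan iUl ((res D (sqFun hab hac hbd hcd)).obj Z)

theorem isLan_res_iff_isBicart {s : ULift.{u} (Fin 2 × Fin 2) → P} (hs : Monotone s)
    (Z : val D (Cat.of P)) : IsLan iUl ((res D (monoFun s hs)).obj Z) ↔
      IsBicart Z (s ⟨(0, 0)⟩) (s ⟨(1, 0)⟩) (s ⟨(0, 1)⟩) (s ⟨(1, 1)⟩) := by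
  have h1 : s ⟨(0, 0)⟩ ≤ s ⟨(1, 0)⟩ := hs (by constructor <;> simp)
  have h2 : s ⟨(0, 0)⟩ ≤ s ⟨(0, 1)⟩ := hs (by constructor <;> simp)
  have h3 : s ⟨(1, 0)⟩ ≤ s ⟨(1, 1)⟩ := hs (by constructor <;> simp)
  have h4 : s ⟨(0, 1)⟩ ≤ s ⟨(1, 1)⟩ := hs (by constructor <;> simp)
  have e : monoFun s hs ≅ sqFun h1 h2 h3 h4 := isoOfThin fun x => by
    obtain ⟨x1, x2⟩ := x
    fin_cases x1 <;> fin_cases x2 <;> rfl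
  have h : IsBicart Z (s ⟨(0, 0)⟩) (s ⟨(1, 0)⟩) (s ⟨(0, 1)⟩) (s ⟨(1, 1)⟩) ↔
      IsLan iUl ((res D (sqFun h1 h2 h3 h4)).obj Z) :=
    ⟨fun h => h.choose_spec.choose_spec.choose_spec.choose_spec, fun h => ⟨h1, h2, h3, h4, h⟩⟩
  rw [h]
  exact isLan_iso_iff ((resIso e).app Z)

theorem IsBicart.of_iso {Z Z' : val D (Cat.of P)} {a b c d : P} (h : IsBicart Z a b c d)
    (e : Z ≅ Z') : IsBicart Z' a b c d := by
  obtain ⟨h1, h2, h3, h4, h⟩ := h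
  exact ⟨h1, h2, h3, h4, h.of_iso ((res D _).mapIso e)⟩

theorem IsBicart.map {f : P → Q} (hf : Monotone f) {Z : val D (Cat.of Q)} {a b c d : P}
    (h : IsBicart ((res D (monoFun f hf)).obj Z) a b c d) : IsBicart Z (f a) (f b) (f c) (f d) := by
  obtain ⟨h1, h2, h3, h4, h⟩ := h
  exact (isLan_res_iff_isBicart (hf.comp (monotone_sqVal h1 h2 h3 h4)) Z).1
    (h.of_iso ((resComp D (sqFun h1 h2 h3 h4) (monoFun f hf)).symm.app Z))

theorem IsBicart.comap {f : P → Q} (hf : Monotone f) {Z : val D (Cat.of Q)} {a b c d : P}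
    (hab : a ≤ b) (hac : a ≤ c) (hbd : b ≤ d) (hcd : c ≤ d)
    (h : IsBicart Z (f a) (f b) (f c) (f d)) :
    IsBicart ((res D (monoFun f hf)).obj Z) a b c d :=
  ⟨hab, hac, hbd, hcd, ((isLan_res_iff_isBicart (hf.comp (monotone_sqVal hab hac hbd hcd)) Z).2
    h).of_iso ((resComp D (sqFun hab hac hbd hcd) (monoFun f hf)).app Z)⟩

/-- The vertices of a cocartesian square can be computed by left Kan extensions. -/
theorem IsDerivator.isBicart_of_isLan (hD : IsDerivator D) {f : P → Q} (hf : Monotone f)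
    {a b c : P} {d : Q} (hab : a ≤ b) (hac : a ≤ c) (hbd : f b ≤ d) (hcd : f c ≤ d)
    (h : ∀ y, f y ≤ d → y ≤ b ∨ y ≤ c) (h' : ∀ y, y ≤ b → y ≤ c → y ≤ a) {X : val D (Cat.of Q)}
    (hX : IsLan (monoFun f hf) X) : IsBicart X (f a) (f b) (f c) d :=
  ⟨_, _, _, _, (hD.isLeftExact_slice_iff_of_span hf hab hac hbd hcd h h' X).1
    (hD.isLeftExact_slice_of_isLan _ hX d)⟩

/-- The vertices of a cartesian square can be computed by right Kan extensions. -/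
theorem IsStableDerivator.isBicart_of_isRan (hD : IsStableDerivator D) {f : P → Q} (hf : Monotone f)
    {b c d : P} {a : Q} (hab : a ≤ f b) (hac : a ≤ f c) (hbd : b ≤ d) (hcd : c ≤ d)
    (h : ∀ y, a ≤ f y → b ≤ y ∨ c ≤ y) (h' : ∀ y, b ≤ y → c ≤ y → d ≤ y) {X : val D (Cat.of Q)}
    (hX : IsRan (monoFun f hf) X) : IsBicart X a (f b) (f c) (f d) :=
  ⟨_, _, _, _, (hD.isLan_iUl_iff_isRan_iLr _).2
    ((hD.isRightExact_slice_iff_of_cospan hf hab hac hbd hcd h h' X).1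
      (hD.isRightExact_slice_of_isRan _ hX a))⟩

theorem monotone_val {α : Type u} [Preorder α] (p : α → Prop) :
    Monotone (Subtype.val : {x // p x} → α) := fun _ _ h => h

/-- Left Kan extensions make squares cocartesian. -/
theorem IsDerivator.isBicart_of_isLan_of_ne (hD : IsDerivator D) {f : P → Q} (hf : Monotone f)
    (hf' : ∀ x y, f x ≤ f y → x ≤ y) {a b c d : Q} (hd : ∀ x, f x ≠ d) (hab : a ≤ b) (hac : a ≤ c)
    (hbd : b ≤ d) (hcd : c ≤ d) (ha : a ≠ d) (hb : b ≠ d) (hc : c ≠ d)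
    (h : ∀ y, y ≤ d → y ≠ d → y ≤ b ∨ y ≤ c) (h' : ∀ y, y ≤ b → y ≤ c → y ≤ a)
    {X : val D (Cat.of Q)} (hX : IsLan (monoFun f hf) X) : IsBicart X a b c d := by
  -- Since `d` is a new vertex, `f` factors through its complement. Then `X` is also a left Kan
  -- extension from the complement, whose slice over `d` contains all `y < d` and not only the
  -- images of `f`.
  let f₁ : P → {y // y ≠ d} := fun x => ⟨f x, hd x⟩
  have hf₁ : Monotone f₁ := hf
  have := full_monoFun hf₁ hf'
  have := faithful_monoFun hf₁
  have := full_monoFun (monotone_val (· ≠ d)) fun _ _ h => h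
  have := faithful_monoFun (monotone_val (· ≠ d))
  have h1 := hD.isLan_of_comp (monoFun f₁ hf₁) (monoFun _ (monotone_val (· ≠ d))) hX
  exact hD.isBicart_of_isLan (monotone_val (· ≠ d)) (a := ⟨a, ha⟩) (b := ⟨b, hb⟩) (c := ⟨c, hc⟩)
    hab hac hbd hcd (fun y hy => h y.1 hy y.2) (fun y hy => h' y.1 hy) h1

/-- Right Kan extensions make squares cartesian. -/
theorem IsStableDerivator.isBicart_of_isRan_of_ne (hD : IsStableDerivator D) {f : P → Q}
    (hf : Monotone f) (hf' : ∀ x y, f x ≤ f y → x ≤ y) {a b c d : Q} (ha : ∀ x, f x ≠ a)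
    (hab : a ≤ b) (hac : a ≤ c) (hbd : b ≤ d) (hcd : c ≤ d) (hb : b ≠ a) (hc : c ≠ a) (hd : d ≠ a)
    (h : ∀ y, a ≤ y → y ≠ a → b ≤ y ∨ c ≤ y) (h' : ∀ y, b ≤ y → c ≤ y → d ≤ y)
    {X : val D (Cat.of Q)} (hX : IsRan (monoFun f hf) X) : IsBicart X a b c d := by
  let f₁ : P → {y // y ≠ a} := fun x => ⟨f x, ha x⟩
  have hf₁ : Monotone f₁ := hf
  have := full_monoFun hf₁ hf'
  have := faithful_monoFun hf₁
  have := full_monoFun (monotone_val (· ≠ a)) fun _ _ h => h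
  have := faithful_monoFun (monotone_val (· ≠ a))
  have h1 := hD.isRan_of_comp (monoFun f₁ hf₁) (monoFun _ (monotone_val (· ≠ a))) hX
  exact hD.isBicart_of_isRan (monotone_val (· ≠ a)) (b := ⟨b, hb⟩) (c := ⟨c, hc⟩) (d := ⟨d, hd⟩)
    hab hac hbd hcd (fun y hy => h y.1 hy y.2) (fun y hy => h' y.1 hy) h1

/-- Here the other three vertices of each square have to come from `P`. When new vertices are
computed from earlier new ones, `isLan_of_forall_isBicart` is used instead. -/
theorem IsDerivator.isLan_of_isBicart (hD : IsDerivator D) {f : P → Q} (hf : Monotone f)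
    (hf' : ∀ x y, f x ≤ f y → x ≤ y) {X : val D (Cat.of Q)}
    (h : ∀ d, (∃ x, f x = d) ∨ ∃ a b c, IsBicart X (f a) (f b) (f c) d ∧ a ≤ b ∧ a ≤ c ∧
      (∀ y, f y ≤ d → y ≤ b ∨ y ≤ c) ∧ (∀ y, y ≤ b → y ≤ c → y ≤ a)) :
    IsLan (monoFun f hf) X := by
  have := full_monoFun hf hf'
  have := faithful_monoFun hf
  refine hD.isLan_of_isLeftExact_slice _ fun d => (h d).imp id ?_
  rintro ⟨a, b, c, ⟨h1, h2, h3, h4, hX⟩, hab, hac, h5, h6⟩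
  exact (hD.isLeftExact_slice_iff_of_span hf hab hac h3 h4 h5 h6 X).2 hX

theorem IsStableDerivator.isRan_of_isBicart (hD : IsStableDerivator D) {f : P → Q} (hf : Monotone f)
    (hf' : ∀ x y, f x ≤ f y → x ≤ y) {X : val D (Cat.of Q)}
    (h : ∀ a, (∃ x, f x = a) ∨ ∃ b c d, IsBicart X a (f b) (f c) (f d) ∧ b ≤ d ∧ c ≤ d ∧
      (∀ y, a ≤ f y → b ≤ y ∨ c ≤ y) ∧ (∀ y, b ≤ y → c ≤ y → d ≤ y)) :
    IsRan (monoFun f hf) X := by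
  have := full_monoFun hf hf'
  have := faithful_monoFun hf
  refine hD.isRan_of_isRightExact_slice _ fun d => (h d).imp id ?_
  rintro ⟨b, c, d, ⟨h1, h2, h3, h4, hX⟩, hbd, hcd, h5, h6⟩
  exact (hD.isRightExact_slice_iff_of_cospan hf h1 h2 hbd hcd h5 h6 X).2
    ((hD.isLan_iUl_iff_isRan_iLr _).1 hX)

/-- Left extension by zero. -/
theorem IsDerivator.isLan_of_zero (hD : IsDerivator D) (h0 : Limits.HasZeroObject (val D pt))
    {f : P → Q} (hf : Monotone f) (hf' : ∀ x y, f x ≤ f y → x ≤ y) {X : val D (Cat.of Q)}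
    (h : ∀ d : Q, (∃ x, f x = d) ∨ ((∀ x, ¬ f x ≤ d) ∧
      Limits.IsZero ((res D (atObj (B := Cat.of Q) d)).obj X))) : IsLan (monoFun f hf) X := by
  have := full_monoFun hf hf'
  have := faithful_monoFun hf
  refine hD.isLan_of_isLeftExact_slice _ fun d => (h d).imp id ?_
  rintro ⟨h1, h2⟩
  have : IsEmpty (sliceOver (monoFun f hf) d) := ⟨fun x => h1 x.left (le_of_catHom x.hom)⟩
  exact (hD.isLeftExact_of_isEmpty_iff h0 _ _).2 h2

/-- Right extension by zero. -/
theorem IsDerivator.isRan_of_zero (hD : IsDerivator D) (h0 : Limits.HasZeroObject (val D pt))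
    {f : P → Q} (hf : Monotone f) (hf' : ∀ x y, f x ≤ f y → x ≤ y) {X : val D (Cat.of Q)}
    (h : ∀ d : Q, (∃ x, f x = d) ∨ ((∀ x, ¬ d ≤ f x) ∧
      Limits.IsZero ((res D (atObj (B := Cat.of Q) d)).obj X))) : IsRan (monoFun f hf) X := by
  have := full_monoFun hf hf'
  have := faithful_monoFun hf
  refine hD.isRan_of_isRightExact_slice _ fun d => (h d).imp id ?_
  rintro ⟨h1, h2⟩
  have : IsEmpty (sliceUnder (monoFun f hf) d) := ⟨fun x => h1 x.right (le_of_catHom x.hom)⟩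
  exact (hD.isRightExact_of_isEmpty_iff h0 _ _).2 h2

theorem IsDerivator.isZero_of_isLan_of_not_le (hD : IsDerivator D)
    (h0 : Limits.HasZeroObject (val D pt)) {f : P → Q} (hf : Monotone f) {X : val D (Cat.of Q)}
    (hX : IsLan (monoFun f hf) X) {d : Q} (h : ∀ x, ¬ f x ≤ d) :
    Limits.IsZero ((res D (atObj (B := Cat.of Q) d)).obj X) := by
  have : IsEmpty (sliceOver (monoFun f hf) d) := ⟨fun x => h x.left (le_of_catHom x.hom)⟩
  exact (hD.isLeftExact_of_isEmpty_iff h0 _ _).1 (hD.isLeftExact_slice_of_isLan _ hX d)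

theorem IsDerivator.isZero_of_isRan_of_not_le (hD : IsDerivator D)
    (h0 : Limits.HasZeroObject (val D pt)) {f : P → Q} (hf : Monotone f) {X : val D (Cat.of Q)}
    (hX : IsRan (monoFun f hf) X) {d : Q} (h : ∀ x, ¬ d ≤ f x) :
    Limits.IsZero ((res D (atObj (B := Cat.of Q) d)).obj X) := by
  have : IsEmpty (sliceUnder (monoFun f hf) d) := ⟨fun x => h x.right (le_of_catHom x.hom)⟩
  exact (hD.isRightExact_of_isEmpty_iff h0 _ _).1 (hD.isRightExact_slice_of_isRan _ hX d)

/-- The reflection of the square in its diagonal preserves the corner and the terminal vertex, so it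
identifies the slices over that vertex. -/
theorem IsDerivator.isBicart_swap (hD : IsDerivator D) {Z : val D (Cat.of P)} {a b c d : P}
    (h : IsBicart Z a b c d) : IsBicart Z a c b d := by
  obtain ⟨h1, h2, h3, h4, h⟩ := h
  let s : ULift.{u} (Fin 2 × Fin 2) → ULift.{u} (Fin 2 × Fin 2) := fun x => ⟨x.down.swap⟩
  have hs : Monotone s := fun x y h => ⟨h.2, h.1⟩
  have hss (x y) : s x ≤ y ↔ x ≤ s y := ⟨fun h => ⟨h.2, h.1⟩, fun h => ⟨h.2, h.1⟩⟩
  have hne : ∀ x : UlSub.{u}, s x.1 ≠ ⟨(1, 1)⟩ := by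
    rintro ⟨⟨x1, x2⟩, hx⟩ h
    refine hx ?_
    have h1 := congrArg (fun k => k.down.1) h
    have h2 := congrArg (fun k => k.down.2) h
    exact congrArg ULift.up (Prod.ext h2 h1)
  let g : UlSub.{u} → UlSub.{u} := fun x => ⟨s x.1, hne x⟩
  have hg : Monotone g := fun x y h => hs h
  have key := (isLeftExact_slice_res_iff_of_galois (k := Subtype.val) (f := Subtype.val) (g := g)
    (Subtype.mono_coe _) (Subtype.mono_coe _) hg hs (fun _ => rfl) ⟨(1, 1)⟩ g
    (fun _ _ => ⟨Fin.le_last _, Fin.le_last _⟩) (fun x _ y _ => hss x.1 y.1)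
    ((res D (sqFun h1 h2 h3 h4)).obj Z)).1 ((hD.isLan_iUl_iff _).1 h)
  have key2 := ((hD.isLan_iUl_iff _).2 key).of_iso
    ((resComp D (monoFun s hs) (sqFun h1 h2 h3 h4)).symm.app Z)
  exact (isLan_res_iff_isBicart ((monotone_sqVal h1 h2 h3 h4).comp hs) Z).1 key2

theorem monotone_paste {a b c d x y : P} (hac : a ≤ c) (hab : a ≤ b) (hbx : b ≤ x) (hcd : c ≤ d)
    (hbd : b ≤ d) (hdy : d ≤ y) (hxy : x ≤ y) : Monotone fun k : ULift.{u} (Fin 2 × Fin 3) =>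
      (![![a, b, x], ![c, d, y]] k.down.1 k.down.2 : P) := by
  rintro ⟨x1, x2⟩ ⟨y1, y2⟩ ⟨h1, h2⟩
  have := hab.trans hbx
  have := hac.trans hcd
  have := hab.trans hbd
  have := hbd.trans hdy
  have := hcd.trans hdy
  have := hac.trans (hcd.trans hdy)
  dsimp at h1 h2
  fin_cases x1 <;> fin_cases x2 <;> fin_cases y1 <;> fin_cases y2 <;> simp_all

/-- Cocartesian squares can be pasted. -/
theorem IsDerivator.isBicart_paste (hD : IsDerivator D) {Z : val D (Cat.of P)} {a b c d x y : P}
    (h : IsBicart Z a b c d) (h' : IsBicart Z b x d y) : IsBicart Z a x c y := by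
  have hF := monotone_paste h.choose_spec.choose h.choose h'.choose
    h.choose_spec.choose_spec.choose_spec.choose h.choose_spec.choose_spec.choose
    h'.choose_spec.choose_spec.choose_spec.choose h'.choose_spec.choose_spec.choose
  let e (i : Fin 2) (j : Fin 3) : ULift.{u} (Fin 2 × Fin 3) := ⟨(i, j)⟩
  let W := (res D (monoFun _ hF)).obj Z
  have h1 : IsBicart W (e 0 0) (e 0 1) (e 1 0) (e 1 1) :=
    IsBicart.comap hF (by constructor <;> simp [e]) (by constructor <;> simp [e])
      (by constructor <;> simp [e]) (by constructor <;> simp [e]) h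
  have h2 : IsBicart W (e 0 1) (e 0 2) (e 1 1) (e 1 2) :=
    IsBicart.comap hF (by constructor <;> simp [e]) (by constructor <;> simp [e])
      (by constructor <;> simp [e]) (by constructor <;> simp [e]) h'
  -- The vertices `(1,1)` and `(1,2)` are added one after the other, each by a cocartesian square.
  -- For the composite left Kan extension the slice over `(1,2)` reduces to the corner of the outer
  -- rectangle.
  let f₁ : {r // r ≠ e 1 1 ∧ r ≠ e 1 2} → {r // r ≠ e 1 2} := fun x => ⟨x.1, x.2.2⟩
  have hf₁ : Monotone f₁ := fun _ _ h => h
  have hf₂ := monotone_val (· ≠ e 1 2)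
  have h3 : IsLan (monoFun _ hf₂) W := by
    refine hD.isLan_of_isBicart hf₂ (fun _ _ h => h) fun d => ?_
    by_cases hd : d = e 1 2
    · subst hd
      refine Or.inr ⟨⟨e 0 1, by simp [e]⟩, ⟨e 0 2, by simp [e]⟩, ⟨e 1 1, by simp [e]⟩, h2,
        by constructor <;> simp [e], by constructor <;> simp [e], ?_, ?_⟩
      · rintro ⟨⟨i, j⟩, hij⟩ -
        fin_cases i <;> fin_cases j <;> first | exact absurd rfl hij | simp_all [e, ← ULift.down_le, ← Subtype.coe_le_coe]
      · rintro ⟨⟨i, j⟩, hij⟩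
        fin_cases i <;> fin_cases j <;> first | exact absurd rfl hij | simp_all [e, ← ULift.down_le, ← Subtype.coe_le_coe]
    · exact Or.inl ⟨⟨d, hd⟩, rfl⟩
  have h4 : IsLan (monoFun f₁ hf₁) ((res D (monoFun _ hf₂)).obj W) := by
    refine hD.isLan_of_isBicart hf₁ (fun _ _ h => h) fun d => ?_
    by_cases hd : d.1 = e 1 1
    · obtain ⟨d, hd'⟩ := d
      dsimp only at hd
      subst hd
      refine Or.inr ⟨⟨e 0 0, by simp [e]⟩, ⟨e 0 1, by simp [e]⟩, ⟨e 1 0, by simp [e]⟩,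
        IsBicart.comap hf₂ (by constructor <;> simp [e, f₁]) (by constructor <;> simp [e, f₁])
          (by constructor <;> simp [e, f₁]) (by constructor <;> simp [e, f₁]) h1,
        by constructor <;> simp [e], by constructor <;> simp [e], ?_, ?_⟩
      · rintro ⟨⟨i, j⟩, hij⟩
        fin_cases i <;> fin_cases j <;> first
          | exact absurd rfl hij.1
          | exact absurd rfl hij.2
          | simp_all [e, f₁, ← ULift.down_le, ← Subtype.coe_le_coe]
      · rintro ⟨⟨i, j⟩, hij⟩
        fin_cases i <;> fin_cases j <;> first
          | exact absurd rfl hij.1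
          | exact absurd rfl hij.2
          | simp_all [e, ← ULift.down_le, ← Subtype.coe_le_coe]
    · exact Or.inl ⟨⟨d.1, hd, d.2⟩, rfl⟩
  have h5 := IsLan.comp h3 h4
  have h6 : IsBicart W (e 0 0) (e 0 2) (e 1 0) (e 1 2) := by
    refine hD.isBicart_of_isLan (hf₂.comp hf₁) (a := ⟨e 0 0, by simp [e]⟩)
      (b := ⟨e 0 2, by simp [e]⟩) (c := ⟨e 1 0, by simp [e]⟩) (by constructor <;> simp [e])
      (by constructor <;> simp [e]) (by constructor <;> simp [e, f₁])
      (by constructor <;> simp [e, f₁]) ?_ ?_ h5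
    · rintro ⟨⟨i, j⟩, hij⟩
      fin_cases i <;> fin_cases j <;> first
        | exact absurd rfl hij.1
        | exact absurd rfl hij.2
        | simp_all [e, f₁, ← ULift.down_le, ← Subtype.coe_le_coe]
    · rintro ⟨⟨i, j⟩, hij⟩
      fin_cases i <;> fin_cases j <;> simp_all [e, ← ULift.down_le, ← Subtype.coe_le_coe]
  exact h6.map hF

end Bicartesian

/-! ### Pseudonatural transformations from componentwise data -/

section Transformations

variable {F G H : Prederivator.{u, v, w}}

/-- The naturality constraint of a pseudonatural transformation at an object. -/
abbrev natAt (φ : F ⟶ G) {a b : Cat.{u, u}ᵒᵖ} (f : a ⟶ b) (X : F.obj a) :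
    (φ.app b).toFunctor.obj ((F.map f).toFunctor.obj X) ≅
      (G.map f).toFunctor.obj ((φ.app a).toFunctor.obj X) :=
  (Cat.Hom.toNatIso (φ.naturality f)).app X

theorem natAt_naturality (φ : F ⟶ G) {a b : Cat.{u, u}ᵒᵖ} (f : a ⟶ b) {X Y : F.obj a} (g : X ⟶ Y) :
    (φ.app b).toFunctor.map ((F.map f).toFunctor.map g) ≫ (natAt φ f Y).hom =
      (natAt φ f X).hom ≫ (G.map f).toFunctor.map ((φ.app a).toFunctor.map g) :=
  (φ.naturality f).hom.toNatTrans.naturality g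

theorem natAt_map₂ (φ : F ⟶ G) {a b : Cat.{u, u}ᵒᵖ} {f g : a ⟶ b} (η : f ⟶ g) (X : F.obj a) :
    (φ.app b).toFunctor.map ((F.map₂ η).toNatTrans.app X) ≫ (natAt φ g X).hom =
      (natAt φ f X).hom ≫ (G.map₂ η).toNatTrans.app ((φ.app a).toFunctor.obj X) :=
  congr($(φ.naturality_naturality η).toNatTrans.app X)

theorem natAt_id (φ : F ⟶ G) (a : Cat.{u, u}ᵒᵖ) (X : F.obj a) :
    (natAt φ (𝟙 a) X).hom ≫ (G.mapId a).hom.toNatTrans.app ((φ.app a).toFunctor.obj X) =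
      (φ.app a).toFunctor.map ((F.mapId a).hom.toNatTrans.app X) := by
  have h : (natAt φ (𝟙 a) X).hom ≫ (G.mapId a).hom.toNatTrans.app ((φ.app a).toFunctor.obj X) =
      (φ.app a).toFunctor.map ((F.mapId a).hom.toNatTrans.app X) ≫ 𝟙 _ ≫ 𝟙 _ :=
    congr($(φ.naturality_id a).toNatTrans.app X)
  exact h.trans ((congrArg _ (Category.id_comp _)).trans (Category.comp_id _))

theorem natAt_comp (φ : F ⟶ G) {a b c : Cat.{u, u}ᵒᵖ} (f : a ⟶ b) (g : b ⟶ c) (X : F.obj a) :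
    (natAt φ (f ≫ g) X).hom ≫ (G.mapComp f g).hom.toNatTrans.app ((φ.app a).toFunctor.obj X) =
      (φ.app c).toFunctor.map ((F.mapComp f g).hom.toNatTrans.app X) ≫
        (natAt φ g ((F.map f).toFunctor.obj X)).hom ≫
          (G.map g).toFunctor.map (natAt φ f X).hom := by
  have h : (natAt φ (f ≫ g) X).hom ≫
      (G.mapComp f g).hom.toNatTrans.app ((φ.app a).toFunctor.obj X) =
      (φ.app c).toFunctor.map ((F.mapComp f g).hom.toNatTrans.app X) ≫ 𝟙 _ ≫
        (natAt φ g ((F.map f).toFunctor.obj X)).hom ≫ 𝟙 _ ≫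
          (G.map g).toFunctor.map (natAt φ f X).hom ≫ 𝟙 _ :=
    congr($(φ.naturality_comp f g).toNatTrans.app X)
  refine h.trans (congrArg _ ((Category.id_comp _).trans (congrArg _ ?_)))
  exact (Category.id_comp _).trans (Category.comp_id _)

/-- Construct a pseudonatural transformation from componentwise data. -/
def mkTrans (A : ∀ a, F.obj a ⥤ G.obj a)
    (N : ∀ {a b : Cat.{u, u}ᵒᵖ} (f : a ⟶ b),
      (F.map f).toFunctor ⋙ A b ≅ A a ⋙ (G.map f).toFunctor)
    (h₂ : ∀ {a b : Cat.{u, u}ᵒᵖ} {f g : a ⟶ b} (η : f ⟶ g) (X : F.obj a),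
      (A b).map ((F.map₂ η).toNatTrans.app X) ≫ (N g).hom.app X =
        (N f).hom.app X ≫ (G.map₂ η).toNatTrans.app ((A a).obj X))
    (hid : ∀ (a : Cat.{u, u}ᵒᵖ) (X : F.obj a),
      (N (𝟙 a)).hom.app X ≫ (G.mapId a).hom.toNatTrans.app ((A a).obj X) =
        (A a).map ((F.mapId a).hom.toNatTrans.app X))
    (hcomp : ∀ {a b c : Cat.{u, u}ᵒᵖ} (f : a ⟶ b) (g : b ⟶ c) (X : F.obj a),
      (N (f ≫ g)).hom.app X ≫ (G.mapComp f g).hom.toNatTrans.app ((A a).obj X) =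
        (A c).map ((F.mapComp f g).hom.toNatTrans.app X) ≫
          (N g).hom.app ((F.map f).toFunctor.obj X) ≫
            (G.map g).toFunctor.map ((N f).hom.app X)) : F ⟶ G where
  app a := (A a).toCatHom
  naturality f := Cat.Hom.isoMk (N f)
  naturality_naturality η := by
    ext X
    exact h₂ η X
  naturality_id a := by
    ext X
    exact (hid a X).trans ((congrArg _ (Category.id_comp _)).trans (Category.comp_id _)).symm
  naturality_comp f g := by
    ext X
    refine (hcomp f g X).trans (congrArg _ ((Category.id_comp _).trans (congrArg _ ?_))).symm
    exact (Category.id_comp _).trans (Category.comp_id _)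

/-- Construct a modification from componentwise data. -/
def mkMod {φ ψ : F ⟶ G} (e : ∀ a, (φ.app a).toFunctor ⟶ (ψ.app a).toFunctor)
    (h : ∀ {a b : Cat.{u, u}ᵒᵖ} (f : a ⟶ b) (X : F.obj a),
      (e b).app ((F.map f).toFunctor.obj X) ≫ (natAt ψ f X).hom =
        (natAt φ f X).hom ≫ (G.map f).toFunctor.map ((e a).app X)) : φ ⟶ ψ :=
  ⟨{ app := fun a => Cat.Hom₂.ofNatTrans (e a)
     naturality := fun f => by
      ext X
      exact h f X }⟩

/-- Construct an invertible modification from componentwise data. -/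
def mkModIso {φ ψ : F ⟶ G} (e : ∀ a, (φ.app a).toFunctor ≅ (ψ.app a).toFunctor)
    (h : ∀ {a b : Cat.{u, u}ᵒᵖ} (f : a ⟶ b) (X : F.obj a),
      (e b).hom.app ((F.map f).toFunctor.obj X) ≫ (natAt ψ f X).hom =
        (natAt φ f X).hom ≫ (G.map f).toFunctor.map ((e a).hom.app X)) : φ ≅ ψ :=
  Pseudofunctor.StrongTrans.isoMk (fun a => Cat.Hom.isoMk (F := (φ.app a).toFunctor)
    (G := (ψ.app a).toFunctor) (e a)) fun f => by
      ext X
      exact h f X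

theorem mod_natAt {φ ψ : F ⟶ G} (m : φ ⟶ ψ) {a b : Cat.{u, u}ᵒᵖ} (f : a ⟶ b) (X : F.obj a) :
    (m.as.app b).toNatTrans.app ((F.map f).toFunctor.obj X) ≫ (natAt ψ f X).hom =
      (natAt φ f X).hom ≫ (G.map f).toFunctor.map ((m.as.app a).toNatTrans.app X) :=
  congr($(m.as.naturality f).toNatTrans.app X)

/-- The component of an invertible modification. -/
def modIsoApp {φ ψ : F ⟶ G} (m : φ ≅ ψ) (a : Cat.{u, u}ᵒᵖ) :
    (φ.app a).toFunctor ≅ (ψ.app a).toFunctor where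
  hom := (m.hom.as.app a).toNatTrans
  inv := (m.inv.as.app a).toNatTrans
  hom_inv_id := congr(($(m.hom_inv_id).as.app a).toNatTrans)
  inv_hom_id := congr(($(m.inv_hom_id).as.app a).toNatTrans)

theorem natAt_comp_trans (φ : F ⟶ G) (ψ : G ⟶ H) {a b : Cat.{u, u}ᵒᵖ} (f : a ⟶ b) (X : F.obj a) :
    (natAt (φ ≫ ψ) f X).hom = (ψ.app b).toFunctor.map (natAt φ f X).hom ≫
      (natAt ψ f ((φ.app a).toFunctor.obj X)).hom := by
  have h : (natAt (φ ≫ ψ) f X).hom = 𝟙 _ ≫ (ψ.app b).toFunctor.map (natAt φ f X).hom ≫ 𝟙 _ ≫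
      (natAt ψ f ((φ.app a).toFunctor.obj X)).hom ≫ 𝟙 _ := rfl
  refine h.trans ((Category.id_comp _).trans (congrArg _ ?_))
  exact (Category.id_comp _).trans (Category.comp_id _)

theorem natAt_id_trans {a b : Cat.{u, u}ᵒᵖ} (f : a ⟶ b) (X : F.obj a) :
    (natAt (𝟙 F) f X).hom = 𝟙 _ := Category.comp_id _

/-! ### Inverting objectwise equivalences -/

section Inverse

variable (E : F ⟶ G) (A : ∀ a, G.obj a ⥤ F.obj a)
  (e : ∀ a, A a ⋙ (E.app a).toFunctor ≅ 𝟭 (G.obj a))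
  (N : ∀ {a b : Cat.{u, u}ᵒᵖ} (f : a ⟶ b) (Y : G.obj a),
    (A b).obj ((G.map f).toFunctor.obj Y) ≅ (F.map f).toFunctor.obj ((A a).obj Y))

/-- A morphism to a value of the inverse is determined by its image under the faithful `E`,
transported back to `G` by the naturality constraint of `E` and by `e`. -/
theorem eq_of_map_comp_natAt (hE : ∀ a, (E.app a).toFunctor.Faithful)
    {a b : Cat.{u, u}ᵒᵖ} (f : a ⟶ b) {Y : G.obj a} {X : F.obj b}
    {h₁ h₂ : X ⟶ (F.map f).toFunctor.obj ((A a).obj Y)}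
    (h : (E.app b).toFunctor.map h₁ ≫ (natAt E f ((A a).obj Y)).hom ≫
      (G.map f).toFunctor.map ((e a).hom.app Y) =
        (E.app b).toFunctor.map h₂ ≫ (natAt E f ((A a).obj Y)).hom ≫
      (G.map f).toFunctor.map ((e a).hom.app Y)) : h₁ = h₂ := by
  have := hE b
  exact (E.app b).toFunctor.map_injective ((cancel_mono _).1 h)

/-- The condition `hN` pins down the constraint `N` by its image under `E`; naturality is then
inherited from `e` and from the constraint of `E`. -/
theorem invNat_naturality (hE : ∀ a, (E.app a).toFunctor.Faithful)
    (hN : ∀ {a b : Cat.{u, u}ᵒᵖ} (f : a ⟶ b) (Y : G.obj a),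
    (E.app b).toFunctor.map (N f Y).hom ≫ (natAt E f ((A a).obj Y)).hom ≫
      (G.map f).toFunctor.map ((e a).hom.app Y) = (e b).hom.app ((G.map f).toFunctor.obj Y))
    {a b : Cat.{u, u}ᵒᵖ} (f : a ⟶ b) {Y Y' : G.obj a} (g : Y ⟶ Y') :
    (A b).map ((G.map f).toFunctor.map g) ≫ (N f Y').hom =
      (N f Y).hom ≫ (F.map f).toFunctor.map ((A a).map g) := by
  refine eq_of_map_comp_natAt E A e hE f ?_
  have h1 : (E.app a).toFunctor.map ((A a).map g) ≫ (e a).hom.app Y' = (e a).hom.app Y ≫ g :=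
    (e a).hom.naturality g
  have h2 : (E.app b).toFunctor.map ((A b).map ((G.map f).toFunctor.map g)) ≫ (e b).hom.app _ =
    (e b).hom.app _ ≫ (G.map f).toFunctor.map g := (e b).hom.naturality ((G.map f).toFunctor.map g)
  rw [Functor.map_comp, Functor.map_comp, Category.assoc, Category.assoc, hN, h2, ← hN,
    ← Category.assoc ((E.app b).toFunctor.map ((F.map f).toFunctor.map _)), natAt_naturality]
  simp only [Category.assoc]
  rw [← Functor.map_comp, ← Functor.map_comp, h1]

/-- The inverse of an objectwise equivalence. -/
def invTrans (hE : ∀ a, (E.app a).toFunctor.Faithful)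
    (hN : ∀ {a b : Cat.{u, u}ᵒᵖ} (f : a ⟶ b) (Y : G.obj a),
    (E.app b).toFunctor.map (N f Y).hom ≫ (natAt E f ((A a).obj Y)).hom ≫
      (G.map f).toFunctor.map ((e a).hom.app Y) = (e b).hom.app ((G.map f).toFunctor.obj Y)) : G ⟶ F :=
  mkTrans A (fun f => NatIso.ofComponents (N f) (invNat_naturality E A e N hE hN f))
    (fun {a b f g} η Y => by
      refine eq_of_map_comp_natAt E A e hE g ?_
      have h2 : (E.app b).toFunctor.map ((A b).map ((G.map₂ η).toNatTrans.app Y)) ≫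
        (e b).hom.app _ = (e b).hom.app _ ≫ (G.map₂ η).toNatTrans.app Y :=
          (e b).hom.naturality ((G.map₂ η).toNatTrans.app Y)
      have h3 : (G.map f).toFunctor.map ((e a).hom.app Y) ≫ (G.map₂ η).toNatTrans.app Y =
        (G.map₂ η).toNatTrans.app _ ≫ (G.map g).toFunctor.map ((e a).hom.app Y) :=
          (G.map₂ η).toNatTrans.naturality _
      have h4 := natAt_map₂ E η ((A a).obj Y)
      dsimp only [NatIso.ofComponents_hom_app]
      rw [Functor.map_comp, Functor.map_comp, Category.assoc, Category.assoc, hN, h2, ← hN,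
        ← Category.assoc ((E.app b).toFunctor.map ((F.map₂ η).toNatTrans.app _)), h4]
      simp only [Category.assoc]
      rw [h3]
      rfl)
    (fun a Y => by
      have := hE a
      refine (E.app a).toFunctor.map_injective ((cancel_mono ((e a).hom.app Y)).1 ?_)
      have h2 : (E.app a).toFunctor.map ((A a).map ((G.mapId a).hom.toNatTrans.app Y)) ≫
        (e a).hom.app _ = (e a).hom.app _ ≫ (G.mapId a).hom.toNatTrans.app Y :=
          (e a).hom.naturality ((G.mapId a).hom.toNatTrans.app Y)
      have h3 : (G.map (𝟙 a)).toFunctor.map ((e a).hom.app Y) ≫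
        (G.mapId a).hom.toNatTrans.app Y = (G.mapId a).hom.toNatTrans.app _ ≫ (e a).hom.app Y :=
          (G.mapId a).hom.toNatTrans.naturality _
      have h4 := natAt_id E a ((A a).obj Y)
      refine Eq.trans ?_ h2.symm
      dsimp only [NatIso.ofComponents_hom_app]
      rw [← hN, Functor.map_comp, Category.assoc, ← h4]
      simp only [Category.assoc]
      rw [h3])
    (fun {a b c} f g Y => by
      have := hE c
      refine (E.app c).toFunctor.map_injective ((cancel_mono ((natAt E g _).hom ≫
        (G.map g).toFunctor.map (natAt E f _).hom ≫
          (G.map g).toFunctor.map ((G.map f).toFunctor.map ((e a).hom.app Y)))).1 ?_)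
      have h2 : (E.app c).toFunctor.map ((A c).map ((G.mapComp f g).hom.toNatTrans.app Y)) ≫
        (e c).hom.app _ = (e c).hom.app _ ≫ (G.mapComp f g).hom.toNatTrans.app Y :=
          (e c).hom.naturality ((G.mapComp f g).hom.toNatTrans.app Y)
      have h3 : (G.map (f ≫ g)).toFunctor.map ((e a).hom.app Y) ≫
          (G.mapComp f g).hom.toNatTrans.app Y = (G.mapComp f g).hom.toNatTrans.app _ ≫
            (G.map g).toFunctor.map ((G.map f).toFunctor.map ((e a).hom.app Y)) :=
          (G.mapComp f g).hom.toNatTrans.naturality _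
      have h4 := natAt_comp E f g ((A a).obj Y)
      have h5 := natAt_naturality E g (N f Y).hom
      dsimp only [NatIso.ofComponents_hom_app]
      -- This evaluates the side involving `f ≫ g`. The other side contracts to the same expression,
      -- first by `hN g` and then by `hN f`.
      have l : (E.app c).toFunctor.map ((N (f ≫ g) Y).hom ≫
          (F.mapComp f g).hom.toNatTrans.app ((A a).obj Y)) ≫ (natAt E g _).hom ≫
            (G.map g).toFunctor.map (natAt E f _).hom ≫
              (G.map g).toFunctor.map ((G.map f).toFunctor.map ((e a).hom.app Y)) =
          (e c).hom.app _ ≫ (G.mapComp f g).hom.toNatTrans.app Y := by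
        rw [← hN (f ≫ g) Y, Functor.map_comp]
        simp only [Category.assoc]
        rw [h3]
        simp only [← Category.assoc] at h4 ⊢
        congr 1
        simp only [Category.assoc] at h4 ⊢
        rw [← h4]
        rfl
      refine l.trans ?_
      rw [← h2, Functor.map_comp, Category.assoc]
      congr 1
      rw [Functor.map_comp, Category.assoc, ← Category.assoc ((E.app c).toFunctor.map
        ((F.map g).toFunctor.map _)), h5]
      refine (hN g _).symm.trans ?_
      simp only [Category.assoc]
      rw [← hN f Y, Functor.map_comp, Functor.map_comp])

theorem invTrans_comp_iso (hE : ∀ a, (E.app a).toFunctor.Faithful)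
    (hN : ∀ {a b : Cat.{u, u}ᵒᵖ} (f : a ⟶ b) (Y : G.obj a),
    (E.app b).toFunctor.map (N f Y).hom ≫ (natAt E f ((A a).obj Y)).hom ≫
      (G.map f).toFunctor.map ((e a).hom.app Y) = (e b).hom.app ((G.map f).toFunctor.obj Y)) :
    Nonempty (invTrans E A e N hE hN ≫ E ≅ 𝟙 G) :=
  ⟨mkModIso (φ := invTrans E A e N hE hN ≫ E) (ψ := 𝟙 G) e fun {a b} f Y => by
    have h := natAt_comp_trans (invTrans E A e N hE hN) E f Y
    rw [natAt_id_trans]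
    refine (Category.comp_id _).trans ((hN f Y).symm.trans ?_)
    rw [← Category.assoc]
    exact congrArg (· ≫ _) h.symm⟩

end Inverse

theorem comp_inv_inv_comp_hom_hom {𝒞 : Type*} [Category 𝒞] {W X Y Z : 𝒞} (p : W ⟶ X) (m : Y ≅ X)
    (n : Z ≅ Y) : (p ≫ m.inv ≫ n.inv) ≫ n.hom ≫ m.hom = p := by
  simp

/-- Objectwise equivalences are (split) equivalences. -/
theorem exists_comp_iso_id (E : F ⟶ G) (hE : ∀ a, (E.app a).toFunctor.IsEquivalence) :
    ∃ K : G ⟶ F, Nonempty (K ≫ E ≅ 𝟙 G) := by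
  -- The constraint is forced: its image under `E` has to be the composite of the counits with the
  -- inverse constraint of `E`.
  let N {a b : Cat.{u, u}ᵒᵖ} (f : a ⟶ b) (Y : G.obj a) : (E.app b).toFunctor.inv.obj
      ((G.map f).toFunctor.obj Y) ≅ (F.map f).toFunctor.obj ((E.app a).toFunctor.inv.obj Y) :=
    (E.app b).toFunctor.preimageIso
      ((E.app b).toFunctor.asEquivalence.counitIso.app ((G.map f).toFunctor.obj Y) ≪≫
        (G.map f).toFunctor.mapIso ((E.app a).toFunctor.asEquivalence.counitIso.app Y).symm ≪≫
          (natAt E f ((E.app a).toFunctor.inv.obj Y)).symm)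
  refine ⟨_, invTrans_comp_iso E (fun a => (E.app a).toFunctor.inv)
    (fun a => (E.app a).toFunctor.asEquivalence.counitIso) N (fun a => inferInstance) ?_⟩
  intro a b f Y
  have h : (E.app b).toFunctor.map (N f Y).hom =
      (E.app b).toFunctor.asEquivalence.counitIso.hom.app ((G.map f).toFunctor.obj Y) ≫
        (G.map f).toFunctor.map ((E.app a).toFunctor.asEquivalence.counitIso.inv.app Y) ≫
          (natAt E f ((E.app a).toFunctor.inv.obj Y)).inv := Functor.map_preimage _ _
  exact (congrArg (· ≫ _) h).trans (comp_inv_inv_comp_hom_hom _ ((G.map f).toFunctor.mapIso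
    ((E.app a).toFunctor.asEquivalence.counitIso.app Y)) (natAt E f _))

/-- Adjunctions of pseudonatural transformations are detected componentwise. -/
def mkAdjunction {L : F ⟶ G} {R : G ⟶ F} (η : 𝟙 F ⟶ L ≫ R) (ξ : R ≫ L ⟶ 𝟙 G)
    (h₁ : ∀ (a : Cat.{u, u}ᵒᵖ) (X : F.obj a), (L.app a).toFunctor.map ((η.as.app a).toNatTrans.app X) ≫
      (ξ.as.app a).toNatTrans.app ((L.app a).toFunctor.obj X) = 𝟙 _)
    (h₂ : ∀ (a : Cat.{u, u}ᵒᵖ) (Y : G.obj a),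
      (η.as.app a).toNatTrans.app ((R.app a).toFunctor.obj Y) ≫
        (R.app a).toFunctor.map ((ξ.as.app a).toNatTrans.app Y) = 𝟙 _) :
    Bicategory.Adjunction L R where
  unit := η
  counit := ξ
  left_triangle := by
    ext a X
    simp only [leftZigzag, bicategoricalComp, BicategoricalCoherence.iso, Iso.trans_hom,
      whiskerRightIso_hom, Iso.refl_hom, id_whiskerRight, Category.comp_id]
    have h : (L.app a).toFunctor.map ((η.as.app a).toNatTrans.app X) ≫ 𝟙 _ ≫
      (ξ.as.app a).toNatTrans.app ((L.app a).toFunctor.obj X) = 𝟙 _ ≫ 𝟙 _ :=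
        (congrArg _ (Category.id_comp _)).trans ((h₁ a X).trans (Category.comp_id _).symm)
    exact h
  right_triangle := by
    ext a Y
    simp only [rightZigzag, bicategoricalComp, BicategoricalCoherence.iso, Iso.trans_hom,
      whiskerRightIso_hom, Iso.refl_hom, id_whiskerRight, Category.id_comp, Iso.symm_hom]
    have h : (η.as.app a).toNatTrans.app ((R.app a).toFunctor.obj Y) ≫ 𝟙 _ ≫
        (R.app a).toFunctor.map ((ξ.as.app a).toNatTrans.app Y) = 𝟙 _ ≫ 𝟙 _ :=
        (congrArg _ (Category.id_comp _)).trans ((h₂ a Y).trans (Category.comp_id _).symm)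
    exact h

theorem map_comp_comp_comp {𝒜 ℬ : Type*} [Category 𝒜] [Category ℬ] (Φ : 𝒜 ⥤ ℬ) {P₀ P₁ P₂ P₃ : 𝒜}
    (x : P₀ ⟶ P₁) (y : P₁ ⟶ P₂) (z : P₂ ⟶ P₃) {B Q : ℬ} (m : Φ.obj P₃ ⟶ B) (m' : Φ.obj P₂ ⟶ Q)
    (w : Q ⟶ B) (h : Φ.map z ≫ m = m' ≫ w) :
    Φ.map (x ≫ y ≫ z) ≫ m = Φ.map x ≫ (Φ.map y ≫ m') ≫ w := by
  simp [h]

theorem map_comp_inv_comp {𝒜 ℬ : Type*} [Category 𝒜] [Category ℬ] (Φ : 𝒜 ⥤ ℬ) {P Q R : 𝒜}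
    (z : P ⟶ Q) (y : R ≅ Q) {B : ℬ} (m : Φ.obj Q ⟶ B) :
    Φ.map (z ≫ y.inv) ≫ Φ.map y.hom ≫ m = Φ.map z ≫ m := by
  rw [← Functor.map_comp_assoc, Category.assoc, Iso.inv_hom_id, Category.comp_id]

/-- The unit is the inverse of `θ`, and the counit at `X` is the unique lift through `φ` of `θ` at
`φ X`. Naturality, the modification axiom and one triangle identity are checked after applying `φ`,
which is injective on the relevant morphisms; the other triangle identity says that `θ` is
invertible. -/
theorem nonempty_adjunction_left (φ : F ⟶ G) (ψ : G ⟶ F) (θ : ψ ≫ φ ≅ 𝟙 G)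
    (h : ∀ (a : Cat.{u, u}ᵒᵖ) (Y : G.obj a) (Z : F.obj a), Function.Bijective
      fun g : (ψ.app a).toFunctor.obj Y ⟶ Z => (φ.app a).toFunctor.map g) :
    Nonempty (Bicategory.Adjunction ψ φ) := by
  have hc (a : Cat.{u, u}ᵒᵖ) (X : F.obj a) := (h a ((φ.app a).toFunctor.obj X) X).2
    ((θ.hom.as.app a).toNatTrans.app ((φ.app a).toFunctor.obj X))
  choose c hc using hc
  dsimp only at hc
  have hθ (a : Cat.{u, u}ᵒᵖ) {Y Y' : G.obj a} (g : Y ⟶ Y') :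
      (φ.app a).toFunctor.map ((ψ.app a).toFunctor.map g) ≫ (θ.hom.as.app a).toNatTrans.app Y' =
        (θ.hom.as.app a).toNatTrans.app Y ≫ g := (θ.hom.as.app a).toNatTrans.naturality g
  have h1 (a : Cat.{u, u}ᵒᵖ) (Y : G.obj a) : (θ.hom.as.app a).toNatTrans.app Y ≫
    (θ.inv.as.app a).toNatTrans.app Y = 𝟙 _ := congr(($(θ.hom_inv_id).as.app a).toNatTrans.app Y)
  have h2 (a : Cat.{u, u}ᵒᵖ) (Y : G.obj a) : (θ.inv.as.app a).toNatTrans.app Y ≫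
    (θ.hom.as.app a).toNatTrans.app Y = 𝟙 _ := congr(($(θ.inv_hom_id).as.app a).toNatTrans.app Y)
  let ξ : φ ≫ ψ ⟶ 𝟙 F := mkMod (fun a =>
    { app := fun X => c a X
      naturality := fun X X' g => (h a _ _).1 (by
        change (φ.app a).toFunctor.map ((ψ.app a).toFunctor.map ((φ.app a).toFunctor.map g) ≫ c a X') =
          (φ.app a).toFunctor.map (c a X ≫ g)
        rw [Functor.map_comp, Functor.map_comp, hc, hc]
        exact hθ a _) })
    (fun {a b} f X => (h b _ _).1 ((cancel_mono (natAt φ f X).hom).1 (by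
      have h3 : (θ.hom.as.app b).toNatTrans.app ((G.map f).toFunctor.obj
          ((φ.app a).toFunctor.obj X)) = ((φ.app b).toFunctor.map (natAt ψ f _).hom ≫
            (natAt φ f _).hom) ≫ (G.map f).toFunctor.map ((θ.hom.as.app a).toNatTrans.app _) :=
        ((Category.comp_id _).symm.trans (congrArg (_ ≫ ·) (natAt_id_trans f _)).symm).trans
          ((mod_natAt θ.hom f ((φ.app a).toFunctor.obj X)).trans
            (congrArg (· ≫ _) (natAt_comp_trans ψ φ f _)))
      have h4 : (natAt (φ ≫ ψ) f X).hom ≫ (F.map f).toFunctor.map (c a X) =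
        (ψ.app b).toFunctor.map (natAt φ f X).hom ≫ (natAt ψ f _).hom ≫
          (F.map f).toFunctor.map (c a X) :=
        (congrArg (· ≫ _) (natAt_comp_trans φ ψ f X)).trans (Category.assoc _ _ _)
      have h5 : (φ.app b).toFunctor.map (c b ((F.map f).toFunctor.obj X) ≫
          (natAt (𝟙 F) f X).hom) = (θ.hom.as.app b).toNatTrans.app _ :=
        (congrArg _ ((congrArg (_ ≫ ·) (natAt_id_trans f X)).trans
          (Category.comp_id _))).trans (hc b _)
      refine (congrArg (· ≫ _) h5).trans (Eq.trans ?_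
        (congrArg (fun z => (φ.app b).toFunctor.map z ≫ _) h4).symm)
      have h7 := natAt_naturality φ f (c a X)
      rw [hc] at h7
      refine Eq.trans ?_ (map_comp_comp_comp (φ.app b).toFunctor _ _ _ _ _ _ h7).symm
      exact (hθ b (natAt φ f X).hom).symm.trans (congrArg _ h3))))
  refine ⟨mkAdjunction θ.inv ξ (fun a Y => (h a _ _).1 ?_) fun a X => ?_⟩
  · change (φ.app a).toFunctor.map ((ψ.app a).toFunctor.map _ ≫ c a _) = _
    rw [Functor.map_comp, hc]
    refine (hθ a _).trans ((h1 a Y).trans ((φ.app a).toFunctor.map_id _).symm)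
  · change _ ≫ (φ.app a).toFunctor.map (c a X) = _
    rw [hc]
    exact h2 a _

/-- Dual to the previous statement: `θ` itself is the counit, and the unit is lifted through `φ`
from the inverse of `θ`. -/
theorem nonempty_adjunction_right (φ : F ⟶ G) (ψ : G ⟶ F) (θ : ψ ≫ φ ≅ 𝟙 G)
    (h : ∀ (a : Cat.{u, u}ᵒᵖ) (Y : G.obj a) (Z : F.obj a), Function.Bijective
      fun g : Z ⟶ (ψ.app a).toFunctor.obj Y => (φ.app a).toFunctor.map g) :
    Nonempty (Bicategory.Adjunction φ ψ) := by
  have hc (a : Cat.{u, u}ᵒᵖ) (X : F.obj a) := (h a ((φ.app a).toFunctor.obj X) X).2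
    ((θ.inv.as.app a).toNatTrans.app ((φ.app a).toFunctor.obj X))
  choose c hc using hc
  dsimp only at hc
  have hθ (a : Cat.{u, u}ᵒᵖ) {Y Y' : G.obj a} (g : Y ⟶ Y') :
      g ≫ (θ.inv.as.app a).toNatTrans.app Y' = (θ.inv.as.app a).toNatTrans.app Y ≫
        (φ.app a).toFunctor.map ((ψ.app a).toFunctor.map g) :=
    (θ.inv.as.app a).toNatTrans.naturality g
  have h1 (a : Cat.{u, u}ᵒᵖ) (Y : G.obj a) : (θ.hom.as.app a).toNatTrans.app Y ≫
    (θ.inv.as.app a).toNatTrans.app Y = 𝟙 _ := congr(($(θ.hom_inv_id).as.app a).toNatTrans.app Y)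
  have h2 (a : Cat.{u, u}ᵒᵖ) (Y : G.obj a) : (θ.inv.as.app a).toNatTrans.app Y ≫
    (θ.hom.as.app a).toNatTrans.app Y = 𝟙 _ := congr(($(θ.inv_hom_id).as.app a).toNatTrans.app Y)
  let ξ : 𝟙 F ⟶ φ ≫ ψ := mkMod (fun a =>
    { app := fun X => c a X
      naturality := fun X X' g => (h a _ _).1 (by
        change (φ.app a).toFunctor.map (g ≫ c a X') = (φ.app a).toFunctor.map
          (c a X ≫ (ψ.app a).toFunctor.map ((φ.app a).toFunctor.map g))
        rw [Functor.map_comp, Functor.map_comp, hc, hc]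
        exact hθ a _) })
    (fun {a b} f X => by
      have h3 : (θ.inv.as.app b).toNatTrans.app ((G.map f).toFunctor.obj
          ((φ.app a).toFunctor.obj X)) ≫ (φ.app b).toFunctor.map (natAt ψ f _).hom ≫
            (natAt φ f _).hom = (G.map f).toFunctor.map ((θ.inv.as.app a).toNatTrans.app _) :=
        (congrArg _ (natAt_comp_trans ψ φ f _)).symm.trans
          ((mod_natAt θ.inv f ((φ.app a).toFunctor.obj X)).trans
            ((congrArg (· ≫ _) (natAt_id_trans f _)).trans (Category.id_comp _)))
      refine (cancel_mono (natAt ψ f ((φ.app a).toFunctor.obj X)).inv).1 ((h b _ _).1 ?_)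
      have h4 : (c b ((F.map f).toFunctor.obj X) ≫ (natAt (φ ≫ ψ) f X).hom) ≫
          (natAt ψ f ((φ.app a).toFunctor.obj X)).inv =
          c b ((F.map f).toFunctor.obj X) ≫ (ψ.app b).toFunctor.map (natAt φ f X).hom := by
        refine (congrArg (fun z => (_ ≫ z) ≫ _) (natAt_comp_trans φ ψ f X)).trans ?_
        exact (Category.assoc _ _ _).trans (congrArg _ ((Category.assoc _ _ _).trans
          ((congrArg _ (Iso.hom_inv_id _)).trans (Category.comp_id _))))
      have h5 : ((natAt (𝟙 F) f X).hom ≫ (F.map f).toFunctor.map (c a X)) ≫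
          (natAt ψ f ((φ.app a).toFunctor.obj X)).inv =
          (F.map f).toFunctor.map (c a X) ≫ (natAt ψ f ((φ.app a).toFunctor.obj X)).inv :=
        congrArg (· ≫ _) ((congrArg (· ≫ _) (natAt_id_trans f X)).trans (Category.id_comp _))
      refine (congrArg (φ.app b).toFunctor.map h4).trans (Eq.trans ?_
        (congrArg (φ.app b).toFunctor.map h5).symm)
      refine (cancel_mono ((φ.app b).toFunctor.map (natAt ψ f _).hom ≫ (natAt φ f _).hom)).1 ?_
      have h6 := hθ b (natAt φ f X).hom
      have h7 := natAt_naturality φ f (c a X)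
      rw [hc] at h7
      have h8 : (φ.app b).toFunctor.map (c b ((F.map f).toFunctor.obj X) ≫
          (ψ.app b).toFunctor.map (natAt φ f X).hom) = (natAt φ f X).hom ≫
            (θ.inv.as.app b).toNatTrans.app _ :=
        ((φ.app b).toFunctor.map_comp _ _).trans ((congrArg (· ≫ _) (hc b _)).trans h6.symm)
      refine (congrArg (· ≫ _) h8).trans ((Category.assoc _ _ _).trans ((congrArg _ h3).trans ?_))
      exact h7.symm.trans (map_comp_inv_comp (φ.app b).toFunctor _ (natAt ψ f _) _).symm)
  refine ⟨mkAdjunction ξ θ.hom (fun a Y => ?_) fun a X => (h a _ _).1 ?_⟩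
  · change (φ.app a).toFunctor.map (c a Y) ≫ _ = _
    rw [hc]
    exact h2 a _
  · change (φ.app a).toFunctor.map (c a _ ≫ (ψ.app a).toFunctor.map _) = _
    rw [Functor.map_comp, hc]
    refine (hθ a _).symm.trans ((h1 a X).trans ((φ.app a).toFunctor.map_id _).symm)

end Transformations

/-! ### Postcomposition with a pseudofunctor -/

section WhiskerPost

variable {B : Type u₁} [Bicategory.{w₁, v₁} B] {C : Type u₂} [Bicategory.{w₂, v₂} C]
  {E : Type u₃} [Bicategory.{w₃, v₃} E] {G H K : Pseudofunctor B C}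

/-- Postcomposition with a pseudofunctor preserves compositions. -/
def whiskerPostComp (φ : G ⟶ H) (ψ : H ⟶ K) (P : Pseudofunctor C E) :
    whiskerPost φ P ≫ whiskerPost ψ P ≅ whiskerPost (φ ≫ ψ) P :=
  Pseudofunctor.StrongTrans.isoMk (fun a => (P.mapComp (φ.app a) (ψ.app a)).symm) fun {a b} f => by
    change P.map (G.map f) ◁ (P.mapComp (φ.app b) (ψ.app b)).inv ≫
      (P.mapComp (G.map f) (φ.app b ≫ ψ.app b)).inv ≫ P.map₂ ((α_ _ _ _).inv ≫
        (φ.naturality f).hom ▷ ψ.app b ≫ (α_ _ _ _).hom ≫ φ.app a ◁ (ψ.naturality f).hom ≫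
          (α_ _ _ _).inv) ≫ (P.mapComp (φ.app a ≫ ψ.app a) (K.map f)).hom =
      ((α_ _ _ _).inv ≫ ((P.mapComp (G.map f) (φ.app b)).inv ≫ P.map₂ (φ.naturality f).hom ≫
        (P.mapComp (φ.app a) (H.map f)).hom) ▷ P.map (ψ.app b) ≫ (α_ _ _ _).hom ≫
        P.map (φ.app a) ◁ ((P.mapComp (H.map f) (ψ.app b)).inv ≫ P.map₂ (ψ.naturality f).hom ≫
        (P.mapComp (ψ.app a) (K.map f)).hom) ≫ (α_ _ _ _).inv) ≫
      (P.mapComp (φ.app a) (ψ.app a)).inv ▷ P.map (K.map f)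
    -- The value on an inverse associator, obtained by inverting the formula for the associator.
    have e2 {p q r s : C} (x : p ⟶ q) (y : q ⟶ r) (z : r ⟶ s) : P.map₂ (α_ x y z).inv =
      (P.mapComp x (y ≫ z)).hom ≫ P.map x ◁ (P.mapComp y z).hom ≫
        (α_ (P.map x) (P.map y) (P.map z)).inv ≫
        (P.mapComp x y).inv ▷ P.map z ≫ (P.mapComp (x ≫ y) z).inv := by
      rw [← cancel_epi (P.map₂ (α_ x y z).hom), ← P.map₂_comp]
      simp
    simp [e2]

/-- Postcomposition with a pseudofunctor preserves isomorphisms. -/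
def whiskerPostIso {φ ψ : G ⟶ H} (m : ∀ a, φ.app a ≅ ψ.app a)
    (hm : ∀ {a b : B} (f : a ⟶ b), G.map f ◁ (m b).hom ≫ (ψ.naturality f).hom =
      (φ.naturality f).hom ≫ (m a).hom ▷ H.map f) (P : Pseudofunctor C E) :
    whiskerPost φ P ≅ whiskerPost ψ P :=
  Pseudofunctor.StrongTrans.isoMk (fun a => P.map₂Iso (m a)) fun {a b} f => by
    have h := congrArg P.map₂ (hm f)
    simp only [P.map₂_comp, P.map₂_whisker_left, P.map₂_whisker_right] at h
    change P.map (G.map f) ◁ P.map₂ (m b).hom ≫ (P.mapComp (G.map f) (ψ.app b)).inv ≫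
      P.map₂ (ψ.naturality f).hom ≫ (P.mapComp (ψ.app a) (H.map f)).hom =
      ((P.mapComp (G.map f) (φ.app b)).inv ≫ P.map₂ (φ.naturality f).hom ≫
        (P.mapComp (φ.app a) (H.map f)).hom) ≫ P.map₂ (m a).hom ▷ P.map (H.map f)
    rw [← cancel_epi (P.mapComp (G.map f) (φ.app b)).hom,
      ← cancel_mono (P.mapComp (ψ.app a) (H.map f)).inv]
    simpa using h

end WhiskerPost

/-! ### Functoriality of restriction morphisms -/

section Restr

variable (D : Prederivator.{u, v, w}) {A B C : Cat.{u, u}}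

theorem nonempty_restr_comp_iso (f : A ⥤ B) (g : B ⥤ C) :
    Nonempty (restr D g ≫ restr D f ≅ restr D (f ⋙ g)) := by
  let m (X : Cat.{u, u}ᵒᵖ) : (shiftBaseMap g ≫ shiftBaseMap f).app X ≅ (shiftBaseMap (f ⋙ g)).app X :=
    Iso.op2 (Cat.Hom.isoMk (Iso.refl (Functor.prod (f ⋙ g) (𝟭 X.unop))))
  refine ⟨whiskerPostComp _ _ _ ≪≫ whiskerPostIso m (fun {X Y} h => ?_) _⟩
  refine congrArg Bicategory.Opposite.op2 ?_
  ext x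
  refine Prod.ext ?_ ?_
  · change 𝟙 _ ≫ 𝟙 _ = (𝟙 _ ≫ 𝟙 _ ≫ 𝟙 _ ≫ g.map (𝟙 _) ≫ 𝟙 _) ≫ 𝟙 _
    simp
  · change h.unop.toFunctor.map (𝟙 _) ≫ 𝟙 _ = (𝟙 _ ≫ 𝟙 _ ≫ 𝟙 _ ≫ 𝟙 _ ≫ 𝟙 _) ≫ 𝟙 _
    simp

theorem nonempty_restr_iso {f g : A ⥤ B} (i : f ≅ g) :
    Nonempty (restr D f ≅ restr D g) := by
  let m (X : Cat.{u, u}ᵒᵖ) : (shiftBaseMap f).app X ≅ (shiftBaseMap g).app X :=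
    Iso.op2 (Cat.Hom.isoMk (NatIso.prod i (Iso.refl (𝟭 X.unop))))
  refine ⟨whiskerPostIso m (fun {X Y} h => ?_) _⟩
  refine congrArg Bicategory.Opposite.op2 ?_
  ext x
  refine Prod.ext ?_ ?_
  · change i.hom.app _ ≫ 𝟙 _ = 𝟙 _ ≫ i.hom.app _
    simp
  · change h.unop.toFunctor.map (𝟙 _) ≫ 𝟙 _ = 𝟙 _ ≫ 𝟙 _
    simp

theorem nonempty_restr_ev_iso (f : A ⥤ B) (a : A) :
    Nonempty (restr D f ≫ ev D a ≅ ev D (f.obj a)) := by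
  let e (X : Cat.{u, u}) : Functor.prod' ((Functor.const X).obj a) (𝟭 X) ⋙ Functor.prod f (𝟭 X) ≅
      Functor.prod' ((Functor.const X).obj (f.obj a)) (𝟭 X) :=
    NatIso.ofComponents (fun x => Iso.refl (f.obj a, x)) fun {X Y} g =>
      Prod.ext (show f.map (𝟙 a) ≫ 𝟙 (f.obj a) = 𝟙 (f.obj a) ≫ 𝟙 (f.obj a) by simp)
        (show g ≫ 𝟙 Y = 𝟙 X ≫ g by simp)
  let m (X : Cat.{u, u}ᵒᵖ) : (shiftBaseMap f ≫ evBase a).app X ≅ (evBase (f.obj a)).app X :=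
    Iso.op2 (Cat.Hom.isoMk (e X.unop))
  refine ⟨(α_ _ _ _).symm ≪≫ whiskerRightIso (whiskerPostComp _ _ _ ≪≫
    whiskerPostIso m (fun {X Y} h => ?_) _) _⟩
  refine congrArg Bicategory.Opposite.op2 ?_
  ext x
  refine Prod.ext ?_ ?_
  · change 𝟙 _ ≫ 𝟙 _ = (𝟙 _ ≫ 𝟙 _ ≫ 𝟙 _ ≫ f.map (𝟙 _) ≫ 𝟙 _) ≫ 𝟙 _
    simp
  · change h.unop.toFunctor.map (𝟙 _) ≫ 𝟙 _ = (𝟙 _ ≫ 𝟙 _ ≫ 𝟙 _ ≫ 𝟙 _ ≫ 𝟙 _) ≫ 𝟙 _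
    simp

end Restr

/-! ### Associativity and unitality of composing pseudofunctors -/

section CompAssoc

universe w₄ v₄ u₄

variable {B : Type u₁} [Bicategory.{w₁, v₁} B] {C : Type u₂} [Bicategory.{w₂, v₂} C]
  {E : Type u₃} [Bicategory.{w₃, v₃} E] {F : Type u₄} [Bicategory.{w₄, v₄} F]

/-- The associativity of the composition of pseudofunctors. -/
def compAssoc (G : Pseudofunctor B C) (P : Pseudofunctor C E) (Q : Pseudofunctor E F) :
    (G.comp P).comp Q ⟶ G.comp (P.comp Q) where
  app X := 𝟙 _
  naturality f := ρ_ _ ≪≫ (λ_ _).symm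
  naturality_naturality {a b f g} η := by
    change Q.map₂ (P.map₂ (G.map₂ η)) ▷ 𝟙 _ ≫ (ρ_ _).hom ≫ (λ_ _).inv =
      ((ρ_ _).hom ≫ (λ_ _).inv) ≫ 𝟙 _ ◁ Q.map₂ (P.map₂ (G.map₂ η))
    simp
  naturality_id a := by
    change ((ρ_ _).hom ≫ (λ_ _).inv) ≫ 𝟙 _ ◁ (Q.map₂ (P.map₂ (G.mapId a).hom) ≫
        Q.map₂ (P.mapId _).hom ≫ (Q.mapId _).hom) =
      (Q.map₂ (P.map₂ (G.mapId a).hom ≫ (P.mapId _).hom) ≫ (Q.mapId _).hom) ▷ 𝟙 _ ≫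
        (λ_ _).hom ≫ (ρ_ _).inv
    simp
  naturality_comp {a b c} f g := by
    change ((ρ_ _).hom ≫ (λ_ _).inv) ≫ 𝟙 _ ◁ (Q.map₂ (P.map₂ (G.mapComp f g).hom) ≫
        Q.map₂ (P.mapComp _ _).hom ≫ (Q.mapComp _ _).hom) =
      (Q.map₂ (P.map₂ (G.mapComp f g).hom ≫ (P.mapComp _ _).hom) ≫ (Q.mapComp _ _).hom) ▷ 𝟙 _ ≫
        (α_ _ _ _).hom ≫ _ ◁ ((ρ_ _).hom ≫ (λ_ _).inv) ≫ (α_ _ _ _).inv ≫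
        ((ρ_ _).hom ≫ (λ_ _).inv) ▷ _ ≫ (α_ _ _ _).hom
    simp

/-- The unitality of the composition of pseudofunctors. -/
def idCompTrans (P : Pseudofunctor B C) : (Pseudofunctor.id B).comp P ⟶ P where
  app X := 𝟙 _
  naturality f := ρ_ _ ≪≫ (λ_ _).symm
  naturality_naturality {a b f g} η := by
    change P.map₂ η ▷ 𝟙 _ ≫ (ρ_ _).hom ≫ (λ_ _).inv =
      ((ρ_ _).hom ≫ (λ_ _).inv) ≫ 𝟙 _ ◁ P.map₂ η
    simp
  naturality_id a := by
    change ((ρ_ _).hom ≫ (λ_ _).inv) ≫ 𝟙 _ ◁ (P.mapId a).hom =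
      (P.map₂ (𝟙 (𝟙 a)) ≫ (P.mapId a).hom) ▷ 𝟙 _ ≫ (λ_ _).hom ≫ (ρ_ _).inv
    simp
  naturality_comp {a b c} f g := by
    change ((ρ_ _).hom ≫ (λ_ _).inv) ≫ 𝟙 _ ◁ (P.mapComp f g).hom =
      (P.map₂ (𝟙 (f ≫ g)) ≫ (P.mapComp f g).hom) ▷ 𝟙 _ ≫
        (α_ _ _ _).hom ≫ _ ◁ ((ρ_ _).hom ≫ (λ_ _).inv) ≫ (α_ _ _ _).inv ≫
        ((ρ_ _).hom ≫ (λ_ _).inv) ▷ _ ≫ (α_ _ _ _).hom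
    simp

/-- The naturality of `compAssoc`. -/
def compAssocIso {G H : Pseudofunctor B C} (φ : G ⟶ H) (P : Pseudofunctor C E)
    (Q : Pseudofunctor E F) : compAssoc G P Q ≫ whiskerPost φ (P.comp Q) ≅
      whiskerPost (whiskerPost φ P) Q ≫ compAssoc H P Q :=
  Pseudofunctor.StrongTrans.isoMk (fun a => λ_ (Q.map (P.map (φ.app a))) ≪≫ (ρ_ _).symm)
    fun {a b} f => by
    change Q.map (P.map (G.map f)) ◁ ((λ_ _).hom ≫ (ρ_ _).inv) ≫
      (α_ _ _ _).inv ≫ ((Q.mapComp _ _).inv ≫ Q.map₂ ((P.mapComp _ _).inv ≫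
        P.map₂ (φ.naturality f).hom ≫ (P.mapComp _ _).hom) ≫ (Q.mapComp _ _).hom) ▷ 𝟙 _ ≫
        (α_ _ _ _).hom ≫ Q.map (P.map (φ.app a)) ◁ ((ρ_ _).hom ≫ (λ_ _).inv) ≫ (α_ _ _ _).inv =
      ((α_ _ _ _).inv ≫ ((ρ_ _).hom ≫ (λ_ _).inv) ▷ _ ≫ (α_ _ _ _).hom ≫
        𝟙 _ ◁ (((Q.mapComp _ _).inv ≫ Q.map₂ (P.mapComp _ _).inv) ≫
          Q.map₂ (P.map₂ (φ.naturality f).hom) ≫ Q.map₂ (P.mapComp _ _).hom ≫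
          (Q.mapComp _ _).hom) ≫ (α_ _ _ _).inv) ≫ ((λ_ _).hom ≫ (ρ_ _).inv) ▷ _
    simp

/-- The compatibility of `compAssoc` and `idCompTrans`. -/
def compAssocIdIso (P : Pseudofunctor B C) (Q : Pseudofunctor C E) :
    compAssoc (Pseudofunctor.id B) P Q ≫ idCompTrans (P.comp Q) ≅
      whiskerPost (idCompTrans P) Q :=
  Pseudofunctor.StrongTrans.isoMk (fun a => λ_ (𝟙 _) ≪≫ (Q.mapId _).symm) fun {a b} f => by
    change Q.map (P.map f) ◁ ((λ_ (𝟙 _)).hom ≫ (Q.mapId _).inv) ≫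
      (Q.mapComp _ _).inv ≫ Q.map₂ ((ρ_ _).hom ≫ (λ_ _).inv) ≫ (Q.mapComp _ _).hom =
      ((α_ _ _ _).inv ≫ ((ρ_ _).hom ≫ (λ_ _).inv) ▷ 𝟙 _ ≫ (α_ _ _ _).hom ≫
        𝟙 _ ◁ ((ρ_ _).hom ≫ (λ_ _).inv) ≫ (α_ _ _ _).inv) ≫
          ((λ_ (𝟙 _)).hom ≫ (Q.mapId _).inv) ▷ Q.map (P.map f)
    have h : Q.map₂ (λ_ (P.map f)).inv ≫ (Q.mapComp (𝟙 (P.obj a)) (P.map f)).hom =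
        (λ_ (Q.map (P.map f))).inv ≫ (Q.mapId (P.obj a)).inv ▷ Q.map (P.map f) := by
      rw [← cancel_epi (Q.map₂ (λ_ (P.map f)).hom), ← Category.assoc, ← Q.map₂_comp]
      simp [Q.map₂_left_unitor]
    simp [h]

end CompAssoc

/-! ### Iterated shifts of a prederivator -/

section ShiftShift

variable (D : Prederivator.{u, v, w})

/-- The associativity of products, as a transformation of shift functors. -/
def assocBase (Q S : Cat.{u, u}) :
    shiftBase (Cat.of (Q × S)) ⟶ (shiftBase S).comp (shiftBase Q) where
  app X := (CategoryTheory.prod.inverseAssociator Q S X.unop).toCatHom.op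
  naturality {X Y} g := Iso.op2 (Cat.Hom.isoMk (Iso.refl
    (CategoryTheory.prod.inverseAssociator Q S Y.unop ⋙
      Functor.prod (𝟭 (Q × S)) g.unop.toFunctor)))
  naturality_naturality η := congrArg Bicategory.Opposite.op2 (by
    ext X
    refine Prod.ext (Prod.ext ?_ ?_) ?_
    · change 𝟙 _ ≫ 𝟙 _ = 𝟙 _ ≫ 𝟙 _
      simp
    · change 𝟙 _ ≫ 𝟙 _ = 𝟙 _ ≫ 𝟙 _
      simp
    · exact (Category.comp_id (η.unop2.toNatTrans.app _)).trans (Category.id_comp _).symm)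
  naturality_id X := congrArg Bicategory.Opposite.op2 (by
    ext X
    refine Prod.ext (Prod.ext ?_ ?_) ?_
    · change 𝟙 _ ≫ 𝟙 _ ≫ 𝟙 _ = 𝟙 _ ≫ 𝟙 _ ≫ 𝟙 _
      simp
    · change 𝟙 _ ≫ 𝟙 _ ≫ 𝟙 _ = 𝟙 _ ≫ 𝟙 _ ≫ 𝟙 _
      simp
    · change 𝟙 _ ≫ 𝟙 _ ≫ 𝟙 _ = 𝟙 _ ≫ 𝟙 _ ≫ 𝟙 _
      simp)
  naturality_comp g h := congrArg Bicategory.Opposite.op2 (by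
    ext X
    refine Prod.ext (Prod.ext ?_ ?_) ?_
    · change 𝟙 _ ≫ 𝟙 _ ≫ 𝟙 _ = 𝟙 _ ≫ 𝟙 _ ≫ 𝟙 _ ≫ 𝟙 _ ≫ 𝟙 _ ≫ 𝟙 _
      simp
    · change 𝟙 _ ≫ 𝟙 _ ≫ 𝟙 _ = 𝟙 _ ≫ 𝟙 _ ≫ 𝟙 _ ≫ 𝟙 _ ≫ 𝟙 _ ≫ 𝟙 _
      simp
    · change 𝟙 _ ≫ 𝟙 _ ≫ 𝟙 _ = 𝟙 _ ≫ 𝟙 _ ≫ g.unop.toFunctor.map (𝟙 _) ≫ 𝟙 _ ≫ 𝟙 _ ≫ 𝟙 _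
      simp)

/-- The transformation `D^{Q × S} ⟶ (D^Q)^S`. -/
def shiftAssoc (Q S : Cat.{u, u}) : shift D (Cat.of (Q × S)) ⟶ shift (shift D Q) S :=
  whiskerPost (assocBase Q S) D ≫ compAssoc _ _ _

/-- The associativity and unit transformations can be moved to the base, before `D` is applied.
There the two functors in question coincide strictly, so the comparison has identity components. -/
theorem nonempty_shiftAssoc_ev_iso (Q S : Cat.{u, u}) (s : S) :
    Nonempty (shiftAssoc D Q S ≫ ev (shift D Q) s ≅
      restr D (Functor.prod' (𝟭 Q) ((Functor.const Q).obj s) : Q ⥤ Cat.of (Q × S))) := by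
  let e (X : Cat.{u, u}ᵒᵖ) : Functor.prod (𝟭 Q) (Functor.prod' ((Functor.const X.unop).obj s)
      (𝟭 X.unop)) ⋙ CategoryTheory.prod.inverseAssociator Q S X.unop ≅
      Functor.prod (Functor.prod' (𝟭 Q) ((Functor.const Q).obj s)) (𝟭 X.unop) :=
    Iso.refl _
  let m (X : Cat.{u, u}ᵒᵖ) : (assocBase Q S ≫ whiskerPost (evBase s) (shiftBase Q) ≫
      idCompTrans (shiftBase Q)).app X ≅ (shiftBaseMap
        (Functor.prod' (𝟭 Q) ((Functor.const Q).obj s) : Q ⥤ Cat.of (Q × S))).app X :=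
    Iso.op2 (Cat.Hom.isoMk (e X))
  have i : shiftAssoc D Q S ≫ ev (shift D Q) s ≅ whiskerPost (assocBase Q S ≫
      whiskerPost (evBase s) (shiftBase Q) ≫ idCompTrans (shiftBase Q)) D :=
    α_ _ _ _ ≪≫ whiskerLeftIso _ ((α_ _ _ _).symm ≪≫ whiskerRightIso (compAssocIso _ _ _) _ ≪≫
      α_ _ _ _ ≪≫ whiskerLeftIso _ (compAssocIdIso _ _) ≪≫ whiskerPostComp _ _ _) ≪≫
        whiskerPostComp _ _ _
  refine ⟨i ≪≫ whiskerPostIso m (fun {X Y} h => ?_) _⟩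
  refine congrArg Bicategory.Opposite.op2 ?_
  ext x
  refine Prod.ext (Prod.ext ?_ ?_) ?_
  · change 𝟙 x.1 ≫ 𝟙 x.1 = (𝟙 _ ≫ 𝟙 _ ≫ 𝟙 _ ≫ (𝟙 _ ≫ (𝟙 _ ≫ 𝟙 _ ≫ 𝟙 _) ≫ 𝟙 _ ≫ (𝟙 _ ≫ 𝟙 _) ≫ 𝟙 _) ≫
      𝟙 _) ≫ 𝟙 _
    simp
  · change 𝟙 s ≫ 𝟙 s = (𝟙 _ ≫ 𝟙 _ ≫ 𝟙 _ ≫ (𝟙 _ ≫ (𝟙 _ ≫ 𝟙 _ ≫ 𝟙 _) ≫ 𝟙 _ ≫ 𝟙 _ ≫ 𝟙 _) ≫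
      𝟙 _) ≫ 𝟙 _
    simp
  · have h1 : h.unop.toFunctor.map (𝟙 x.2) ≫ 𝟙 (h.unop.toFunctor.obj x.2) =
        (𝟙 _ ≫ 𝟙 _ ≫ 𝟙 _ ≫ (𝟙 _ ≫ (𝟙 _ ≫ 𝟙 _ ≫ 𝟙 _) ≫ 𝟙 _ ≫ (𝟙 _ ≫ 𝟙 _) ≫ 𝟙 _) ≫ 𝟙 _) ≫ 𝟙 _ := by
      simp
    exact h1

end ShiftShift

/-! ### Kan extension morphisms as bicategorical adjoints -/

section Adjoint

variable {F G H : Prederivator.{u, v, w}}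

/-- The components of an adjunction of pseudonatural transformations. -/
def appAdj {L : F ⟶ G} {R : G ⟶ F} (adj : Bicategory.Adjunction L R) (a : Cat.{u, u}ᵒᵖ) :
    (L.app a).toFunctor ⊣ (R.app a).toFunctor :=
  CategoryTheory.Adjunction.mkOfUnitCounit
    { unit := (adj.unit.as.app a).toNatTrans
      counit := (adj.counit.as.app a).toNatTrans
      left_triangle := by
        have h := adj.left_triangle
        simp only [leftZigzag, bicategoricalComp, BicategoricalCoherence.iso, Iso.trans_hom,
          whiskerRightIso_hom, Iso.refl_hom, id_whiskerRight, Category.comp_id] at h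
        ext X
        have h1 : (L.app a).toFunctor.map ((adj.unit.as.app a).toNatTrans.app X) ≫ 𝟙 _ ≫
          (adj.counit.as.app a).toNatTrans.app ((L.app a).toFunctor.obj X) = 𝟙 _ ≫ 𝟙 _ :=
            congr(($(h).as.app a).toNatTrans.app X)
        exact h1.trans (Category.comp_id _)
      right_triangle := by
        have h := adj.right_triangle
        simp only [rightZigzag, bicategoricalComp, BicategoricalCoherence.iso, Iso.trans_hom,
          whiskerRightIso_hom, Iso.refl_hom, id_whiskerRight, Category.id_comp,
          Iso.symm_hom] at h
        ext Y
        have h1 : (adj.unit.as.app a).toNatTrans.app ((R.app a).toFunctor.obj Y) ≫ 𝟙 _ ≫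
            (R.app a).toFunctor.map ((adj.counit.as.app a).toNatTrans.app Y) = 𝟙 _ ≫ 𝟙 _ :=
          congr(($(h).as.app a).toNatTrans.app Y)
        exact h1.trans (Category.comp_id _) }

theorem nonempty_iso_of_isIso_app {φ ψ : F ⟶ G} (m : φ ⟶ ψ)
    (h : ∀ a (X : F.obj a), IsIso ((m.as.app a).toNatTrans.app X)) : Nonempty (φ ≅ ψ) :=
  ⟨mkModIso (fun a => NatIso.ofComponents (fun X => @asIso _ _ _ _ _ (h a X))
    fun g => (m.as.app a).toNatTrans.naturality g) fun f X => mod_natAt m f X⟩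

/-- A left adjoint of `φ` recovers the objects on which maps out are detected by `φ`. -/
theorem nonempty_comp_comp_left_iso {φ : F ⟶ G} {L : G ⟶ F} (adj : Bicategory.Adjunction L φ)
    (T : H ⟶ F) (h : ∀ a (X : H.obj a) (Z : F.obj a), Function.Bijective
      fun g : (T.app a).toFunctor.obj X ⟶ Z => (φ.app a).toFunctor.map g) :
    Nonempty (T ≫ φ ≫ L ≅ T) := by
  obtain ⟨i⟩ := nonempty_iso_of_isIso_app (T ◁ adj.counit) fun a X => by
    have h1 := IsUnivArrow.of_adj (appAdj adj a)
      ((φ.app a).toFunctor.obj ((T.app a).toFunctor.obj X))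
    refine h1.isIso ?_
    -- Colocality makes the identity of `φ (T X)` universal; by a triangle identity it is the unit
    -- followed by the image of the counit, so the counit compares two universal arrows.
    have h2 : IsUnivArrow (φ.app a).toFunctor (Z := (T.app a).toFunctor.obj X) (𝟙 _) := by
      simpa [IsUnivArrow] using h a X
    exact (iff_of_eq (congrArg (IsUnivArrow _) ((appAdj adj a).right_triangle_components _))).2 h2
  exact ⟨i ≪≫ ρ_ T⟩

/-- A right adjoint of `φ` recovers the objects on which maps in are detected by `φ`. -/
theorem nonempty_comp_comp_right_iso {φ : F ⟶ G} {R : G ⟶ F} (adj : Bicategory.Adjunction φ R)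
    (T : H ⟶ F) (h : ∀ a (X : H.obj a) (Z : F.obj a), Function.Bijective
      fun g : Z ⟶ (T.app a).toFunctor.obj X => (φ.app a).toFunctor.map g) :
    Nonempty (T ≫ φ ≫ R ≅ T) := by
  obtain ⟨i⟩ := nonempty_iso_of_isIso_app (T ◁ adj.unit) fun a X => by
    have h1 := IsCounivArrow.of_adj (appAdj adj a)
      ((φ.app a).toFunctor.obj ((T.app a).toFunctor.obj X))
    refine h1.isIso ?_
    have h2 : IsCounivArrow (φ.app a).toFunctor (Z := (T.app a).toFunctor.obj X) (𝟙 _) := by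
      simpa [IsCounivArrow] using h a X
    exact (iff_of_eq (congrArg (IsCounivArrow _) ((appAdj adj a).left_triangle_components _))).2 h2
  exact ⟨i.symm ≪≫ ρ_ T⟩

section Sub

variable (P : F.ObjectProperty) [P.IsClosedUnderMapObj]

/-- On the sub-prederivator spanned by `P`, `φ` is an equivalence in each parameter, and
`exists_comp_iso_id` inverts it pseudonaturally. -/
theorem exists_section (φ : F ⟶ G) (hP : ∀ a (X Z : F.obj a), P.prop a X → P.prop a Z →
      Function.Bijective fun g : X ⟶ Z => (φ.app a).toFunctor.map g)
    (hess : ∀ a (Y : G.obj a), ∃ X, P.prop a X ∧ Nonempty ((φ.app a).toFunctor.obj X ≅ Y)) :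
    ∃ ψ : G ⟶ F, (∀ a Y, P.prop a ((ψ.app a).toFunctor.obj Y)) ∧ Nonempty (ψ ≫ φ ≅ 𝟙 G) := by
  obtain ⟨K, ⟨i⟩⟩ := exists_comp_iso_id (P.ι ≫ φ) fun a => by
    have h1 : ((P.ι ≫ φ).app a).toFunctor.Faithful := ⟨fun {X Z f g} hfg =>
      ObjectProperty.hom_ext _ ((hP a X.1 Z.1 X.2 Z.2).1 hfg)⟩
    have h2 : ((P.ι ≫ φ).app a).toFunctor.Full := ⟨fun {X Z} g => by
      obtain ⟨k, hk⟩ := (hP a X.1 Z.1 X.2 Z.2).2 g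
      exact ⟨ObjectProperty.homMk k, hk⟩⟩
    have h3 : ((P.ι ≫ φ).app a).toFunctor.EssSurj := ⟨fun Y => by
      obtain ⟨X, hX, ⟨e⟩⟩ := hess a Y
      exact ⟨⟨X, hX⟩, ⟨e⟩⟩⟩
    exact { faithful := h1, full := h2, essSurj := h3 }
  exact ⟨K ≫ P.ι, fun a Y => ((K.app a).toFunctor.obj Y).2, ⟨α_ _ _ _ ≪≫ i⟩⟩

/-- The source of the left Kan extension morphisms: `P` will be the class of colocal diagrams, so
the required inputs are existence with fixed parameters and stability of `P` under change of
parameters. -/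
theorem exists_left_adjoint (φ : F ⟶ G) (hP : ∀ a (X Z : F.obj a), P.prop a X →
      Function.Bijective fun g : X ⟶ Z => (φ.app a).toFunctor.map g)
    (hess : ∀ a (Y : G.obj a), ∃ X, P.prop a X ∧ Nonempty ((φ.app a).toFunctor.obj X ≅ Y)) :
    ∃ ψ : G ⟶ F, Nonempty (Bicategory.Adjunction ψ φ) := by
  obtain ⟨ψ, h, ⟨i⟩⟩ := exists_section P φ (fun a X Z hX _ => hP a X Z hX) hess
  exact ⟨ψ, nonempty_adjunction_left φ ψ i fun a Y Z => hP a _ Z (h a Y)⟩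

theorem exists_right_adjoint (φ : F ⟶ G) (hP : ∀ a (X Z : F.obj a), P.prop a X →
      Function.Bijective fun g : Z ⟶ X => (φ.app a).toFunctor.map g)
    (hess : ∀ a (Y : G.obj a), ∃ X, P.prop a X ∧ Nonempty ((φ.app a).toFunctor.obj X ≅ Y)) :
    ∃ ψ : G ⟶ F, Nonempty (Bicategory.Adjunction φ ψ) := by
  obtain ⟨ψ, h, ⟨i⟩⟩ := exists_section P φ (fun a X Z _ hZ => hP a Z X hZ) hess
  exact ⟨ψ, nonempty_adjunction_right φ ψ i fun a Y Z => hP a _ Z (h a Y)⟩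

end Sub

end Adjoint

/-! ### Recognizing suspensions -/

section Suspension

variable {E G : Prederivator.{u, v, w}}

/-- A family of cocartesian squares with zeros exhibits its last vertex as the suspension of its
first vertex. -/
theorem IsSuspension.nonempty_iso {Sg : E ⟶ E} (h : IsSuspension E Sg) (T : G ⟶ shift E Sq)
    (h₁ : ∀ a (X : G.obj a) (Z : (shift E UlCorner).obj a), Function.Bijective
      fun g : Z ⟶ ((T ≫ restr E iUl).app a).toFunctor.obj X =>
        ((ev E (B := UlCorner) ⟨⟨(0, 0)⟩, by simp⟩).app a).toFunctor.map g)
    (h₂ : ∀ a (X : G.obj a) (Z : (shift E Sq).obj a), Function.Bijective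
      fun g : (T.app a).toFunctor.obj X ⟶ Z => ((restr E iUl).app a).toFunctor.map g) :
    Nonempty ((T ≫ ev E (B := Sq) ⟨(0, 0)⟩) ≫ Sg ≅ T ≫ ev E (B := Sq) ⟨(1, 1)⟩) := by
  obtain ⟨R, L, ⟨adjR⟩, ⟨adjL⟩, ⟨e⟩⟩ := h
  -- `R` recovers the corner of `T` from its first vertex, and `L` recovers `T` from its corner;
  -- evaluating at the last vertex gives the claim.
  obtain ⟨i⟩ := nonempty_comp_comp_right_iso adjR (T ≫ restr E iUl) h₁
  obtain ⟨j⟩ := nonempty_comp_comp_left_iso adjL T h₂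
  obtain ⟨k⟩ := nonempty_restr_ev_iso E iUl (⟨⟨(0, 0)⟩, by simp⟩ : UlCorner)
  have i' : (T ≫ ev E (B := Sq) ⟨(0, 0)⟩) ≫ R ≅ T ≫ restr E iUl :=
    whiskerRightIso (whiskerLeftIso T k.symm ≪≫ (α_ _ _ _).symm) R ≪≫ α_ _ _ _ ≪≫ i
  exact ⟨whiskerLeftIso _ e ≪≫ (α_ _ _ _).symm ≪≫ whiskerRightIso i' _ ≪≫ (α_ _ _ _).symm ≪≫
    whiskerRightIso (α_ _ _ _ ≪≫ j) _⟩

theorem nonempty_comp_iter_iso (G₀ : G ⟶ E) (S : E ⟶ E) (S' : G ⟶ G)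
    (h : Nonempty (G₀ ≫ S ≅ S' ≫ G₀)) (m : ℕ) : Nonempty (G₀ ≫ iter S m ≅ iter S' m ≫ G₀) := by
  obtain ⟨e⟩ := h
  induction m with
  | zero => exact ⟨ρ_ _ ≪≫ (λ_ _).symm⟩
  | succ m ih =>
    obtain ⟨i⟩ := ih
    exact ⟨(α_ _ _ _).symm ≪≫ whiskerRightIso i S ≪≫ α_ _ _ _ ≪≫ whiskerLeftIso _ e ≪≫
      (α_ _ _ _).symm⟩

end Suspension

/-! ### Transformations with values in a sub-prederivator -/

section Lift

variable {F G : Prederivator.{u, v, w}} (P : F.ObjectProperty) [P.IsClosedUnderMapObj]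

/-- The inclusion of a full sub-prederivator is fully faithful in each parameter, so the components
and the modification axiom lift. -/
theorem nonempty_iso_of_comp_ι {φ ψ : G ⟶ P.fullsubcategory} (h : Nonempty (φ ≫ P.ι ≅ ψ ≫ P.ι)) :
    Nonempty (φ ≅ ψ) := by
  obtain ⟨i⟩ := h
  let e (a : Cat.{u, u}ᵒᵖ) : (φ.app a).toFunctor ≅ (ψ.app a).toFunctor :=
    NatIso.ofComponents (fun X => ObjectProperty.isoMk _ ((modIsoApp i a).app X))
      fun g => ObjectProperty.hom_ext _ ((modIsoApp i a).hom.naturality g)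
  refine ⟨mkModIso e fun {a b} f X => ObjectProperty.hom_ext _ ?_⟩
  have h1 := mod_natAt i.hom f X
  have h2 (χ : G ⟶ P.fullsubcategory) : (natAt (χ ≫ P.ι) f X).hom = (natAt χ f X).hom.hom :=
    (natAt_comp_trans χ P.ι f X).trans (Category.comp_id _)
  exact (congrArg (_ ≫ ·) (h2 ψ)).symm.trans (h1.trans (congrArg (· ≫ _) (h2 φ)))

/-- A transformation with values in a shifted sub-prederivator. -/
def liftShift (S : Cat.{u, u}) (φ : G ⟶ shift F S)
    (h : ∀ A X, P.prop ((shiftBase S).obj A) ((φ.app A).toFunctor.obj X)) :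
    G ⟶ shift P.fullsubcategory S where
  app A := ((P.prop ((shiftBase S).obj A)).lift (φ.app A).toFunctor (h A)).toCatHom
  naturality {A B} f := Cat.Hom.isoMk (NatIso.ofComponents
    (fun X => ObjectProperty.isoMk _ ((Cat.Hom.toNatIso (φ.naturality f)).app X))
    (fun {X Y} g => by
      apply ObjectProperty.hom_ext
      exact (Cat.Hom.toNatIso (φ.naturality f)).hom.naturality g))
  naturality_naturality {A B f g} η := by
    ext X
    apply ObjectProperty.hom_ext
    exact congr($(φ.naturality_naturality η).toNatTrans.app X)
  naturality_id A := by
    ext X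
    apply ObjectProperty.hom_ext
    exact congr($(φ.naturality_id A).toNatTrans.app X)
  naturality_comp f g := by
    ext X
    apply ObjectProperty.hom_ext
    exact congr($(φ.naturality_comp f g).toNatTrans.app X)

theorem nonempty_liftShift_ev_iso (S : Cat.{u, u}) (φ : G ⟶ shift F S)
    (h : ∀ A X, P.prop ((shiftBase S).obj A) ((φ.app A).toFunctor.obj X)) (s : S) :
    Nonempty ((liftShift P S φ h ≫ ev P.fullsubcategory s) ≫ P.ι ≅ φ ≫ ev F s) :=
  ⟨mkModIso (fun a => Iso.refl _) fun {a b} f X => by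
    refine (Category.id_comp _).trans (Eq.trans ?_ (congrArg (_ ≫ ·)
      (CategoryTheory.Functor.map_id _ _)).symm)
    refine Eq.trans ?_ (Category.comp_id _).symm
    refine Eq.trans ?_ (natAt_comp_trans (liftShift P S φ h ≫ ev P.fullsubcategory s) P.ι f X).symm
    refine Eq.trans ?_ (Category.comp_id _).symm
    rfl⟩

end Lift

/-! ### Evaluation of diagrams with parameters -/

section Pointwise

variable {D : Prederivator.{u, v, w}} {A A' B B' C C' : Cat.{u, u}}

/-- Restrictions along commutative squares. -/
def resSquare {f : A ⥤ B} {g : B ⥤ C} {f' : A ⥤ B'} {g' : B' ⥤ C} (i : f ⋙ g ≅ f' ⋙ g')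
    (X : val D C) : (res D f).obj ((res D g).obj X) ≅ (res D f').obj ((res D g').obj X) :=
  (resComp D f g).symm.app X ≪≫ (resIso i).app X ≪≫ (resComp D f' g').app X

theorem IsDerivator.isRan_of_isEmpty (hD : IsDerivator D) (h0 : Limits.HasZeroObject (val D pt))
    (f : A ⥤ B) [f.Full] [f.Faithful] {X : val D B} (h : ∀ b : B, (∃ a, f.obj a = b) ∨
      (IsEmpty (sliceUnder f b) ∧ Limits.IsZero ((res D (atObj b)).obj X))) : IsRan f X := by
  refine hD.isRan_of_isRightExact_slice _ fun b => (h b).imp id ?_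
  rintro ⟨h1, h2⟩
  exact (hD.isRightExact_of_isEmpty_iff h0 _ _).2 h2

theorem IsDerivator.isZero_of_isRan_of_isEmpty (hD : IsDerivator D)
    (h0 : Limits.HasZeroObject (val D pt)) (f : A ⥤ B) {X : val D B} (hX : IsRan f X) {b : B}
    (hb : IsEmpty (sliceUnder f b)) : Limits.IsZero ((res D (atObj b)).obj X) :=
  (hD.isRightExact_of_isEmpty_iff h0 _ _).1 (hD.isRightExact_slice_of_isRan _ hX b)

theorem IsDerivator.isZero_iff (hD : IsDerivator D) (h0 : Limits.HasZeroObject (val D pt))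
    {X : val D B} : Limits.IsZero X ↔ ∀ b : B, Limits.IsZero ((res D (atObj b)).obj X) :=
  ⟨fun h b => hD.isZero_res h0 _ h, hD.isZero_of_atObj h0⟩

/-- Evaluating `(b, c)`. -/
def atObjParamIso (b : B) (c : C) (X : val D (Cat.of (B × C))) :
    (res D (atObj b)).obj ((res D (inclParam B c)).obj X) ≅
      (res D (atObj (B := Cat.of (B × C)) (b, c))).obj X :=
  (resComp D (atObj b) (inclParam B c)).symm.app X ≪≫ (resIso (atObjIso (inclParam B c) b)).symm.app X

/-- Evaluating a restricted diagram. -/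
def resAtObjIso (f : A ⥤ B) (a : A) (X : val D B) :
    (res D (atObj a)).obj ((res D f).obj X) ≅ (res D (atObj (f.obj a))).obj X :=
  (resComp D (atObj a) f).symm.app X ≪≫ (resIso (atObjIso f a)).symm.app X

/-- Restriction along `f × C` at a parameter. -/
def resProdParamIso (f : A ⥤ B) (c : C) (X : val D (Cat.of (B × C))) :
    (res D (inclParam A c)).obj ((res D (prodParam f C)).obj X) ≅
      (res D f).obj ((res D (inclParam B c)).obj X) :=
  resSquare (inclParamIso f c) X

/-- The functor `B × g`. -/
abbrev paramFun (B : Cat.{u, u}) (g : C ⥤ C') : Cat.of (B × C) ⥤ Cat.of (B × C') :=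
  Functor.prod (𝟭 B) g

/-- The compatibility of `paramFun` and `inclParam`. -/
def inclParamParamIso (g : C ⥤ C') (c : C) :
    inclParam B c ⋙ paramFun B g ≅ inclParam B (g.obj c) :=
  NatIso.ofComponents (fun b => Iso.refl (b, g.obj c)) fun {x y} h => Prod.ext
    ((Category.comp_id _).trans (Category.id_comp _).symm)
    (show g.map (𝟙 c) ≫ 𝟙 _ = 𝟙 _ ≫ 𝟙 _ by simp)

/-- Restriction along the parameters at a parameter. -/
def resParamIso (g : C ⥤ C') (c : C) (X : val D (Cat.of (B × C'))) :
    (res D (inclParam B c)).obj ((res D (paramFun B g)).obj X) ≅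
      (res D (inclParam B (g.obj c))).obj X :=
  (resComp D (inclParam B c) (paramFun B g)).symm.app X ≪≫ (resIso (inclParamParamIso g c)).app X

end Pointwise

/-! ### Coherent Auslander-Reiten quivers, pointwise in the parameter -/

section ARPointwise

variable {D : Prederivator.{u, v, w}} {n : ℕ} {C : Cat.{u, u}}

/-- A coherent diagram on the mesh category, without parameters, which vanishes at the boundary and
all of whose mesh squares are bicartesian. -/
structure IsAR (Z : val D (mesh n)) : Prop where
  zero_bot (x : Mesh.{u} n) (hx : x.l = 0) : Limits.IsZero ((res D (atObj (B := mesh n) x)).obj Z)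
  zero_top (x : Mesh.{u} n) (hx : x.l = n + 1) : Limits.IsZero ((res D (atObj (B := mesh n) x)).obj Z)
  bicart (a b c d : Mesh.{u} n) (hb : b.k = a.k) (hc : c.k = a.k + 1) (hd : d.k = a.k + 1)
    (hb' : b.l = a.l + 1) (hc' : a.l = c.l + 1) (hd' : d.l = a.l) :
    IsBicart (P := Mesh.{u} n) Z a b c d

theorem IsAR.of_iso {Z Z' : val D (mesh n)} (h : IsAR Z) (e : Z ≅ Z') : IsAR Z' where
  zero_bot x hx := (h.zero_bot x hx).of_iso ((res D _).mapIso e.symm)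
  zero_top x hx := (h.zero_top x hx).of_iso ((res D _).mapIso e.symm)
  bicart a b c d h1 h2 h3 h4 h5 h6 := (h.bicart a b c d h1 h2 h3 h4 h5 h6).of_iso e

theorem isAR_iff_meshSquare {Z : val D (mesh n)} : IsAR Z ↔
    (∀ k, Limits.IsZero ((res D (atObj (B := mesh n) ⟨k, 0, by omega⟩)).obj Z)) ∧
    (∀ k, Limits.IsZero ((res D (atObj (B := mesh n) ⟨k, n + 1, by omega⟩)).obj Z)) ∧
    ∀ k j hj, IsLan iUl ((res D (meshSquare n k j hj)).obj Z) := by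
  have key (k j hj) : IsLan iUl ((res D (meshSquare n k j hj)).obj Z) ↔
      IsBicart (P := Mesh.{u} n) Z ⟨k, j + 1, by omega⟩ ⟨k, j + 2, by omega⟩ ⟨k + 1, j, by omega⟩
        ⟨k + 1, j + 1, by omega⟩ := by
    refine (isLan_res_iff_isBicart _ _).trans (iff_of_eq ?_)
    congr 1 <;> refine Mesh.ext ?_ ?_ <;> simp
  constructor
  · exact fun h => ⟨fun k => h.zero_bot _ rfl, fun k => h.zero_top _ rfl, fun k j hj => (key k j hj).2
      (h.bicart _ _ _ _ rfl rfl rfl rfl rfl rfl)⟩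
  · rintro ⟨h1, h2, h3⟩
    refine ⟨?_, ?_, ?_⟩
    · rintro ⟨k, l, hl⟩ rfl
      exact h1 k
    · rintro ⟨k, l, hl⟩ rfl
      exact h2 k
    · intro a b c d hb hc hd hb' hc' hd'
      have := b.hl
      refine (iff_of_eq ?_).1 ((key a.k c.l (by omega)).1 (h3 _ _ _))
      congr 1 <;> refine Mesh.ext ?_ ?_ <;> simp <;> omega

/-- Zero objects are detected pointwise and cocartesian squares are detected pointwise in
parameters; cartesianness follows by stability. -/
theorem isARDiagram_iff (hS : IsStableDerivator D) (X : val D (Cat.of (mesh n × C))) :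
    IsARDiagram D n (op C) X ↔ ∀ c : C, IsAR ((res D (inclParam (mesh n) c)).obj X) := by
  have hD := hS.toIsDerivator
  have h0 := hS.pointed
  have hz (x : mesh.{u} n) : Limits.IsZero (((ev D x).app (op C)).toFunctor.obj X) ↔
      ∀ c : C, Limits.IsZero ((res D (atObj x)).obj ((res D (inclParam (mesh n) c)).obj X)) := by
    refine (hD.isZero_iff h0).trans (forall_congr' fun c => ?_)
    exact ((resAtObjIso (B := Cat.of (mesh.{u} n × C)) (Functor.prod' ((Functor.const C).obj x) (𝟭 C)) c X) ≪≫
      (atObjParamIso x c X).symm).isZero_iff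
  have hs (k j hj) : IsLan (prodParam iUl C) ((res D (prodParam (meshSquare n k j hj) C)).obj X) ↔
      ∀ c : C, IsLan iUl ((res D (meshSquare n k j hj)).obj
        ((res D (inclParam (mesh n) c)).obj X)) := by
    refine (hD.isLan_prodParam_iff _ _).trans (forall_congr' fun c => ?_)
    exact isLan_iso_iff (resProdParamIso _ _ _)
  constructor
  · intro h c
    refine isAR_iff_meshSquare.2 ⟨fun k => (hz _).1 (h.zero_bot k) c,
      fun k => (hz _).1 (h.zero_top k) c, fun k j hj => ?_⟩
    exact (hs k j hj).1 ((isCocartesian_iff_isLan hD).1 (h.cocartesian k j hj)) c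
  · intro h
    have h' c := isAR_iff_meshSquare.1 (h c)
    refine ⟨fun k => (hz _).2 fun c => (h' c).1 k, fun k => (hz _).2 fun c => (h' c).2.1 k,
      fun k j hj => (isCocartesian_iff_isLan hD).2 ((hs k j hj).2 fun c => (h' c).2.2 k j hj),
      fun k j hj => ?_⟩
    exact (hS.cocartesian_iff_cartesian _ _).1 
      ((isCocartesian_iff_isLan hD).2 ((hs k j hj).2 fun c => (h' c).2.2 k j hj))

/-- Because the conditions are pointwise, passing to all restrictions of the parameter imposes
nothing new. -/
theorem arProp_iff (hS : IsStableDerivator D) (X : val D (Cat.of (mesh n × C))) :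
    (arProp D n).prop (op C) X ↔ ∀ c : C, IsAR ((res D (inclParam (mesh n) c)).obj X) := by
  constructor
  · exact fun h => (isARDiagram_iff hS X).1
      ((h (op C) (𝟙 _)).of_iso ((Cat.Hom.toNatIso ((shift D (mesh n)).mapId (op C))).app X))
  · intro h B f
    exact (isARDiagram_iff hS _).2 fun c =>
      (h (f.unop.toFunctor.obj c)).of_iso (resParamIso f.unop.toFunctor c X).symm

end ARPointwise

/-! ### Existence of the suspension on shifted derivators -/

section Corner

variable {D : Prederivator.{u, v, w}} {Q C C' : Cat.{u, u}}

/-- The inclusion of the first vertex of `⌜`, with parameters. -/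
abbrev cornerFun (Q C : Cat.{u, u}) : Cat.of (Q × C) ⥤ Cat.of (Q × Cat.of (UlCorner.{u} × C)) :=
  Functor.prod (𝟭 Q) (Functor.prod' ((Functor.const C).obj
    (⟨⟨(0, 0)⟩, by simp⟩ : UlCorner.{u})) (𝟭 C))

instance : (cornerFun Q C).Full :=
  ⟨fun g => ⟨(g.1, g.2.2), Prod.ext rfl (Prod.ext (hom_ext_of_preorder _ _) rfl)⟩⟩

instance : (cornerFun Q C).Faithful :=
  ⟨fun h => Prod.ext (congrArg (fun k => k.1) h) (congrArg (fun k => k.2.2) h)⟩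

/-- Diagrams on `⌜` which vanish away from the first vertex. -/
def CornerZero (X : val D (Cat.of (Q × Cat.of (UlCorner.{u} × C)))) : Prop :=
  ∀ (q : Q) (s : UlSub.{u}) (c : C), s.1 ≠ ⟨(0, 0)⟩ →
    Limits.IsZero ((res D (atObj (B := Cat.of (Q × Cat.of (UlCorner.{u} × C))) (q, (s, c)))).obj X)

theorem isEmpty_sliceUnder_cornerFun (q : Q) {s : UlSub.{u}} (c : C) (hs : s.1 ≠ ⟨(0, 0)⟩) :
    IsEmpty (sliceUnder (cornerFun Q C) (q, (s, c))) := by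
  refine ⟨fun x => hs ?_⟩
  have h : s ≤ ⟨⟨(0, 0)⟩, by simp⟩ := le_of_catHom (P := UlSub.{u}) x.hom.2.1
  exact le_antisymm h ⟨Fin.zero_le _, Fin.zero_le _⟩

/-- No morphism leads from another vertex of the corner to `(0,0)`, so right Kan extension inserts
empty limits there, that is, zero objects. -/
theorem CornerZero.isRan (hS : IsStableDerivator D)
    {X : val D (Cat.of (Q × Cat.of (UlCorner.{u} × C)))} (h : CornerZero X) :
    IsRan (cornerFun Q C) X := by
  refine hS.isRan_of_isEmpty hS.pointed _ fun b => ?_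
  obtain ⟨q, s, c⟩ := b
  by_cases hs : s.1 = ⟨(0, 0)⟩
  · exact Or.inl ⟨(q, c), Prod.ext rfl (Prod.ext (Subtype.ext hs.symm) rfl)⟩
  · exact Or.inr ⟨isEmpty_sliceUnder_cornerFun q c hs, h q s c hs⟩

theorem cornerZero_of_isRan (hS : IsStableDerivator D)
    {X : val D (Cat.of (Q × Cat.of (UlCorner.{u} × C)))} (h : IsRan (cornerFun Q C) X) :
    CornerZero X := fun q _ c hs =>
  hS.isZero_of_isRan_of_isEmpty hS.pointed _ h (isEmpty_sliceUnder_cornerFun q c hs)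

theorem CornerZero.map {X : val D (Cat.of (Q × Cat.of (UlCorner.{u} × C')))} (h : CornerZero X)
    (g : C ⥤ C') : CornerZero ((res D (paramFun Q (paramFun UlCorner.{u} g))).obj X) :=
  fun q s c hs => (h q s (g.obj c) hs).of_iso (resAtObjIso _ _ X)

/-- The compatibility of `paramFun` and `inclParam₂`. -/
def inclParam₂ParamIso (B : Cat.{u, u}) (g : C ⥤ C') (q : Q) (c : C) :
    inclParam₂ q B c ⋙ paramFun Q (paramFun B g) ≅ inclParam₂ q B (g.obj c) :=
  NatIso.ofComponents (fun b => Iso.refl (q, (b, g.obj c))) fun _ =>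
    Prod.ext rfl (Prod.ext ((Category.comp_id _).trans (Category.id_comp _).symm)
      (show g.map (𝟙 c) ≫ 𝟙 _ = 𝟙 _ ≫ 𝟙 _ by simp))

/-- Restriction along the parameters at a parameter. -/
def resParam₂Iso {B : Cat.{u, u}} (g : C ⥤ C') (q : Q) (c : C)
    (X : val D (Cat.of (Q × Cat.of (B × C')))) :
    (res D (inclParam₂ q B c)).obj ((res D (paramFun Q (paramFun B g))).obj X) ≅
      (res D (inclParam₂ q B (g.obj c))).obj X :=
  (resComp D (inclParam₂ q B c) (paramFun Q (paramFun B g))).symm.app X ≪≫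
    (resIso (inclParam₂ParamIso B g q c)).app X

/-- The compatibility of `prodParam` and `inclParam₂`. -/
def inclParam₂ProdIso {Q' : Cat.{u, u}} (B : Cat.{u, u}) (h : Q ⥤ Q') (q : Q) (c : C) :
    inclParam₂ q B c ⋙ prodParam h (Cat.of (B × C)) ≅ inclParam₂ (h.obj q) B c :=
  NatIso.ofComponents (fun b => Iso.refl (h.obj q, (b, c))) fun _ =>
    Prod.ext (show h.map (𝟙 q) ≫ 𝟙 _ = 𝟙 _ ≫ 𝟙 _ by simp)
      (Prod.ext ((Category.comp_id _).trans (Category.id_comp _).symm) rfl)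

/-- Stability under change of parameters, as required for these diagrams to span a sub-prederivator.
-/
theorem isLan_prodParam₂_map (hD : IsDerivator D) {A B : Cat.{u, u}} (f : A ⥤ B) [f.Full]
    [f.Faithful] {X : val D (Cat.of (Q × Cat.of (B × C')))} (h : IsLan (prodParam₂ Q f C') X)
    (g : C ⥤ C') : IsLan (prodParam₂ Q f C) ((res D (paramFun Q (paramFun B g))).obj X) := by
  rw [hD.isLan_prodParam₂_iff f] at h ⊢
  exact fun q c => (h q (g.obj c)).of_iso (resParam₂Iso g q c X).symm

theorem isLan_prodParam_map (hD : IsDerivator D) {A B : Cat.{u, u}} (f : A ⥤ B) [f.Full]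
    [f.Faithful] {X : val D (Cat.of (B × C'))} (h : IsLan (prodParam f C') X)
    (g : C ⥤ C') : IsLan (prodParam f C) ((res D (paramFun B g)).obj X) := by
  rw [hD.isLan_prodParam_iff f] at h ⊢
  exact fun c => (h (g.obj c)).of_iso (resParamIso g c X).symm

theorem isRan_prodParam_map (hD : IsDerivator D) {A B : Cat.{u, u}} (f : A ⥤ B) [f.Full]
    [f.Faithful] {X : val D (Cat.of (B × C'))} (h : IsRan (prodParam f C') X)
    (g : C ⥤ C') : IsRan (prodParam f C) ((res D (paramFun B g)).obj X) := by
  rw [hD.isRan_prodParam_iff f] at h ⊢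
  exact fun c => (h (g.obj c)).of_iso (resParamIso g c X).symm

variable (D) in
/-- The diagrams obtained by right extension by zero from the first vertex of `⌜`. -/
def cornerProp (Q : Cat.{u, u}) : (shift (shift D Q) UlCorner.{u}).ObjectProperty where
  prop a X := CornerZero (C := a.unop) (Q := Q) X

instance : (cornerProp D Q).IsClosedUnderMapObj where
  map_obj {_ _ _} hX f := CornerZero.map hX f.unop.toFunctor

theorem exists_corner_extension (hS : IsStableDerivator D) (Q : Cat.{u, u}) :
    ∃ R : shift D Q ⟶ shift (shift D Q) UlCorner.{u}, Nonempty (Bicategory.Adjunction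
      (ev (shift D Q) (B := UlCorner.{u}) ⟨⟨(0, 0)⟩, by simp⟩) R) := by
  refine exists_right_adjoint (cornerProp D Q) _ (fun a X Z hX => ?_) fun a Y => ?_
  · exact CornerZero.isRan hS (C := a.unop) (Q := Q) hX Z
  · obtain ⟨X, hX, e⟩ := hS.exists_isRan (cornerFun Q a.unop) Y
    exact ⟨X, cornerZero_of_isRan hS hX, e⟩

variable (D) in
/-- The diagrams obtained by left Kan extension from `⌜` to `□`. -/
def cocartProp (Q : Cat.{u, u}) : (shift (shift D Q) Sq.{u}).ObjectProperty where
  prop a X := IsLan (prodParam₂ Q iUl.{u} a.unop) X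

theorem exists_cocartesian_extension (hS : IsStableDerivator D) (Q : Cat.{u, u}) :
    ∃ L : shift (shift D Q) UlCorner.{u} ⟶ shift (shift D Q) Sq.{u},
      Nonempty (Bicategory.Adjunction L (restr (shift D Q) iUl.{u})) := by
  have : (cocartProp D Q).IsClosedUnderMapObj :=
    ⟨fun hX f => isLan_prodParam₂_map hS.toIsDerivator iUl.{u} hX f.unop.toFunctor⟩
  refine exists_left_adjoint (cocartProp D Q) _ (fun a X Z hX => ?_) fun a Y => ?_
  · exact hX Z
  · exact hS.exists_isLan (prodParam₂ Q iUl.{u} a.unop) Y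

theorem exists_isSuspension_shift (hS : IsStableDerivator D) (Q : Cat.{u, u}) :
    ∃ Sg : shift D Q ⟶ shift D Q, IsSuspension (shift D Q) Sg := by
  obtain ⟨R, hR⟩ := exists_corner_extension hS Q
  obtain ⟨L, hL⟩ := exists_cocartesian_extension hS Q
  exact ⟨_, R, L, hR, hL, ⟨Iso.refl _⟩⟩

end Corner

/-! ### Existence of the suspension on coherent Auslander-Reiten quivers -/

section ARSuspension

variable {D : Prederivator.{u, v, w}} {n : ℕ} {C : Cat.{u, u}}

theorem bijective_of_hom {𝒞 𝒞' : Type*} [Category 𝒞] [Category 𝒞'] {P : ObjectProperty 𝒞}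
    {P' : ObjectProperty 𝒞'} {X Z : P.FullSubcategory} {X' Z' : P'.FullSubcategory}
    (φ : (X ⟶ Z) → (X' ⟶ Z')) {ψ : (X.obj ⟶ Z.obj) → (X'.obj ⟶ Z'.obj)}
    (h : ∀ g, (φ g).hom = ψ g.hom) (hψ : Function.Bijective ψ) : Function.Bijective φ := by
  refine ⟨fun f g hfg => ObjectProperty.hom_ext _ (hψ.1 ?_), fun g => ?_⟩
  · rw [← h, ← h, hfg]
  · obtain ⟨k, hk⟩ := hψ.2 g.hom
    exact ⟨ObjectProperty.homMk k, ObjectProperty.hom_ext _ ((h _).trans hk)⟩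

theorem isAR_of_isZero (hS : IsStableDerivator D) {Z : val D (mesh n)} (h : Limits.IsZero Z) :
    IsAR Z :=
  isAR_iff_meshSquare.2 ⟨fun _ => hS.isZero_res hS.pointed _ h,
    fun _ => hS.isZero_res hS.pointed _ h,
    fun _ _ _ => hS.isLan_of_isZero hS.pointed _ (hS.isZero_res hS.pointed _ h)⟩

/-- Away from `(0,0)` the diagram on `M_n` is zero, and the zero diagram satisfies all exactness
conditions. -/
theorem arProp_of_cornerZero (hS : IsStableDerivator D)
    {X : val D (Cat.of (mesh n × Cat.of (UlCorner.{u} × C)))} (h : CornerZero X)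
    (hX : (arProp D n).prop (op C) ((res D (cornerFun (mesh n) C)).obj X)) :
    (arProp D n).prop (op (Cat.of (UlCorner.{u} × C))) X := by
  rw [arProp_iff hS] at hX ⊢
  rintro ⟨s, c⟩
  by_cases hs : s.1 = ⟨(0, 0)⟩
  · obtain rfl : s = ⟨⟨(0, 0)⟩, by simp⟩ := Subtype.ext hs
    refine (hX c).of_iso ((resComp D (inclParam (mesh n) c) (cornerFun (mesh n) C)).symm.app X ≪≫
      (resIso (Iso.refl (inclParam (mesh n) (C := Cat.of (UlCorner.{u} × C)) (_, c)))).app X)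
  · exact isAR_of_isZero hS ((hS.isZero_iff hS.pointed).2 fun b =>
      (h b s c hs).of_iso (atObjParamIso b _ X))

/-- Cocartesian squares are closed under left Kan extension from `⌜` to `□`. -/
theorem isLan_of_isLan_corner (hD : IsDerivator D) {V : val D (Cat.of (Sq.{u} × Cat.of (Sq.{u} × C)))}
    (h₁ : IsLan (prodParam₂ Sq.{u} iUl.{u} C) V)
    (h₂ : ∀ (s : UlCorner.{u}) (c : C), IsLan iUl.{u} ((res D (inclParam Sq.{u} (C := Cat.of (Sq.{u} × C))
      (iUl.{u}.obj s, c))).obj V)) (y : Cat.of (Sq.{u} × C)) :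
    IsLan iUl.{u} ((res D (inclParam Sq.{u} y)).obj V) := by
  have h3 : IsLan (prodParam iUl.{u} (Cat.of (UlCorner.{u} × C)))
      ((res D (prodParam₂ Sq.{u} iUl.{u} C)).obj V) := by
    rw [hD.isLan_prodParam_iff iUl.{u}]
    rintro ⟨s, c⟩
    exact (h₂ s c).of_iso (resParamIso (C := Cat.of (UlCorner.{u} × C)) (prodParam iUl.{u} C) (s, c) V).symm
  -- Kan extensions in the two square variables commute: the same functor `⌜ × ⌜ → □ × □` factors in
  -- either order.
  have h4 := IsLan.comp h₁ h3
  have h5 : IsLan (prodParam₂ UlCorner.{u} iUl.{u} C ⋙ prodParam iUl.{u} (Cat.of (Sq.{u} × C))) V := h4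
  exact (hD.isLan_prodParam_iff iUl.{u} _).1 (hD.isLan_of_comp _ _ h5) y

/-- Left Kan extension from the corner stays inside `D^{M_n,ex}`: it extends zero objects by zero
objects, and it commutes with the left Kan extensions expressing that mesh squares are cocartesian.
Hence the suspension can be formed in the sub-prederivator. -/
theorem arProp_of_isLan (hS : IsStableDerivator D)
    {X : val D (Cat.of (mesh n × Cat.of (Sq.{u} × C)))} (h : IsLan (prodParam₂ (mesh n) iUl.{u} C) X)
    (hX : (arProp D n).prop (op (Cat.of (UlCorner.{u} × C)))
      ((res D (prodParam₂ (mesh n) iUl.{u} C)).obj X)) :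
    (arProp D n).prop (op (Cat.of (Sq.{u} × C))) X := by
  rw [arProp_iff hS] at hX ⊢
  have hX' (s : UlCorner.{u}) (c : C) : IsAR ((res D (inclParam (mesh n) (C := Cat.of (Sq.{u} × C))
      (iUl.{u}.obj s, c))).obj X) := (hX (s, c)).of_iso (resParamIso (prodParam iUl.{u} C) _ X)
  -- At a fixed vertex `m` the square is left Kan extended from its corner, so it vanishes if its
  -- corner does.
  have hz (m : mesh n) (hm : ∀ (s : UlCorner.{u}) (c : C), Limits.IsZero ((res D (atObj (B := mesh n) m)).obj
      ((res D (inclParam (mesh n) (C := Cat.of (Sq.{u} × C)) (iUl.{u}.obj s, c))).obj X)))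
      (y : Cat.of (Sq.{u} × C)) : Limits.IsZero ((res D (atObj m)).obj
        ((res D (inclParam (mesh n) y)).obj X)) := by
    obtain ⟨s, c⟩ := y
    have h1 := (hS.isLan_prodParam₂_iff iUl.{u} _).1 h m c
    have h2 := hS.isZero_of_isLan hS.pointed _ h1 ((hS.isZero_iff hS.pointed).2 fun t =>
      (hm t c).of_iso (resAtObjIso _ _ _ ≪≫ resAtObjIso _ _ _ ≪≫ (atObjParamIso _ _ _).symm))
    exact (hS.isZero_res hS.pointed (atObj s) h2).of_iso
      (atObjParamIso _ _ _ ≪≫ (resAtObjIso (inclParam₂ m Sq.{u} c) s X).symm)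
  intro y
  refine isAR_iff_meshSquare.2 ⟨fun k => hz _ (fun s c => (hX' s c).zero_bot _ rfl) y,
    fun k => hz _ (fun s c => (hX' s c).zero_top _ rfl) y, fun k j hj => ?_⟩
  have h1 := isLan_of_isLan_corner hS.toIsDerivator
    (V := (res D (prodParam (meshSquare n k j hj) (Cat.of (Sq.{u} × C)))).obj X) ?_ ?_ y
  · exact h1.of_iso (resProdParamIso _ _ _)
  · rw [hS.isLan_prodParam₂_iff iUl.{u}] at h ⊢
    intro q c
    exact (h ((meshSquare n k j hj).obj q) c).of_iso
      ((resIso (inclParam₂ProdIso Sq.{u} (meshSquare n k j hj) q c)).symm.app X ≪≫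
        (resComp D (inclParam₂ q Sq.{u} c) (prodParam (meshSquare n k j hj) (Cat.of (Sq.{u} × C)))).app X)
  · exact fun s c => ((isAR_iff_meshSquare.1 (hX' s c)).2.2 k j hj).of_iso (resProdParamIso _ _ _).symm


variable (D n) in
/-- The coherent Auslander-Reiten quivers obtained by right extension by zero from `⌜`. -/
def arCornerProp : (shift (arDer D n) UlCorner.{u}).ObjectProperty where
  prop a X := CornerZero (C := a.unop) (Q := mesh n) (D := D) X.obj

variable (D n) in
/-- The coherent Auslander-Reiten quivers obtained by left Kan extension from `⌜` to `□`. -/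
def arCocartProp : (shift (arDer D n) Sq.{u}).ObjectProperty where
  prop a X := IsLan (D := D) (prodParam₂ (mesh n) iUl.{u} a.unop) X.obj

instance : (arCornerProp D n).IsClosedUnderMapObj where
  map_obj {_ _ _} hX f := CornerZero.map hX f.unop.toFunctor

theorem exists_ar_corner_extension (hS : IsStableDerivator D) (n : ℕ) :
    ∃ R : arDer D n ⟶ shift (arDer D n) UlCorner.{u}, Nonempty (Bicategory.Adjunction
      (ev (arDer D n) (B := UlCorner.{u}) ⟨⟨(0, 0)⟩, by simp⟩) R) := by
  refine exists_right_adjoint (arCornerProp D n) _ (fun a X Z hX => ?_) fun a Y => ?_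
  · exact bijective_of_hom _ (ψ := fun g => (res D (cornerFun (mesh n) a.unop)).map g)
      (fun _ => rfl) (CornerZero.isRan hS (C := a.unop) (Q := mesh n) hX Z.obj)
  · obtain ⟨X, hX, ⟨e⟩⟩ := hS.exists_isRan (cornerFun (mesh n) a.unop) Y.obj
    have h := cornerZero_of_isRan hS hX
    exact ⟨⟨X, arProp_of_cornerZero hS h ((arProp_iff hS _).2 fun c =>
      ((arProp_iff hS _).1 Y.2 c).of_iso ((res D _).mapIso e.symm))⟩, h,
        ⟨ObjectProperty.isoMk _ e⟩⟩

theorem exists_ar_cocartesian_extension (hS : IsStableDerivator D) (n : ℕ) :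
    ∃ L : shift (arDer D n) UlCorner.{u} ⟶ shift (arDer D n) Sq.{u},
      Nonempty (Bicategory.Adjunction L (restr (arDer D n) iUl.{u})) := by
  have : (arCocartProp D n).IsClosedUnderMapObj :=
    ⟨fun hX f => isLan_prodParam₂_map hS.toIsDerivator iUl.{u} hX f.unop.toFunctor⟩
  refine exists_left_adjoint (arCocartProp D n) _ (fun a X Z hX => ?_) fun a Y => ?_
  · exact bijective_of_hom _ (ψ := fun g => (res D (prodParam₂ (mesh n) iUl.{u} a.unop)).map g)
      (fun _ => rfl) (hX Z.obj)
  · obtain ⟨X, hX, ⟨e⟩⟩ := hS.exists_isLan (prodParam₂ (mesh n) iUl.{u} a.unop) Y.obj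
    exact ⟨⟨X, arProp_of_isLan hS hX ((arProp_iff hS _).2 fun c =>
      ((arProp_iff hS _).1 Y.2 c).of_iso ((res D _).mapIso e.symm))⟩, hX,
        ⟨ObjectProperty.isoMk _ e⟩⟩

theorem exists_isSuspension_arDer (hS : IsStableDerivator D) (n : ℕ) :
    ∃ Sg : arDer D n ⟶ arDer D n, IsSuspension (arDer D n) Sg := by
  obtain ⟨R, hR⟩ := exists_ar_corner_extension hS n
  obtain ⟨L, hL⟩ := exists_ar_cocartesian_extension hS n
  exact ⟨_, R, L, hR, hL, ⟨Iso.refl _⟩⟩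

end ARSuspension

/-! ### Bicartesian rectangles in the mesh category -/

section Rectangle

variable {D : Prederivator.{u, v, w}} {n : ℕ} {C Q : Cat.{u, u}}

/-- Mesh squares are pasted along the arrows that lower the level. `isBicart_paste` glues in the
other direction, whence the swaps. -/
theorem IsAR.isBicart_column (hS : IsStableDerivator D) {Z : val D (mesh n)} (h : IsAR Z)
    (q : ℕ) (a b c d : Mesh.{u} n) (hb : b.k = a.k) (hb' : b.l = a.l + 1) (hc : c.k = a.k + (q + 1))
    (hc' : a.l = c.l + (q + 1)) (hd : d.k = a.k + (q + 1)) (hd' : d.l + (q + 1) = a.l + 1) :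
    IsBicart (P := Mesh.{u} n) Z a b c d := by
  induction q generalizing c d with
  | zero => exact h.bicart a b c d hb (by omega) (by omega) hb' (by omega) (by omega)
  | succ q ih =>
    have h1 := a.hl
    have h2 := ih ⟨a.k + (q + 1), c.l + 1, by omega⟩ ⟨a.k + (q + 1), d.l + 1, by omega⟩ rfl
      (by dsimp; omega) rfl (by dsimp; omega)
    have h3 := h.bicart ⟨a.k + (q + 1), c.l + 1, by omega⟩ ⟨a.k + (q + 1), d.l + 1, by omega⟩ c d rfl
      (by dsimp; omega) (by dsimp; omega) (by dsimp; omega) (by dsimp) (by dsimp; omega)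
    exact hS.isBicart_swap (hS.isBicart_paste (hS.isBicart_swap h2) (hS.isBicart_swap h3))

/-- Strips of width one are pasted in the direction that raises the level. -/
theorem IsAR.isBicart_rectangle (hS : IsStableDerivator D) {Z : val D (mesh n)} (h : IsAR Z)
    (p q : ℕ) (a b c d : Mesh.{u} n) (hb : b.k = a.k) (hb' : b.l = a.l + (p + 1))
    (hc : c.k = a.k + (q + 1)) (hc' : a.l = c.l + (q + 1)) (hd : d.k = a.k + (q + 1))
    (hd' : d.l + (q + 1) = a.l + (p + 1)) :
    IsBicart (P := Mesh.{u} n) Z a b c d := by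
  induction p generalizing b d with
  | zero => exact h.isBicart_column hS q a b c d hb hb' hc hc' hd hd'
  | succ p ih =>
    have h1 := b.hl
    have h2 := ih ⟨a.k, a.l + (p + 1), by omega⟩ ⟨a.k + (q + 1), d.l - 1, by omega⟩ rfl rfl rfl
      (by dsimp; omega)
    have h3 := h.isBicart_column hS q ⟨a.k, a.l + (p + 1), by omega⟩ b
      ⟨a.k + (q + 1), d.l - 1, by omega⟩ d hb (by dsimp; omega) rfl (by dsimp; omega) hd
        (by dsimp; omega)
    exact hS.isBicart_paste h2 h3

/-- The map `(k, l) ↦ (k + l, n + 1 - l)`, which describes the suspension. -/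
def flipVal {n : ℕ} (x : Mesh.{u} n) : Mesh.{u} n := ⟨x.k + x.l, n + 1 - x.l, by omega⟩

theorem monotone_flipVal {n : ℕ} : Monotone (flipVal.{u} (n := n)) := fun x y h => by
  have h1 : x.k ≤ y.k := h.1
  have h2 : x.k + x.l ≤ y.k + y.l := h.2
  have := x.hl
  have := y.hl
  exact ⟨h2, by dsimp [flipVal]; omega⟩

/-- The map `(k, l) ↦ (k - 1, l)`. -/
def shiftVal {n : ℕ} (x : Mesh.{u} n) : Mesh.{u} n := ⟨x.k - 1, x.l, x.hl⟩

theorem monotone_shiftVal {n : ℕ} : Monotone (shiftVal.{u} (n := n)) := fun x y h => by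
  have h1 : x.k ≤ y.k := h.1
  have h2 : x.k + x.l ≤ y.k + y.l := h.2
  exact ⟨by dsimp [shiftVal]; omega, by dsimp [shiftVal]; omega⟩

/-- The flip exchanges the two boundary lines and carries mesh squares to transposed mesh squares.
-/
theorem IsAR.res_flip (hS : IsStableDerivator D) {Z : val D (mesh n)} (h : IsAR Z) :
    IsAR ((res D (monoFun flipVal monotone_flipVal)).obj Z) where
  zero_bot x hx := (h.zero_top (flipVal x) (by simp [flipVal, hx])).of_iso (resAtObjIso _ _ Z)
  zero_top x hx := (h.zero_bot (flipVal x) (by simp [flipVal, hx])).of_iso (resAtObjIso _ _ Z)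
  bicart a b c d hb hc hd hb' hc' hd' := by
    have := a.hl
    have := b.hl
    refine IsBicart.comap monotone_flipVal ?_ ?_ ?_ ?_ (hS.isBicart_swap (h.bicart (flipVal a)
      (flipVal c) (flipVal b) (flipVal d) ?_ ?_ ?_ ?_ ?_ ?_))
    any_goals dsimp [flipVal]; omega
    all_goals constructor <;> omega

/-- The rectangle starting at a vertex of the mesh category. -/
def rectVal {n : ℕ} (x : Mesh.{u} n) (s : ULift.{u} (Fin 2 × Fin 2)) : Mesh.{u} n :=
  sqVal x ⟨x.k, n + 1, le_rfl⟩ ⟨x.k + x.l, 0, by omega⟩ (flipVal x) s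

theorem monotone_rectVal {n : ℕ} : Monotone fun y : Mesh.{u} n × ULift.{u} (Fin 2 × Fin 2) =>
    rectVal y.1 y.2 := by
  rintro ⟨x, s⟩ ⟨y, t⟩ ⟨⟨h1, h2⟩, h3⟩
  have := x.hl
  have := y.hl
  dsimp at h1 h2
  refine le_trans (b := rectVal y s) ?_ ?_
  · obtain ⟨s1, s2⟩ := s
    fin_cases s1 <;> fin_cases s2 <;>
      (constructor <;> simp [rectVal, sqVal, flipVal] <;> omega)
  · refine monotone_sqVal (P := Mesh.{u} n) ?_ ?_ ?_ ?_ h3 <;>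
      (constructor <;> simp [flipVal] <;> omega)

theorem rectVal_le {n : ℕ} {x y : Mesh.{u} n} {s t : ULift.{u} (Fin 2 × Fin 2)} (h : x ≤ y)
    (h' : s ≤ t) : rectVal x s ≤ rectVal y t :=
  monotone_rectVal (n := n) (show (x, s) ≤ (y, t) from ⟨h, h'⟩)

theorem rectVal_first {n : ℕ} (x : Mesh.{u} n) : rectVal x (ULift.up (0, 0)) = x := by
  simp [rectVal, sqVal]

theorem rectVal_last {n : ℕ} (x : Mesh.{u} n) : rectVal x (ULift.up (1, 1)) = flipVal x := by
  simp [rectVal, sqVal]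

theorem IsAR.isLan_rect (hS : IsStableDerivator D) {Z : val D (mesh n)} (h : IsAR Z) (x : Mesh.{u} n)
    (hx : Monotone (rectVal x)) : IsLan iUl.{u} ((res D (monoFun (rectVal x) hx)).obj Z) := by
  -- From a boundary vertex the rectangle degenerates, but then all its vertices lie on the boundary
  -- and the square is zero.
  by_cases h0 : x.l = 0 ∨ x.l = n + 1
  · refine hS.isLan_of_isZero hS.pointed _ ((hS.isZero_iff hS.pointed).2 fun s => ?_)
    refine Limits.IsZero.of_iso ?_ (resAtObjIso _ _ Z)
    have h1 : (rectVal x s).l = 0 ∨ (rectVal x s).l = n + 1 := by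
      obtain ⟨s1, s2⟩ := s
      fin_cases s1 <;> fin_cases s2 <;> simp [rectVal, sqVal, flipVal] <;> omega
    rcases h1 with h1 | h1
    · exact h.zero_bot _ h1
    · exact h.zero_top _ h1
  · have := x.hl
    -- The side lengths are `n + 1 - l` upwards and `l` downwards; `isBicart_rectangle` takes them
    -- diminished by one.
    refine (isLan_res_iff_isBicart hx Z).2 (h.isBicart_rectangle hS (n - x.l) (x.l - 1) _ _ _ _
      ?_ ?_ ?_ ?_ ?_ ?_) <;> simp [rectVal, sqVal, flipVal] <;> omega

end Rectangle

/-! ### Suspension of restrictions of Auslander-Reiten quivers -/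

section SuspensionFlip

variable (D : Prederivator.{u, v, w}) (n : ℕ)

/-- The restriction of a coherent Auslander-Reiten quiver along a functor to the mesh category. -/
def arRestr {Q : Cat.{u, u}} (e : Q ⥤ mesh.{u} n) : arDer D n ⟶ shift D Q :=
  (arProp D n).ι ≫ restr D e

/-- The functor `Q × □ ⥤ M_n` given by the rectangles starting at the values of `e`. -/
def rectFun {Q : Cat.{u, u}} (e : Q ⥤ mesh.{u} n) : Cat.of (Q × Sq.{u}) ⥤ mesh.{u} n where
  obj y := rectVal (e.obj y.1) y.2
  map f := catHomOfLE (rectVal_le (le_of_catHom (e.map f.1)) (le_of_catHom f.2))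
  map_id _ := hom_ext_of_preorder _ _
  map_comp _ _ := hom_ext_of_preorder _ _

/-- The transformation exhibiting `rectVal` as cocartesian squares. -/
def arRect {Q : Cat.{u, u}} (e : Q ⥤ mesh.{u} n) : arDer D n ⟶ shift (shift D Q) Sq.{u} :=
  arRestr D n (rectFun n e) ≫ shiftAssoc D Q Sq.{u}

variable {D n} {Q C : Cat.{u, u}}

/-- The functor `(q, s, c) ↦ ((q, s), c)`. -/
abbrev unassocFun (Q S C : Cat.{u, u}) :
    Cat.of (Q × Cat.of (S × C)) ⥤ Cat.of (Cat.of (Q × S) × C) :=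
  CategoryTheory.prod.inverseAssociator Q S C

/-- The rectangles at an object of `Q`. -/
def rectFunInclIso (e : Q ⥤ mesh.{u} n) (q : Q) (c : C)
    (hm : Monotone (rectVal (e.obj q : Mesh.{u} n))) :
    (inclParam₂ q Sq.{u} c ⋙ unassocFun Q Sq.{u} C) ⋙ prodParam (rectFun n e) C ≅
      monoFun (rectVal (e.obj q : Mesh.{u} n)) hm ⋙ inclParam (mesh.{u} n) c :=
  NatIso.ofComponents (fun s => Iso.refl (rectVal (e.obj q) s, c)) fun _ =>
    Prod.ext (hom_ext_of_preorder _ _) rfl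

/-- The values of `arRect` at an object of `Q`. -/
def arRectInclIso (e : Q ⥤ mesh.{u} n) (q : Q) (c : C) (X : val D (Cat.of (mesh.{u} n × C)))
    (hm : Monotone (rectVal (e.obj q : Mesh.{u} n))) :
    (res D (inclParam₂ q Sq.{u} c)).obj ((res D (unassocFun Q Sq.{u} C)).obj
      ((res D (prodParam (rectFun n e) C)).obj X)) ≅
      (res D (monoFun (rectVal (e.obj q : Mesh.{u} n)) hm)).obj
        ((res D (inclParam (mesh.{u} n) c)).obj X) :=
  (resComp D (inclParam₂ q Sq.{u} c) (unassocFun Q Sq.{u} C)).symm.app _ ≪≫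
    resSquare (rectFunInclIso e q c hm) X

theorem arRect_isLan (hS : IsStableDerivator D) (e : Q ⥤ mesh.{u} n)
    (X : (arDer D n).obj (op C)) : IsLan (D := D) (prodParam₂ Q iUl.{u} C)
      (((arRect D n e).app (op C)).toFunctor.obj X) := by
  refine (hS.isLan_prodParam₂_iff iUl.{u} (Q := Q) (C := C) _).2 fun q c => ?_
  have hm : Monotone (rectVal (e.obj q : Mesh.{u} n)) := fun s t h =>
    rectVal_le le_rfl h
  exact (((arProp_iff hS _).1 X.2 c).isLan_rect hS (e.obj q) hm).of_iso
    (arRectInclIso e q c X.obj hm).symm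

/-- The vertices of the rectangles. -/
def rectFunAt (e : Q ⥤ mesh.{u} n) (s : Sq.{u}) : Q ⥤ mesh.{u} n :=
  Functor.prod' (𝟭 Q) ((Functor.const Q).obj s) ⋙ rectFun n e

/-- The vertices of the rectangles, with parameters. -/
def rectFunAtIso (e : Q ⥤ mesh.{u} n) (s : Sq.{u}) (c : C) :
    (inclParam Q (C := Cat.of (Sq.{u} × C)) (s, c) ⋙ unassocFun Q Sq.{u} C) ⋙
      prodParam (rectFun n e) C ≅ rectFunAt e s ⋙ inclParam (mesh.{u} n) c :=
  NatIso.ofComponents (fun x => Iso.refl (rectVal (e.obj x) s, c)) fun _ =>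
    Prod.ext (hom_ext_of_preorder _ _) rfl

/-- The values of `arRect` at a vertex. -/
def arRectAtIso (e : Q ⥤ mesh.{u} n) (s : Sq.{u}) (c : C) (X : val D (Cat.of (mesh.{u} n × C))) :
    (res D (inclParam Q (C := Cat.of (Sq.{u} × C)) (s, c))).obj ((res D (unassocFun Q Sq.{u} C)).obj
      ((res D (prodParam (rectFun n e) C)).obj X)) ≅
      (res D (rectFunAt e s)).obj ((res D (inclParam (mesh.{u} n) c)).obj X) :=
  (resComp D (inclParam Q (C := Cat.of (Sq.{u} × C)) (s, c)) (unassocFun Q Sq.{u} C)).symm.app _ ≪≫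
    resSquare (rectFunAtIso e s c) X

theorem rectVal_boundary (x : Mesh.{u} n) {s : ULift.{u} (Fin 2 × Fin 2)} (h0 : s ≠ ⟨(0, 0)⟩)
    (h1 : s ≠ ⟨(1, 1)⟩) : (rectVal x s).l = 0 ∨ (rectVal x s).l = n + 1 := by
  obtain ⟨s1, s2⟩ := s
  fin_cases s1 <;> fin_cases s2 <;>
    first | exact absurd rfl h0 | exact absurd rfl h1 | simp [rectVal, sqVal]

theorem IsAR.isZero {Z : val D (mesh.{u} n)} (h : IsAR Z) (x : Mesh.{u} n)
    (hx : x.l = 0 ∨ x.l = n + 1) : Limits.IsZero ((res D (atObj (B := mesh.{u} n) x)).obj Z) :=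
  hx.elim (h.zero_bot x) (h.zero_top x)

theorem arRect_cornerZero (hS : IsStableDerivator D) (e : Q ⥤ mesh.{u} n)
    (X : (arDer D n).obj (op C)) : CornerZero (D := D) ((res D (prodParam₂ Q iUl.{u} C)).obj
      (((arRect D n e).app (op C)).toFunctor.obj X)) := by
  intro q s c hs
  have h := ((arProp_iff hS _).1 X.2 c).isZero _ (rectVal_boundary (e.obj q) hs s.2)
  refine h.of_iso ?_
  refine resAtObjIso _ _ _ ≪≫ (atObjParamIso (B := Q) (C := Cat.of (Sq.{u} × C)) q (s.1, c) _).symm ≪≫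
    (res D (atObj q)).mapIso (arRectAtIso e s.1 c X.obj) ≪≫
      resAtObjIso (rectFunAt e s.1) q _

/-- Since `M_n` is thin, equality on objects suffices. All later isomorphisms thereby reduce to
identities between coordinates. -/
theorem nonempty_arRestr_iso {e e' : Q ⥤ mesh.{u} n} (h : ∀ x, e.obj x = e'.obj x) :
    Nonempty (arRestr D n e ≅ arRestr D n e') := by
  obtain ⟨i⟩ := nonempty_restr_iso D (isoOfThin h)
  exact ⟨whiskerLeftIso _ i⟩

theorem nonempty_arRect_ev_iso (e : Q ⥤ mesh.{u} n) (s : Sq.{u}) :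
    Nonempty (arRect D n e ≫ ev (shift D Q) s ≅ arRestr D n (rectFunAt e s)) := by
  obtain ⟨i⟩ := nonempty_shiftAssoc_ev_iso D Q Sq.{u} s
  obtain ⟨j⟩ := nonempty_restr_comp_iso D (Functor.prod' (𝟭 Q) ((Functor.const Q).obj s) :
    Q ⥤ Cat.of (Q × Sq.{u})) (rectFun n e)
  exact ⟨α_ _ _ _ ≪≫ whiskerLeftIso _ i ≪≫ α_ _ _ _ ≪≫ whiskerLeftIso _ j⟩

/-- The functor `flipVal`. -/
abbrev flipFun (n : ℕ) : mesh.{u} n ⥤ mesh.{u} n := monoFun flipVal monotone_flipVal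

/-- The rectangles starting at the values of `e` form a family of cocartesian squares with two zero
vertices, so the last vertex is the suspension of the first. Nothing is assumed about `e`. -/
theorem nonempty_arRestr_comp_suspension_iso (hS : IsStableDerivator D) (e : Q ⥤ mesh.{u} n)
    {Sg : shift D Q ⟶ shift D Q} (h : IsSuspension (shift D Q) Sg) :
    Nonempty (arRestr D n e ≫ Sg ≅ arRestr D n (e ⋙ flipFun n)) := by
  obtain ⟨i⟩ := h.nonempty_iso (arRect D n e)
    (fun a X Z => CornerZero.isRan hS (C := a.unop) (arRect_cornerZero hS e X) Z)
    (fun a X Z => arRect_isLan hS e X Z)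
  obtain ⟨j₀⟩ := nonempty_arRect_ev_iso (D := D) e (ULift.up (0, 0))
  obtain ⟨j₁⟩ := nonempty_arRect_ev_iso (D := D) e (ULift.up (1, 1))
  obtain ⟨k₀⟩ := nonempty_arRestr_iso (D := D) (e := e) (e' := rectFunAt e (ULift.up (0, 0)))
    fun _ => (rectVal_first _).symm
  obtain ⟨k₁⟩ := nonempty_arRestr_iso (D := D) (e := rectFunAt e (ULift.up (1, 1)))
    (e' := e ⋙ flipFun n) fun _ => rectVal_last _
  exact ⟨whiskerRightIso (k₀ ≪≫ j₀.symm) Sg ≪≫ i ≪≫ j₁ ≪≫ k₁⟩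

end SuspensionFlip

/-! ### The fractionally Calabi-Yau relation on the mesh category -/

section ARIterate

/-- Postcomposition with a pseudofunctor preserves identities. -/
def whiskerPostId {B : Type u₁} [Bicategory.{w₁, v₁} B] {C : Type u₂} [Bicategory.{w₂, v₂} C]
    {E : Type u₃} [Bicategory.{w₃, v₃} E] (G : Pseudofunctor B C) (P : Pseudofunctor C E) :
    whiskerPost (𝟙 G) P ≅ 𝟙 (G.comp P) :=
  Pseudofunctor.StrongTrans.isoMk (fun a => P.mapId (G.obj a)) fun {a b} f => by
    change P.map (G.map f) ◁ (P.mapId _).hom ≫ (ρ_ _).hom ≫ (λ_ _).inv =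
      ((P.mapComp _ _).inv ≫ P.map₂ ((ρ_ _).hom ≫ (λ_ _).inv) ≫ (P.mapComp _ _).hom) ≫
        (P.mapId _).hom ▷ P.map (G.map f)
    have h : P.map₂ (λ_ (G.map f)).inv ≫ (P.mapComp (𝟙 (G.obj a)) (G.map f)).hom =
        (λ_ (P.map (G.map f))).inv ≫ (P.mapId (G.obj a)).inv ▷ P.map (G.map f) := by
      rw [← cancel_epi (P.map₂ (λ_ (G.map f)).hom), ← Category.assoc, ← P.map₂_comp]
      simp [P.map₂_left_unitor]
    simp [P.map₂_right_unitor, reassoc_of% h]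

theorem nonempty_restr_id_iso (D : Prederivator.{u, v, w}) (A : Cat.{u, u}) :
    Nonempty (restr D (𝟭 A) ≅ 𝟙 (shift D A)) := by
  let m (X : Cat.{u, u}ᵒᵖ) : (shiftBaseMap (𝟭 A)).app X ≅ Pseudofunctor.StrongTrans.app (𝟙 (shiftBase A)) X :=
    Iso.op2 (Cat.Hom.isoMk (Iso.refl (Functor.prod (𝟭 A) (𝟭 X.unop))))
  refine ⟨whiskerPostIso m (fun {X Y} h => ?_) _ ≪≫ whiskerPostId _ _⟩
  refine congrArg Bicategory.Opposite.op2 ?_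
  ext x
  refine Prod.ext ?_ ?_
  · change 𝟙 _ ≫ 𝟙 _ ≫ 𝟙 _ = 𝟙 _ ≫ 𝟙 _
    simp
  · change h.unop.toFunctor.map (𝟙 _) ≫ 𝟙 _ ≫ 𝟙 _ = 𝟙 _ ≫ 𝟙 _
    simp

variable {D : Prederivator.{u, v, w}} {n : ℕ} {C Q : Cat.{u, u}}

variable (D n) in
theorem nonempty_arRestr_id_iso : Nonempty (arRestr D n (𝟭 (mesh.{u} n)) ≅ (arProp D n).ι) := by
  obtain ⟨i⟩ := nonempty_restr_id_iso D (mesh.{u} n)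
  exact ⟨whiskerLeftIso _ i ≪≫ ρ_ _⟩

theorem nonempty_iso_of_comp_arRestr_id {G : Prederivator.{u, v, w}} {φ ψ : G ⟶ arDer D n}
    (h : Nonempty (φ ≫ arRestr D n (𝟭 (mesh.{u} n)) ≅ ψ ≫ arRestr D n (𝟭 (mesh.{u} n)))) :
    Nonempty (φ ≅ ψ) := by
  obtain ⟨i⟩ := h
  obtain ⟨j⟩ := nonempty_arRestr_id_iso D n
  exact nonempty_iso_of_comp_ι _ ⟨whiskerLeftIso φ j.symm ≪≫ i ≪≫ whiskerLeftIso ψ j⟩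

/-- At the first vertex the rectangles give back `X`, at the last its flip, and at the other two a
zero diagram. -/
theorem arProp_arRect (hS : IsStableDerivator D) (X : (arDer D n).obj (op C)) :
    (arProp D n).prop (op (Cat.of (Sq.{u} × C)))
      (((arRect D n (𝟭 (mesh.{u} n))).app (op C)).toFunctor.obj X) := by
  refine (arProp_iff hS (C := Cat.of (Sq.{u} × C)) _).2 ?_
  rintro ⟨s, c⟩
  have h := (arProp_iff hS _).1 X.2 c
  refine IsAR.of_iso ?_ (arRectAtIso (𝟭 (mesh.{u} n)) s c X.obj).symm
  by_cases h0 : s = ⟨(0, 0)⟩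
  · subst h0
    have i : rectFunAt (𝟭 (mesh.{u} n)) (ULift.up (0, 0)) ≅ 𝟭 _ := isoOfThin fun x => rectVal_first x
    exact h.of_iso ((resIso i).app _ ≪≫ (resId D _).app _).symm
  by_cases h1 : s = ⟨(1, 1)⟩
  · subst h1
    have i : rectFunAt (𝟭 (mesh.{u} n)) (ULift.up (1, 1)) ≅ flipFun n :=
      isoOfThin fun x => rectVal_last x
    exact (h.res_flip hS).of_iso ((resIso i).symm.app _)
  · exact isAR_of_isZero hS ((hS.isZero_iff hS.pointed).2 fun x =>
      (h.isZero _ (rectVal_boundary x h0 h1)).of_iso (resAtObjIso (rectFunAt (𝟭 (mesh.{u} n)) s) x _))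

/-- Here the suspension is formed inside the sub-prederivator. The family of all rectangles is
lifted there, so that the uniqueness of its Kan extensions can be applied. -/
theorem nonempty_suspension_comp_arRestr_iso (hS : IsStableDerivator D)
    {Sg : arDer D n ⟶ arDer D n} (h : IsSuspension (arDer D n) Sg) (e : Q ⥤ mesh.{u} n) :
    Nonempty (Sg ≫ arRestr D n e ≅ arRestr D n (e ⋙ flipFun n)) := by
  let T := liftShift (arProp D n) Sq.{u} (arRect D n (𝟭 (mesh.{u} n)))
    fun A X => arProp_arRect hS (C := A.unop) X
  have hT (s : Sq.{u}) := nonempty_liftShift_ev_iso (arProp D n) Sq.{u} (arRect D n (𝟭 (mesh.{u} n)))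
    (fun A X => arProp_arRect hS (C := A.unop) X) s
  obtain ⟨i⟩ := h.nonempty_iso T
    (fun a X Z => bijective_of_hom _ (ψ := fun g => (res D (cornerFun (mesh n) a.unop)).map g)
      (fun _ => rfl) (CornerZero.isRan hS (C := a.unop) (arRect_cornerZero hS _ X) Z.obj))
    (fun a X Z => bijective_of_hom _
      (ψ := fun g => (res D (prodParam₂ (mesh n) iUl.{u} a.unop)).map g)
      (fun _ => rfl) (arRect_isLan hS _ X Z.obj))
  obtain ⟨j₀⟩ := nonempty_arRect_ev_iso (D := D) (𝟭 (mesh.{u} n)) (ULift.up (0, 0))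
  obtain ⟨j₁⟩ := nonempty_arRect_ev_iso (D := D) (𝟭 (mesh.{u} n)) (ULift.up (1, 1))
  obtain ⟨k₀⟩ := nonempty_arRestr_iso (D := D) (e' := 𝟭 (mesh.{u} n))
    (e := rectFunAt (𝟭 (mesh.{u} n)) (ULift.up (0, 0))) fun x => rectVal_first x
  obtain ⟨k₁⟩ := nonempty_arRestr_iso (D := D) (e' := flipFun n)
    (e := rectFunAt (𝟭 (mesh.{u} n)) (ULift.up (1, 1))) fun x => rectVal_last x
  obtain ⟨t₀⟩ := hT (ULift.up (0, 0))
  obtain ⟨t₁⟩ := hT (ULift.up (1, 1))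
  obtain ⟨l⟩ := nonempty_arRestr_id_iso D n
  -- The first vertices of all rectangles make up the identity, so the recognition principle
  -- describes the suspension on all of `D^{M_n,ex}`.
  obtain ⟨m⟩ := nonempty_iso_of_comp_ι (arProp D n) (φ := T ≫ ev (arDer D n) (ULift.up (0, 0)))
    (ψ := 𝟙 _) ⟨t₀ ≪≫ j₀ ≪≫ k₀ ≪≫ (λ_ _).symm ≪≫ whiskerLeftIso (𝟙 (arDer D n)) l⟩
  have o : Sg ≫ (arProp D n).ι ≅ arRestr D n (flipFun n) :=
    whiskerRightIso ((λ_ Sg).symm ≪≫ whiskerRightIso m.symm Sg ≪≫ i) _ ≪≫ t₁ ≪≫ j₁ ≪≫ k₁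
  obtain ⟨q⟩ := nonempty_restr_comp_iso D e (flipFun n)
  exact ⟨(α_ _ _ _).symm ≪≫ whiskerRightIso o _ ≪≫ α_ _ _ _ ≪≫ whiskerLeftIso _ q⟩

theorem nonempty_arTranslation_comp_arRestr_iso (e : Q ⥤ mesh.{u} n) :
    Nonempty (arTranslation D n ≫ arRestr D n e ≅ arRestr D n (e ⋙ meshShift n)) := by
  have o : arTranslation D n ≫ (arProp D n).ι ≅ arRestr D n (meshShift n) :=
    mkModIso (fun a => Iso.refl _) fun {a b} f X => by
      refine (Category.id_comp _).trans (Eq.trans ?_ (congrArg (_ ≫ ·)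
        (CategoryTheory.Functor.map_id _ _)).symm)
      refine Eq.trans ?_ (Category.comp_id _).symm
      refine Eq.trans ?_ (natAt_comp_trans (arTranslation D n) (arProp D n).ι f X).symm
      refine Eq.trans ?_ (Category.comp_id _).symm
      refine (natAt_comp_trans (arProp D n).ι (restr D (meshShift n)) f X).trans ?_
      refine (congrArg (· ≫ _) (CategoryTheory.Functor.map_id _ _)).trans (Category.id_comp _)
  obtain ⟨q⟩ := nonempty_restr_comp_iso D e (meshShift n)
  exact ⟨(α_ _ _ _).symm ≪≫ whiskerRightIso o _ ≪≫ α_ _ _ _ ≪≫ whiskerLeftIso _ q⟩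

/-- The hypothesis has to cover every `e`, as each application of `S` replaces `e` by its composite
with `f`. -/
theorem nonempty_iter_comp_arRestr_iso {S : arDer D n ⟶ arDer D n} {f : Mesh.{u} n → Mesh.{u} n}
    (hf : Monotone f) (h : ∀ e : Q ⥤ mesh.{u} n, Nonempty (S ≫ arRestr D n e ≅
      arRestr D n (e ⋙ monoFun f hf))) (m : ℕ) (e : Q ⥤ mesh.{u} n) :
    Nonempty (iter S m ≫ arRestr D n e ≅ arRestr D n (e ⋙ monoFun f^[m] (hf.iterate m))) := by
  induction m generalizing e with
  | zero =>
    obtain ⟨i⟩ := nonempty_arRestr_iso (D := D) (e := e)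
      (e' := e ⋙ monoFun f^[0] (hf.iterate 0)) fun _ => rfl
    exact ⟨λ_ _ ≪≫ i⟩
  | succ m ih =>
    obtain ⟨i⟩ := h e
    obtain ⟨j⟩ := ih (e ⋙ monoFun f hf)
    obtain ⟨k⟩ := nonempty_arRestr_iso (D := D) (e := (e ⋙ monoFun f hf) ⋙ monoFun f^[m] (hf.iterate m))
      (e' := e ⋙ monoFun f^[m + 1] (hf.iterate (m + 1))) fun _ => rfl
    exact ⟨α_ _ _ _ ≪≫ whiskerLeftIso _ i ≪≫ j ≪≫ k⟩

theorem shiftVal_iterate (m : ℕ) (x : Mesh.{u} n) :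
    shiftVal^[m] x = ⟨x.k - m, x.l, x.hl⟩ := by
  induction m with
  | zero => exact Mesh.ext (by simp) rfl
  | succ m ih =>
    rw [Function.iterate_succ_apply', ih]
    exact Mesh.ext (by simp [shiftVal]; omega) rfl

/-- The combinatorial form of `Σ² ≅ τ^{-(n+1)}`. -/
theorem flipVal_flipVal (x : Mesh.{u} n) : flipVal (flipVal x) = ⟨x.k + (n + 1), x.l, x.hl⟩ := by
  have := x.hl
  exact Mesh.ext (by simp [flipVal]; omega) (by simp [flipVal]; omega)

/-- The two maps commute, so the power on the right is `n+1` shifts, two flips and `n-1` flips; the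
two flips undo the shifts. The bound on `n` guards the truncated subtraction. -/
theorem flipVal_iterate (hn : 1 ≤ n) (x : Mesh.{u} n) :
    flipVal^[n - 1] x = (shiftVal ∘ flipVal)^[n + 1] x := by
  have hc : Function.Commute (shiftVal (n := n)) flipVal := fun y =>
    Mesh.ext (by simp [shiftVal, flipVal]; omega) rfl
  rw [hc.comp_iterate, Function.comp_apply, show n + 1 = 2 + (n - 1) by omega,
    Function.iterate_add_apply flipVal, shiftVal_iterate]
  change _ = (⟨(flipVal (flipVal _)).k - _, _, _⟩ : Mesh.{u} n)
  refine Mesh.ext ?_ ?_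
  · dsimp only
    have := congrArg Mesh.k (flipVal_flipVal (flipVal^[n - 1] x))
    dsimp only at this
    rw [this]
    omega
  · exact (congrArg Mesh.l (flipVal_flipVal (flipVal^[n - 1] x))).symm

/-- Both sides are restrictions along self-maps of `M_n`, and these agree by `flipVal_iterate`. -/
theorem nonempty_arDer_iso (hS : IsStableDerivator D) (hn : 1 ≤ n)
    {Sg : arDer D n ⟶ arDer D n} (h : IsSuspension (arDer D n) Sg) :
    Nonempty (iter Sg (n - 1) ≅ iter (arTranslation D n ≫ Sg) (n + 1)) := by
  obtain ⟨i⟩ := nonempty_iter_comp_arRestr_iso monotone_flipVal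
    (nonempty_suspension_comp_arRestr_iso hS h) (n - 1) (𝟭 (mesh.{u} n))
  have h2 (e : mesh.{u} n ⥤ mesh.{u} n) : Nonempty ((arTranslation D n ≫ Sg) ≫ arRestr D n e ≅
      arRestr D n (e ⋙ monoFun _ (monotone_shiftVal.comp monotone_flipVal))) := by
    obtain ⟨j⟩ := nonempty_suspension_comp_arRestr_iso hS h e
    obtain ⟨k⟩ := nonempty_arTranslation_comp_arRestr_iso (D := D) (e ⋙ flipFun n)
    obtain ⟨l⟩ := nonempty_arRestr_iso (D := D) (e := (e ⋙ flipFun n) ⋙ meshShift n)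
      (e' := e ⋙ monoFun _ (monotone_shiftVal.comp monotone_flipVal)) fun _ => rfl
    exact ⟨α_ _ _ _ ≪≫ whiskerLeftIso _ j ≪≫ k ≪≫ l⟩
  obtain ⟨j⟩ := nonempty_iter_comp_arRestr_iso _ h2 (n + 1) (𝟭 (mesh.{u} n))
  obtain ⟨k⟩ := nonempty_arRestr_iso (D := D)
    (e := 𝟭 (mesh.{u} n) ⋙ monoFun flipVal^[n - 1] (monotone_flipVal.iterate (n - 1)))
    (e' := 𝟭 (mesh.{u} n) ⋙ monoFun (shiftVal ∘ flipVal)^[n + 1]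
      ((monotone_shiftVal.comp monotone_flipVal).iterate (n + 1))) fun x => flipVal_iterate hn x
  exact nonempty_iso_of_comp_arRestr_id ⟨i ≪≫ k ≪≫ j.symm⟩

end ARIterate

/-! ### Kan extensions computed successively by bicartesian squares -/

section SquareExtension

variable {D : Prederivator.{u, v, w}} {A B : Cat.{u, u}}

theorem IsLan.isIso_of_isIso_map {f : A ⥤ B} {Z Z' : val D B} (h : IsLan f Z) (h' : IsLan f Z')
    (g : Z ⟶ Z') [IsIso ((res D f).map g)] : IsIso g := by
  obtain ⟨k, hk⟩ := (h' Z).2 (inv ((res D f).map g))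
  dsimp only at hk
  refine ⟨k, (h Z).1 ?_, (h' Z').1 ?_⟩ <;> simp [hk]

theorem IsRan.isIso_of_isIso_map {f : A ⥤ B} {Z Z' : val D B} (h : IsRan f Z) (h' : IsRan f Z')
    (g : Z ⟶ Z') [IsIso ((res D f).map g)] : IsIso g := by
  obtain ⟨k, hk⟩ := (h Z').2 (inv ((res D f).map g))
  dsimp only at hk
  refine ⟨k, (h Z).1 ?_, (h' Z').1 ?_⟩ <;> simp [hk]

variable {P Q : Type u} [Preorder P] [Preorder Q]

/-- Both squares are left Kan extended from their corners, on which `g` is invertible. -/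
theorem IsDerivator.isIso_atObj_of_isBicart (hD : IsDerivator D) {X Y : val D (Cat.of P)}
    (g : X ⟶ Y) {a b c d : P} (hX : IsBicart X a b c d) (hY : IsBicart Y a b c d)
    (ha : IsIso ((res D (atObj (B := Cat.of P) a)).map g))
    (hb : IsIso ((res D (atObj (B := Cat.of P) b)).map g))
    (hc : IsIso ((res D (atObj (B := Cat.of P) c)).map g)) :
    IsIso ((res D (atObj (B := Cat.of P) d)).map g) := by
  obtain ⟨hab, hac, hbd, hcd, hX⟩ := hX
  obtain ⟨_, _, _, _, hY⟩ := hY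
  have : IsIso ((res D iUl.{u}).map ((res D (sqFun hab hac hbd hcd)).map g)) := by
    refine hD.der2 _ _ ?_
    rintro ⟨⟨x1, x2⟩, hx⟩
    refine (isIso_map_atObj_comp_iff _ _ _).2 ((isIso_map_atObj_comp_iff _ _ _).2 ?_)
    fin_cases x1 <;> fin_cases x2
    · exact ha
    · exact hc
    · exact hb
    · exact absurd rfl hx
  have := hX.isIso_of_isIso_map hY ((res D (sqFun hab hac hbd hcd)).map g)
  exact (isIso_map_atObj_comp_iff (sqFun hab hac hbd hcd) (ULift.up (1, 1)) g).1 inferInstance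

theorem IsStableDerivator.isIso_atObj_of_isBicart (hS : IsStableDerivator D)
    {X Y : val D (Cat.of P)} (g : X ⟶ Y) {a b c d : P} (hX : IsBicart X a b c d)
    (hY : IsBicart Y a b c d) (hb : IsIso ((res D (atObj (B := Cat.of P) b)).map g))
    (hc : IsIso ((res D (atObj (B := Cat.of P) c)).map g))
    (hd : IsIso ((res D (atObj (B := Cat.of P) d)).map g)) :
    IsIso ((res D (atObj (B := Cat.of P) a)).map g) := by
  obtain ⟨hab, hac, hbd, hcd, hX⟩ := hX
  obtain ⟨_, _, _, _, hY⟩ := hY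
  have : IsIso ((res D iLr.{u}).map ((res D (sqFun hab hac hbd hcd)).map g)) := by
    refine hS.der2 _ _ ?_
    rintro ⟨⟨x1, x2⟩, hx⟩
    refine (isIso_map_atObj_comp_iff _ _ _).2 ((isIso_map_atObj_comp_iff _ _ _).2 ?_)
    fin_cases x1 <;> fin_cases x2
    · exact absurd rfl hx
    · exact hc
    · exact hb
    · exact hd
  have := ((hS.isLan_iUl_iff_isRan_iLr _).1 hX).isIso_of_isIso_map
    ((hS.isLan_iUl_iff_isRan_iLr _).1 hY) ((res D (sqFun hab hac hbd hcd)).map g)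
  exact (isIso_map_atObj_comp_iff (sqFun hab hac hbd hcd) (ULift.up (0, 0)) g).1 inferInstance

/-- A diagram is a left Kan extension if its new values are successively computed by
bicartesian squares. -/
theorem IsDerivator.isLan_of_forall_isBicart (hD : IsDerivator D) {f : P → Q} (hf : Monotone f)
    (hf' : ∀ x y, f x ≤ f y → x ≤ y) (μ : Q → ℕ) {X : val D (Cat.of Q)}
    (h : ∀ d, (∃ x, f x = d) ∨ ∃ a b c, μ a < μ d ∧ μ b < μ d ∧ μ c < μ d ∧
      (∀ y, y ≤ d → y ≠ d → y ≤ b ∨ y ≤ c) ∧ (∀ y, y ≤ b → y ≤ c → y ≤ a) ∧ IsBicart X a b c d) :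
    IsLan (monoFun f hf) X := by
  have := full_monoFun hf hf'
  have := faithful_monoFun hf
  obtain ⟨W, hW, ⟨i⟩⟩ := hD.exists_isLan (monoFun f hf) ((res D (monoFun f hf)).obj X)
  obtain ⟨g, hg⟩ := (hW X).2 i.hom
  dsimp only at hg
  suffices IsIso g from hW.of_iso (asIso g)
  have hr (x : P) : IsIso ((res D (atObj (B := Cat.of Q) (f x))).map g) :=
    (isIso_map_atObj_comp_iff (monoFun f hf) x g).1 (by rw [hg]; infer_instance)
  refine hD.der2 _ _ fun d => ?_
  -- The square at a new vertex is bicartesian in `W` by the Kan extension property and in `X` by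
  -- assumption. Its other vertices have smaller `μ`, so invertibility of `g` propagates from the
  -- image of `f`.
  induction hm : μ d using Nat.strong_induction_on generalizing d with
  | _ m ih =>
    subst hm
    by_cases hd : ∃ x, f x = d
    · obtain ⟨x, rfl⟩ := hd
      exact hr x
    · obtain ⟨a, b, c, ha, hb, hc, h1, h2, h3⟩ := (h d).resolve_left hd
      have h4 : IsBicart W a b c d := by
        obtain ⟨hab, hac, hbd, hcd, -⟩ := h3
        exact hD.isBicart_of_isLan_of_ne hf hf' (fun x hx => hd ⟨x, hx⟩) hab hac hbd hcd
          (fun h => by simp [h] at ha) (fun h => by simp [h] at hb) (fun h => by simp [h] at hc)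
          h1 h2 hW
      exact hD.isIso_atObj_of_isBicart g h4 h3 (ih _ ha a rfl) (ih _ hb b rfl) (ih _ hc c rfl)

/-- A diagram is a right Kan extension if its new values are successively computed by
bicartesian squares. -/
theorem IsStableDerivator.isRan_of_forall_isBicart (hS : IsStableDerivator D) {f : P → Q}
    (hf : Monotone f) (hf' : ∀ x y, f x ≤ f y → x ≤ y) (μ : Q → ℕ) {X : val D (Cat.of Q)}
    (h : ∀ a, (∃ x, f x = a) ∨ ∃ b c d, μ b < μ a ∧ μ c < μ a ∧ μ d < μ a ∧
      (∀ y, a ≤ y → y ≠ a → b ≤ y ∨ c ≤ y) ∧ (∀ y, b ≤ y → c ≤ y → d ≤ y) ∧ IsBicart X a b c d) :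
    IsRan (monoFun f hf) X := by
  have := full_monoFun hf hf'
  have := faithful_monoFun hf
  obtain ⟨W, hW, ⟨i⟩⟩ := hS.exists_isRan (monoFun f hf) ((res D (monoFun f hf)).obj X)
  obtain ⟨g, hg⟩ := (hW X).2 i.inv
  dsimp only at hg
  suffices IsIso g from hW.of_iso (asIso g).symm
  have hr (x : P) : IsIso ((res D (atObj (B := Cat.of Q) (f x))).map g) :=
    (isIso_map_atObj_comp_iff (monoFun f hf) x g).1 (by rw [hg]; infer_instance)
  refine hS.der2 _ _ fun a => ?_
  induction hm : μ a using Nat.strong_induction_on generalizing a with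
  | _ m ih =>
    subst hm
    by_cases ha : ∃ x, f x = a
    · obtain ⟨x, rfl⟩ := ha
      exact hr x
    · obtain ⟨b, c, d, hb, hc, hd, h1, h2, h3⟩ := (h a).resolve_left ha
      have h4 : IsBicart W a b c d := by
        obtain ⟨hab, hac, hbd, hcd, -⟩ := h3
        exact hS.isBicart_of_isRan_of_ne hf hf' (fun x hx => ha ⟨x, hx⟩) hab hac hbd hcd
          (fun h => by simp [h] at hb) (fun h => by simp [h] at hc) (fun h => by simp [h] at hd)
          h1 h2 hW
      exact hS.isIso_atObj_of_isBicart g h3 h4 (ih _ hb b rfl) (ih _ hc c rfl) (ih _ hd d rfl)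

end SquareExtension

/-! ### Chains of four Kan extensions -/

section Chain

variable {D : Prederivator.{u, v, w}} {A₀ A₁ A₂ A₃ A₄ : Cat.{u, u}}

/-- Diagrams obtained by a left, two right, and a left Kan extension. -/
structure IsChainExt (f₁ : A₀ ⥤ A₁) (f₂ : A₁ ⥤ A₂) (f₃ : A₂ ⥤ A₃) (f₄ : A₃ ⥤ A₄) (Z : val D A₄) :
    Prop where
  first : IsLan f₁ ((res D f₂).obj ((res D f₃).obj ((res D f₄).obj Z)))
  second : IsRan f₂ ((res D f₃).obj ((res D f₄).obj Z))
  third : IsRan f₃ ((res D f₄).obj Z)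
  fourth : IsLan f₄ Z

/-- The composite of four functors. -/
abbrev chainFun (f₁ : A₀ ⥤ A₁) (f₂ : A₁ ⥤ A₂) (f₃ : A₂ ⥤ A₃) (f₄ : A₃ ⥤ A₄) : A₀ ⥤ A₄ :=
  f₁ ⋙ f₂ ⋙ f₃ ⋙ f₄

/-- Restriction along a composite of four functors. -/
def resChainIso (D : Prederivator.{u, v, w}) (f₁ : A₀ ⥤ A₁) (f₂ : A₁ ⥤ A₂) (f₃ : A₂ ⥤ A₃)
    (f₄ : A₃ ⥤ A₄) : res D (chainFun f₁ f₂ f₃ f₄) ≅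
      ((res D f₄ ⋙ res D f₃) ⋙ res D f₂) ⋙ res D f₁ :=
  resComp D f₁ (f₂ ⋙ f₃ ⋙ f₄) ≪≫ Functor.isoWhiskerRight (resComp D f₂ (f₃ ⋙ f₄) ≪≫
    Functor.isoWhiskerRight (resComp D f₃ f₄) _) _

theorem bijective_map_of_iso {𝒜 ℬ : Type*} [Category 𝒜] [Category ℬ] {F G : 𝒜 ⥤ ℬ} (i : F ≅ G)
    {X Y : 𝒜} (h : Function.Bijective fun g : X ⟶ Y => G.map g) :
    Function.Bijective fun g : X ⟶ Y => F.map g := by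
  have e : (fun g : X ⟶ Y => F.map g) =
      fun g => i.hom.app X ≫ G.map g ≫ i.inv.app Y := by
    ext g
    simp
  rw [e]
  exact (((i.app X).homCongr (i.app Y)).symm.bijective.comp h :)

/-- At each stage one of the two objects does the work: the source is colocal in the left Kan
extensions, the target is local in the right ones. -/
theorem IsChainExt.bijective {f₁ : A₀ ⥤ A₁} {f₂ : A₁ ⥤ A₂} {f₃ : A₂ ⥤ A₃} {f₄ : A₃ ⥤ A₄}
    {X Y : val D A₄} (hX : IsChainExt f₁ f₂ f₃ f₄ X) (hY : IsChainExt f₁ f₂ f₃ f₄ Y) :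
    Function.Bijective fun g : X ⟶ Y => (res D (chainFun f₁ f₂ f₃ f₄)).map g :=
  bijective_map_of_iso (resChainIso D f₁ f₂ f₃ f₄)
    ((hX.first _).comp ((hY.second _).comp ((hY.third _).comp (hX.fourth _))))

theorem IsDerivator.exists_isChainExt (hD : IsDerivator D) (f₁ : A₀ ⥤ A₁) (f₂ : A₁ ⥤ A₂)
    (f₃ : A₂ ⥤ A₃) (f₄ : A₃ ⥤ A₄) [f₁.Full] [f₁.Faithful] [f₂.Full] [f₂.Faithful] [f₃.Full]
    [f₃.Faithful] [f₄.Full] [f₄.Faithful] (W : val D A₀) :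
    ∃ Z, IsChainExt f₁ f₂ f₃ f₄ Z ∧ Nonempty ((res D (chainFun f₁ f₂ f₃ f₄)).obj Z ≅ W) := by
  obtain ⟨X₁, h₁, ⟨i₁⟩⟩ := hD.exists_isLan f₁ W
  obtain ⟨X₂, h₂, ⟨i₂⟩⟩ := hD.exists_isRan f₂ X₁
  obtain ⟨X₃, h₃, ⟨i₃⟩⟩ := hD.exists_isRan f₃ X₂
  obtain ⟨X₄, h₄, ⟨i₄⟩⟩ := hD.exists_isLan f₄ X₃
  let j₃ : (res D f₃).obj ((res D f₄).obj X₄) ≅ X₂ := (res D f₃).mapIso i₄ ≪≫ i₃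
  let j₂ : (res D f₂).obj ((res D f₃).obj ((res D f₄).obj X₄)) ≅ X₁ := (res D f₂).mapIso j₃ ≪≫ i₂
  exact ⟨X₄, ⟨h₁.of_iso j₂.symm, h₂.of_iso j₃.symm, h₃.of_iso i₄.symm, h₄⟩,
    ⟨(resChainIso D f₁ f₂ f₃ f₄).app _ ≪≫ (res D f₁).mapIso j₂ ≪≫ i₁⟩⟩

theorem IsDerivator.isChainExt_prodParam_iff (hD : IsDerivator D) {f₁ : A₀ ⥤ A₁} {f₂ : A₁ ⥤ A₂}
    {f₃ : A₂ ⥤ A₃} {f₄ : A₃ ⥤ A₄} [f₁.Full] [f₁.Faithful] [f₂.Full] [f₂.Faithful] [f₃.Full]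
    [f₃.Faithful] [f₄.Full] [f₄.Faithful] {C : Cat.{u, u}} {Z : val D (Cat.of (A₄ × C))} :
    IsChainExt (prodParam f₁ C) (prodParam f₂ C) (prodParam f₃ C) (prodParam f₄ C) Z ↔
      ∀ c : C, IsChainExt f₁ f₂ f₃ f₄ ((res D (inclParam A₄ c)).obj Z) := by
  have j₃ (c : C) := resProdParamIso f₄ c Z
  have j₂ (c : C) := resProdParamIso f₃ c ((res D (prodParam f₄ C)).obj Z) ≪≫
    (res D f₃).mapIso (j₃ c)
  have j₁ (c : C) := resProdParamIso f₂ c ((res D (prodParam f₃ C)).obj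
    ((res D (prodParam f₄ C)).obj Z)) ≪≫ (res D f₂).mapIso (j₂ c)
  constructor
  · intro h c
    exact ⟨((hD.isLan_prodParam_iff f₁ _).1 h.first c).of_iso (j₁ c),
      ((hD.isRan_prodParam_iff f₂ _).1 h.second c).of_iso (j₂ c),
      ((hD.isRan_prodParam_iff f₃ _).1 h.third c).of_iso (j₃ c),
      (hD.isLan_prodParam_iff f₄ _).1 h.fourth c⟩
  · intro h
    exact ⟨(hD.isLan_prodParam_iff f₁ _).2 fun c => (h c).first.of_iso (j₁ c).symm,
      (hD.isRan_prodParam_iff f₂ _).2 fun c => (h c).second.of_iso (j₂ c).symm,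
      (hD.isRan_prodParam_iff f₃ _).2 fun c => (h c).third.of_iso (j₃ c).symm,
      (hD.isLan_prodParam_iff f₄ _).2 fun c => (h c).fourth⟩

end Chain

/-! ### Auslander-Reiten quivers are determined by a slice -/

section SliceExtension

/-- The values of `h` are the first coordinates of a slice `(h l, l)`, `0 ≤ l ≤ n + 1`, of the mesh
category, where the arrow between the levels `0` and `1` points upwards and the arrow between the
levels `n` and `n + 1` points downwards. -/
structure IsSlice (n : ℕ) (h : ℕ → ℤ) : Prop where
  step (l : ℕ) (hl : l ≤ n) : h (l + 1) = h l ∨ h (l + 1) = h l - 1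
  first : h 1 = h 0
  last : h (n + 1) = h n - 1

variable {n : ℕ} {h : ℕ → ℤ}

/-- Each upward step lowers `h` by zero or one. The two resulting bounds are all that later
comparisons with the slice use about distant levels. -/
theorem IsSlice.le (hh : IsSlice n h) {l m : ℕ} (hlm : l ≤ m) (hm : m ≤ n + 1) :
    h m ≤ h l ∧ h l + l ≤ h m + m := by
  induction m, hlm using Nat.le_induction with
  | base => exact ⟨le_rfl, le_rfl⟩
  | succ m _ ih =>
    have h1 := hh.step m (by omega)
    have h2 := ih (by omega)
    push_cast
    omega

/-- The vertices of a slice and the boundary vertices on its left. -/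
abbrev SliceBoundary (n : ℕ) (h : ℕ → ℤ) : Type u :=
  {x : Mesh.{u} n // (x.k = h x.l ∧ 1 ≤ x.l ∧ x.l ≤ n) ∨ ((x.l = 0 ∨ x.l = n + 1) ∧ x.k ≤ h x.l)}

/-- The vertices on the left of a slice. -/
abbrev SliceLeft (n : ℕ) (h : ℕ → ℤ) : Type u := {x : Mesh.{u} n // x.k ≤ h x.l}

/-- The vertices on the left of a slice and all boundary vertices. -/
abbrev SliceLeftBoundary (n : ℕ) (h : ℕ → ℤ) : Type u :=
  {x : Mesh.{u} n // x.k ≤ h x.l ∨ x.l = 0 ∨ x.l = n + 1}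

/-- A full embedding of a preorder onto the vertices `(h l, l)`, `1 ≤ l ≤ n`. -/
structure IsSliceMap (h : ℕ → ℤ) {P : Type u} [Preorder P] (e : P → Mesh.{u} n) : Prop where
  mono : Monotone e
  reflects : ∀ x y, e x ≤ e y → x ≤ y
  k_eq : ∀ x, (e x).k = h (e x).l
  one_le : ∀ x, 1 ≤ (e x).l
  le : ∀ x, (e x).l ≤ n
  surj : ∀ l, 1 ≤ l → l ≤ n → ∃ x, (e x).l = l

variable {P : Type u} [Preorder P] {e : P → Mesh.{u} n}

/-- The inclusion of the slice into `SliceBoundary`. -/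
def sliceMap (he : IsSliceMap h e) (x : P) : SliceBoundary.{u} n h :=
  ⟨e x, Or.inl ⟨he.k_eq x, he.one_le x, he.le x⟩⟩

theorem monotone_sliceMap (he : IsSliceMap h e) : Monotone (sliceMap he) := he.mono

/-- The inclusion of `SliceBoundary` into `SliceLeft`. -/
def sliceBoundaryMap (x : SliceBoundary.{u} n h) : SliceLeft.{u} n h :=
  ⟨x.1, x.2.elim (fun hx => hx.1.le) fun hx => hx.2⟩

theorem monotone_sliceBoundaryMap : Monotone (sliceBoundaryMap.{u} (n := n) (h := h)) :=
  fun _ _ h => h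

/-- The inclusion of `SliceLeft` into `SliceLeftBoundary`. -/
def sliceLeftMap (x : SliceLeft.{u} n h) : SliceLeftBoundary.{u} n h := ⟨x.1, Or.inl x.2⟩

theorem monotone_sliceLeftMap : Monotone (sliceLeftMap.{u} (n := n) (h := h)) := fun _ _ h => h

/-- The diagrams on the mesh category which are obtained from a slice by extending by zero and by
bicartesian squares, first to the left and then to the right. -/
abbrev IsSliceExt {D : Prederivator.{u, v, w}} (he : IsSliceMap h e) (Z : val D (mesh.{u} n)) :
    Prop :=
  IsChainExt (monoFun (sliceMap he) (monotone_sliceMap he))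
    (monoFun sliceBoundaryMap.{u} (monotone_sliceBoundaryMap (n := n) (h := h)))
    (monoFun sliceLeftMap.{u} (monotone_sliceLeftMap (n := n) (h := h)))
    (monoFun (Subtype.val : SliceLeftBoundary.{u} n h → Mesh.{u} n) (monotone_val _)) Z

variable {D : Prederivator.{u, v, w}}

/-- The values on `SliceLeftBoundary` of a diagram on the mesh category. -/
def sliceLeftBoundaryAtIso (Z : val D (mesh.{u} n)) (x : SliceLeftBoundary.{u} n h) :
    (res D (atObj (B := Cat.of (SliceLeftBoundary.{u} n h)) x)).obj
      ((res D (monoFun (Subtype.val : SliceLeftBoundary.{u} n h → Mesh.{u} n)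
        (monotone_val _))).obj Z) ≅ (res D (atObj (B := mesh.{u} n) x.1)).obj Z :=
  resAtObjIso (monoFun (Subtype.val : SliceLeftBoundary.{u} n h → Mesh.{u} n) (monotone_val _)) x Z

/-- The values on `SliceBoundary` of a diagram on the mesh category. -/
def sliceBoundaryAtIso (Z : val D (mesh.{u} n)) (x : SliceBoundary.{u} n h) :
    (res D (atObj (B := Cat.of (SliceBoundary.{u} n h)) x)).obj
      ((res D (monoFun sliceBoundaryMap.{u} (monotone_sliceBoundaryMap (n := n) (h := h)))).obj
      ((res D (monoFun sliceLeftMap.{u} (monotone_sliceLeftMap (n := n) (h := h)))).obj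
      ((res D (monoFun (Subtype.val : SliceLeftBoundary.{u} n h → Mesh.{u} n)
        (monotone_val _))).obj Z))) ≅ (res D (atObj (B := mesh.{u} n) x.1)).obj Z :=
  resAtObjIso (monoFun sliceBoundaryMap.{u} (monotone_sliceBoundaryMap (n := n) (h := h))) x _ ≪≫
    resAtObjIso (monoFun sliceLeftMap.{u} (monotone_sliceLeftMap (n := n) (h := h)))
      (sliceBoundaryMap x) _ ≪≫ sliceLeftBoundaryAtIso Z (sliceLeftMap (sliceBoundaryMap x))

/-- The normalizations `first` and `last` place the boundary vertices counted as left so that no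
slice vertex lies below them. Left Kan extension from the slice hence puts zeros there. -/
theorem IsSlice.slice_le_boundary (hh : IsSlice n h) {x y : Mesh.{u} n} (hx : x.k = h x.l)
    (hx1 : 1 ≤ x.l) (hx2 : x.l ≤ n) (hy : y.l = 0 ∨ y.l = n + 1) (hy' : y.k ≤ h y.l) : ¬ x ≤ y := by
  rintro ⟨h1, h2⟩
  have h3 := hh.le hx1 (by omega)
  have h4 := hh.le hx2 (by omega)
  have h5 := hh.first
  have h6 := hh.last
  rcases hy with hy | hy <;> rw [hy] at hy' h2 <;> push_cast at * <;> omega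

theorem IsSlice.boundary_le_left (hh : IsSlice n h) {x y : Mesh.{u} n}
    (hx : x.l = 0 ∨ x.l = n + 1) (hx' : h x.l < x.k) (hy : y.k ≤ h y.l) : ¬ x ≤ y := by
  rintro ⟨h1, h2⟩
  have h3 := hh.le (Nat.zero_le y.l) y.hl
  have h4 := hh.le y.hl le_rfl
  rcases hx with hx | hx <;> rw [hx] at hx' h2 <;> push_cast at * <;> omega

/-- The mesh square ending at `(k+1, l)` computes its first vertex on the left of the slice, and the
one starting at `(k-1, l)` its last vertex on the right. The vanishing conditions account for the
two extensions by zero. -/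
theorem IsAR.isSliceExt (hS : IsStableDerivator D) (hh : IsSlice n h) (he : IsSliceMap h e)
    {Z : val D (mesh.{u} n)} (hZ : IsAR Z) : IsSliceExt he Z where
  first := by
    refine hS.isLan_of_zero hS.pointed (monotone_sliceMap he) he.reflects fun d => ?_
    obtain ⟨d, hd | ⟨hd, hd'⟩⟩ := d
    · obtain ⟨x, hx⟩ := he.surj d.l hd.2.1 hd.2.2
      exact Or.inl ⟨x, Subtype.ext (Mesh.ext ((he.k_eq x).trans (by rw [hx, hd.1])) hx)⟩
    · refine Or.inr ⟨fun x => hh.slice_le_boundary (he.k_eq x) (he.one_le x) (he.le x) hd hd', ?_⟩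
      exact (hZ.isZero d hd).of_iso (sliceBoundaryAtIso Z _)
  second := by
    -- Each mesh arrow raises `2k + l` by one, so this measure falls towards the slice. On the left
    -- `k ≤ h l ≤ h 0`, and the constant keeps the difference nonnegative.
    refine hS.isRan_of_forall_isBicart (f := sliceBoundaryMap) monotone_sliceBoundaryMap (fun _ _ h => h)
      (fun x => (2 * h 0 + n + 1 - 2 * x.1.k - x.1.l).toNat) fun a => ?_
    obtain ⟨a, ha⟩ := a
    by_cases ha' : a.k = h a.l ∨ a.l = 0 ∨ a.l = n + 1
    · refine Or.inl ⟨⟨a, ?_⟩, rfl⟩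
      have := a.hl
      omega
    · right
      have h1 := a.hl
      have h2 := hh.step a.l (by omega)
      have h3 := hh.step (a.l - 1) (by omega)
      have h4 := hh.le (Nat.zero_le a.l) a.hl
      rw [show a.l - 1 + 1 = a.l by omega] at h3
      refine ⟨⟨⟨a.k, a.l + 1, by omega⟩, ?_⟩, ⟨⟨a.k + 1, a.l - 1, by omega⟩, ?_⟩,
        ⟨⟨a.k + 1, a.l, by omega⟩, ?_⟩, ?_, ?_, ?_, ?_, ?_, ?_⟩
      · dsimp; omega
      · dsimp; omega
      · dsimp; omega
      · dsimp; omega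
      · dsimp; omega
      · dsimp; omega
      · rintro ⟨y, hy⟩ ⟨h5, h6⟩ h7
        have h8 : ¬ (y.k = a.k ∧ y.l = a.l) := fun h => h7 (Subtype.ext (Mesh.ext h.1 h.2))
        dsimp only at h5 h6
        by_cases h9 : a.k + a.l + 1 ≤ y.k + y.l
        · exact Or.inl ⟨h5, by dsimp only; omega⟩
        · exact Or.inr ⟨by dsimp only; omega, by dsimp only; omega⟩
      · rintro ⟨y, hy⟩ ⟨h5, h6⟩ ⟨h7, h8⟩
        dsimp only at h5 h6 h7 h8
        exact ⟨h7, by dsimp only; omega⟩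
      · refine IsBicart.comap (f := sliceLeftMap) monotone_sliceLeftMap ?_ ?_ ?_ ?_
          (IsBicart.comap (f := Subtype.val) (monotone_val _) ?_ ?_ ?_ ?_
            (hZ.bicart _ _ _ _ rfl rfl rfl rfl (by dsimp [sliceLeftMap]; omega) rfl)) <;>
        constructor <;> dsimp [sliceLeftMap] <;> omega
  third := by
    refine hS.isRan_of_zero hS.pointed (f := sliceLeftMap) monotone_sliceLeftMap (fun _ _ h => h) fun d => ?_
    obtain ⟨d, hd⟩ := d
    by_cases hd' : d.k ≤ h d.l
    · exact Or.inl ⟨⟨d, hd'⟩, rfl⟩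
    · refine Or.inr ⟨fun x => hh.boundary_le_left (hd.resolve_left hd') (not_le.1 hd') x.2, ?_⟩
      exact (hZ.isZero d (hd.resolve_left hd')).of_iso (sliceLeftBoundaryAtIso Z _)
  fourth := by
    -- The same quantity increases away from the slice on the right, where `k > h l ≥ h (n+1)` makes
    -- the difference positive.
    refine hS.isLan_of_forall_isBicart (f := Subtype.val) (monotone_val _) (fun _ _ h => h)
      (fun x => (2 * x.k + x.l - 2 * h (n + 1)).toNat) fun d => ?_
    by_cases hd : d.k ≤ h d.l ∨ d.l = 0 ∨ d.l = n + 1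
    · exact Or.inl ⟨⟨d, hd⟩, rfl⟩
    · right
      have h1 := d.hl
      have h4 := hh.le d.hl le_rfl
      refine ⟨⟨d.k - 1, d.l, d.hl⟩, ⟨d.k - 1, d.l + 1, by omega⟩, ⟨d.k, d.l - 1, by omega⟩,
        ?_, ?_, ?_, ?_, ?_, hZ.bicart _ _ _ _ rfl (by simp) (by simp) rfl
          (by dsimp; omega) rfl⟩
      · dsimp; omega
      · dsimp; omega
      · dsimp; omega
      · rintro y ⟨h5, h6⟩ h7
        have h8 : ¬ (y.k = d.k ∧ y.l = d.l) := fun h => h7 (Mesh.ext h.1 h.2)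
        by_cases h9 : y.k + y.l + 1 ≤ d.k + d.l
        · exact Or.inr ⟨h5, by dsimp only; omega⟩
        · exact Or.inl ⟨by dsimp only; omega, by dsimp only; omega⟩
      · rintro y ⟨h5, h6⟩ ⟨h7, h8⟩
        dsimp only at h5 h6 h7 h8
        exact ⟨h5, by dsimp only; omega⟩

/-- Every mesh square is produced by one of the two extensions by squares: by the right Kan
extension if it lies on the left of the slice, by the left one otherwise. -/
theorem IsSliceExt.isAR (hS : IsStableDerivator D) (hh : IsSlice n h) {he : IsSliceMap h e}
    {Z : val D (mesh.{u} n)} (hZ : IsSliceExt he Z) : IsAR Z := by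
  have hb (x : Mesh.{u} n) (hx : x.l = 0 ∨ x.l = n + 1) :
      Limits.IsZero ((res D (atObj (B := mesh.{u} n) x)).obj Z) := by
    by_cases hx' : x.k ≤ h x.l
    · refine (hS.isZero_of_isLan_of_not_le hS.pointed (monotone_sliceMap he) hZ.first
        (d := ⟨x, Or.inr ⟨hx, hx'⟩⟩) fun y => hh.slice_le_boundary (he.k_eq y) (he.one_le y)
          (he.le y) hx hx').of_iso ?_
      exact (sliceBoundaryAtIso Z ⟨x, Or.inr ⟨hx, hx'⟩⟩).symm
    · refine (hS.isZero_of_isRan_of_not_le hS.pointed monotone_sliceLeftMap hZ.third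
        (d := ⟨x, Or.inr hx⟩) fun y => hh.boundary_le_left hx (not_le.1 hx') y.2).of_iso ?_
      exact (sliceLeftBoundaryAtIso Z ⟨x, Or.inr hx⟩).symm
  refine ⟨fun x hx => hb x (Or.inl hx), fun x hx => hb x (Or.inr hx), ?_⟩
  intro a b c d h1 h2 h3 h4 h5 h6
  have h7 := b.hl
  -- If the last vertex is on the left, so is the whole square, and its first vertex is then not on
  -- the slice. If not, the last vertex is new for the final left Kan extension.
  by_cases hd : d.k ≤ h d.l
  · have h8 := hh.step a.l (by omega)
    have h9 := hh.step c.l (by omega)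
    rw [← h5] at h9
    have hb' : b.k ≤ h b.l := by rw [h4]; rw [h6] at hd; omega
    have hc' : c.k ≤ h c.l := by rw [h6] at hd; omega
    have ha' : a.k < h a.l := by rw [h6] at hd; omega
    refine IsBicart.map (f := Subtype.val) (monotone_val _) (IsBicart.map (f := sliceLeftMap)
      (a := ⟨a, ha'.le⟩) (b := ⟨b, hb'⟩) (c := ⟨c, hc'⟩) (d := ⟨d, hd⟩) monotone_sliceLeftMap
      (hS.isBicart_of_isRan_of_ne monotone_sliceBoundaryMap (fun _ _ h => h) ?_ ?_ ?_ ?_ ?_ ?_ ?_ ?_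
        ?_ ?_ hZ.second))
    · rintro ⟨x, hx⟩ hxa
      have hxa' : x = a := congrArg Subtype.val hxa
      rw [hxa'] at hx
      omega
    · constructor <;> dsimp <;> omega
    · constructor <;> dsimp <;> omega
    · constructor <;> dsimp <;> omega
    · constructor <;> dsimp <;> omega
    · exact fun h => by have := congrArg (fun x => x.1.l) h; dsimp at this; omega
    · exact fun h => by have := congrArg (fun x => x.1.k) h; dsimp at this; omega
    · exact fun h => by have := congrArg (fun x => x.1.k) h; dsimp at this; omega
    · rintro ⟨y, hy⟩ ⟨h10, h11⟩ h12
      have h13 : ¬ (y.k = a.k ∧ y.l = a.l) := fun h => h12 (Subtype.ext (Mesh.ext h.1 h.2))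
      dsimp only at h10 h11
      by_cases h14 : a.k + a.l + 1 ≤ y.k + y.l
      · exact Or.inl ⟨by dsimp only; omega, by dsimp only; omega⟩
      · exact Or.inr ⟨by dsimp only; omega, by dsimp only; omega⟩
    · rintro ⟨y, hy⟩ ⟨h10, h11⟩ ⟨h12, h13⟩
      dsimp only at h10 h11 h12 h13
      exact ⟨by dsimp only; omega, by dsimp only; omega⟩
  · refine hS.isBicart_of_isLan_of_ne (monotone_val _) (fun _ _ h => h) ?_ ?_ ?_ ?_ ?_ ?_ ?_ ?_
        ?_ ?_ hZ.fourth
    · rintro ⟨x, hx⟩ rfl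
      dsimp only at *
      omega
    · constructor <;> omega
    · constructor <;> omega
    · constructor <;> omega
    · constructor <;> omega
    · exact fun h => by have := congrArg Mesh.k h; omega
    · exact fun h => by have := congrArg Mesh.k h; omega
    · exact fun h => by have := congrArg Mesh.l h; omega
    · rintro y ⟨h10, h11⟩ h12
      have h13 : ¬ (y.k = d.k ∧ y.l = d.l) := fun h => h12 (Mesh.ext h.1 h.2)
      by_cases h14 : y.k + y.l + 1 ≤ d.k + d.l
      · exact Or.inr ⟨by omega, by omega⟩
      · exact Or.inl ⟨by omega, by omega⟩
    · rintro y ⟨h10, h11⟩ ⟨h12, h13⟩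
      exact ⟨by omega, by omega⟩


theorem isAR_iff_isSliceExt (hS : IsStableDerivator D) (hh : IsSlice n h) (he : IsSliceMap h e)
    {Z : val D (mesh.{u} n)} : IsAR Z ↔ IsSliceExt he Z :=
  ⟨fun hZ => hZ.isSliceExt hS hh he, fun hZ => IsSliceExt.isAR hS hh hZ⟩

/-- The functor `P ⥤ M_n`, with a parameter, is the composite of the inclusions used in
`IsSliceExt`. -/
def sliceChainIso (he : IsSliceMap h e) (C : Cat.{u, u}) :
    prodParam (monoFun e he.mono) C ≅ chainFun
      (prodParam (monoFun (sliceMap he) (monotone_sliceMap he)) C)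
      (prodParam (monoFun sliceBoundaryMap.{u} (monotone_sliceBoundaryMap (n := n) (h := h))) C)
      (prodParam (monoFun sliceLeftMap.{u} (monotone_sliceLeftMap (n := n) (h := h))) C)
      (prodParam (monoFun (Subtype.val : SliceLeftBoundary.{u} n h → Mesh.{u} n)
        (monotone_val _)) C) :=
  NatIso.ofComponents (fun x => Iso.refl ((e x.1, x.2) : Mesh.{u} n × C)) fun _ =>
    Prod.ext (hom_ext_of_preorder _ _) ((Category.comp_id _).trans (Category.id_comp _).symm)

theorem arProp_iff_isChainExt (hS : IsStableDerivator D) (hh : IsSlice n h) (he : IsSliceMap h e)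
    {C : Cat.{u, u}} (X : val D (Cat.of (mesh.{u} n × C))) : (arProp D n).prop (op C) X ↔
      IsChainExt (prodParam (monoFun (sliceMap he) (monotone_sliceMap he)) C)
        (prodParam (monoFun sliceBoundaryMap.{u} (monotone_sliceBoundaryMap (n := n) (h := h))) C)
        (prodParam (monoFun sliceLeftMap.{u} (monotone_sliceLeftMap (n := n) (h := h))) C)
        (prodParam (monoFun (Subtype.val : SliceLeftBoundary.{u} n h → Mesh.{u} n)
          (monotone_val _)) C) X := by
  have := full_monoFun (monotone_sliceMap he) he.reflects
  have := faithful_monoFun (monotone_sliceMap he)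
  have := full_monoFun (monotone_sliceBoundaryMap.{u} (n := n) (h := h)) fun _ _ h => h
  have := faithful_monoFun (monotone_sliceBoundaryMap.{u} (n := n) (h := h))
  have := full_monoFun (monotone_sliceLeftMap.{u} (n := n) (h := h)) fun _ _ h => h
  have := faithful_monoFun (monotone_sliceLeftMap.{u} (n := n) (h := h))
  have := full_monoFun (f := (Subtype.val : SliceLeftBoundary.{u} n h → Mesh.{u} n))
    (monotone_val _) fun _ _ h => h
  have := faithful_monoFun (f := (Subtype.val : SliceLeftBoundary.{u} n h → Mesh.{u} n))
    (monotone_val _)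
  rw [arProp_iff hS, hS.isChainExt_prodParam_iff]
  exact forall_congr' fun c => isAR_iff_isSliceExt hS hh he

theorem bijective_map_arRestr (hS : IsStableDerivator D) (hh : IsSlice n h) (he : IsSliceMap h e)
    {C : Cat.{u, u}} (X Y : (arDer D n).obj (op C)) : Function.Bijective fun g : X ⟶ Y =>
      ((arRestr D n (monoFun e he.mono)).app (op C)).toFunctor.map g := by
  have h1 := IsChainExt.bijective ((arProp_iff_isChainExt hS hh he X.obj).1 X.2)
    ((arProp_iff_isChainExt hS hh he Y.obj).1 Y.2)
  have h2 := bijective_map_of_iso (resIso (D := D) (sliceChainIso he C)) h1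
  refine h2.comp (f := fun g : X ⟶ Y => g.hom) ⟨fun _ _ h => ObjectProperty.hom_ext _ h, fun g => ?_⟩
  exact ⟨ObjectProperty.homMk g, rfl⟩

theorem exists_arRestr_iso (hS : IsStableDerivator D) (hh : IsSlice n h) (he : IsSliceMap h e)
    {C : Cat.{u, u}} (W : (shift D (Cat.of P)).obj (op C)) : ∃ X : (arDer D n).obj (op C),
      Nonempty (((arRestr D n (monoFun e he.mono)).app (op C)).toFunctor.obj X ≅ W) := by
  have := full_monoFun (monotone_sliceMap he) he.reflects
  have := faithful_monoFun (monotone_sliceMap he)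
  have := full_monoFun (monotone_sliceBoundaryMap.{u} (n := n) (h := h)) fun _ _ h => h
  have := faithful_monoFun (monotone_sliceBoundaryMap.{u} (n := n) (h := h))
  have := full_monoFun (monotone_sliceLeftMap.{u} (n := n) (h := h)) fun _ _ h => h
  have := faithful_monoFun (monotone_sliceLeftMap.{u} (n := n) (h := h))
  have := full_monoFun (f := (Subtype.val : SliceLeftBoundary.{u} n h → Mesh.{u} n))
    (monotone_val _) fun _ _ h => h
  have := faithful_monoFun (f := (Subtype.val : SliceLeftBoundary.{u} n h → Mesh.{u} n))
    (monotone_val _)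
  obtain ⟨Z, hZ, ⟨i⟩⟩ := hS.exists_isChainExt
    (prodParam (monoFun (sliceMap he) (monotone_sliceMap he)) C)
    (prodParam (monoFun sliceBoundaryMap.{u} (monotone_sliceBoundaryMap (n := n) (h := h))) C)
    (prodParam (monoFun sliceLeftMap.{u} (monotone_sliceLeftMap (n := n) (h := h))) C)
    (prodParam (monoFun (Subtype.val : SliceLeftBoundary.{u} n h → Mesh.{u} n)
      (monotone_val _)) C) W
  exact ⟨⟨Z, (arProp_iff_isChainExt hS hh he Z).2 hZ⟩,
    ⟨(resIso (D := D) (sliceChainIso he C)).app Z ≪≫ i⟩⟩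

/-- Coherent Auslander-Reiten quivers are determined by their restrictions to a slice. -/
theorem exists_comp_arRestr_iso (hS : IsStableDerivator D) (hh : IsSlice n h)
    (he : IsSliceMap h e) : ∃ K : shift D (Cat.of P) ⟶ arDer D n,
      Nonempty (K ≫ arRestr D n (monoFun e he.mono) ≅ 𝟙 _) := by
  refine exists_comp_iso_id _ fun a => ?_
  have hf : ((arRestr D n (monoFun e he.mono)).app a).toFunctor.Faithful :=
    ⟨fun {X Y} g g' h => (bijective_map_arRestr hS hh he (C := a.unop) X Y).1 h⟩
  have hF : ((arRestr D n (monoFun e he.mono)).app a).toFunctor.Full :=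
    ⟨fun {X Y} g => (bijective_map_arRestr hS hh he (C := a.unop) X Y).2 g⟩
  have hE : ((arRestr D n (monoFun e he.mono)).app a).toFunctor.EssSurj :=
    ⟨fun W => exists_arRestr_iso hS hh he (C := a.unop) W⟩
  exact {}

end SliceExtension

/-! ### Quivers of type `A_n` as slices -/

section Section

/-- An embedding of a quiver of type `A_n` as a slice of the mesh category. -/
structure IsSection {n : ℕ} {V : Type u} (r : V → V → Prop) (h : ℕ → ℤ) (e : V → Mesh.{u} n) :
    Prop where
  slice : IsSlice n h
  k_eq : ∀ x, (e x).k = h (e x).l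
  one_le : ∀ x, 1 ≤ (e x).l
  le : ∀ x, (e x).l ≤ n
  surj : ∀ l, 1 ≤ l → l ≤ n → ∃ x, (e x).l = l
  inj : ∀ x y, (e x).l = (e y).l → x = y
  arrow : ∀ x y, r x y ↔ Mesh.Arrow (e x) (e y)

variable {n : ℕ} {V : Type u} {r : V → V → Prop} {h : ℕ → ℤ} {e : V → Mesh.{u} n}

/-- If the level rises from `x` to `y`, the inequality forces `h` to be constant in between; if it
falls, `h` has to grow by one at each level. In both cases the slice itself contains the path. -/
theorem IsSection.reflTransGen (he : IsSection r h e) {x y : V} (hxy : e x ≤ e y) :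
    Relation.ReflTransGen r x y := by
  have hx := he.le x
  have hy := he.le y
  have hx' := he.one_le x
  have hy' := he.one_le y
  have hkx := he.k_eq x
  have hky := he.k_eq y
  obtain ⟨h1, h2⟩ := hxy
  rcases le_total (e x).l (e y).l with hl | hl
  · obtain ⟨m, hm⟩ := Nat.exists_eq_add_of_le hl
    induction m generalizing x with
    | zero => rw [he.inj x y (by omega)]
    | succ m ih =>
      obtain ⟨z, hz⟩ := he.surj ((e x).l + 1) (by omega) (by omega)
      have h3 := he.slice.step (e x).l (by omega)
      have h4 := he.slice.le (l := (e x).l + 1) (m := (e y).l) (by omega) (by omega)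
      have h5 := he.k_eq z
      rw [hz] at h5
      refine .head ((he.arrow x z).2 (Or.inl ⟨by omega, hz⟩))
        (ih (he.le z) (he.one_le z) (he.k_eq z) ?_ ?_ ?_ ?_) <;> omega
  · obtain ⟨m, hm⟩ := Nat.exists_eq_add_of_le hl
    induction m generalizing x with
    | zero => rw [he.inj x y (by omega)]
    | succ m ih =>
      obtain ⟨z, hz⟩ := he.surj ((e x).l - 1) (by omega) (by omega)
      have h3 := he.slice.step ((e x).l - 1) (by omega)
      rw [show (e x).l - 1 + 1 = (e x).l by omega] at h3
      have h4 := he.slice.le (l := (e y).l) (m := (e x).l - 1) (by omega) (by omega)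
      have h5 := he.k_eq z
      rw [hz] at h5
      refine .head ((he.arrow x z).2 (Or.inr ⟨by omega, by omega⟩))
        (ih (he.le z) (he.one_le z) (he.k_eq z) ?_ ?_ ?_ ?_) <;> omega

theorem IsSection.isSliceMap (he : IsSection r h e) : IsSliceMap h (P := Reach r) e where
  mono x y hxy := (Mesh.le_iff _ _).2 (Relation.ReflTransGen.lift e
    (fun x y hr => (he.arrow x y).1 hr) x y hxy)
  reflects _ _ hxy := he.reflTransGen hxy
  k_eq := he.k_eq
  one_le := he.one_le
  le := he.le
  surj := he.surj

/-- The functor to the mesh category given by a section. -/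
abbrev IsSection.fun (he : IsSection r h e) : reachCat r ⥤ mesh.{u} n :=
  monoFun (P := Reach r) e he.isSliceMap.mono

variable {D : Prederivator.{u, v, w}}

/-- Restriction to the section intertwines both suspensions and carries `τ` to `Φ`, hence also their
iterates. Precomposing with a section `K` of the restriction transports the relation from
`D^{M_n,ex}`. -/
theorem IsSection.nonempty_iter_iso (hS : IsStableDerivator D) (hn : 1 ≤ n) (he : IsSection r h e)
    {Sg Φ : shift D (reachCat r) ⟶ shift D (reachCat r)}
    (hSg : IsSuspension (shift D (reachCat r)) Sg)
    (hΦ : Nonempty (arRestr D n he.fun ≫ Φ ≅ arRestr D n (he.fun ⋙ meshShift n))) :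
    Nonempty (iter Sg (n - 1) ≅ iter (Φ ≫ Sg) (n + 1)) := by
  obtain ⟨K, ⟨i⟩⟩ := exists_comp_arRestr_iso hS he.slice he.isSliceMap
  obtain ⟨Sg₀, h₀⟩ := exists_isSuspension_arDer hS n
  obtain ⟨j⟩ := nonempty_arDer_iso hS hn h₀
  obtain ⟨a⟩ := nonempty_arRestr_comp_suspension_iso hS he.fun hSg
  obtain ⟨b⟩ := nonempty_suspension_comp_arRestr_iso hS h₀ he.fun
  obtain ⟨t⟩ := nonempty_arTranslation_comp_arRestr_iso (D := D) he.fun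
  obtain ⟨s⟩ := hΦ
  obtain ⟨p⟩ := nonempty_comp_iter_iso (arRestr D n he.fun) Sg Sg₀ ⟨a ≪≫ b.symm⟩ (n - 1)
  obtain ⟨q⟩ := nonempty_comp_iter_iso (arRestr D n he.fun) (Φ ≫ Sg) (arTranslation D n ≫ Sg₀)
    ⟨(α_ _ _ _).symm ≪≫ whiskerRightIso (s ≪≫ t.symm) Sg ≪≫ α_ _ _ _ ≪≫
      whiskerLeftIso _ (a ≪≫ b.symm) ≪≫ (α_ _ _ _).symm⟩ (n + 1)
  exact ⟨(λ_ _).symm ≪≫ whiskerRightIso i.symm _ ≪≫ α_ _ _ _ ≪≫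
    whiskerLeftIso K (p ≪≫ whiskerRightIso j _ ≪≫ q.symm) ≪≫ (α_ _ _ _).symm ≪≫
    whiskerRightIso i _ ≪≫ λ_ _⟩

/-- Every quiver of type `A_n` has a section. -/
theorem exists_isSection (hn : 1 ≤ n) (hr : IsAnQuiver n r) :
    ∃ (h : ℕ → ℤ) (e : V → Mesh.{u} n), IsSection r h e := by
  classical
  obtain ⟨hr, ⟨φ⟩⟩ := hr
  -- The vertex numbered `i` by `φ` sits on level `i + 1`; `up l` says that the arrow between levels
  -- `l` and `l + 1` points upwards.
  let up (l : ℕ) : Prop := ∃ x y, (φ x : ℕ) + 1 = l ∧ (φ y : ℕ) = l ∧ r x y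
  -- The case `l = 0` is included by hand to get `h 1 = h 0`. At the other end `up n` fails because
  -- no vertex has number `n`, which gives `h (n+1) = h n - 1`.
  let h (l : ℕ) : ℤ := Nat.rec 0 (fun l hl => if l = 0 ∨ up l then hl else hl - 1) l
  have hs (l : ℕ) : h (l + 1) = if l = 0 ∨ up l then h l else h l - 1 := rfl
  have hinj (x y : V) (hxy : (φ x : ℕ) = φ y) : x = y := φ.injective (Fin.ext hxy)
  have hadj (x y : V) (hxy : (φ x : ℕ) + 1 = φ y) : r x y ∨ r y x := by
    have h1 : (SimpleGraph.fromRel r).Adj x y := by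
      rw [← φ.map_adj_iff, SimpleGraph.pathGraph_adj]
      exact Or.inl hxy
    exact ((SimpleGraph.fromRel_adj _ _ _).1 h1).2
  have hadj' (x y : V) (hxy : r x y) : (φ x : ℕ) + 1 = φ y ∨ (φ y : ℕ) + 1 = φ x := by
    have h1 : (SimpleGraph.fromRel r).Adj x y :=
      (SimpleGraph.fromRel_adj _ _ _).2 ⟨fun h => by subst h; exact hr _ _ hxy hxy, Or.inl hxy⟩
    rwa [← φ.map_adj_iff, SimpleGraph.pathGraph_adj] at h1
  have hup (x y : V) (hxy : (φ x : ℕ) + 1 = φ y) : up ((φ x : ℕ) + 1) ↔ r x y := by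
    refine ⟨?_, fun h => ⟨x, y, rfl, hxy.symm, h⟩⟩
    rintro ⟨x', y', h1, h2, h3⟩
    rwa [hinj x x' (by omega), hinj y y' (by omega)]
  refine ⟨h, fun x => ⟨h (φ x + 1), φ x + 1, by omega⟩, ?_, fun x => rfl, ?_, ?_, ?_, ?_, ?_⟩
  · refine ⟨fun l _ => ?_, ?_, ?_⟩
    · rw [hs]
      split_ifs <;> simp
    · exact (hs 0).trans (if_pos (Or.inl rfl))
    · rw [hs, if_neg]
      rintro (h1 | ⟨x, y, h1, h2, -⟩) <;> omega
  · intro x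
    dsimp
    omega
  · intro x
    dsimp
    omega
  · intro l hl hl'
    exact ⟨φ.symm ⟨l - 1, by omega⟩, by simp; omega⟩
  · intro x y hxy
    exact hinj x y (by dsimp at hxy; omega)
  · intro x y
    dsimp only [Mesh.Arrow]
    constructor
    · intro hxy
      rcases hadj' x y hxy with h1 | h1
      · refine Or.inl ⟨?_, by omega⟩
        rw [← h1, hs, if_pos (Or.inr ((hup x y h1).2 hxy))]
      · refine Or.inr ⟨?_, by omega⟩
        rw [← h1, hs ((φ y : ℕ) + 1), if_neg]
        · omega
        · rintro (h2 | h2)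
          · omega
          · exact hr _ _ hxy ((hup y x h1).1 h2)
    · rintro (⟨h1, h2⟩ | ⟨h1, h2⟩)
      · have h3 : (φ x : ℕ) + 1 = φ y := by omega
        rw [← h3, hs ((φ x : ℕ) + 1)] at h1
        by_contra h4
        rw [if_neg] at h1
        · omega
        · rintro (h5 | h5)
          · omega
          · exact h4 ((hup x y h3).1 h5)
      · have h3 : (φ y : ℕ) + 1 = φ x := by omega
        refine (hadj y x h3).resolve_left fun h4 => ?_
        rw [← h3, hs ((φ y : ℕ) + 1), if_pos (Or.inr ((hup y x h3).2 h4))] at h1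
        omega

end Section

/-! ### Reflection functors and the reflected slice -/

section Reflection

/-- Kan extension morphisms along fully faithful functors exist. -/
theorem exists_lan_restr {D : Prederivator.{u, v, w}} (hD : IsDerivator D) {A B : Cat.{u, u}}
    (f : A ⥤ B) [f.Full] [f.Faithful] :
    ∃ L : shift D A ⟶ shift D B, Nonempty (Bicategory.Adjunction L (restr D f)) := by
  let P : (shift D B).ObjectProperty := ⟨fun a X => IsLan (D := D) (prodParam f a.unop) X⟩
  have : P.IsClosedUnderMapObj :=
    ⟨fun {_ _ _} hX g => isLan_prodParam_map hD f hX g.unop.toFunctor⟩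
  exact exists_left_adjoint P (restr D f) (fun a X Z hX => hX Z) fun a Y =>
    hD.exists_isLan (prodParam f a.unop) Y

theorem exists_ran_restr {D : Prederivator.{u, v, w}} (hD : IsDerivator D) {A B : Cat.{u, u}}
    (f : A ⥤ B) [f.Full] [f.Faithful] :
    ∃ R : shift D A ⟶ shift D B, Nonempty (Bicategory.Adjunction (restr D f) R) := by
  let P : (shift D B).ObjectProperty := ⟨fun a X => IsRan (D := D) (prodParam f a.unop) X⟩
  have : P.IsClosedUnderMapObj :=
    ⟨fun {_ _ _} hX g => isRan_prodParam_map hD f hX g.unop.toFunctor⟩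
  exact exists_right_adjoint P (restr D f) (fun a X Z hX => hX Z) fun a Y =>
    hD.exists_isRan (prodParam f a.unop) Y

/-- A path cannot leave a set of vertices closed under outgoing arrows. This gives the fullness of
both quiver inclusions, as their new vertices receive no arrows. -/
theorem reflTransGen_of_closed {V W : Type*} {r : V → V → Prop} {s : W → W → Prop} (f : V → W)
    (hf : ∀ x w, s (f x) w → ∃ y, w = f y ∧ r x y) {x : V} {w : W}
    (h : Relation.ReflTransGen s (f x) w) : ∃ y, w = f y ∧ Relation.ReflTransGen r x y := by
  induction h with
  | refl => exact ⟨x, rfl, .refl⟩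
  | tail _ h ih =>
    obtain ⟨y, rfl, hy⟩ := ih
    obtain ⟨z, rfl, hz⟩ := hf _ _ h
    exact ⟨z, rfl, hy.tail hz⟩

variable {V : Type u} {r : V → V → Prop} {a : V}

theorem exists_of_zeroExt_inl {x : V} {w : ZeroExtVertex r a} (h : zeroExt r a (.inl x) w) :
    ∃ y, w = .inl y ∧ r x y := by
  rcases w with y | z
  · exact ⟨y, rfl, h⟩
  · exact h.elim

theorem exists_of_squareExt_some {x : ZeroExtVertex r a} {w : Option (ZeroExtVertex r a)}
    (h : squareExt r a (some x) w) : ∃ y, w = some y ∧ zeroExt r a x y := by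
  rcases w with - | y
  · exact h.elim
  · exact ⟨y, rfl, h⟩

theorem reach_inl {x y : V} (h : Relation.ReflTransGen (zeroExt r a) (.inl x) (.inl y)) :
    Relation.ReflTransGen r x y := by
  obtain ⟨z, hz, h⟩ := reflTransGen_of_closed Sum.inl (fun _ _ h => exists_of_zeroExt_inl h) h
  rwa [Sum.inl.inj hz]

theorem not_reach_inr {x : V} {z} :
    ¬ Relation.ReflTransGen (zeroExt r a) (.inl x) (.inr z) := fun h => by
  obtain ⟨z, hz, -⟩ := reflTransGen_of_closed Sum.inl (fun _ _ h => exists_of_zeroExt_inl h) h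
  cases hz

theorem eq_of_reach_inr {x : ZeroExtVertex r a} {z} :
    Relation.ReflTransGen (zeroExt r a) x (.inr z) → x = .inr z := fun h => by
  rcases x with x | x
  · exact (not_reach_inr h).elim
  · rcases Relation.ReflTransGen.cases_tail h with h | ⟨y, -, h⟩
    · exact h.symm
    · rcases y with y | y <;> exact h.elim

theorem reach_some {x y : ZeroExtVertex r a}
    (h : Relation.ReflTransGen (squareExt r a) (some x) (some y)) :
    Relation.ReflTransGen (zeroExt r a) x y := by
  obtain ⟨z, hz, h⟩ := reflTransGen_of_closed some (fun _ _ h => exists_of_squareExt_some h) h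
  rwa [Option.some.inj hz]

instance : (inclZeroExt r a).Full :=
  full_monoFun (P := Reach r) (Q := Reach (zeroExt r a)) (f := Sum.inl)
    (fun _ _ h => Relation.ReflTransGen.lift Sum.inl (fun _ _ h => h) _ _ h) fun _ _ h => reach_inl h

instance : (inclZeroExt r a).Faithful :=
  faithful_monoFun (P := Reach r) (Q := Reach (zeroExt r a)) (f := Sum.inl)
    (fun _ _ h => Relation.ReflTransGen.lift Sum.inl (fun _ _ h => h) _ _ h)

instance : (inclSquareExt r a).Full :=
  full_monoFun (P := Reach (zeroExt r a)) (Q := Reach (squareExt r a)) (f := some)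
    (fun _ _ h => Relation.ReflTransGen.lift some (fun _ _ h => h) _ _ h) fun _ _ h => reach_some h

instance : (inclSquareExt r a).Faithful :=
  faithful_monoFun (P := Reach (zeroExt r a)) (Q := Reach (squareExt r a)) (f := some)
    (fun _ _ h => Relation.ReflTransGen.lift some (fun _ _ h => h) _ _ h)

theorem exists_isReflection {D : Prederivator.{u, v, w}} (hD : IsDerivator D) (ha : IsSink r a) :
    ∃ s, IsReflection r a D ha s := by
  obtain ⟨L, hL⟩ := exists_lan_restr hD (inclZeroExt r a)
  obtain ⟨R, hR⟩ := exists_ran_restr hD (inclSquareExt r a)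
  exact ⟨_, L, R, hL, hR, ⟨Iso.refl _⟩⟩

variable {n : ℕ} {h : ℕ → ℤ} {e : V → Mesh.{u} n}

/-- The position of the sink `a` after reflection. -/
noncomputable def reflectSection (a : V) (e : V → Mesh.{u} n) (x : V) : Mesh.{u} n :=
  open scoped Classical in if x = a then shiftVal (e a) else e x

/-- The values of the slice after reflection at level `m`. -/
def reflectSlice (n : ℕ) (h : ℕ → ℤ) (m : ℕ) (l : ℕ) : ℤ :=
  -- The boundary levels move along with the levels `1` and `n`, which preserves the normalization
  -- of slices.
  if l = m ∨ (l = 0 ∧ m = 1) ∨ (l = n + 1 ∧ m = n) then h l - 1 else h l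

/-- Otherwise `h` would drop between these levels, which means an arrow from `a` down to its
neighbour. -/
theorem IsSection.below_sink (he : IsSection r h e) (ha : IsSink r a) (hl : 1 < (e a).l) :
    h ((e a).l - 1) = h (e a).l := by
  have h1 := he.le a
  obtain ⟨x, hx⟩ := he.surj ((e a).l - 1) (by omega) (by omega)
  have h2 := mt (he.arrow a x).2 (ha x)
  have h3 := he.slice.step ((e a).l - 1) (by omega)
  have h4 := he.k_eq x
  have h5 := he.k_eq a
  rw [hx] at h4
  rw [show (e a).l - 1 + 1 = (e a).l by omega] at h3
  unfold Mesh.Arrow at h2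
  omega

/-- Otherwise `h` would be constant between these levels, which means an arrow from `a` up to its
neighbour. -/
theorem IsSection.above_sink (he : IsSection r h e) (ha : IsSink r a) (hl : (e a).l < n) :
    h ((e a).l + 1) = h (e a).l - 1 := by
  have h1 := he.le a
  obtain ⟨x, hx⟩ := he.surj ((e a).l + 1) (by omega) (by omega)
  have h2 := mt (he.arrow a x).2 (ha x)
  have h3 := he.slice.step (e a).l (by omega)
  have h4 := he.k_eq x
  have h5 := he.k_eq a
  rw [hx] at h4
  unfold Mesh.Arrow at h2
  omega

theorem IsSection.isSlice_reflect (he : IsSection r h e) (ha : IsSink r a) :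
    IsSlice n (reflectSlice n h (e a).l) := by
  have h1 := he.one_le a
  have h2 := he.le a
  have h3 := he.slice.first
  have h4 := he.slice.last
  have h5 := he.below_sink ha
  have h6 := he.above_sink ha
  have hp (l : ℕ) : _ → reflectSlice n h (e a).l l = h l - 1 := fun hl => if_pos hl
  have hn (l : ℕ) : _ → reflectSlice n h (e a).l l = h l := fun hl => if_neg hl
  refine ⟨fun l hl => ?_, ?_, ?_⟩
  · have h7 := he.slice.step l hl
    have q1 := hp l
    have q2 := hn l
    have q3 := hp (l + 1)
    have q4 := hn (l + 1)
    by_cases h8 : l = (e a).l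
    · subst h8
      by_cases h9 : (e a).l = n
      · rw [h9] at q1 q2 q3 q4 ⊢
        omega
      · have := h6 (by omega)
        omega
    · by_cases h9 : l + 1 = (e a).l
      · by_cases h10 : l = 0
        · subst h10
          rw [zero_add] at *
          omega
        · have h11 := h5 (by omega)
          rw [← h9, Nat.add_sub_cancel] at h11
          omega
      · omega
  · have := hp 0
    have := hn 0
    have := hp 1
    have := hn 1
    omega
  · have := hp n
    have := hn n
    have := hp (n + 1)
    have := hn (n + 1)
    omega

/-- A sink at `(k, l)` has neighbours at `(k-1, l+1)` and `(k, l-1)`, as far as they exist. Both are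
targets of arrows from `(k-1, l)`, so moving the sink there reverses exactly the arrows at it. -/
theorem IsSection.reflect (he : IsSection r h e) (ha : IsSink r a) :
    IsSection (reflectAt r a) (reflectSlice n h (e a).l) (reflectSection a e) := by
  have hl (x : V) : (reflectSection a e x).l = (e x).l := by
    unfold reflectSection
    split_ifs with hx
    · rw [hx]; rfl
    · rfl
  have hk (x : V) (hx : x ≠ a) : reflectSection a e x = e x := if_neg hx
  have hk' : reflectSection a e a = shiftVal (e a) := if_pos rfl
  have h1 := he.one_le
  have h2 := he.le
  refine ⟨he.isSlice_reflect ha, fun x => ?_, fun x => ?_, fun x => ?_, fun l hl' hl'' => ?_,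
    fun x y hxy => ?_, fun x y => ?_⟩
  · rw [hl]
    have h3 := he.k_eq x
    have h4 := h1 x
    have h5 := h2 x
    by_cases hx : x = a
    · subst hx
      rw [hk', reflectSlice, if_pos (Or.inl rfl), ← h3]
      rfl
    · have h6 := mt (he.inj x a) hx
      rw [hk x hx, reflectSlice, if_neg (by omega), h3]
  · rw [hl]
    exact h1 x
  · rw [hl]
    exact h2 x
  · simpa only [hl] using he.surj l hl' hl''
  · rw [hl, hl] at hxy
    exact he.inj x y hxy
  · have h3 := he.k_eq
    have h4 := he.below_sink ha
    have h5 := he.above_sink ha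
    by_cases hx : x = a
    · subst hx
      by_cases hy : y = x
      · subst hy
        have := ha y
        simp [reflectAt, Mesh.Arrow, this]
      · rw [hk y hy, hk']
        have : reflectAt r x x y ↔ r y x := by simp [reflectAt, hy]
        rw [this, he.arrow]
        unfold Mesh.Arrow shiftVal
        dsimp only
        omega
    · by_cases hy : y = a
      · subst hy
        rw [hk x hx, hk']
        have h6 : ¬ reflectAt r y x y := by
          have := ha x
          simp [reflectAt, this]
        refine iff_of_false h6 ?_
        unfold Mesh.Arrow shiftVal
        dsimp only
        have h7 := h1 x
        have h8 := h2 x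
        have h9 := h3 x
        have h10 := h3 y
        rintro (⟨h11, h12⟩ | ⟨h11, h12⟩)
        · have h13 := h4 (by omega)
          rw [show (e y).l - 1 = (e x).l by omega] at h13
          omega
        · have h13 := h5 (by omega)
          rw [← h12] at h13
          omega
      · rw [hk x hx, hk y hy, ← he.arrow]
        simp [reflectAt, hx, hy]

end Reflection

/-! ### Reflections of restrictions of Auslander-Reiten quivers -/

section ReflectSection

variable {n : ℕ} {V : Type u} {r : V → V → Prop} {a : V} {h : ℕ → ℤ} {e : V → Mesh.{u} n}

theorem monotone_reach {W : Type u} {s : W → W → Prop} {Q : Type*} [Preorder Q] {f : W → Q}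
    (hf : ∀ x y, s x y → f x ≤ f y) : Monotone (α := Reach s) f := fun _ _ hxy => by
  induction hxy with
  | refl => exact le_rfl
  | tail _ h ih => exact ih.trans (hf _ _ h)

/-- The extension of a section to the additional vertices, which are placed on the boundary. -/
def zeroSection (a : V) (e : V → Mesh.{u} n) : ZeroExtVertex r a → Mesh.{u} n
  | .inl x => e x
  -- A sink on level `1` lacks its lower neighbour, which becomes the added vertex with index `0`.
  -- Any other added vertex is the upper neighbour of a sink on level `n`.
  | .inr z => if (e a).l = 1 ∧ (z : ℕ) = 0 then ⟨(e a).k, 0, by omega⟩ else ⟨(e a).k - 1, n + 1, le_rfl⟩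

theorem zeroSection_inr_l (z : Fin (2 - Nat.card {x // r x a})) :
    (zeroSection a e (.inr z)).l = if (e a).l = 1 ∧ (z : ℕ) = 0 then 0 else n + 1 := by
  rw [zeroSection]
  split_ifs <;> rfl

/-- The extension of a section to the vertex replacing the sink. -/
def squareSection (a : V) (e : V → Mesh.{u} n) : Option (ZeroExtVertex r a) → Mesh.{u} n
  | none => shiftVal (e a)
  | some x => zeroSection a e x

theorem IsSection.arrow_sink_iff (he : IsSection r h e) (ha : IsSink r a) (x : V) :
    r x a ↔ (e x).l + 1 = (e a).l ∨ (e x).l = (e a).l + 1 := by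
  have h1 := he.k_eq x
  have h2 := he.k_eq a
  have h3 := he.one_le x
  have h4 := he.le x
  rw [he.arrow]
  unfold Mesh.Arrow
  constructor
  · omega
  · rintro (h5 | h5)
    · have h6 := he.below_sink ha (by omega)
      rw [← h5, Nat.add_sub_cancel] at h6
      rw [← h5] at h2
      omega
    · have h6 := he.above_sink ha (by omega)
      rw [h5] at h1
      omega

/-- Both neighbouring levels contribute a predecessor whenever they lie between `1` and `n`. The
count determines how many zero vertices `zeroExt` adds. -/
theorem IsSection.card_arrow_sink (he : IsSection r h e) (ha : IsSink r a) :
    Nat.card {x // r x a} = (if 1 < (e a).l then 1 else 0) + (if (e a).l < n then 1 else 0) := by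
  have h1 := he.le a
  have h2 := he.one_le a
  have h3 := he.arrow_sink_iff ha
  have h4 := he.one_le
  have h5 := he.le
  change Nat.card {x | r x a} = _
  rw [Nat.card_coe_set_eq]
  split_ifs with h6 h7 h7
  · obtain ⟨x, hx⟩ := he.surj ((e a).l - 1) (by omega) (by omega)
    obtain ⟨y, hy⟩ := he.surj ((e a).l + 1) (by omega) (by omega)
    rw [one_add_one_eq_two, ← Set.ncard_pair (a := x) (b := y) fun h => by subst h; omega]
    congr 1
    ext z
    simp only [Set.mem_ofPred_eq, h3, Set.mem_insert_iff, Set.mem_singleton_iff]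
    refine or_congr ⟨fun h => he.inj _ _ (by omega), ?_⟩ ⟨fun h => he.inj _ _ (by omega), ?_⟩ <;>
      rintro rfl <;> omega
  · obtain ⟨x, hx⟩ := he.surj ((e a).l - 1) (by omega) (by omega)
    rw [add_zero, ← Set.ncard_singleton x]
    congr 1
    ext z
    simp only [Set.mem_ofPred_eq, h3, Set.mem_singleton_iff]
    have := h5 z
    refine ⟨fun h => he.inj _ _ (by omega), ?_⟩
    rintro rfl
    omega
  · obtain ⟨x, hx⟩ := he.surj ((e a).l + 1) (by omega) (by omega)
    rw [zero_add, ← Set.ncard_singleton x]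
    congr 1
    ext z
    simp only [Set.mem_ofPred_eq, h3, Set.mem_singleton_iff]
    have := h4 z
    refine ⟨fun h => he.inj _ _ (by omega), ?_⟩
    rintro rfl
    omega
  · rw [add_zero, ← Set.ncard_empty V]
    congr 1
    ext z
    simp only [Set.mem_ofPred_eq, h3, Set.mem_empty_iff_false, iff_false]
    have := h4 z
    have := h5 z
    omega

/-- `b` and `c` sit on the two middle vertices of the mesh square ending at `e a`, either as old
neighbours or as added zeros. That they are the only predecessors of `a` makes the limit at the new
vertex a pullback over this cospan. -/
theorem IsSection.exists_corner (he : IsSection r h e) (ha : IsSink r a) :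
    ∃ b c : ZeroExtVertex r a, ((zeroSection a e b).k = (e a).k - 1 ∧
      (zeroSection a e b).l = (e a).l + 1) ∧ ((zeroSection a e c).k = (e a).k ∧
      (zeroSection a e c).l + 1 = (e a).l) ∧ zeroExt r a b (.inl a) ∧ zeroExt r a c (.inl a) ∧
      ∀ x, zeroExt r a x (.inl a) → x = b ∨ x = c := by
  have h1 := he.le a
  have h2 := he.one_le a
  have h3 := he.arrow_sink_iff ha
  have h4 := he.card_arrow_sink ha
  have h5 := he.k_eq a
  have hb : ∃ b : ZeroExtVertex r a, ((zeroSection a e b).k = (e a).k - 1 ∧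
      (zeroSection a e b).l = (e a).l + 1) ∧ zeroExt r a b (.inl a) := by
    by_cases h6 : (e a).l < n
    · obtain ⟨y, hy⟩ := he.surj ((e a).l + 1) (by omega) (by omega)
      have h7 := he.above_sink ha h6
      have h8 := he.k_eq y
      rw [hy] at h8
      exact ⟨.inl y, ⟨show (e y).k = _ by omega, hy⟩, (h3 y).2 (Or.inr hy)⟩
    · rw [if_neg h6] at h4
      -- If the sink also lies on level `1`, index `0` is already taken by the lower neighbour.
      refine ⟨.inr ⟨if 1 < (e a).l then 0 else 1, by split_ifs at h4 ⊢ <;> omega⟩, ?_, rfl⟩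
      rw [zeroSection, if_neg (by rintro ⟨h7, h8⟩; dsimp only at h8; split_ifs at h8; omega)]
      exact ⟨rfl, by dsimp only; omega⟩
  have hc : ∃ c : ZeroExtVertex r a, ((zeroSection a e c).k = (e a).k ∧
      (zeroSection a e c).l + 1 = (e a).l) ∧ zeroExt r a c (.inl a) := by
    by_cases h6 : 1 < (e a).l
    · obtain ⟨y, hy⟩ := he.surj ((e a).l - 1) (by omega) (by omega)
      have h7 := he.below_sink ha h6
      have h8 := he.k_eq y
      rw [hy] at h8
      have h9 : (e y).l + 1 = (e a).l := by omega
      exact ⟨.inl y, ⟨show (e y).k = _ by omega, h9⟩, (h3 y).2 (Or.inl h9)⟩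
    · rw [if_neg h6] at h4
      refine ⟨.inr ⟨0, by split_ifs at h4 <;> omega⟩, ?_, rfl⟩
      rw [zeroSection, if_pos ⟨by omega, rfl⟩]
      exact ⟨rfl, by dsimp only; omega⟩
  obtain ⟨b, hb, hb'⟩ := hb
  obtain ⟨c, hc, hc'⟩ := hc
  refine ⟨b, c, hb, hc, hb', hc', ?_⟩
  have key (x y : ZeroExtVertex r a) (hx : zeroExt r a x (.inl a)) (hy : zeroExt r a y (.inl a))
      (hxy : (zeroSection a e x).l = (zeroSection a e y).l) : x = y := by
    rcases x with x | x <;> rcases y with y | y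
    · exact congrArg Sum.inl (he.inj x y hxy)
    · have h6 : (zeroSection (r := r) a e (.inl x)).l = (e x).l := rfl
      have h7 := he.one_le x
      have h8 := he.le x
      rw [zeroSection_inr_l, h6] at hxy
      split_ifs at hxy <;> omega
    · have h6 : (zeroSection (r := r) a e (.inl y)).l = (e y).l := rfl
      have h7 := he.one_le y
      have h8 := he.le y
      rw [zeroSection_inr_l, h6] at hxy
      split_ifs at hxy <;> omega
    · have h7 := x.2
      have h8 := y.2
      rw [zeroSection_inr_l, zeroSection_inr_l] at hxy
      refine congrArg Sum.inr (Fin.ext ?_)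
      split_ifs at hxy h4 <;> omega
  intro x hx
  have hx' : (zeroSection a e x).l = (e a).l + 1 ∨ (zeroSection a e x).l + 1 = (e a).l := by
    rcases x with x | z
    · exact ((h3 x).1 hx).symm
    · have h7 := z.2
      rw [zeroSection_inr_l]
      split_ifs at h4 ⊢ <;> omega
  rcases hx' with hx' | hx'
  · exact Or.inl (key x b hx hb' (by omega))
  · exact Or.inr (key x c hx hc' (by omega))

theorem IsSection.monotone_zeroSection (he : IsSection r h e) (ha : IsSink r a) :
    Monotone (α := Reach (zeroExt r a)) (zeroSection a e) := by
  obtain ⟨b, c, hb, hc, -, -, hbc⟩ := he.exists_corner ha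
  refine monotone_reach fun x y hxy => ?_
  rcases x with x | x <;> rcases y with y | y
  · exact he.isSliceMap.mono (Relation.ReflTransGen.single hxy)
  · exact hxy.elim
  · obtain rfl : y = a := hxy
    have h1 : (zeroSection (r := r) y e (.inl y)) = e y := rfl
    rcases hbc (.inr x) rfl with h | h <;> rw [h, h1] <;> constructor <;> omega
  · exact hxy.elim

theorem IsSection.monotone_squareSection (he : IsSection r h e) (ha : IsSink r a) :
    Monotone (α := Reach (squareExt r a)) (squareSection a e) := by
  obtain ⟨b, c, hb, hc, -, -, hbc⟩ := he.exists_corner ha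
  refine monotone_reach fun x y hxy => ?_
  rcases x with - | x <;> rcases y with - | y
  · exact hxy.elim
  · change shiftVal (e a) ≤ zeroSection a e y
    rcases hbc y hxy with rfl | rfl <;> constructor <;> dsimp [shiftVal] <;> omega
  · exact hxy.elim
  · exact he.monotone_zeroSection ha (Relation.ReflTransGen.single hxy)

/-- The extension of a section to the additional vertices as a functor. -/
abbrev IsSection.zeroFun (he : IsSection r h e) (ha : IsSink r a) :
    reachCat (zeroExt r a) ⥤ mesh.{u} n :=
  monoFun (P := Reach (zeroExt r a)) (zeroSection a e) (he.monotone_zeroSection ha)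

/-- The extension of a section to the vertex replacing the sink as a functor. -/
abbrev IsSection.squareFun (he : IsSection r h e) (ha : IsSink r a) :
    reachCat (squareExt r a) ⥤ mesh.{u} n :=
  monoFun (P := Reach (squareExt r a)) (squareSection a e) (he.monotone_squareSection ha)

variable {D : Prederivator.{u, v, w}}

/-- The added vertices lie on the boundary, and no old vertex lies below them. -/
theorem IsSection.isLan_zeroFun (hS : IsStableDerivator D) (he : IsSection r h e) (ha : IsSink r a)
    {Z : val D (mesh.{u} n)} (hZ : IsAR Z) :
    IsLan (inclZeroExt r a) ((res D (he.zeroFun ha)).obj Z) := by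
  refine hS.isLan_of_zero hS.pointed (P := Reach r) (Q := Reach (zeroExt r a)) (f := Sum.inl)
    (fun _ _ h => Relation.ReflTransGen.lift Sum.inl (fun _ _ h => h) _ _ h)
    (fun _ _ h => reach_inl h) fun d => ?_
  rcases d with d | d
  · exact Or.inl ⟨d, rfl⟩
  · refine Or.inr ⟨fun x => not_reach_inr, (hZ.isZero _ ?_).of_iso
      (resAtObjIso (he.zeroFun ha) (.inr d) Z)⟩
    change (zeroSection a e (.inr d)).l = 0 ∨ (zeroSection a e (.inr d)).l = n + 1
    rw [zeroSection_inr_l]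
    split_ifs <;> simp

/-- The only new vertex is `none`. Whatever lies strictly above it lies above `b` or `c`, and the
square it spans with `b`, `c`, `a` is mapped to a mesh square. -/
theorem IsSection.isRan_squareFun (hS : IsStableDerivator D) (he : IsSection r h e)
    (ha : IsSink r a) {Z : val D (mesh.{u} n)} (hZ : IsAR Z) :
    IsRan (inclSquareExt r a) ((res D (he.squareFun ha)).obj Z) := by
  obtain ⟨b, c, hb, hc, hb', hc', hbc⟩ := he.exists_corner ha
  have hm : Monotone (α := Reach (zeroExt r a)) (β := Reach (squareExt r a)) some :=
    fun _ _ h => Relation.ReflTransGen.lift some (fun _ _ h => h) _ _ h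
  have hba : LE.le (α := Reach (zeroExt r a)) b (Sum.inl a) :=
    Relation.ReflTransGen.single hb'
  have hca : LE.le (α := Reach (zeroExt r a)) c (Sum.inl a) :=
    Relation.ReflTransGen.single hc'
  refine hS.isRan_of_isBicart (P := Reach (zeroExt r a)) (Q := Reach (squareExt r a)) (f := some)
    hm (fun _ _ h => reach_some h) fun d => ?_
  rcases d with - | d
  · refine Or.inr ⟨b, c, .inl a, ?_, hba, hca, ?_, ?_⟩
    · refine IsBicart.comap (P := Reach (squareExt r a)) (f := squareSection a e)
        (he.monotone_squareSection ha) (Relation.ReflTransGen.single hb')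
        (Relation.ReflTransGen.single hc') (hm hba) (hm hca)
        (hZ.bicart (shiftVal (e a)) (zeroSection a e b) (zeroSection a e c) (e a) hb.1 ?_ ?_ hb.2
          hc.2.symm rfl)
      · rw [hc.1]; simp [shiftVal]
      · simp [shiftVal]
    · intro y hy
      rcases Relation.ReflTransGen.cases_head hy with hy | ⟨x, hx, hy⟩
      · cases hy
      · rcases x with - | x
        · exact hx.elim
        · rcases hbc x hx with rfl | rfl
          · exact Or.inl (reach_some hy)
          · exact Or.inr (reach_some hy)
    -- Being above both `b` and `c` is tested in `M_n`: the first coordinate of `c` and the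
    -- coordinate sum of `b` give the two inequalities for `e a ≤ e y`. An added vertex `y` would
    -- force `b = c`.
    · intro y h1 h2
      rcases y with y | y
      · have h3 := he.monotone_zeroSection ha h1
        have h4 := he.monotone_zeroSection ha h2
        refine Relation.ReflTransGen.lift Sum.inl (fun _ _ h => h) _ _
          (he.reflTransGen (x := a) (y := y) ?_)
        have h5 : zeroSection (r := r) a e (.inl y) = e y := rfl
        obtain ⟨h3, h3'⟩ := h3
        obtain ⟨h4, h4'⟩ := h4
        rw [h5] at h3 h3' h4 h4'
        constructor <;> omega
      · have h3 := eq_of_reach_inr h1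
        have h4 := eq_of_reach_inr h2
        rw [h4] at hc
        rw [h3] at hb
        omega
  · exact Or.inl ⟨d, rfl⟩

theorem arRestr_isLan (hS : IsStableDerivator D) {A B C : Cat.{u, u}} (f : A ⥤ B) [f.Full]
    [f.Faithful] (g : B ⥤ mesh.{u} n)
    (H : ∀ Z : val D (mesh.{u} n), IsAR Z → IsLan f ((res D g).obj Z))
    (X : (arDer D n).obj (op C)) : IsLan (D := D) (prodParam f C)
      (((arRestr D n g).app (op C)).toFunctor.obj X) :=
  (hS.isLan_prodParam_iff f _).2 fun c => (H _ ((arProp_iff hS X.obj).1 X.2 c)).of_iso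
    (resProdParamIso g c X.obj).symm

theorem arRestr_isRan (hS : IsStableDerivator D) {A B C : Cat.{u, u}} (f : A ⥤ B) [f.Full]
    [f.Faithful] (g : B ⥤ mesh.{u} n)
    (H : ∀ Z : val D (mesh.{u} n), IsAR Z → IsRan f ((res D g).obj Z))
    (X : (arDer D n).obj (op C)) : IsRan (D := D) (prodParam f C)
      (((arRestr D n g).app (op C)).toFunctor.obj X) :=
  (hS.isRan_prodParam_iff f _).2 fun c => (H _ ((arProp_iff hS X.obj).1 X.2 c)).of_iso
    (resProdParamIso g c X.obj).symm

theorem nonempty_arRestr_comp_restr_iso {A B : Cat.{u, u}} (f : A ⥤ B) (g : B ⥤ mesh.{u} n)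
    (g' : A ⥤ mesh.{u} n) (H : ∀ x, g.obj (f.obj x) = g'.obj x) :
    Nonempty (arRestr D n g ≫ restr D f ≅ arRestr D n g') := by
  obtain ⟨i⟩ := nonempty_restr_comp_iso D f g
  obtain ⟨j⟩ := nonempty_arRestr_iso (D := D) (e := f ⋙ g) (e' := g') H
  exact ⟨α_ _ _ _ ≪≫ whiskerLeftIso _ i ≪≫ j⟩

/-- Reflection functors commute with the restriction of coherent Auslander-Reiten quivers to
sections. -/
theorem IsSection.nonempty_reflection_iso (hS : IsStableDerivator D) (he : IsSection r h e)
    (ha : IsSink r a) {s : shift D (reachCat r) ⟶ shift D (reachCat (reflectAt r a))}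
    (hs : IsReflection r a D ha s) :
    Nonempty (arRestr D n he.fun ≫ s ≅ arRestr D n (he.reflect ha).fun) := by
  obtain ⟨L, R, ⟨hL⟩, ⟨hR⟩, ⟨i⟩⟩ := hs
  obtain ⟨j₀⟩ := nonempty_arRestr_comp_restr_iso (D := D) (inclZeroExt r a) (he.zeroFun ha) he.fun
    fun x => rfl
  obtain ⟨j₁⟩ := nonempty_arRestr_comp_restr_iso (D := D) (inclSquareExt r a) (he.squareFun ha)
    (he.zeroFun ha) fun x => rfl
  obtain ⟨j₂⟩ := nonempty_arRestr_comp_restr_iso (D := D) (inclReflect r a ha) (he.squareFun ha)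
    (he.reflect ha).fun fun x => by
      classical
      change squareSection (r := r) a e (if (x : V) = a then none else some (.inl x)) =
        reflectSection a e x
      by_cases hx : (x : V) = a
      · exact (congrArg (squareSection a e) (if_pos hx)).trans (if_pos hx).symm
      · exact (congrArg (squareSection a e) (if_neg hx)).trans (if_neg hx).symm
  -- `L` and `R` are applied to restrictions of diagrams that are already extended, so each recovers
  -- the larger restriction.
  obtain ⟨k₀⟩ := nonempty_comp_comp_left_iso hL (arRestr D n (he.zeroFun ha)) fun C X Z =>
    arRestr_isLan hS (C := C.unop) (inclZeroExt r a) (he.zeroFun ha)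
      (fun Z hZ => he.isLan_zeroFun hS ha hZ) X Z
  obtain ⟨k₁⟩ := nonempty_comp_comp_right_iso hR (arRestr D n (he.squareFun ha)) fun C X Z =>
    arRestr_isRan hS (C := C.unop) (inclSquareExt r a) (he.squareFun ha)
      (fun Z hZ => he.isRan_squareFun hS ha hZ) X Z
  have l₀ : arRestr D n he.fun ≫ L ≅ arRestr D n (he.zeroFun ha) :=
    whiskerRightIso j₀.symm L ≪≫ α_ _ _ _ ≪≫ k₀
  have l₁ : arRestr D n (he.zeroFun ha) ≫ R ≅ arRestr D n (he.squareFun ha) :=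
    whiskerRightIso j₁.symm R ≪≫ α_ _ _ _ ≪≫ k₁
  exact ⟨whiskerLeftIso _ i ≪≫ (α_ _ _ _).symm ≪≫ whiskerRightIso l₀ _ ≪≫ (α_ _ _ _).symm ≪≫
    whiskerRightIso l₁ _ ≪≫ j₂⟩

end ReflectSection

/-! ### Coxeter functors and the Auslander-Reiten translation -/

section Coxeter

variable {n : ℕ} {V : Type u} {r r' : V → V → Prop} {D : Prederivator.{u, v, w}}

/-- Every reflection moves its sink one step to the left and fixes the other vertices, so a vertex
is displaced by the number of its occurrences in `l`. -/
theorem IsIteratedReflection.nonempty_iso [DecidableEq V] (hS : IsStableDerivator D) {l : List V}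
    {Φ : shift D (reachCat r) ⟶ shift D (reachCat r')} (H : IsIteratedReflection D l r r' Φ)
    {h : ℕ → ℤ} {e : V → Mesh.{u} n} (he : IsSection r h e) :
    ∃ (h' : ℕ → ℤ) (e' : V → Mesh.{u} n) (he' : IsSection r' h' e'),
      (∀ x, e' x = ⟨(e x).k - l.count x, (e x).l, (e x).hl⟩) ∧
      Nonempty (arRestr D n he.fun ≫ Φ ≅ arRestr D n he'.fun) := by
  induction H generalizing h e with
  | nil r => exact ⟨h, e, he, fun x => by simp, ⟨ρ_ _⟩⟩
  | @cons r r' a l ha s hs Φ _ ih =>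
    obtain ⟨h', e', he', hc, ⟨i⟩⟩ := ih (he.reflect ha)
    obtain ⟨j⟩ := he.nonempty_reflection_iso hS ha hs
    refine ⟨h', e', he', fun x => ?_, ⟨(α_ _ _ _).symm ≪≫ whiskerRightIso j _ ≪≫ i⟩⟩
    rw [hc, reflectSection]
    by_cases hx : x = a
    · subst hx
      rw [if_pos rfl]
      refine Mesh.ext ?_ rfl
      simp [shiftVal]
      ring
    · rw [if_neg hx]
      refine Mesh.ext ?_ rfl
      simp [Ne.symm hx]

/-- Each vertex occurs exactly once, whatever the order, so the section as a whole is translated by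
`t`. -/
theorem IsCoxeter.nonempty_iso (hS : IsStableDerivator D)
    {Φ : shift D (reachCat r) ⟶ shift D (reachCat r)} (H : IsCoxeter D r Φ) {h : ℕ → ℤ}
    {e : V → Mesh.{u} n} (he : IsSection r h e) :
    Nonempty (arRestr D n he.fun ≫ Φ ≅ arRestr D n (he.fun ⋙ meshShift n)) := by
  classical
  obtain ⟨l, hl, hl', H⟩ := H
  obtain ⟨h', e', he', hc, ⟨i⟩⟩ := H.nonempty_iso hS he
  obtain ⟨j⟩ := nonempty_arRestr_iso (D := D) (e := he'.fun) (e' := he.fun ⋙ meshShift n) fun x =>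
    (hc x).trans (Mesh.ext (by
      rw [List.count_eq_one_of_mem hl (hl' x)]
      rfl) rfl)
  exact ⟨i ≪≫ j⟩

/-- The hypotheses make the head of the list a sink. They persist for the tail: reflection only
creates arrows starting at the head, which no longer belongs to the list. -/
theorem exists_isIteratedReflection (hD : IsDerivator D) (l : List V) (hl : l.Nodup)
    (h₁ : l.Pairwise fun a b => ¬ r a b) (h₂ : ∀ a ∈ l, ∀ b ∉ l, ¬ r a b) (h₃ : ∀ a, ¬ r a a) :
    ∃ (r' : V → V → Prop) (Φ : shift D (reachCat r) ⟶ shift D (reachCat r')),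
      IsIteratedReflection D l r r' Φ := by
  induction l generalizing r with
  | nil => exact ⟨r, _, .nil r⟩
  | cons a l ih =>
    obtain ⟨hal, hl⟩ := List.nodup_cons.1 hl
    obtain ⟨h₁', h₁⟩ := List.pairwise_cons.1 h₁
    have ha : IsSink r a := fun x => by
      by_cases hx : x = a
      · subst hx
        exact h₃ x
      · by_cases hx' : x ∈ l
        · exact h₁' x hx'
        · exact h₂ a (by simp) x (by simp [hx, hx'])
    obtain ⟨s, hs⟩ := exists_isReflection hD ha
    suffices h : ∃ (r' : V → V → Prop) (Φ : shift D (reachCat (reflectAt r a)) ⟶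
        shift D (reachCat r')), IsIteratedReflection D l (reflectAt r a) r' Φ by
      obtain ⟨r', Φ, hΦ⟩ := h
      exact ⟨r', _, .cons ha hs hΦ⟩
    refine ih hl (List.Pairwise.imp_of_mem (fun {b c} hb hc h => ?_) h₁) (fun b hb c hc => ?_) ?_
    · have hb' : b ≠ a := fun h => hal (h ▸ hb)
      have hc' : c ≠ a := fun h => hal (h ▸ hc)
      simpa [reflectAt, hb', hc'] using h
    · have hb' : b ≠ a := fun h => hal (h ▸ hb)
      by_cases hc' : c = a
      · subst hc'
        simpa [reflectAt, hb'] using ha b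
      · simpa [reflectAt, hb', hc'] using h₂ b (by simp [hb]) c (by simp [hc, hc'])
    · rintro b (⟨-, hb⟩ | ⟨-, -, hb⟩) <;> exact h₃ b hb

/-- The Coxeter functor exists. -/
theorem IsSection.exists_isCoxeter (hS : IsStableDerivator D) {h : ℕ → ℤ} {e : V → Mesh.{u} n}
    (he : IsSection r h e) : ∃ Φ, IsCoxeter D r Φ := by
  classical
  have hfin : Finite V := Finite.of_injective (fun x => (⟨(e x).l, by
    have := (e x).hl; omega⟩ : Fin (n + 2))) fun x y hxy => he.inj x y (congrArg Fin.val hxy)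
  have := Fintype.ofFinite V
  -- Arrows strictly increase this height, so listing the vertices by decreasing height gives an
  -- admissible sequence of sinks.
  let ρ (x : V) : ℤ := 2 * (e x).k + (e x).l
  have hρ (x y : V) (hxy : r x y) : ρ x < ρ y := by
    have := (he.arrow x y).1 hxy
    unfold Mesh.Arrow at this
    dsimp only [ρ]
    omega
  obtain ⟨l, hl, hl', hs⟩ : ∃ l : List V, l.Nodup ∧ (∀ a, a ∈ l) ∧
      l.Pairwise fun a b => ρ b ≤ ρ a := by
    have h1 : Std.Total fun a b : V => ρ b ≤ ρ a := ⟨fun a b => le_total _ _⟩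
    have h2 : IsTrans V fun a b : V => ρ b ≤ ρ a := ⟨fun a b c h h' => h'.trans h⟩
    refine ⟨Finset.univ.toList.insertionSort fun a b => ρ b ≤ ρ a, ?_, fun a => ?_,
      List.pairwise_insertionSort _ _⟩
    · exact (List.perm_insertionSort _ _).nodup_iff.2 (Finset.nodup_toList _)
    · exact (List.perm_insertionSort _ _).mem_iff.2 (Finset.mem_toList.2 (Finset.mem_univ a))
  obtain ⟨r', Φ, H⟩ := exists_isIteratedReflection (r := r) hS.toIsDerivator l hl
    (hs.imp fun h h' => (hρ _ _ h').not_ge h) (fun a _ b hb => (hb (hl' b)).elim)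
    fun a ha => (hρ a a ha).false
  obtain ⟨h', e', he', hc, -⟩ := H.nonempty_iso hS he
  -- Translating every vertex by the same amount leaves the arrows unchanged, so the reflected
  -- quiver is the original one.
  obtain rfl : r' = r := by
    ext x y
    rw [he.arrow, he'.arrow, hc, hc, List.count_eq_one_of_mem hl (hl' x),
      List.count_eq_one_of_mem hl (hl' y)]
    unfold Mesh.Arrow
    dsimp only
    omega
  exact ⟨Φ, l, hl, hl', H⟩

end Coxeter

end AbstractRep

theorem mainTheorem5
    (D : Prederivator.{u, v, w}) (hD : IsStableDerivator D) (n : ℕ)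
    (hn : 1 ≤ n) :
    ((∃ Sg : arDer D n ⟶ arDer D n, IsSuspension (arDer D n) Sg) ∧
      ∀ Sg : arDer D n ⟶ arDer D n, IsSuspension (arDer D n) Sg →
        Nonempty (iter Sg (n - 1) ≅ iter (arTranslation D n ≫ Sg) (n + 1))) ∧
    ∀ (V : Type u) (r : V → V → Prop), IsAnQuiver n r →
      (∃ Sg : shift D (reachCat r) ⟶ shift D (reachCat r), IsSuspension (shift D (reachCat r)) Sg) ∧
      (∃ Φ : shift D (reachCat r) ⟶ shift D (reachCat r), IsCoxeter D r Φ) ∧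
      ∀ Sg Φ : shift D (reachCat r) ⟶ shift D (reachCat r),
        IsSuspension (shift D (reachCat r)) Sg → IsCoxeter D r Φ →
        Nonempty (iter Sg (n - 1) ≅ iter (Φ ≫ Sg) (n + 1)) := by
  refine ⟨⟨exists_isSuspension_arDer hD n, fun Sg hSg => nonempty_arDer_iso hD hn hSg⟩,
    fun V r hr => ?_⟩
  -- The section is auxiliary: it provides one Coxeter functor, and it compares an arbitrary one
  -- with `τ`.
  obtain ⟨h, e, he⟩ := exists_isSection hn hr
  exact ⟨exists_isSuspension_shift hD (reachCat r), he.exists_isCoxeter hD,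
    fun Sg Φ hSg hΦ => he.nonempty_iter_iso hD hn hSg (hΦ.nonempty_iso hD he)⟩
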